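/- Let $\Theta\subseteq\mathbb{R}^d$ be open, with $\|\cdot\|$ the Euclidean norm on $\mathbb{R}^d$, and let $(\mathsf{X},\mathcal{X})$ be a measurable space with countably generated $\sigma$-field. Let $\{P_\theta,\theta\in\Theta\}$ be Markov kernels on $\mathsf{X}$ (with $(\theta,x)\mapsto P_\theta(x,A)$ measurable for $A\in\mathcal X$), let $(x,\theta)\mapsto H_\theta(x)\in\mathbb{R}^d$ be measurable on $\mathsf{X}\times\Theta$, and let $(\mathcal{K}_q)_{q\ge 0}$ be compact sets with $\bigcup_q\mathcal{K}_q=\Theta$ and $\mathcal{K}_q\subset\operatorname{int}(\mathcal{K}_{q+1})$ for all $q$. For $W:\mathsf X\to[1,\infty)$ write $|f|_W=\sup_{x}\|f(x)\|/W(x)$, $\|\mu\|_W=\sup_{|f|_W\le 1}|\mu(f)|$ and $D_W(\theta,\theta')=\sup_x\|P_\theta(x,\cdot)-P_{\theta'}(x,\cdot)\|_W/W(x)$. Algorithm. Given $(x_\star,\theta_\star)\in\mathsf{X}\times\mathcal{K}_0$ and step sizes $(\gamma_n)_{n\ge0}$, set $(X_0,\theta_0,I_0,\zeta_0)=(x_\star,\theta_\star,0,0)$.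 For $n\ge 0$ let $(X_{n+1/2},\theta_{n+1/2})=(x_\star,\theta_\star)$ if $\zeta_n=0$, and $(X_{n+1/2},\theta_{n+1/2})=(X_n,\theta_n)$ otherwise; draw $X_{n+1}\sim P_{\theta_{n+1/2}}(X_{n+1/2},\cdot)$ and put $\theta_{n+1}=\theta_{n+1/2}+\gamma_{I_n+\zeta_n+1}H_{\theta_{n+1/2}}(X_{n+1})$. If $\theta_{n+1}\in\mathcal{K}_{I_n}$, set $(I_{n+1},\zeta_{n+1})=(I_n,\zeta_n+1)$; otherwise set $(I_{n+1},\zeta_{n+1})=(I_n+1,0)$. Let $\overline{\mathbb{P}}$ be the law of this process. Assume that there are $p>1$ and $\alpha,\upsilon\in(0,1]$ such that: (A1) There is a measurable $W:\mathsf{X}\to[1,\infty)$ such that $\sup_{\theta\in\mathcal{K}}|H_\theta|_W<\infty$ for every compact $\mathcal{K}\subseteq\Theta$. (A2) (a) Each $P_\theta$, $\theta\in\Theta$, has a unique invariant probability distribution $\pi_\theta$. (b) For every compact $\mathcal{K}\subseteq\Theta$ there are $C>0$ and $\lambda\in(0,1)$ such that $\sup_{\theta\in\mathcal{K}}\|P_\theta^l(x,\cdot)-\pi_\theta\|_W\le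 C\lambda^lW(x)$ for all $x\in\mathsf X$, $l\ge0$; moreover $\sup_{\theta\in\mathcal{K}}\pi_\theta(W)<\infty$. (c) For every compact $\mathcal{K}\subseteq\Theta$ there are $\varrho\in(0,1)$ and $b<\infty$ such that $\sup_{\theta\in\mathcal{K}}P_\theta W^p(x)\le\varrho W^p(x)+b$ for all $x\in\mathsf X$. (A3) For every compact $\mathcal{K}\subseteq\Theta$ there is $C$ such that $D_W(\theta,\theta')\le C\|\theta-\theta'\|^{\upsilon}$ for all $\theta,\theta'\in\mathcal{K}$. (A4) For every compact $\mathcal{K}\subseteq\Theta$ there is $C>0$ such that for all $\delta>0$ $$\sup_{\theta\in\mathcal{K}}\int\pi_\theta(\mathrm{d}x)\sup_{\theta'\in\mathcal{K},\,\|\theta'-\theta\|\le\delta}\|H_{\theta'}(x)-H_\theta(x)\|\le C\delta^\alpha .$$ (A5) Let $h(\theta)=\int H_\theta\,\mathrm{d}\pi_\theta$. There is a continuously differentiable $w:\Theta\to[0,\infty)$ such that $\{\theta\in\Theta:w(\theta)\le M\}$ is compact for every $M>0$, the set $\mathcal{L}=\{\theta\in\Theta:\langle\nabla w(\theta),h(\theta)\rangle=0\}$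 is compact, and $\langle\nabla w(\theta),h(\theta)\rangle<0$ for $\theta\in\Theta\setminus\mathcal{L}$. (A6) $\gamma_n=\gamma_0/(n+1)^\beta$ with $\gamma_0>0$ and $\beta\in\left(\frac1p\vee\frac{1+(\alpha\wedge\upsilon)/p}{1+(\alpha\wedge\upsilon)},\,1\right]$. Then, $\overline{\mathbb{P}}$-almost surely, the active set is updated only finitely often: there is $i$ with $I_n=i$ and $\theta_n\in\mathcal{K}_i$ for all large $n$; moreover there is $j$ such that every $\theta_k$, $k\ge0$, that lies in $\Theta$ lies in $\mathcal{K}_j$ (so that $\theta_k\in\mathcal{K}_j$ for all $k\ge 0$ if no rejected iterate falls outside $\Theta$, in particular if $\Theta=\mathbb{R}^d$). If in addition either (i) $w(\mathcal{L})$ has empty interior in $\mathbb R$, or (ii) $\nabla w$ is locally Lipschitz on $\Theta$, $p\ge2$ and $\beta>1/2$, then $\overline{\mathbb{P}}$-almost surely $\lim_k\mathrm{d}(\theta_k,\mathcal{L})=0$, $\lim_k\|\theta_{k+1}-\theta_k\|=0$, and $(\theta_k)$ converges to a connected component of $\mathcal{L}$: there is a (random) connected component $C$ of $\mathcal{L}$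 with $\lim_k\mathrm{d}(\theta_k,C)=0$. -/

import Mathlib

open MeasureTheory ProbabilityTheory Filter Topology Set
open scoped ENNReal NNReal

noncomputable section

namespace StabSA

/-- `ℝ^d` with the Euclidean norm and scalar product. -/
abbrev E (d : ℕ) := EuclideanSpace ℝ (Fin d)

/-! ### Weighted norms -/

section Weighted

variable {X : Type*} [MeasurableSpace X]

/-- `|f|_W = sup_x |f x| / W x`. -/
def wNorm {F : Type*} [NormedAddCommGroup F] (W : X → ℝ) (f : X → F) : ℝ≥0∞ :=
  ⨆ x, ‖f x‖ₑ / ENNReal.ofReal (W x)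

/-- `‖μ - ν‖_W = sup {|μ(f) - ν(f)| : |f|_W ≤ 1}`, the supremum being over measurable
real functions. -/
def wDist (W : X → ℝ) (μ ν : Measure X) : ℝ≥0∞ :=
  ⨆ (f : X → ℝ) (_ : Measurable f) (_ : wNorm W f ≤ 1), ‖(∫ x, f x ∂μ) - ∫ x, f x ∂ν‖ₑ

/-- The integral `∫ f dμ` of a nonnegative function, as an upper integral, so that no
measurability of `f` has to be assumed. -/
def upperIntegral (μ : Measure X) (f : X → ℝ≥0∞) : ℝ≥0∞ :=
  ⨅ (g : X → ℝ≥0∞) (_ : Measurable g) (_ : ∀ x, f x ≤ g x), ∫⁻ x, g x ∂μ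

/-- For measurable functions the upper integral is the usual integral. -/
theorem upperIntegral_eq_lintegral (μ : Measure X) {f : X → ℝ≥0∞} (hf : Measurable f) :
    upperIntegral μ f = ∫⁻ x, f x ∂μ :=
  le_antisymm (iInf_le_of_le f (iInf_le_of_le hf (iInf_le _ fun _ => le_rfl)))
    (le_iInf fun _ => le_iInf fun _ => le_iInf fun h => lintegral_mono h)

end Weighted

/-! ### Assumptions

The family `P_θ(x, ·)` is given by the kernel `P` as `P (θ, x)`, and the field `H_θ(x)` is
`H θ x`. Only their values at parameters `θ ∈ Θ` occur. -/

section Assumptions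

variable {d : ℕ} {X : Type*} [MeasurableSpace X]

/-- A sequence of compact subsets of `Θ` that covers `Θ`, each set lying in the interior of
the next one. -/
structure IsCompactCover (Θ : Set (E d)) (K : ℕ → Set (E d)) : Prop where
  compact : ∀ i, IsCompact (K i)
  iUnion_eq : ⋃ i, K i = Θ
  subset_interior : ∀ i, K i ⊆ interior (K (i + 1))

/-- The field `H` is bounded in the `W`-norm, uniformly on compact sets of parameters. -/
structure FieldBound (Θ : Set (E d)) (H : E d → X → E d) (W : X → ℝ) : Prop where
  measurable_W : Measurable W
  one_le_W : ∀ x, 1 ≤ W x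
  bound : ∀ 𝒦 : Set (E d), IsCompact 𝒦 → 𝒦 ⊆ Θ → ⨆ θ ∈ 𝒦, wNorm W (H θ) < ∞

/-- `P_θ` has the unique invariant distribution `π θ`; geometric ergodicity in the `W`-norm,
uniform on compact sets of parameters; drift condition for `W ^ p`. -/
structure UniformErgodicity (Θ : Set (E d)) (P : Kernel (E d × X) X) (π : E d → Measure X)
    (W : X → ℝ) (p : ℝ) : Prop where
  isProbabilityMeasure : ∀ θ ∈ Θ, IsProbabilityMeasure (π θ)
  invariant : ∀ θ ∈ Θ, Kernel.Invariant (P.sectR θ) (π θ)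
  unique : ∀ θ ∈ Θ, ∀ μ : Measure X, IsProbabilityMeasure μ →
    Kernel.Invariant (P.sectR θ) μ → μ = π θ
  ergodic : ∀ 𝒦 : Set (E d), IsCompact 𝒦 → 𝒦 ⊆ Θ →
    (∃ C : ℝ, 0 < C ∧ ∃ r ∈ Ioo (0 : ℝ) 1, ∀ (x : X) (l : ℕ),
      ⨆ θ ∈ 𝒦, wDist W ((P.sectR θ ^ l) x) (π θ) ≤ ENNReal.ofReal (C * r ^ l * W x)) ∧
    ⨆ θ ∈ 𝒦, ∫⁻ x, ENNReal.ofReal (W x) ∂(π θ) < ∞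
  drift : ∀ 𝒦 : Set (E d), IsCompact 𝒦 → 𝒦 ⊆ Θ → ∃ ρ ∈ Ioo (0 : ℝ) 1, ∃ b : ℝ, ∀ x : X,
    ⨆ θ ∈ 𝒦, ∫⁻ y, ENNReal.ofReal (W y ^ p) ∂(P (θ, x)) ≤ ENNReal.ofReal (ρ * W x ^ p + b)

/-- `D_W(θ, θ') = sup_x ‖P_θ(x, ·) - P_θ'(x, ·)‖_W / W x`. -/
def kernelDist (P : Kernel (E d × X) X) (W : X → ℝ) (θ θ' : E d) : ℝ≥0∞ :=
  ⨆ x, wDist W (P (θ, x)) (P (θ', x)) / ENNReal.ofReal (W x)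

/-- On each compact set of parameters, `D_W(θ, θ') ≤ C ‖θ - θ'‖ ^ υ`. -/
def HolderKernels (Θ : Set (E d)) (P : Kernel (E d × X) X) (W : X → ℝ) (υ : ℝ) : Prop :=
  ∀ 𝒦 : Set (E d), IsCompact 𝒦 → 𝒦 ⊆ Θ → ∃ C : ℝ, ∀ θ ∈ 𝒦, ∀ θ' ∈ 𝒦,
    kernelDist P W θ θ' ≤ ENNReal.ofReal (C * ‖θ - θ'‖ ^ υ)

/-- Averaged Hölder condition on `θ ↦ H_θ`. -/
def AveragedHolder (Θ : Set (E d)) (H : E d → X → E d) (π : E d → Measure X) (α : ℝ) : Prop :=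
  ∀ 𝒦 : Set (E d), IsCompact 𝒦 → 𝒦 ⊆ Θ → ∃ C : ℝ, 0 < C ∧ ∀ δ : ℝ, 0 < δ →
    ⨆ θ ∈ 𝒦, upperIntegral (π θ)
      (fun x => ⨆ θ' ∈ {θ' | θ' ∈ 𝒦 ∧ ‖θ' - θ‖ ≤ δ}, ‖H θ' x - H θ x‖ₑ)
      ≤ ENNReal.ofReal (C * δ ^ α)

/-- The mean field `h(θ) = ∫ H_θ dπ_θ`. -/
def meanField (H : E d → X → E d) (π : E d → Measure X) (θ : E d) : E d :=
  ∫ x, H θ x ∂(π θ)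

/-- The set `ℒ = {θ ∈ Θ : ⟨∇w(θ), h(θ)⟩ = 0}`. -/
def stationarySet (Θ : Set (E d)) (w : E d → ℝ) (h : E d → E d) : Set (E d) :=
  {θ | θ ∈ Θ ∧ inner ℝ (gradient w θ) (h θ) = 0}

/-- `w` is a Lyapunov function on the open set `Θ` for the field `h`. -/
structure IsLyapunov (Θ : Set (E d)) (h : E d → E d) (w : E d → ℝ) : Prop where
  contDiffOn : ContDiffOn ℝ 1 w Θ
  nonneg : ∀ θ ∈ Θ, 0 ≤ w θ
  isCompact_level : ∀ M : ℝ, 0 < M → IsCompact {θ | θ ∈ Θ ∧ w θ ≤ M}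
  isCompact_stationarySet : IsCompact (stationarySet Θ w h)
  inner_neg : ∀ θ ∈ Θ \ stationarySet Θ w h, inner ℝ (gradient w θ) (h θ) < 0

/-- The step sizes `γ_n = γ₀ / (n + 1) ^ β`. -/
def polyStep (γ₀ β : ℝ) (n : ℕ) : ℝ := γ₀ / ((n : ℝ) + 1) ^ β

end Assumptions

/-! ### The stabilized stochastic approximation algorithm -/

section Algorithm

variable {d : ℕ} {X : Type*} [MeasurableSpace X]

/-- State `(X_n, θ_n, I_n, ζ_n)` of the algorithm: `I_n` is the index of the active set, `ζ_n`
the number of iterations in the current active set. -/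
abbrev State (X : Type*) (d : ℕ) := X × E d × ℕ × ℕ

/-- The component `θ_n`. -/
abbrev State.theta {X : Type*} {d : ℕ} (s : State X d) : E d := s.2.1

/-- The component `I_n`. -/
abbrev State.index {X : Type*} {d : ℕ} (s : State X d) : ℕ := s.2.2.1

/-- The component `ζ_n`. -/
abbrev State.count {X : Type*} {d : ℕ} (s : State X d) : ℕ := s.2.2.2

/-- The intermediate point `(θ_{n+1/2}, X_{n+1/2})`: restart from `(θs, xs)` if `ζ_n = 0`. -/
def halfPoint (xs : X) (θs : E d) (s : State X d) : E d × X :=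
  if s.count = 0 then (θs, xs) else (s.theta, s.1)

/-- `θ_{n+1} = θ_{n+1/2} + γ_{I_n + ζ_n + 1} H_{θ_{n+1/2}}(X_{n+1})`, where `y = X_{n+1}`. -/
def newTheta (H : E d → X → E d) (γ : ℕ → ℝ) (xs : X) (θs : E d) (s : State X d) (y : X) : E d :=
  (halfPoint xs θs s).1 + γ (s.index + s.count + 1) • H (halfPoint xs θs s).1 y

open Classical in
/-- The state at time `n + 1`, given the state `s` at time `n` and the draw `y = X_{n+1}`. -/
def update (K : ℕ → Set (E d)) (H : E d → X → E d) (γ : ℕ → ℝ) (xs : X) (θs : E d)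
    (s : State X d) (y : X) : State X d :=
  if newTheta H γ xs θs s y ∈ K s.index then
    (y, newTheta H γ xs θs s y, s.index, s.count + 1)
  else (y, newTheta H γ xs θs s y, s.index + 1, 0)

theorem measurable_halfPoint (xs : X) (θs : E d) : Measurable (halfPoint xs θs) := by
  refine Measurable.ite ?_ measurable_const (by fun_prop)
  exact (measurable_snd.snd.snd : Measurable fun s : State X d => s.2.2.2)
    (measurableSet_singleton 0)

theorem measurable_newTheta {H : E d → X → E d} (hH : Measurable (Function.uncurry H))
    (γ : ℕ → ℝ) (xs : X) (θs : E d) :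
    Measurable fun q : State X d × X => newTheta H γ xs θs q.1 q.2 := by
  have h1 : Measurable fun q : State X d × X => (halfPoint xs θs q.1).1 :=
    ((measurable_halfPoint xs θs).comp measurable_fst).fst
  have h2 : Measurable fun q : State X d × X => γ (q.1.index + q.1.count + 1) :=
    (measurable_of_countable γ).comp (by fun_prop)
  exact h1.add (h2.smul (hH.comp (h1.prodMk measurable_snd)))

theorem measurable_update {K : ℕ → Set (E d)} (hK : ∀ i, MeasurableSet (K i))
    {H : E d → X → E d} (hH : Measurable (Function.uncurry H))
    (γ : ℕ → ℝ) (xs : X) (θs : E d) :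
    Measurable fun q : State X d × X => update K H γ xs θs q.1 q.2 := by
  classical
  have h1 := measurable_newTheta hH γ xs θs
  have hI : Measurable fun q : State X d × X => q.1.index := by fun_prop
  refine Measurable.ite ?_ (by fun_prop) (by fun_prop)
  have : {q : State X d × X | newTheta H γ xs θs q.1 q.2 ∈ K q.1.index} =
      ⋃ n, ((fun q : State X d × X => newTheta H γ xs θs q.1 q.2) ⁻¹' K n) ∩
        ((fun q : State X d × X => q.1.index) ⁻¹' {n}) := by
    ext q
    simp
  rw [this]
  exact MeasurableSet.iUnion fun n => (h1 (hK n)).inter (hI (measurableSet_singleton n))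

/-- One iteration of the algorithm, as a transition kernel: from the state `s`, draw
`y ∼ P_{θ_{n+1/2}}(X_{n+1/2}, ·)` and pass to `update s y`. -/
def stepKernel (P : Kernel (E d × X) X) (K : ℕ → Set (E d)) (H : E d → X → E d) (γ : ℕ → ℝ)
    (xs : X) (θs : E d) : Kernel (State X d) (State X d) :=
  (Kernel.id ×ₖ P.comap (halfPoint xs θs) (measurable_halfPoint xs θs)).map
    fun q => update K H γ xs θs q.1 q.2

theorem isMarkovKernel_stepKernel (P : Kernel (E d × X) X) [IsMarkovKernel P]
    {K : ℕ → Set (E d)} (hK : ∀ i, MeasurableSet (K i))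
    {H : E d → X → E d} (hH : Measurable (Function.uncurry H))
    (γ : ℕ → ℝ) (xs : X) (θs : E d) : IsMarkovKernel (stepKernel P K H γ xs θs) :=
  Kernel.IsMarkovKernel.map _ (measurable_update hK hH γ xs θs)

/-- The step kernel is the law of `update s y` for `y ∼ P_{θ_{n+1/2}}(X_{n+1/2}, ·)`. -/
theorem stepKernel_apply (P : Kernel (E d × X) X) [IsMarkovKernel P]
    {K : ℕ → Set (E d)} (hK : ∀ i, MeasurableSet (K i))
    {H : E d → X → E d} (hH : Measurable (Function.uncurry H))
    (γ : ℕ → ℝ) (xs : X) (θs : E d) (s : State X d) :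
    stepKernel P K H γ xs θs s =
      (P (halfPoint xs θs s)).map (update K H γ xs θs s) := by
  have hu := measurable_update hK hH γ xs θs
  rw [stepKernel, Kernel.map_apply _ hu, Kernel.prod_apply, Kernel.id_apply,
    Kernel.comap_apply, Measure.dirac_prod, Measure.map_map hu measurable_prodMk_left]
  rfl

/-- The law, on the space of sequences of states, of the homogeneous Markov chain with
transition kernel `Q` that starts from `s₀`. -/
def chainLaw {S : Type*} [MeasurableSpace S] (Q : Kernel S S) (hQ : IsMarkovKernel Q) (s₀ : S) :
    Measure (ℕ → S) :=
  Kernel.traj (X := fun _ => S)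
    (fun n => Q.comap (fun x : (Π _ : Finset.Iic n, S) => x ⟨n, Finset.mem_Iic.2 le_rfl⟩)
      (measurable_pi_apply _)) 0 (fun _ => s₀)

instance {S : Type*} [MeasurableSpace S] (Q : Kernel S S) (hQ : IsMarkovKernel Q) (s₀ : S) :
    IsProbabilityMeasure (chainLaw Q hQ s₀) := by
  unfold chainLaw
  infer_instance

/-- The canonical probability of the algorithm with input `(xs, θs)`, started with the active
set `K i`: the law of the sequence of states `(X_n, θ_n, I_n, ζ_n)`, `n ≥ 0`, with
`(X_0, θ_0, I_0, ζ_0) = (xs, θs, i, 0)`. -/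
def algorithmLaw (P : Kernel (E d × X) X) [IsMarkovKernel P]
    (K : ℕ → Set (E d)) (hK : ∀ i, IsCompact (K i))
    (H : E d → X → E d) (hH : Measurable (Function.uncurry H))
    (γ : ℕ → ℝ) (xs : X) (θs : E d) (i : ℕ) : Measure (ℕ → State X d) :=
  chainLaw (stepKernel P K H γ xs θs)
    (isMarkovKernel_stepKernel P (fun j => (hK j).measurableSet) hH γ xs θs) (xs, θs, i, 0)

end Algorithm

end StabSA

end

noncomputable section

set_option linter.unusedSectionVars false

/-! Write one accepted update as a mean-field step `γ h(θ)` plus the noise `γ (H_θ(X') - h(θ))`. Two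
things are needed. The noise series must be small when it starts late, and `w` must be a Lyapunov
function robust to small steps and small accumulated noise.

Noise. Fix a compact parameter set and consider a chain whose parameter never leaves it. Given the
past at lag `l`, the parameter has moved by about `γ` and the chain with frozen parameter has
forgotten its start at rate `r ^ l`, so the conditional mean of the noise is of order `r ^ l + γ ^
κ` up to a power of `l` (`IsDriven.abs_integral_noise_le`). Only averaged Hölder continuity of `H`
is available; displacements larger than `γ ^ s` are paid for with the moment of order `p`. With lags
of logarithmic size, the rest of the noise splits into few martingale-difference sums, one for each
lag, controlled by a Doob inequality under moments of order `1 + κ`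
(`measure_exists_lt_abs_sum_le`). The resulting series converge when `β (1 + κ) > 1`, and the best
`κ` here turns this into the lower bound assumed on `β` (`exists_exponents`). No solution of a
Poisson equation is used.

Transfer. Before it leaves the compact set, the algorithm has the law of an auxiliary chain that
rejects outside proposals and hence lives there forever (`IsDominated.measure_exists_le`,
`isDominated_stepKernel`). This gives the maximal inequality `Setting.exists_algNoise_rate` for the
algorithm itself.

Stability. Removing the accumulated noise from the path leaves a recursion along `h`. By descent of
`w`, a path starting in `{w ≤ M}` stays in `{w ≤ M + 1}` if steps and accumulated noise are small
(`IsLyapunov.exists_stable`). After a restart with large index the steps are small and the active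
set contains this level set, so another restart has probability at most `1/2`
(`Setting.exists_exit_le`). Hence the index is bounded almost surely (`Setting.ae_exists_alive`).

Convergence. After the last restart the noise series converges, and adding its tail to `θ_k` gives
an asymptotic sequence `y` driven by `h` alone (`IsShadow`). Convergence of `w (y k)` follows either
because `w` cannot cross upwards a value outside `w(ℒ)`, or from a second-order expansion of `w`
with summable squared steps. If `w (y k)` converges while the steps have infinite sum, `y` cannot
return far from `ℒ` (`IsShadow.tendsto_infDist`). Vanishing increments then select one component of
the compact set `ℒ`. -/

namespace StabSA

/-! ### Homogeneous Markov chains: uniqueness of the law and Markov property -/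

section Chain

variable {S : Type*} [MeasurableSpace S]

/-- One-step Markov property of a law on sequences, with transition kernel `Q`. -/
def IsMarkovLaw (Q : Kernel S S) (ν : Measure (ℕ → S)) : Prop :=
  ∀ (n : ℕ) (F : (Finset.Iic n → S) × S → ℝ≥0∞), Measurable F →
    ∫⁻ ω, F (Preorder.frestrictLe (π := fun _ => S) n ω, ω (n + 1)) ∂ν =
      ∫⁻ ω, ∫⁻ s', F (Preorder.frestrictLe (π := fun _ => S) n ω, s') ∂(Q (ω n)) ∂ν

/-- The coordinate at time `n + 1` can be integrated out through `Q`, which leaves a function of the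
path up to time `n`; induction therefore determines all laws of initial segments. Cylinders over
initial segments form a generating π-system. -/
theorem isMarkovLaw_ext {Q : Kernel S S} [IsMarkovKernel Q] {ν μ : Measure (ℕ → S)}
    [IsProbabilityMeasure ν] [IsProbabilityMeasure μ]
    (hν : IsMarkovLaw Q ν) (hμ : IsMarkovLaw Q μ)
    (h0 : ν.map (fun ω => ω 0) = μ.map (fun ω => ω 0)) : ν = μ := by
  have key : ∀ n (f : (Finset.Iic n → S) → ℝ≥0∞), Measurable f →
      ∫⁻ ω, f (Preorder.frestrictLe (π := fun _ => S) n ω) ∂ν =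
        ∫⁻ ω, f (Preorder.frestrictLe (π := fun _ => S) n ω) ∂μ := by
    intro n
    induction n with
    | zero =>
      intro f hf
      have hg : Measurable fun s : S => f (fun _ => s) :=
        hf.comp (measurable_pi_lambda _ fun _ => measurable_id)
      have e : ∀ ω : ℕ → S, f (Preorder.frestrictLe (π := fun _ => S) 0 ω) =
          (fun s : S => f (fun _ => s)) (ω 0) := by
        intro ω
        congr 1
        ext i
        have : (i : ℕ) = 0 := Nat.le_zero.1 (Finset.mem_Iic.1 i.2)
        simp [Preorder.frestrictLe, this]
      simp_rw [e]
      rw [← lintegral_map hg (measurable_pi_apply 0), h0,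
        lintegral_map hg (measurable_pi_apply 0)]
    | succ n ih =>
      intro f hf
      let e : (Finset.Iic n → S) × S → (Finset.Iic (n + 1) → S) := fun q i =>
        if h : (i : ℕ) ≤ n then q.1 ⟨i, Finset.mem_Iic.2 h⟩ else q.2
      have he : Measurable e := by
        refine measurable_pi_lambda _ fun i => ?_
        by_cases h : (i : ℕ) ≤ n
        · simp only [e, h, dif_pos]; fun_prop
        · simp only [e, h, dif_neg, not_false_iff]; fun_prop
      have e1 : ∀ ω : ℕ → S, Preorder.frestrictLe (π := fun _ => S) (n + 1) ω =
          e (Preorder.frestrictLe (π := fun _ => S) n ω, ω (n + 1)) := by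
        intro ω
        ext i
        by_cases h : (i : ℕ) ≤ n
        · simp [e, h]
        · have : (i : ℕ) = n + 1 := by
            have := Finset.mem_Iic.1 i.2
            omega
          simp [e, this]
      simp_rw [e1]
      have hfe : Measurable fun q => f (e q) := hf.comp he
      rw [hν n _ hfe, hμ n _ hfe]
      have hm : Measurable fun x : Finset.Iic n → S =>
          ∫⁻ s', f (e (x, s')) ∂((Q.comap (fun x : Finset.Iic n → S =>
            x ⟨n, Finset.mem_Iic.2 le_rfl⟩) (measurable_pi_apply _)) x) :=
        Measurable.lintegral_kernel_prod_right' hfe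
      exact ih _ hm
  refine ext_of_generate_finite _ generateFrom_measurableCylinders.symm
    isPiSystem_measurableCylinders (fun t ht => ?_) (by simp)
  obtain ⟨N, A, hA, rfl⟩ : ∃ N A, MeasurableSet A ∧ t = cylinder (Finset.Iic N) A := by
    simpa [measurableCylinders_nat] using ht
  have := key N (A.indicator 1) (measurable_one.indicator hA)
  have e2 : ∀ ω : ℕ → S, A.indicator (1 : (Finset.Iic N → S) → ℝ≥0∞) (Preorder.frestrictLe (π := fun _ => S) N ω) =
      (cylinder (Finset.Iic N) A).indicator 1 ω := fun ω => rfl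
  simp_rw [e2] at this
  rwa [lintegral_indicator_one (hA.cylinder _), lintegral_indicator_one (hA.cylinder _)] at this

variable (Q : Kernel S S) [hQ : IsMarkovKernel Q]

/-- The history-dependent form of a homogeneous transition kernel. -/
abbrev histKernel (n : ℕ) : Kernel (Finset.Iic n → S) S :=
  Q.comap (fun x => x ⟨n, Finset.mem_Iic.2 le_rfl⟩) (measurable_pi_apply _)

/-- The starting time `a` is arbitrary so that the identity serves both for the chain law (`a = 0`)
and for a trajectory continued from a given past, in `traj_map_shift`. -/
theorem lintegral_traj_step {a b : ℕ} (hab : a ≤ b) (x : Finset.Iic a → S)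
    (F : (Finset.Iic b → S) × S → ℝ≥0∞) (hF : Measurable F) :
    ∫⁻ ω, F (Preorder.frestrictLe (π := fun _ => S) b ω, ω (b + 1))
        ∂(Kernel.traj (X := fun _ => S) (histKernel Q) a x) =
      ∫⁻ ω, ∫⁻ s', F (Preorder.frestrictLe (π := fun _ => S) b ω, s') ∂(Q (ω b))
        ∂(Kernel.traj (X := fun _ => S) (histKernel Q) a x) := by
  have h := Kernel.partialTraj_compProd_eq_map_traj (X := fun _ => S) (κ := histKernel Q) hab
    (x₀ := x)
  have hm : Measurable fun ω : ℕ → S =>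
      (Preorder.frestrictLe (π := fun _ => S) b ω, ω (b + 1)) := by fun_prop
  rw [← lintegral_map (f := F) (g := fun ω : ℕ → S =>
      (Preorder.frestrictLe (π := fun _ => S) b ω, ω (b + 1))) hF hm, ← h,
    Measure.lintegral_compProd hF, ← Kernel.traj_map_frestrictLe_apply,
    lintegral_map (Measurable.lintegral_kernel_prod_right' hF) (by fun_prop)]
  rfl

theorem isMarkovLaw_chainLaw (s : S) : IsMarkovLaw Q (chainLaw Q hQ s) :=
  fun n F hF => lintegral_traj_step Q (Nat.zero_le n) (fun _ => s) F hF

theorem traj_map_eval {n : ℕ} (x : Finset.Iic n → S) :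
    (Kernel.traj (X := fun _ => S) (histKernel Q) n x).map (fun ω => ω n) =
      Measure.dirac (x ⟨n, Finset.mem_Iic.2 le_rfl⟩) := by
  ext A hA
  rw [← Kernel.traj_map_updateFinset, Measure.map_map (measurable_pi_apply n)
    (measurable_updateFinset_left), Measure.dirac_apply' _ hA]
  have : ((fun ω : ℕ → S => ω n) ∘ fun ω => Function.updateFinset ω (Finset.Iic n) x) =
      fun _ => x ⟨n, Finset.mem_Iic.2 le_rfl⟩ := by
    ext ω; simp [Function.updateFinset]
  rw [this, Measure.map_const]
  simp [hA]

theorem chainLaw_map_zero (s : S) :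
    (chainLaw Q hQ s).map (fun ω => ω 0) = Measure.dirac s :=
  traj_map_eval Q (n := 0) (fun _ => s)

/-- `histKernel` sees only the last coordinate of the past, so the shifted trajectory again has the
one-step Markov property with kernel `Q` and starts at a Dirac mass. Uniqueness of such laws
identifies it. -/
theorem traj_map_shift {n : ℕ} (x : Finset.Iic n → S) :
    (Kernel.traj (X := fun _ => S) (histKernel Q) n x).map (fun ω k => ω (n + k)) =
      chainLaw Q hQ (x ⟨n, Finset.mem_Iic.2 le_rfl⟩) := by
  have hsh : Measurable fun (ω : ℕ → S) k => ω (n + k) := by fun_prop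
  have : IsProbabilityMeasure
      ((Kernel.traj (X := fun _ => S) (histKernel Q) n x).map (fun ω k => ω (n + k))) :=
    Measure.isProbabilityMeasure_map hsh.aemeasurable
  refine isMarkovLaw_ext (Q := Q) ?_ (isMarkovLaw_chainLaw Q _) ?_
  · intro m F hF
    have hm1 : Measurable fun ω : ℕ → S =>
        F (Preorder.frestrictLe (π := fun _ => S) m ω, ω (m + 1)) :=
      hF.comp (by fun_prop)
    have hm2 : Measurable fun ω : ℕ → S =>
        ∫⁻ s', F (Preorder.frestrictLe (π := fun _ => S) m ω, s') ∂(Q (ω m)) := by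
      have h1 : Measurable fun x : Finset.Iic m → S =>
          ∫⁻ s', F (x, s') ∂(histKernel Q m x) := Measurable.lintegral_kernel_prod_right' hF
      exact h1.comp (by fun_prop : Measurable (Preorder.frestrictLe (π := fun _ => S) m))
    rw [lintegral_map hm1 hsh, lintegral_map hm2 hsh]
    -- Time `i` of the shifted path is time `n + i` of the original one.
    let e : (Finset.Iic (n + m) → S) → (Finset.Iic m → S) := fun y i =>
      y ⟨n + i, Finset.mem_Iic.2 (by have := Finset.mem_Iic.1 i.2; omega)⟩
    have he : Measurable e := measurable_pi_lambda _ fun i => measurable_pi_apply _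
    exact lintegral_traj_step Q (Nat.le_add_right n m) x (fun q => F (e q.1, q.2))
      (hF.comp ((he.comp measurable_fst).prodMk measurable_snd))
  · rw [Measure.map_map (measurable_pi_apply 0) hsh, chainLaw_map_zero]
    exact traj_map_eval Q x

/-- The laws of a Markov chain, as a kernel in the initial state. -/
def chainKernel : Kernel S (ℕ → S) where
  toFun s := chainLaw Q hQ s
  measurable' := (Kernel.traj (X := fun _ => S) (histKernel Q) 0).measurable.comp
    (measurable_pi_lambda _ fun _ => measurable_id)

theorem chainKernel_apply (s : S) : chainKernel Q s = chainLaw Q hQ s := rfl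

/-- Natural filtration of the coordinate process. -/
abbrev natFil (S : Type*) [MeasurableSpace S] :
    Filtration ℕ (MeasurableSpace.pi (X := fun _ : ℕ => S)) :=
  Filtration.piLE (X := fun _ : ℕ => S)

theorem measurable_eval_natFil {i n : ℕ} (h : i ≤ n) :
    Measurable[natFil S n] fun ω : ℕ → S => ω i := by
  rw [Filtration.piLE_eq_comap_frestrictLe]
  exact (measurable_pi_apply (⟨i, Finset.mem_Iic.2 h⟩ : Finset.Iic n)).comp
    (comap_measurable (Preorder.frestrictLe (π := fun _ : ℕ => S) n))

theorem lintegral_traj_shift {n : ℕ} (x : Finset.Iic n → S) {F : (ℕ → S) → ℝ≥0∞}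
    (hF : Measurable F) :
    ∫⁻ ω, F (fun k => ω (n + k)) ∂(Kernel.traj (X := fun _ => S) (histKernel Q) n x) =
      ∫⁻ ω', F ω' ∂(chainLaw Q hQ (x ⟨n, Finset.mem_Iic.2 le_rfl⟩)) := by
  have hsh : Measurable fun (ω : ℕ → S) k => ω (n + k) := by fun_prop
  rw [← traj_map_shift, lintegral_map hF hsh]

/-- Given its first coordinates, the path is distributed as the trajectory continued from them. `Φ`
may depend on past and whole path jointly, which later gives the Markov property with a factor
measurable in the past. -/
theorem lintegral_chainLaw_frestrictLe (s : S) (n : ℕ)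
    {Φ : (Finset.Iic n → S) × (ℕ → S) → ℝ≥0∞} (hΦ : Measurable Φ) :
    ∫⁻ ω, Φ (Preorder.frestrictLe (π := fun _ => S) n ω, ω) ∂(chainLaw Q hQ s) =
      ∫⁻ ω, ∫⁻ ω', Φ (Preorder.frestrictLe (π := fun _ => S) n ω, ω')
        ∂(Kernel.traj (X := fun _ => S) (histKernel Q) n
          (Preorder.frestrictLe (π := fun _ => S) n ω)) ∂(chainLaw Q hQ s) := by
  have hfr : Measurable (Preorder.frestrictLe (π := fun _ : ℕ => S) n) := by fun_prop
  have hm : Measurable fun ω : ℕ → S => (Preorder.frestrictLe (π := fun _ => S) n ω, ω) :=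
    hfr.prodMk measurable_id
  have h := Kernel.partialTraj_compProd_traj (X := fun _ => S) (κ := histKernel Q)
    (Nat.zero_le n) (fun _ => s)
  rw [← lintegral_map (f := Φ) hΦ hm]
  unfold chainLaw
  rw [← h, Measure.lintegral_compProd hΦ, ← Kernel.traj_map_frestrictLe_apply]
  exact lintegral_map (Measurable.lintegral_kernel_prod_right' hΦ) hfr

/-- Markov property at a deterministic time. -/
theorem lintegral_chainLaw_shift (s : S) (n : ℕ) {Z : (ℕ → S) → ℝ≥0∞}
    (hZ : Measurable[natFil S n] Z) {F : (ℕ → S) → ℝ≥0∞} (hF : Measurable F) :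
    ∫⁻ ω, Z ω * F (fun k => ω (n + k)) ∂(chainLaw Q hQ s) =
      ∫⁻ ω, Z ω * ∫⁻ ω', F ω' ∂(chainLaw Q hQ (ω n)) ∂(chainLaw Q hQ s) := by
  rw [Filtration.piLE_eq_comap_frestrictLe] at hZ
  obtain ⟨z, hz, rfl⟩ := hZ.exists_eq_measurable_comp
  have hsh : Measurable fun (ω : ℕ → S) k => ω (n + k) := by fun_prop
  have hΦ : Measurable fun q : (Finset.Iic n → S) × (ℕ → S) =>
      z q.1 * F (fun k => q.2 (n + k)) :=
    (hz.comp measurable_fst).mul (hF.comp (hsh.comp measurable_snd))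
  refine (lintegral_chainLaw_frestrictLe Q s n hΦ).trans (lintegral_congr fun ω => ?_)
  dsimp only [Function.comp]
  have hFs : Measurable fun ω' : ℕ → S => F (fun k => ω' (n + k)) := hF.comp hsh
  rw [lintegral_const_mul _ hFs, lintegral_traj_shift Q _ hF]
  rfl

theorem lintegral_chainLaw_zero (s : S) {f : S → ℝ≥0∞} (hf : Measurable f) :
    ∫⁻ ω, f (ω 0) ∂(chainLaw Q hQ s) = f s := by
  rw [← lintegral_map hf (measurable_pi_apply 0), chainLaw_map_zero, lintegral_dirac' _ hf]

theorem ae_chainLaw_zero {β : Type*} [MeasurableSpace β] [MeasurableSingletonClass β] (s : S)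
    {f : S → β} (hf : Measurable f) : ∀ᵐ ω ∂(chainLaw Q hQ s), f (ω 0) = f s := by
  have h : MeasurableSet {t | f t = f s} := hf (measurableSet_singleton _)
  have h1 : ∀ᵐ t ∂((chainLaw Q hQ s).map (fun ω => ω 0)), f t = f s := by
    rw [chainLaw_map_zero, ae_dirac_iff h]
  exact ae_of_ae_map (measurable_pi_apply 0).aemeasurable h1

/-- One-step form of the Markov property. -/
theorem lintegral_chainLaw_step (s : S) (n : ℕ) {Z : (ℕ → S) → ℝ≥0∞}
    (hZ : Measurable[natFil S n] Z) {F : S × S → ℝ≥0∞} (hF : Measurable F) :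
    ∫⁻ ω, Z ω * F (ω n, ω (n + 1)) ∂(chainLaw Q hQ s) =
      ∫⁻ ω, Z ω * ∫⁻ s', F (ω n, s') ∂(Q (ω n)) ∂(chainLaw Q hQ s) := by
  have h := lintegral_chainLaw_shift Q s n hZ
    (F := fun ω => F (ω 0, ω 1)) (hF.comp (by fun_prop))
  simp only [add_zero] at h
  rw [h]
  refine lintegral_congr fun ω => ?_
  congr 1
  have h1 := isMarkovLaw_chainLaw Q (ω n) 0
    (fun q => F (q.1 ⟨0, Finset.mem_Iic.2 le_rfl⟩, q.2)) (hF.comp (by fun_prop))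
  simp only [zero_add, Preorder.frestrictLe_apply] at h1
  rw [h1]
  exact lintegral_chainLaw_zero Q (ω n) (f := fun t => ∫⁻ s', F (t, s') ∂(Q t))
    (Measurable.lintegral_kernel_prod_right' hF)

/-- Restricting to an event of the past before taking the image puts the Markov property in the form
of a composition-product, from which integrability and set integrals of signed functions can be read
off. -/
theorem map_restrict_chainLaw (s : S) (n : ℕ) {A : Set (ℕ → S)}
    (hA : MeasurableSet[natFil S n] A) :
    ((chainLaw Q hQ s).restrict A).map (fun ω => (ω n, ω (n + 1))) =
      (((chainLaw Q hQ s).restrict A).map (fun ω => ω n)) ⊗ₘ Q := by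
  have hA' : MeasurableSet A := (natFil S).le n _ hA
  refine Measure.ext_of_lintegral _ fun F hF => ?_
  have hI : Measurable[natFil S n] (A.indicator (1 : (ℕ → S) → ℝ≥0∞)) :=
    (measurable_const (a := (1 : ℝ≥0∞))).indicator hA
  have h := lintegral_chainLaw_step Q s n hI hF
  have e : ∀ G : (ℕ → S) → ℝ≥0∞, ∫⁻ ω, A.indicator 1 ω * G ω ∂(chainLaw Q hQ s) =
      ∫⁻ ω in A, G ω ∂(chainLaw Q hQ s) := by
    intro G
    rw [← lintegral_indicator hA']
    refine lintegral_congr fun ω => ?_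
    by_cases h : ω ∈ A <;> simp [h]
  rw [e, e] at h
  rw [lintegral_map hF (by fun_prop), Measure.lintegral_compProd hF,
    lintegral_map (Measurable.lintegral_kernel_prod_right' hF) (by fun_prop), h]

theorem setIntegral_chainLaw_step (s : S) (n : ℕ) {A : Set (ℕ → S)}
    (hA : MeasurableSet[natFil S n] A) {c : S × S → ℝ} (hc : Measurable c)
    (hi : IntegrableOn (fun ω => c (ω n, ω (n + 1))) A (chainLaw Q hQ s)) :
    IntegrableOn (fun ω => ∫ s', c (ω n, s') ∂(Q (ω n))) A (chainLaw Q hQ s) ∧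
    ∫ ω in A, c (ω n, ω (n + 1)) ∂(chainLaw Q hQ s) =
      ∫ ω in A, ∫ s', c (ω n, s') ∂(Q (ω n)) ∂(chainLaw Q hQ s) := by
  have hm := map_restrict_chainLaw Q s n hA
  have h2 : Measurable fun ω : ℕ → S => (ω n, ω (n + 1)) := by fun_prop
  have hic : Integrable c ((((chainLaw Q hQ s).restrict A).map (fun ω => ω n)) ⊗ₘ Q) := by
    rw [← hm]
    exact (integrable_map_measure hc.aestronglyMeasurable h2.aemeasurable).2 hi
  have hsm : StronglyMeasurable fun t => ∫ s', c (t, s') ∂(Q t) :=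
    hc.stronglyMeasurable.integral_kernel_prod_right'
  constructor
  · have := ((Measure.integrable_compProd_iff hc.aestronglyMeasurable).1 hic).2.mono'
      hsm.aestronglyMeasurable (ae_of_all _ fun t => norm_integral_le_integral_norm _)
    exact (integrable_map_measure hsm.aestronglyMeasurable
      (measurable_pi_apply n).aemeasurable).1 this
  · rw [← integral_map (f := c) h2.aemeasurable hc.aestronglyMeasurable, hm,
      Measure.integral_compProd hic, integral_map (measurable_pi_apply n).aemeasurable
        hsm.aestronglyMeasurable]

theorem ae_chainLaw_step (s : S) {p : S × S → Prop} (hp : MeasurableSet {q | p q})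
    (h : ∀ s, ∀ᵐ s' ∂(Q s), p (s, s')) :
    ∀ᵐ ω ∂(chainLaw Q hQ s), ∀ n, p (ω n, ω (n + 1)) := by
  rw [ae_all_iff]
  intro n
  have h2 : Measurable fun ω : ℕ → S => (ω n, ω (n + 1)) := by fun_prop
  have hm := map_restrict_chainLaw Q s n (A := univ) (by exact @MeasurableSet.univ _ (natFil S n))
  rw [Measure.restrict_univ] at hm
  refine ae_of_ae_map (p := p) h2.aemeasurable ?_
  rw [hm]
  exact (Measure.ae_compProd_iff hp).2 (ae_of_all _ h)

theorem ae_chainLaw_shift (s : S) (n : ℕ) {p : (ℕ → S) → Prop} (hp : MeasurableSet {ω | p ω})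
    (h : ∀ s, ∀ᵐ ω ∂(chainLaw Q hQ s), p ω) :
    ∀ᵐ ω ∂(chainLaw Q hQ s), p (fun k => ω (n + k)) := by
  have hsh : Measurable fun (ω : ℕ → S) k => ω (n + k) := by fun_prop
  have := lintegral_chainLaw_shift Q s n (Z := fun _ => 1) measurable_const
    (F := {ω | p ω}ᶜ.indicator 1) (measurable_one.indicator hp.compl)
  have e : ∀ t, ∫⁻ ω', {ω | p ω}ᶜ.indicator 1 ω' ∂(chainLaw Q hQ t) = 0 := by
    intro t
    rw [lintegral_indicator_one hp.compl]
    exact h t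
  simp only [e, one_mul, lintegral_zero] at this
  have e2 : ∀ ω : ℕ → S, {ω | p ω}ᶜ.indicator (1 : (ℕ → S) → ℝ≥0∞) (fun k => ω (n + k)) =
      ((fun (ω : ℕ → S) k => ω (n + k)) ⁻¹' {ω | p ω}ᶜ).indicator 1 ω := fun ω => rfl
  simp_rw [e2] at this
  rw [lintegral_indicator_one (hsh hp.compl)] at this
  exact this

end Chain

/-! ### Maximal inequalities for sums of martingale differences -/

section Martingale

variable {Ω : Type*} {m0 : MeasurableSpace Ω} {μ : Measure Ω}
  {𝓕 : Filtration ℕ m0}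

/-- Sum of the martingale differences `Y_j - E[Y_j | 𝓕_j]`. -/
def centeredSum (μ : Measure Ω) (𝓕 : Filtration ℕ m0) (Y : ℕ → Ω → ℝ) (n : ℕ) (ω : Ω) : ℝ :=
  ∑ j ∈ Finset.range n, (Y j ω - (μ[Y j | 𝓕 j]) ω)

theorem centeredSum_succ (Y : ℕ → Ω → ℝ) (n : ℕ) (ω : Ω) :
    centeredSum μ 𝓕 Y (n + 1) ω = centeredSum μ 𝓕 Y n ω + (Y n ω - (μ[Y n | 𝓕 n]) ω) :=
  Finset.sum_range_succ _ _

theorem stronglyMeasurable_centeredSum {Y : ℕ → Ω → ℝ}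
    (hY : ∀ j, StronglyMeasurable[𝓕 (j + 1)] (Y j)) (n : ℕ) :
    StronglyMeasurable[𝓕 n] (centeredSum μ 𝓕 Y n) := by
  refine Finset.stronglyMeasurable_fun_sum _ fun j hj => ?_
  have hj' : j + 1 ≤ n := Finset.mem_range.1 hj
  exact ((hY j).mono (𝓕.mono hj')).sub
    (stronglyMeasurable_condExp.mono (𝓕.mono ((Nat.le_succ j).trans hj')))

theorem abs_centeredSum_le {Y : ℕ → Ω → ℝ} (hb : ∀ j ω, |Y j ω| ≤ 1) :
    ∀ᵐ ω ∂μ, ∀ n, |centeredSum μ 𝓕 Y n ω| ≤ 2 * n := by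
  have h : ∀ᵐ ω ∂μ, ∀ j, |(μ[Y j | 𝓕 j]) ω| ≤ 1 := by
    rw [ae_all_iff]
    intro j
    exact ae_bdd_abs_condExp_of_ae_bdd_abs (ae_of_all _ fun ω => hb j ω)
  filter_upwards [h] with ω hω n
  refine (Finset.abs_sum_le_sum_abs _ _).trans ?_
  calc ∑ j ∈ Finset.range n, |Y j ω - (μ[Y j | 𝓕 j]) ω| ≤ ∑ j ∈ Finset.range n, (2 : ℝ) :=
        Finset.sum_le_sum fun j _ => by
          have := abs_sub (Y j ω) ((μ[Y j | 𝓕 j]) ω)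
          linarith [hb j ω, hω j]
    _ = 2 * n := by simp [mul_comm]

variable [IsProbabilityMeasure μ]

/-- The cross term vanishes: the sum up to `n` is known at time `n` and the new difference has zero
conditional mean. Allowing every `𝓕 n`-measurable set gives at once the submartingale property of
the squares and, for the whole space, the growth of the second moment. -/
theorem setIntegral_centeredSum_sq_succ {Y : ℕ → Ω → ℝ}
    (hY : ∀ j, StronglyMeasurable[𝓕 (j + 1)] (Y j)) (hb : ∀ j ω, |Y j ω| ≤ 1) (n : ℕ)
    {s : Set Ω} (hs : MeasurableSet[𝓕 n] s) :
    ∫ ω in s, centeredSum μ 𝓕 Y (n + 1) ω ^ 2 ∂μ = ∫ ω in s, centeredSum μ 𝓕 Y n ω ^ 2 ∂μ +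
      ∫ ω in s, (Y n ω - (μ[Y n | 𝓕 n]) ω) ^ 2 ∂μ := by
  set M := centeredSum μ 𝓕 Y with hM
  set D : Ω → ℝ := fun ω => Y n ω - (μ[Y n | 𝓕 n]) ω with hD
  have hs' : MeasurableSet s := 𝓕.le n _ hs
  have hMm : ∀ k, StronglyMeasurable (M k) := fun k =>
    (stronglyMeasurable_centeredSum hY k).mono (𝓕.le k)
  have hYi : Integrable (Y n) μ :=
    Integrable.of_bound ((hY n).mono (𝓕.le _)).aestronglyMeasurable 1
      (ae_of_all _ fun ω => by simpa using hb n ω)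
  have hDm : StronglyMeasurable D := ((hY n).mono (𝓕.le _)).sub
    (stronglyMeasurable_condExp.mono (𝓕.le _))
  have hDi : Integrable D μ := hYi.sub integrable_condExp
  have hMb := abs_centeredSum_le (μ := μ) (𝓕 := 𝓕) hb
  have hDb : ∀ᵐ ω ∂μ, |D ω| ≤ 2 := by
    have h : ∀ᵐ ω ∂μ, |(μ[Y n | 𝓕 n]) ω| ≤ 1 :=
      ae_bdd_abs_condExp_of_ae_bdd_abs (ae_of_all _ fun ω => hb n ω)
    filter_upwards [h] with ω hω
    have := abs_sub (Y n ω) ((μ[Y n | 𝓕 n]) ω)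
    simp only [hD]
    linarith [hb n ω]
  have hM2 : Integrable (fun ω => M n ω ^ 2) μ := by
    refine Integrable.of_bound ((hMm n).pow 2).aestronglyMeasurable ((2 * n) ^ 2) ?_
    filter_upwards [hMb] with ω hω
    rw [Real.norm_eq_abs, abs_pow]
    exact pow_le_pow_left₀ (abs_nonneg _) (hω n) 2
  have hD2 : Integrable (fun ω => D ω ^ 2) μ := by
    refine Integrable.of_bound (hDm.pow 2).aestronglyMeasurable (2 ^ 2) ?_
    filter_upwards [hDb] with ω hω
    rw [Real.norm_eq_abs, abs_pow]
    exact pow_le_pow_left₀ (abs_nonneg _) hω 2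
  have hMD : Integrable (M n * D) μ := by
    refine Integrable.of_bound ((hMm n).mul hDm).aestronglyMeasurable (2 * n * 2) ?_
    filter_upwards [hMb, hDb] with ω h1 h2
    rw [Real.norm_eq_abs, Pi.mul_apply, abs_mul]
    exact mul_le_mul (h1 n) h2 (abs_nonneg _) (by positivity)
  have h0 : ∫ ω in s, (M n * D) ω ∂μ = 0 := by
    rw [← setIntegral_condExp (𝓕.le n) hMD hs]
    have h1 := condExp_mul_of_stronglyMeasurable_left
      (stronglyMeasurable_centeredSum (μ := μ) hY n) hMD hDi
    have h2 : μ[D | 𝓕 n] =ᵐ[μ] 0 := by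
      have h3 := condExp_sub hYi (integrable_condExp (m := 𝓕 n) (f := Y n) (μ := μ)) (𝓕 n)
      have h4 : μ[μ[Y n | 𝓕 n] | 𝓕 n] = μ[Y n | 𝓕 n] :=
        condExp_of_stronglyMeasurable (𝓕.le n) stronglyMeasurable_condExp integrable_condExp
      filter_upwards [h3] with ω h
      have h' : (μ[D | 𝓕 n]) ω = _ := h
      rw [h', h4]
      simp
    rw [setIntegral_congr_ae (g := fun _ => 0) hs' ?_, integral_zero]
    filter_upwards [h1, h2] with ω h1 h2 _
    rw [h1, Pi.mul_apply, h2]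
    simp
  have e : ∀ ω, M (n + 1) ω ^ 2 = M n ω ^ 2 + (2 * (M n * D) ω + D ω ^ 2) := by
    intro ω
    rw [hM, centeredSum_succ, ← hM]
    simp only [Pi.mul_apply, hD]
    ring
  have hi1 : Integrable (fun ω => 2 * (M n * D) ω) (μ.restrict s) :=
    (hMD.const_mul 2).integrableOn
  have hi2 : Integrable (fun ω => 2 * (M n * D) ω + D ω ^ 2) (μ.restrict s) :=
    hi1.add hD2.integrableOn
  simp_rw [e]
  rw [integral_add hM2.integrableOn hi2, integral_add hi1 hD2.integrableOn, integral_const_mul, h0]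
  simp [hD]

theorem integral_sub_condExp_sq_le {m : MeasurableSpace Ω} (hm : m ≤ m0) {T : Ω → ℝ}
    (hT : StronglyMeasurable[m0] T) (hb : ∀ ω, |T ω| ≤ 1) :
    ∫ ω, (T ω - (μ[T | m]) ω) ^ 2 ∂μ ≤ ∫ ω, T ω ^ 2 ∂μ := by
  have hL : MemLp T 2 μ := MemLp.of_bound hT.aestronglyMeasurable 1
    (ae_of_all _ fun ω => by simpa using hb ω)
  have h1 := condVar_ae_le_condExp_sq hm hL
  have hi : Integrable ((T - μ[T | m]) ^ 2) μ := (hL.sub (hL.condExp one_le_two)).integrable_sq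
  have h2 : ∫ ω, (Var[T; μ | m]) ω ∂μ = ∫ ω, ((T - μ[T | m]) ^ 2) ω ∂μ := integral_condExp hm
  have h3 : ∫ ω, (μ[T ^ 2 | m]) ω ∂μ = ∫ ω, (T ^ 2) ω ∂μ := integral_condExp hm
  have h4 := integral_mono_ae integrable_condVar integrable_condExp h1
  rw [h2, h3] at h4
  exact h4

/-- Doob's `L²` maximal inequality for sums of centered bounded variables. -/
theorem measure_exists_lt_abs_centeredSum_le_of_bounded {Y : ℕ → Ω → ℝ}
    (hY : ∀ j, StronglyMeasurable[𝓕 (j + 1)] (Y j)) (hb : ∀ j ω, |Y j ω| ≤ 1)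
    {δ : ℝ} (hδ : 0 < δ) :
    μ {ω | ∃ n, δ < |centeredSum μ 𝓕 Y n ω|} ≤
      ENNReal.ofReal (1 / δ ^ 2) * ∑' j, ∫⁻ ω, ENNReal.ofReal (Y j ω ^ 2) ∂μ := by
  set M := centeredSum μ 𝓕 Y with hM
  have hMm : ∀ k, StronglyMeasurable[𝓕 k] (M k) := stronglyMeasurable_centeredSum hY
  have hM2 : ∀ n, Integrable (fun ω => M n ω ^ 2) μ := by
    intro n
    refine Integrable.of_bound (((hMm n).mono (𝓕.le n)).pow 2).aestronglyMeasurable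
      ((2 * n) ^ 2) ?_
    filter_upwards [abs_centeredSum_le (μ := μ) (𝓕 := 𝓕) hb] with ω hω
    rw [Real.norm_eq_abs, abs_pow]
    exact pow_le_pow_left₀ (abs_nonneg _) (hω n) 2
  have hsub : Submartingale (fun n ω => M n ω ^ 2) 𝓕 μ := by
    refine submartingale_of_setIntegral_le_succ (fun n => (hMm n).pow 2) hM2 fun n s hs => ?_
    rw [setIntegral_centeredSum_sq_succ hY hb n hs]
    have : 0 ≤ ∫ ω in s, (Y n ω - (μ[Y n | 𝓕 n]) ω) ^ 2 ∂μ := integral_nonneg fun ω => sq_nonneg _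
    linarith
  have hY2 : ∀ j, Integrable (fun ω => Y j ω ^ 2) μ := by
    intro j
    refine Integrable.of_bound (((hY j).mono (𝓕.le _)).pow 2).aestronglyMeasurable 1 ?_
    refine ae_of_all _ fun ω => ?_
    rw [Real.norm_eq_abs, abs_pow]
    exact pow_le_one₀ (abs_nonneg _) (hb j ω)
  have hbound : ∀ n, ∫ ω, M n ω ^ 2 ∂μ ≤ ∑ j ∈ Finset.range n, ∫ ω, Y j ω ^ 2 ∂μ := by
    intro n
    induction n with
    | zero => simp [hM, centeredSum]
    | succ n ih =>
      have h := setIntegral_centeredSum_sq_succ (μ := μ) hY hb n (s := univ)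
        (@MeasurableSet.univ _ (𝓕 n))
      simp only [Measure.restrict_univ] at h
      rw [Finset.sum_range_succ, h]
      exact add_le_add ih (integral_sub_condExp_sq_le (𝓕.le n) ((hY n).mono (𝓕.le (n + 1))) (hb n))
  have hfin : ∀ n, μ {ω | ∃ k ≤ n, δ < |M k ω|} ≤
      ENNReal.ofReal (1 / δ ^ 2) * ∑' j, ∫⁻ ω, ENNReal.ofReal (Y j ω ^ 2) ∂μ := by
    intro n
    have h := maximal_ineq hsub (fun n ω => sq_nonneg _) (ε := (δ ^ 2).toNNReal) n
    rw [Real.coe_toNNReal _ (sq_nonneg δ)] at h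
    set B := {ω | δ ^ 2 ≤ (Finset.range (n + 1)).sup'
      Finset.nonempty_range_add_one fun k => M k ω ^ 2} with hB
    have hsubset : {ω | ∃ k ≤ n, δ < |M k ω|} ⊆ B := by
      rintro ω ⟨k, hk, hlt⟩
      have h1 : δ ^ 2 ≤ M k ω ^ 2 := by
        rw [← sq_abs (M k ω)]
        exact pow_le_pow_left₀ hδ.le hlt.le 2
      exact h1.trans (Finset.le_sup' (f := fun k => M k ω ^ 2)
        (Finset.mem_range.2 (Nat.lt_succ_of_le hk)))
    have h2 : ∫ ω in B, M n ω ^ 2 ∂μ ≤ ∑ j ∈ Finset.range n, ∫ ω, Y j ω ^ 2 ∂μ :=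
      (setIntegral_le_integral (hM2 n) (ae_of_all _ fun ω => sq_nonneg _)).trans (hbound n)
    have h3 : ENNReal.ofReal (∑ j ∈ Finset.range n, ∫ ω, Y j ω ^ 2 ∂μ) ≤
        ∑' j, ∫⁻ ω, ENNReal.ofReal (Y j ω ^ 2) ∂μ := by
      rw [ENNReal.ofReal_sum_of_nonneg fun j _ => integral_nonneg fun ω => sq_nonneg _]
      refine (Finset.sum_le_sum fun j _ => ?_).trans (ENNReal.sum_le_tsum (Finset.range n))
      rw [ofReal_integral_eq_lintegral_ofReal (hY2 j) (ae_of_all _ fun ω => sq_nonneg _)]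
    have h4 : ENNReal.ofReal (δ ^ 2) * μ B ≤ ∑' j, ∫⁻ ω, ENNReal.ofReal (Y j ω ^ 2) ∂μ := by
      exact h.trans ((ENNReal.ofReal_le_ofReal h2).trans h3)
    calc μ {ω | ∃ k ≤ n, δ < |M k ω|} ≤ μ B := measure_mono hsubset
      _ = ENNReal.ofReal (1 / δ ^ 2) * (ENNReal.ofReal (δ ^ 2) * μ B) := by
          rw [← mul_assoc, ← ENNReal.ofReal_mul (by positivity), one_div_mul_cancel (by positivity),
            ENNReal.ofReal_one, one_mul]
      _ ≤ _ := by gcongr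
  -- The bound at a finite horizon does not depend on the horizon, so it passes to the increasing
  -- union.
  have hU : {ω | ∃ n, δ < |M n ω|} = ⋃ n, {ω | ∃ k ≤ n, δ < |M k ω|} := by
    ext ω
    simp only [mem_ofPred_eq, mem_iUnion]
    exact ⟨fun ⟨n, h⟩ => ⟨n, n, le_rfl, h⟩, fun ⟨_, k, _, h⟩ => ⟨k, h⟩⟩
  have hmono : Monotone fun n => {ω | ∃ k ≤ n, δ < |M k ω|} := by
    rintro a b hab ω ⟨k, hk, h⟩
    exact ⟨k, hk.trans hab, h⟩
  rw [hU, hmono.measure_iUnion]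
  exact iSup_le hfin

/-- Maximal inequality under a moment condition of order `q ∈ [1, 2]`. -/
theorem measure_exists_lt_abs_centeredSum_le {q : ℝ} (hq1 : 1 ≤ q) (hq2 : q ≤ 2)
    {Y : ℕ → Ω → ℝ} (hY : ∀ j, StronglyMeasurable[𝓕 (j + 1)] (Y j))
    (hYi : ∀ j, Integrable (Y j) μ) {δ : ℝ} (hδ : 0 < δ) (hδ1 : δ ≤ 1) :
    μ {ω | ∃ n, δ < |centeredSum μ 𝓕 Y n ω|} ≤
      ENNReal.ofReal (8 / δ ^ 2) * ∑' j, ∫⁻ ω, ENNReal.ofReal (|Y j ω| ^ q) ∂μ := by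
  -- Truncation at level one: `T² ≤ |Y| ^ q` because `q ≤ 2`, and `|R| ≤ |Y| ^ q` because `q ≥ 1`.
  set T : ℕ → Ω → ℝ := fun j ω => if |Y j ω| ≤ 1 then Y j ω else 0 with hT
  set R : ℕ → Ω → ℝ := fun j ω => if |Y j ω| ≤ 1 then 0 else Y j ω with hR
  have hYm : ∀ j, Measurable[𝓕 (j + 1)] (Y j) := fun j => (hY j).measurable
  have hset : ∀ j, MeasurableSet[𝓕 (j + 1)] {ω | |Y j ω| ≤ 1} := fun j =>
    (measurable_norm.comp (hYm j)) measurableSet_Iic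
  have hTm : ∀ j, StronglyMeasurable[𝓕 (j + 1)] (T j) := fun j =>
    (Measurable.ite (hset j) (hYm j) measurable_const).stronglyMeasurable
  have hRm : ∀ j, StronglyMeasurable (R j) := fun j =>
    ((Measurable.ite (hset j) measurable_const (hYm j)).stronglyMeasurable).mono (𝓕.le _)
  have hTb : ∀ j ω, |T j ω| ≤ 1 := by
    intro j ω
    simp only [hT]
    split_ifs with h <;> simp [h]
  have hTR : ∀ j, Y j = T j + R j := by
    intro j; ext ω
    simp only [hT, hR, Pi.add_apply]
    split_ifs <;> simp
  have hTi : ∀ j, Integrable (T j) μ := fun j =>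
    Integrable.of_bound ((hTm j).mono (𝓕.le _)).aestronglyMeasurable 1
      (ae_of_all _ fun ω => by simpa using hTb j ω)
  have hRi : ∀ j, Integrable (R j) μ := by
    intro j
    have : R j = Y j - T j := by rw [hTR j]; simp
    rw [this]
    exact (hYi j).sub (hTi j)
  set N : ℝ≥0∞ := ∑' j, ∫⁻ ω, ENNReal.ofReal (|Y j ω| ^ q) ∂μ with hN
  -- The large parts are summed in absolute value; their first moments suffice and no cancellation
  -- is needed.
  set V : Ω → ℝ≥0∞ := fun ω => ∑' j, ‖R j ω - (μ[R j | 𝓕 j]) ω‖ₑ with hV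
  have hsplit : ∀ᵐ ω ∂μ, ∀ n, ENNReal.ofReal |centeredSum μ 𝓕 Y n ω| ≤
      ENNReal.ofReal |centeredSum μ 𝓕 T n ω| + V ω := by
    have h : ∀ᵐ ω ∂μ, ∀ j, (μ[Y j | 𝓕 j]) ω = (μ[T j | 𝓕 j]) ω + (μ[R j | 𝓕 j]) ω := by
      rw [ae_all_iff]
      intro j
      have := condExp_add (hTi j) (hRi j) (𝓕 j)
      rw [← hTR j] at this
      exact this
    filter_upwards [h] with ω hω n
    have e : centeredSum μ 𝓕 Y n ω = centeredSum μ 𝓕 T n ω +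
        ∑ j ∈ Finset.range n, (R j ω - (μ[R j | 𝓕 j]) ω) := by
      unfold centeredSum
      rw [← Finset.sum_add_distrib]
      refine Finset.sum_congr rfl fun j _ => ?_
      rw [hω j, hTR j, Pi.add_apply]
      ring
    rw [e]
    refine (ENNReal.ofReal_le_ofReal (abs_add_le _ _)).trans ?_
    rw [ENNReal.ofReal_add (abs_nonneg _) (abs_nonneg _)]
    gcongr
    rw [← Real.enorm_eq_ofReal_abs]
    exact (enorm_sum_le _ _).trans (ENNReal.sum_le_tsum _)
  have hVm : Measurable V := Measurable.tsum fun j =>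
    ((hRm j).measurable.sub (stronglyMeasurable_condExp.mono (𝓕.le j)).measurable).enorm
  have hRq : ∀ j ω, ‖R j ω‖ₑ ≤ ENNReal.ofReal (|Y j ω| ^ q) := by
    intro j ω
    simp only [hR]
    split_ifs with h
    · simp
    · rw [Real.enorm_eq_ofReal_abs]
      refine ENNReal.ofReal_le_ofReal ?_
      calc |Y j ω| = |Y j ω| ^ (1 : ℝ) := (Real.rpow_one _).symm
        _ ≤ |Y j ω| ^ q := Real.rpow_le_rpow_of_exponent_le (not_le.1 h).le hq1
  have hTq : ∀ j ω, ENNReal.ofReal (T j ω ^ 2) ≤ ENNReal.ofReal (|Y j ω| ^ q) := by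
    intro j ω
    refine ENNReal.ofReal_le_ofReal ?_
    simp only [hT]
    split_ifs with h
    · rw [← sq_abs, ← Real.rpow_two]
      rcases (abs_nonneg (Y j ω)).eq_or_lt with h0 | h0
      · rw [← h0, Real.zero_rpow (by norm_num), Real.zero_rpow (by linarith)]
      · exact Real.rpow_le_rpow_of_exponent_ge h0 h hq2
    · simp only [ne_eq, OfNat.ofNat_ne_zero, not_false_eq_true, zero_pow]
      positivity
  -- The factor two accounts for `R j` and for its conditional expectation, which contracts the
  -- first moment.
  have hVint : ∫⁻ ω, V ω ∂μ ≤ 2 * N := by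
    have hm : ∀ j, AEMeasurable (fun ω => ‖R j ω - (μ[R j | 𝓕 j]) ω‖ₑ) μ := fun j =>
      ((hRm j).measurable.sub
        (stronglyMeasurable_condExp.mono (𝓕.le j)).measurable).enorm.aemeasurable
    simp only [hV]
    rw [lintegral_tsum hm, hN, ← ENNReal.tsum_mul_left]
    refine ENNReal.tsum_le_tsum fun j => ?_
    have h1 : ∫⁻ ω, ‖(μ[R j | 𝓕 j]) ω‖ₑ ∂μ ≤ ∫⁻ ω, ‖R j ω‖ₑ ∂μ := by
      have := eLpNorm_condExp_le_eLpNorm (μ := μ) (m := 𝓕 j) (R j) (le_refl (1 : ℝ≥0∞))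
      rwa [eLpNorm_one_eq_lintegral_enorm, eLpNorm_one_eq_lintegral_enorm] at this
    have h2 : ∫⁻ ω, ‖R j ω‖ₑ ∂μ ≤ ∫⁻ ω, ENNReal.ofReal (|Y j ω| ^ q) ∂μ :=
      lintegral_mono fun ω => hRq j ω
    calc ∫⁻ ω, ‖R j ω - (μ[R j | 𝓕 j]) ω‖ₑ ∂μ
        ≤ ∫⁻ ω, (‖R j ω‖ₑ + ‖(μ[R j | 𝓕 j]) ω‖ₑ) ∂μ := lintegral_mono fun ω => enorm_sub_le
      _ = ∫⁻ ω, ‖R j ω‖ₑ ∂μ + ∫⁻ ω, ‖(μ[R j | 𝓕 j]) ω‖ₑ ∂μ :=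
          lintegral_add_left (hRm j).measurable.enorm _
      _ ≤ 2 * ∫⁻ ω, ENNReal.ofReal (|Y j ω| ^ q) ∂μ := by
          rw [two_mul]
          exact add_le_add h2 (h1.trans h2)
  have hA := measure_exists_lt_abs_centeredSum_le_of_bounded (μ := μ) hTm hTb (half_pos hδ)
  have hB : μ {ω | ENNReal.ofReal (δ / 2) ≤ V ω} ≤ ENNReal.ofReal (2 / δ) * (2 * N) := by
    have h := mul_meas_ge_le_lintegral (μ := μ) hVm (ENNReal.ofReal (δ / 2))
    calc μ {ω | ENNReal.ofReal (δ / 2) ≤ V ω}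
        = ENNReal.ofReal (2 / δ) * (ENNReal.ofReal (δ / 2) * μ {ω | ENNReal.ofReal (δ / 2) ≤ V ω}) := by
          rw [← mul_assoc, ← ENNReal.ofReal_mul (by positivity),
            show 2 / δ * (δ / 2) = 1 by field_simp, ENNReal.ofReal_one, one_mul]
      _ ≤ _ := mul_le_mul_right (h.trans hVint) _
  have hsum : ∑' j, ∫⁻ ω, ENNReal.ofReal (T j ω ^ 2) ∂μ ≤ N :=
    ENNReal.tsum_le_tsum fun j => lintegral_mono fun ω => hTq j ω
  have hunion : μ {ω | ∃ n, δ < |centeredSum μ 𝓕 Y n ω|} ≤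
      μ ({ω | ∃ n, δ / 2 < |centeredSum μ 𝓕 T n ω|} ∪ {ω | ENNReal.ofReal (δ / 2) ≤ V ω}) := by
    refine measure_mono_ae ?_
    filter_upwards [hsplit] with ω hω
    rintro ⟨n, hn⟩
    by_contra hcon
    have h1 : ∀ k, |centeredSum μ 𝓕 T k ω| ≤ δ / 2 := by
      intro k
      by_contra h
      exact hcon (Or.inl ⟨k, not_le.1 h⟩)
    have h2 : V ω < ENNReal.ofReal (δ / 2) := by
      by_contra h
      exact hcon (Or.inr (not_lt.1 h))
    have h3 : ENNReal.ofReal |centeredSum μ 𝓕 Y n ω| <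
        ENNReal.ofReal (δ / 2) + ENNReal.ofReal (δ / 2) :=
      (hω n).trans_lt (ENNReal.add_lt_add_of_le_of_lt ENNReal.ofReal_ne_top
        (ENNReal.ofReal_le_ofReal (h1 n)) h2)
    rw [← ENNReal.ofReal_add (by positivity) (by positivity), add_halves,
      ENNReal.ofReal_lt_ofReal_iff hδ] at h3
    exact absurd hn (not_lt.2 h3.le)
  calc _ ≤ _ := hunion
    _ ≤ _ := measure_union_le _ _
    _ ≤ ENNReal.ofReal (1 / (δ / 2) ^ 2) * N + ENNReal.ofReal (2 / δ) * (2 * N) := by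
        gcongr
        exact hA.trans (by gcongr)
    _ = ENNReal.ofReal (4 / δ ^ 2 + 4 / δ) * N := by
        rw [ENNReal.ofReal_add (by positivity) (by positivity), add_mul, ← mul_assoc]
        congr 2
        · congr 1; field_simp; norm_num
        · rw [show (2 : ℝ≥0∞) = ENNReal.ofReal 2 by simp, ← ENNReal.ofReal_mul (by positivity)]
          congr 1; ring
    _ ≤ _ := by
        -- Doob at level `δ / 2` gives `4 / δ²`, Markov's inequality for `V` gives `4 / δ`; `δ ≤ 1`
        -- merges them into `8 / δ²`.
        gcongr
        have : 4 / δ ≤ 4 / δ ^ 2 := by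
          apply div_le_div_of_nonneg_left (by norm_num) (by positivity)
          nlinarith
        calc 4 / δ ^ 2 + 4 / δ ≤ 4 / δ ^ 2 + 4 / δ ^ 2 := by linarith
          _ = 8 / δ ^ 2 := by ring

end Martingale

/-! ### Uniform ergodicity on compact parameter sets and regularity of the invariant laws -/

section LocalBounds

variable {d : ℕ} {X : Type*} [MeasurableSpace X]

/-- Quantitative ergodicity of the kernels `P_θ`, uniformly over `θ ∈ 𝒦`. -/
structure LocalBounds (P : Kernel (E d × X) X) (π : E d → Measure X) (W : X → ℝ)
    (𝒦 : Set (E d)) (p υ C r : ℝ) : Prop where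
  measurable_W : Measurable W
  one_le_W : ∀ x, 1 ≤ W x
  one_le_C : 1 ≤ C
  r_mem : r ∈ Ioo (0 : ℝ) 1
  prob : ∀ θ ∈ 𝒦, IsProbabilityMeasure (π θ)
  invariant : ∀ θ ∈ 𝒦, Kernel.Invariant (P.sectR θ) (π θ)
  integrable_W : ∀ θ ∈ 𝒦, Integrable W (π θ)
  integral_W_le : ∀ θ ∈ 𝒦, ∫ x, W x ∂(π θ) ≤ C
  integrable_W_pow : ∀ θ ∈ 𝒦, ∀ (l : ℕ) (x : X), Integrable W ((P.sectR θ ^ l) x)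
  ergodic : ∀ θ ∈ 𝒦, ∀ f : X → ℝ, Measurable f → (∀ x, |f x| ≤ W x) → ∀ (l : ℕ) (x : X),
    |(∫ y, f y ∂((P.sectR θ ^ l) x)) - ∫ y, f y ∂(π θ)| ≤ C * r ^ l * W x
  drift : ∀ θ ∈ 𝒦, ∀ x, ∫⁻ y, ENNReal.ofReal (W y ^ p) ∂(P (θ, x)) ≤
    ENNReal.ofReal (r * W x ^ p + C)
  holder : ∀ θ ∈ 𝒦, ∀ θ' ∈ 𝒦, ∀ f : X → ℝ, Measurable f → (∀ x, |f x| ≤ W x) → ∀ x : X,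
    |(∫ y, f y ∂(P (θ, x))) - ∫ y, f y ∂(P (θ', x))| ≤ C * ‖θ - θ'‖ ^ υ * W x

theorem abs_integral_sub_le_of_wDist_le {W : X → ℝ} {μ ν : Measure X}
    {B : ℝ} (hB : 0 ≤ B) (h : wDist W μ ν ≤ ENNReal.ofReal B) {f : X → ℝ} (hf : Measurable f)
    (hfW : ∀ x, |f x| ≤ W x) : |(∫ x, f x ∂μ) - ∫ x, f x ∂ν| ≤ B := by
  have hn : wNorm W f ≤ 1 := by
    refine iSup_le fun x => ENNReal.div_le_of_le_mul ?_
    rw [one_mul, Real.enorm_eq_ofReal_abs]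
    exact ENNReal.ofReal_le_ofReal (hfW x)
  have h1 : ‖(∫ x, f x ∂μ) - ∫ x, f x ∂ν‖ₑ ≤ wDist W μ ν :=
    le_iSup_of_le f (le_iSup_of_le hf (le_iSup_of_le hn le_rfl))
  have h2 := h1.trans h
  rw [Real.enorm_eq_ofReal_abs] at h2
  exact (ENNReal.ofReal_le_ofReal_iff hB).1 h2

theorem norm_le_of_wNorm_le {F : Type*} [NormedAddCommGroup F] {W : X → ℝ} (hW : ∀ x, 1 ≤ W x)
    {f : X → F} {B : ℝ} (hB : 0 ≤ B) (h : wNorm W f ≤ ENNReal.ofReal B) (x : X) :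
    ‖f x‖ ≤ B * W x := by
  have h0 : 0 < W x := lt_of_lt_of_le one_pos (hW x)
  have h1 : ‖f x‖ₑ / ENNReal.ofReal (W x) ≤ ENNReal.ofReal B := (le_iSup _ x).trans h
  rw [ENNReal.div_le_iff (by simpa using h0) ENNReal.ofReal_ne_top, ← ENNReal.ofReal_mul hB,
    ← ofReal_norm] at h1
  exact (ENNReal.ofReal_le_ofReal_iff (by positivity)).1 h1

/-- Each step costs at most the constant `b`, so all iterates have finite moments. The two
conclusions are proved together because integrating `b` at the next step uses that `(R ^ l) x` has
mass one. -/
theorem lintegral_pow_lt_top (R : Kernel X X) [IsMarkovKernel R] {V : X → ℝ}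
    (hV : Measurable V) {b : ℝ}
    (h : ∀ x, ∫⁻ y, ENNReal.ofReal (V y) ∂(R x) ≤ ENNReal.ofReal (V x + b)) (l : ℕ) (x : X) :
    ∫⁻ y, ENNReal.ofReal (V y) ∂((R ^ l) x) < ∞ ∧ IsProbabilityMeasure ((R ^ l) x) := by
  induction l with
  | zero =>
    have e : (R ^ 0) x = Measure.dirac x := by rw [pow_zero]; exact Kernel.id_apply x
    rw [e, lintegral_dirac' _ hV.ennreal_ofReal]
    exact ⟨ENNReal.ofReal_lt_top, inferInstance⟩
  | succ l ih =>
    obtain ⟨ih1, ih2⟩ := ih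
    have e : R ^ (l + 1) = R ∘ₖ (R ^ l) := pow_succ' R l
    rw [e]
    constructor
    · rw [Kernel.lintegral_comp _ _ _ hV.ennreal_ofReal]
      calc ∫⁻ y, ∫⁻ z, ENNReal.ofReal (V z) ∂(R y) ∂((R ^ l) x)
          ≤ ∫⁻ y, (ENNReal.ofReal (V y) + ENNReal.ofReal b) ∂((R ^ l) x) :=
            lintegral_mono fun y => (h y).trans ENNReal.ofReal_add_le
        _ = ∫⁻ y, ENNReal.ofReal (V y) ∂((R ^ l) x) + ENNReal.ofReal b := by
            rw [lintegral_add_right _ measurable_const]; simp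
        _ < ∞ := ENNReal.add_lt_top.2 ⟨ih1, ENNReal.ofReal_lt_top⟩
    · rw [Kernel.comp_apply]
      infer_instance

theorem integrable_of_abs_le_mul {W : X → ℝ} {μ : Measure X}
    (hμ : Integrable W μ) {f : X → ℝ} (hf : Measurable f) {c : ℝ} (hfW : ∀ x, |f x| ≤ c * W x) :
    Integrable f μ :=
  (hμ.const_mul c).mono' hf.aestronglyMeasurable (ae_of_all _ fun x => hfW x)

/-- A bound for functions dominated by `W` extends linearly to multiples of `W`. -/
theorem abs_integral_sub_le_mul {W : X → ℝ} {μ ν : Measure X} {B : ℝ}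
    (h : ∀ f : X → ℝ, Measurable f → (∀ x, |f x| ≤ W x) → |(∫ x, f x ∂μ) - ∫ x, f x ∂ν| ≤ B)
    {f : X → ℝ} (hf : Measurable f) {c : ℝ} (hc : 0 ≤ c) (hfW : ∀ x, |f x| ≤ c * W x) :
    |(∫ x, f x ∂μ) - ∫ x, f x ∂ν| ≤ c * B := by
  rcases hc.eq_or_lt with rfl | hc
  · have : f = fun _ => 0 := by
      ext x
      have := hfW x
      rw [zero_mul] at this
      exact abs_nonpos_iff.1 this
    simp [this]
  · have h1 := h (fun x => c⁻¹ * f x) (hf.const_mul _) (fun x => by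
      rw [abs_mul, abs_of_pos (inv_pos.2 hc), inv_mul_le_iff₀ hc]
      exact hfW x)
    rw [integral_const_mul, integral_const_mul, ← mul_sub, abs_mul, abs_of_pos (inv_pos.2 hc),
      inv_mul_le_iff₀ hc] at h1
    exact h1

/-- The assumptions on the kernels give uniform bounds on every compact subset of `Θ`. -/
theorem exists_localBounds {Θ : Set (E d)} {P : Kernel (E d × X) X} [IsMarkovKernel P]
    {H : E d → X → E d} {π : E d → Measure X} {W : X → ℝ} {p υ : ℝ} (hp : 1 < p)
    (hHW : FieldBound Θ H W) (hP : UniformErgodicity Θ P π W p) (hPυ : HolderKernels Θ P W υ)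
    {𝒦 : Set (E d)} (h𝒦 : IsCompact 𝒦) (hΘ : 𝒦 ⊆ Θ) :
    ∃ C r, LocalBounds P π W 𝒦 p υ C r := by
  obtain ⟨⟨C₁, hC₁, r₁, hr₁, herg⟩, hπW⟩ := hP.ergodic 𝒦 h𝒦 hΘ
  obtain ⟨ρ, hρ, b, hdrift⟩ := hP.drift 𝒦 h𝒦 hΘ
  obtain ⟨C₂, hC₂⟩ := hPυ 𝒦 h𝒦 hΘ
  set B : ℝ≥0∞ := ⨆ θ ∈ 𝒦, ∫⁻ x, ENNReal.ofReal (W x) ∂(π θ) with hB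
  have hW1 := hHW.one_le_W
  have hW0 : ∀ x, 0 < W x := fun x => one_pos.trans_le (hW1 x)
  have hWp : ∀ x, 0 < W x ^ p := fun x => Real.rpow_pos_of_pos (hW0 x) p
  set C : ℝ := 1 + C₁ + |C₂| + |b| + B.toReal with hC
  have hCb : |b| ≤ C := by
    have := abs_nonneg C₂; have : 0 ≤ B.toReal := ENNReal.toReal_nonneg
    linarith
  have hC1 : C₁ ≤ C := by
    have := abs_nonneg C₂; have : 0 ≤ B.toReal := ENNReal.toReal_nonneg
    have := abs_nonneg b; linarith
  have hC2 : C₂ ≤ C := by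
    have := le_abs_self C₂; have : 0 ≤ B.toReal := ENNReal.toReal_nonneg
    have := abs_nonneg b; linarith
  have hCone : 1 ≤ C := by
    have := abs_nonneg C₂; have : 0 ≤ B.toReal := ENNReal.toReal_nonneg
    have := abs_nonneg b; linarith
  have hCB : B.toReal ≤ C := by
    have := abs_nonneg C₂
    have := abs_nonneg b; linarith
  have hlW : ∀ θ ∈ 𝒦, ∫⁻ x, ENNReal.ofReal (W x) ∂(π θ) ≤ B := fun θ hθ =>
    le_iSup₂_of_le θ hθ le_rfl
  have hint : ∀ θ ∈ 𝒦, Integrable W (π θ) := fun θ hθ =>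
    ⟨hHW.measurable_W.aestronglyMeasurable, by
      rw [hasFiniteIntegral_iff_ofReal (ae_of_all _ fun x => (hW0 x).le)]
      exact (hlW θ hθ).trans_lt hπW⟩
  have hdr : ∀ θ ∈ 𝒦, ∀ x, ∫⁻ y, ENNReal.ofReal (W y ^ p) ∂(P (θ, x)) ≤
      ENNReal.ofReal (max r₁ ρ * W x ^ p + C) := by
    intro θ hθ x
    refine (le_iSup₂_of_le (f := fun θ _ => ∫⁻ y, ENNReal.ofReal (W y ^ p) ∂(P (θ, x)))
      θ hθ le_rfl).trans ((hdrift x).trans (ENNReal.ofReal_le_ofReal ?_))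
    have h1 := mul_le_mul_of_nonneg_right (le_max_right r₁ ρ) (hWp x).le
    have h2 := le_abs_self b
    linarith
  -- One rate serves for both ergodicity and drift, and one constant `C` dominates all the constants
  -- in the assumptions.
  have hr0 : 0 < max r₁ ρ := lt_max_of_lt_left hr₁.1
  have hr1 : max r₁ ρ < 1 := max_lt hr₁.2 hρ.2
  refine ⟨C, max r₁ ρ, hHW.measurable_W, hW1, hCone, ⟨hr0, hr1⟩,
    fun θ hθ => hP.isProbabilityMeasure θ (hΘ hθ), fun θ hθ => hP.invariant θ (hΘ hθ), hint,
    fun θ hθ => ?_, fun θ hθ l x => ?_, fun θ hθ f hf hfW l x => ?_, hdr,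
    fun θ hθ θ' hθ' f hf hfW x => ?_⟩
  · rw [integral_eq_lintegral_of_nonneg_ae (ae_of_all _ fun x => (hW0 x).le)
      hHW.measurable_W.aestronglyMeasurable]
    exact (ENNReal.toReal_mono hπW.ne (hlW θ hθ)).trans hCB
  · have h := (lintegral_pow_lt_top (P.sectR θ) (V := fun y => W y ^ p)
      (hHW.measurable_W.pow_const p) (b := C) (fun y => by
        refine (hdr θ hθ y).trans (ENNReal.ofReal_le_ofReal ?_)
        have := mul_le_of_le_one_left (hWp y).le hr1.le
        linarith) l x).1
    refine ⟨hHW.measurable_W.aestronglyMeasurable, ?_⟩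
    rw [hasFiniteIntegral_iff_ofReal (ae_of_all _ fun x => (hW0 x).le)]
    refine lt_of_le_of_lt (lintegral_mono fun y => ENNReal.ofReal_le_ofReal ?_) h
    calc W y = W y ^ (1 : ℝ) := (Real.rpow_one _).symm
      _ ≤ W y ^ p := Real.rpow_le_rpow_of_exponent_le (hW1 y) hp.le
  · have h1 : wDist W ((P.sectR θ ^ l) x) (π θ) ≤ ENNReal.ofReal (C₁ * r₁ ^ l * W x) :=
      (le_iSup₂_of_le (f := fun θ _ => wDist W ((P.sectR θ ^ l) x) (π θ)) θ hθ le_rfl).trans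
        (herg x l)
    have hpos : 0 ≤ C₁ * r₁ ^ l * W x :=
      mul_nonneg (mul_nonneg hC₁.le (pow_nonneg hr₁.1.le l)) (hW0 x).le
    refine (abs_integral_sub_le_of_wDist_le hpos h1 hf hfW).trans ?_
    have h2 : r₁ ^ l ≤ max r₁ ρ ^ l := pow_le_pow_left₀ hr₁.1.le (le_max_left _ _) l
    exact mul_le_mul_of_nonneg_right (mul_le_mul hC1 h2 (pow_nonneg hr₁.1.le l) (by linarith))
      (hW0 x).le
  · have h1 := hC₂ θ hθ θ' hθ'
    have h2 : wDist W (P (θ, x)) (P (θ', x)) / ENNReal.ofReal (W x) ≤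
        ENNReal.ofReal (C * ‖θ - θ'‖ ^ υ) :=
      (le_iSup (fun x => wDist W (P (θ, x)) (P (θ', x)) / ENNReal.ofReal (W x)) x).trans
        (h1.trans (ENNReal.ofReal_le_ofReal
          (mul_le_mul_of_nonneg_right hC2 (by positivity))))
    have h0 : 0 ≤ C * ‖θ - θ'‖ ^ υ := mul_nonneg (by linarith) (by positivity)
    rw [ENNReal.div_le_iff (by simpa using hW0 x) ENNReal.ofReal_ne_top,
      ← ENNReal.ofReal_mul h0] at h2
    exact abs_integral_sub_le_of_wDist_le (mul_nonneg h0 (hW0 x).le) h2 hf hfW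

/-- The function `P_θ ^ l f`. -/
def iter (P : Kernel (E d × X) X) (θ : E d) (l : ℕ) (f : X → ℝ) (x : X) : ℝ :=
  ∫ y, f y ∂((P.sectR θ ^ l) x)

theorem iter_zero {P : Kernel (E d × X) X} (θ : E d) {f : X → ℝ} (hf : Measurable f) (x : X) :
    iter P θ 0 f x = f x := by
  have e : (P.sectR θ ^ 0) x = Measure.dirac x := by rw [pow_zero]; exact Kernel.id_apply x
  rw [iter, e, integral_dirac' _ _ hf.stronglyMeasurable]

theorem measurable_iter {P : Kernel (E d × X) X} [IsMarkovKernel P] (θ : E d) (l : ℕ) {f : X → ℝ} (hf : Measurable f) :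
    Measurable (iter P θ l f) := by
  have : ∀ l : ℕ, IsMarkovKernel (P.sectR θ ^ l) := by
    intro l
    induction l with
    | zero => rw [pow_zero]; exact inferInstanceAs (IsMarkovKernel Kernel.id)
    | succ l ih =>
      rw [pow_succ]
      exact inferInstanceAs (IsMarkovKernel ((P.sectR θ ^ l) ∘ₖ P.sectR θ))
  exact (hf.stronglyMeasurable.integral_kernel (κ := P.sectR θ ^ l)).measurable

/-- Invariance says that the second marginal of `μ ⊗ₘ R` is `μ`; both claims follow by integrating
`f` of the second coordinate. -/
theorem integral_of_invariant {R : Kernel X X} [IsMarkovKernel R] {μ : Measure X}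
    [IsProbabilityMeasure μ] (hμ : Kernel.Invariant R μ) {f : X → ℝ} (hf : Measurable f)
    (hi : Integrable f μ) :
    Integrable (fun x => ∫ y, f y ∂(R x)) μ ∧ ∫ x, f x ∂μ = ∫ x, ∫ y, f y ∂(R x) ∂μ := by
  have h : (μ ⊗ₘ R).map Prod.snd = μ := by
    have := Measure.snd_compProd μ R
    rw [Measure.snd] at this
    rw [this]
    exact hμ
  have hc : Integrable (fun q : X × X => f q.2) (μ ⊗ₘ R) := by
    rw [← h] at hi
    exact hi.comp_measurable measurable_snd
  have e : ∫ x, f x ∂μ = ∫ q, f q.2 ∂(μ ⊗ₘ R) := by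
    conv_lhs => rw [← h]
    exact integral_map measurable_snd.aemeasurable hf.aestronglyMeasurable
  constructor
  · have hsm : StronglyMeasurable fun x => ∫ y, f y ∂(R x) := hf.stronglyMeasurable.integral_kernel
    exact ((Measure.integrable_compProd_iff hc.aestronglyMeasurable).1 hc).2.mono'
      hsm.aestronglyMeasurable (ae_of_all _ fun t => norm_integral_le_integral_norm _)
  · rw [e, Measure.integral_compProd hc]

namespace LocalBounds

variable {P : Kernel (E d × X) X} [IsMarkovKernel P] {π : E d → Measure X} {W : X → ℝ}
  {𝒦 : Set (E d)} {p υ C r : ℝ}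

theorem W_pos (hB : LocalBounds P π W 𝒦 p υ C r) (x : X) : 0 < W x :=
  one_pos.trans_le (hB.one_le_W x)

theorem C_pos (hB : LocalBounds P π W 𝒦 p υ C r) : 0 < C := one_pos.trans_le hB.one_le_C

theorem integrable_W_kernel (hB : LocalBounds P π W 𝒦 p υ C r) {θ : E d} (hθ : θ ∈ 𝒦) (x : X) :
    Integrable W (P (θ, x)) := by
  have := hB.integrable_W_pow θ hθ 1 x
  rwa [pow_one] at this

theorem abs_integral_le (hB : LocalBounds P π W 𝒦 p υ C r) {θ : E d} (hθ : θ ∈ 𝒦) {f : X → ℝ}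
    (hfW : ∀ x, |f x| ≤ W x) : |∫ x, f x ∂(π θ)| ≤ C := by
  rw [← Real.norm_eq_abs]
  exact (norm_integral_le_of_norm_le (hB.integrable_W θ hθ) (ae_of_all _ fun x => hfW x)).trans
    (hB.integral_W_le θ hθ)

theorem iter_succ (hB : LocalBounds P π W 𝒦 p υ C r) {θ : E d} (hθ : θ ∈ 𝒦) (l : ℕ) {f : X → ℝ}
    (hf : Measurable f) {c : ℝ} (hfW : ∀ x, |f x| ≤ c * W x) (x : X) :
    iter P θ (l + 1) f x = ∫ y, iter P θ l f y ∂(P (θ, x)) := by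
  have hi := integrable_of_abs_le_mul (hB.integrable_W_pow θ hθ (l + 1) x) hf hfW
  have e : P.sectR θ ^ (l + 1) = (P.sectR θ ^ l) ∘ₖ P.sectR θ := pow_succ _ l
  unfold iter
  rw [e] at hi ⊢
  exact Kernel.integral_comp hi

theorem abs_iter_sub_le (hB : LocalBounds P π W 𝒦 p υ C r) {θ : E d} (hθ : θ ∈ 𝒦) (l : ℕ)
    {f : X → ℝ} (hf : Measurable f) (hfW : ∀ x, |f x| ≤ W x) (x : X) :
    |iter P θ l f x - ∫ y, f y ∂(π θ)| ≤ C * r ^ l * W x :=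
  hB.ergodic θ hθ f hf hfW l x

theorem abs_iter_le (hB : LocalBounds P π W 𝒦 p υ C r) {θ : E d} (hθ : θ ∈ 𝒦) (l : ℕ)
    {f : X → ℝ} (hf : Measurable f) (hfW : ∀ x, |f x| ≤ W x) (x : X) :
    |iter P θ l f x| ≤ 2 * C * W x := by
  have h1 := hB.abs_iter_sub_le hθ l hf hfW x
  have h2 := hB.abs_integral_le hθ hfW
  have h3 : |iter P θ l f x| ≤
      |iter P θ l f x - ∫ y, f y ∂(π θ)| + |∫ y, f y ∂(π θ)| := by
    have := abs_add_le (iter P θ l f x - ∫ y, f y ∂(π θ)) (∫ y, f y ∂(π θ))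
    simpa using this
  have h4 : C * r ^ l * W x ≤ C * W x := by
    refine mul_le_mul_of_nonneg_right ?_ (hB.W_pos x).le
    exact mul_le_of_le_one_right hB.C_pos.le (pow_le_one₀ hB.r_mem.1.le hB.r_mem.2.le)
  have h5 : C ≤ C * W x := le_mul_of_one_le_right hB.C_pos.le (hB.one_le_W x)
  linarith

theorem integrable_iter (hB : LocalBounds P π W 𝒦 p υ C r) {θ : E d} (hθ : θ ∈ 𝒦) (l : ℕ)
    {f : X → ℝ} (hf : Measurable f) (hfW : ∀ x, |f x| ≤ W x) {μ : Measure X}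
    (hμ : Integrable W μ) : Integrable (iter P θ l f) μ :=
  integrable_of_abs_le_mul hμ (measurable_iter θ l hf) (hB.abs_iter_le hθ l hf hfW)

/-- Change of one kernel applied to an iterate: the difference decays geometrically. -/
theorem abs_integral_iter_sub_le (hB : LocalBounds P π W 𝒦 p υ C r) {θ θ₁ : E d} (hθ : θ ∈ 𝒦)
    (hθ₁ : θ₁ ∈ 𝒦) (l : ℕ) {f : X → ℝ} (hf : Measurable f) (hfW : ∀ x, |f x| ≤ W x) (x : X) :
    |(∫ y, iter P θ l f y ∂(P (θ₁, x))) - ∫ y, iter P θ l f y ∂(P (θ, x))| ≤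
      C ^ 2 * r ^ l * ‖θ₁ - θ‖ ^ υ * W x := by
  -- Subtracting the constant `π_θ f` does not change the difference of two probability integrals,
  -- but makes the integrand of size `C r ^ l W`. This is the source of the geometric factor.
  have hm : Measurable fun y => iter P θ l f y - ∫ y, f y ∂(π θ) :=
    (measurable_iter θ l hf).sub_const _
  have h3 := abs_integral_sub_le_mul (μ := P (θ₁, x)) (ν := P (θ, x))
    (fun f hf hfW => hB.holder θ₁ hθ₁ θ hθ f hf hfW x) hm (c := C * r ^ l)
    (mul_nonneg hB.C_pos.le (pow_nonneg hB.r_mem.1.le l)) (hB.abs_iter_sub_le hθ l hf hfW)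
  have hi : ∀ θ' ∈ 𝒦, Integrable (iter P θ l f) (P (θ', x)) := fun θ' h =>
    hB.integrable_iter hθ l hf hfW (hB.integrable_W_kernel h x)
  rw [integral_sub (hi θ₁ hθ₁) (integrable_const _),
    integral_sub (hi θ hθ) (integrable_const _)] at h3
  simp only [integral_const, probReal_univ, one_smul, sub_sub_sub_cancel_right] at h3
  refine h3.trans (le_of_eq ?_)
  ring

/-- By invariance of `π θ'`, one may insert a step of `P_θ'` before `P_θ ^ l`; compared with a step
of `P_θ`, this is the kernel-change estimate integrated against `π θ'`. -/
theorem abs_integral_iter_invariant_sub_le (hB : LocalBounds P π W 𝒦 p υ C r) {θ θ' : E d}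
    (hθ : θ ∈ 𝒦) (hθ' : θ' ∈ 𝒦) {f : X → ℝ} (hf : Measurable f) (hfW : ∀ x, |f x| ≤ W x)
    (l : ℕ) :
    |(∫ x, iter P θ l f x ∂(π θ')) - ∫ x, iter P θ (l + 1) f x ∂(π θ')| ≤
      C ^ 3 * ‖θ' - θ‖ ^ υ * r ^ l := by
  have := hB.prob θ' hθ'
  have hi := hB.integrable_iter hθ l hf hfW (hB.integrable_W θ' hθ')
  have hinv := integral_of_invariant (hB.invariant θ' hθ') (measurable_iter θ l hf) hi
  have h1 : ∫ x, iter P θ l f x ∂(π θ') = ∫ x, ∫ y, iter P θ l f y ∂(P (θ', x)) ∂(π θ') := hinv.2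
  have hs : ∀ x, iter P θ (l + 1) f x = ∫ y, iter P θ l f y ∂(P (θ, x)) :=
    hB.iter_succ hθ l hf (c := 1) (by simpa using hfW)
  have hi1 : Integrable (fun x => ∫ y, iter P θ l f y ∂(P (θ', x))) (π θ') := hinv.1
  have hi2 : Integrable (fun x => ∫ y, iter P θ l f y ∂(P (θ, x))) (π θ') :=
    (hB.integrable_iter hθ (l + 1) hf hfW (hB.integrable_W θ' hθ')).congr (ae_of_all _ hs)
  rw [h1, integral_congr_ae (ae_of_all _ hs), ← integral_sub hi1 hi2, ← Real.norm_eq_abs]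
  refine (norm_integral_le_of_norm_le
    ((hB.integrable_W θ' hθ').const_mul (C ^ 2 * r ^ l * ‖θ' - θ‖ ^ υ))
    (ae_of_all _ fun x => hB.abs_integral_iter_sub_le hθ hθ' l hf hfW x)).trans ?_
  rw [integral_const_mul]
  have h := hB.integral_W_le θ' hθ'
  have := pow_nonneg hB.r_mem.1.le l
  have := hB.C_pos
  calc C ^ 2 * r ^ l * ‖θ' - θ‖ ^ υ * ∫ x, W x ∂(π θ')
      ≤ C ^ 2 * r ^ l * ‖θ' - θ‖ ^ υ * C := by gcongr
    _ = C ^ 3 * ‖θ' - θ‖ ^ υ * r ^ l := by ring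

/-- The invariant distributions are Hölder in `θ`, in the `W`-norm. -/
theorem invariant_holder (hB : LocalBounds P π W 𝒦 p υ C r) {θ θ' : E d} (hθ : θ ∈ 𝒦)
    (hθ' : θ' ∈ 𝒦) {f : X → ℝ} (hf : Measurable f) (hfW : ∀ x, |f x| ≤ W x) :
    |(∫ x, f x ∂(π θ)) - ∫ x, f x ∂(π θ')| ≤ C ^ 3 / (1 - r) * ‖θ - θ'‖ ^ υ := by
  have := hB.prob θ hθ
  have := hB.prob θ' hθ'
  have hCp := hB.C_pos
  have hr := hB.r_mem
  set D := ‖θ' - θ‖ ^ υ with hD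
  have hD0 : 0 ≤ D := by positivity
  -- The sequence `π_θ'(P_θ ^ l f)` starts at `π_θ' f` and tends to `π_θ f`; its increments form a
  -- geometric series proportional to `‖θ - θ'‖ ^ υ`.
  obtain ⟨a, ha⟩ : ∃ a : ℕ → ℝ, ∀ l, a l = ∫ x, iter P θ l f x ∂(π θ') := ⟨_, fun _ => rfl⟩
  have hstep : ∀ l, |a l - a (l + 1)| ≤ C ^ 3 * D * r ^ l := by
    intro l
    rw [ha, ha]
    exact hB.abs_integral_iter_invariant_sub_le hθ hθ' hf hfW l
  have hsum : ∀ n, |a 0 - a n| ≤ C ^ 3 / (1 - r) * D := by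
    intro n
    have h1 : a 0 - a n = ∑ l ∈ Finset.range n, (a l - a (l + 1)) :=
      (Finset.sum_range_sub' a n).symm
    rw [h1]
    refine (Finset.abs_sum_le_sum_abs _ _).trans ((Finset.sum_le_sum fun l _ => hstep l).trans ?_)
    rw [← Finset.mul_sum]
    have h2 : ∑ l ∈ Finset.range n, r ^ l ≤ (1 - r)⁻¹ := by
      rw [← tsum_geometric_of_lt_one hr.1.le hr.2]
      exact (summable_geometric_of_lt_one hr.1.le hr.2).sum_le_tsum _
        (fun l _ => pow_nonneg hr.1.le l)
    calc C ^ 3 * D * ∑ l ∈ Finset.range n, r ^ l ≤ C ^ 3 * D * (1 - r)⁻¹ := by gcongr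
      _ = C ^ 3 / (1 - r) * D := by ring
  have h0 : a 0 = ∫ x, f x ∂(π θ') := by
    rw [ha]
    exact integral_congr_ae (ae_of_all _ fun x => iter_zero θ hf x)
  have hlim : Tendsto a atTop (𝓝 (∫ x, f x ∂(π θ))) := by
    rw [tendsto_iff_norm_sub_tendsto_zero]
    have hr0 : Tendsto (fun l : ℕ => C * r ^ l * C) atTop (𝓝 0) := by
      have := tendsto_pow_atTop_nhds_zero_of_lt_one hr.1.le hr.2
      simpa using (this.const_mul C).mul_const C
    refine squeeze_zero (fun l => norm_nonneg _) (fun l => ?_) hr0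
    have e : a l - ∫ x, f x ∂(π θ) = ∫ x, (iter P θ l f x - ∫ y, f y ∂(π θ)) ∂(π θ') := by
      rw [integral_sub (hB.integrable_iter hθ l hf hfW (hB.integrable_W θ' hθ'))
        (integrable_const _), ha]
      simp
    rw [e]
    refine (norm_integral_le_of_norm_le ((hB.integrable_W θ' hθ').const_mul (C * r ^ l))
      (ae_of_all _ fun x => hB.abs_iter_sub_le hθ l hf hfW x)).trans ?_
    rw [integral_const_mul]
    exact mul_le_mul_of_nonneg_left (hB.integral_W_le θ' hθ')
      (mul_nonneg hCp.le (pow_nonneg hr.1.le l))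
  have hfin := le_of_tendsto ((tendsto_const_nhds.sub hlim).abs) (Eventually.of_forall hsum)
  rw [h0, abs_sub_comm, hD, norm_sub_rev] at hfin
  exact hfin

end LocalBounds

end LocalBounds

/-! ### Regularity of real fields and of their means -/

section LocalField

variable {d : ℕ} {X : Type*} [MeasurableSpace X]

/-- Regularity on `𝒦` of a real-valued field `g`: domination by `W` and averaged Hölder
condition. -/
structure LocalField (π : E d → Measure X) (W : X → ℝ) (𝒦 : Set (E d)) (α C : ℝ)
    (g : E d → X → ℝ) : Prop where
  measurable : Measurable (Function.uncurry g)
  bound : ∀ θ ∈ 𝒦, ∀ x, |g θ x| ≤ C * W x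
  holder : ∀ θ ∈ 𝒦, ∀ δ : ℝ, 0 < δ → upperIntegral (π θ)
    (fun x => ⨆ θ' ∈ {θ' | θ' ∈ 𝒦 ∧ ‖θ' - θ‖ ≤ δ}, ‖g θ' x - g θ x‖ₑ) ≤ ENNReal.ofReal (C * δ ^ α)

theorem exists_majorant_of_upperIntegral_lt {μ : Measure X} {f : X → ℝ≥0∞} {B : ℝ≥0∞}
    (h : upperIntegral μ f < B) :
    ∃ φ : X → ℝ≥0∞, Measurable φ ∧ (∀ x, f x ≤ φ x) ∧ ∫⁻ x, φ x ∂μ < B := by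
  unfold upperIntegral at h
  obtain ⟨φ, h⟩ := iInf_lt_iff.1 h
  obtain ⟨h1, h⟩ := iInf_lt_iff.1 h
  obtain ⟨h2, h⟩ := iInf_lt_iff.1 h
  exact ⟨φ, h1, h2, h⟩

theorem upperIntegral_le_of_majorant {μ : Measure X} {f φ : X → ℝ≥0∞} (hφ : Measurable φ)
    (h : ∀ x, f x ≤ φ x) : upperIntegral μ f ≤ ∫⁻ x, φ x ∂μ :=
  iInf_le_of_le φ (iInf_le_of_le hφ (iInf_le _ h))

theorem LocalBounds.mono {P : Kernel (E d × X) X} {π : E d → Measure X} {W : X → ℝ}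
    {𝒦 : Set (E d)} {p υ C C' r : ℝ} (hB : LocalBounds P π W 𝒦 p υ C r) (h : C ≤ C') :
    LocalBounds P π W 𝒦 p υ C' r where
  measurable_W := hB.measurable_W
  one_le_W := hB.one_le_W
  one_le_C := hB.one_le_C.trans h
  r_mem := hB.r_mem
  prob := hB.prob
  invariant := hB.invariant
  integrable_W := hB.integrable_W
  integral_W_le θ hθ := (hB.integral_W_le θ hθ).trans h
  integrable_W_pow := hB.integrable_W_pow
  ergodic θ hθ f hf hfW l x := (hB.ergodic θ hθ f hf hfW l x).trans
    (mul_le_mul_of_nonneg_right (mul_le_mul_of_nonneg_right h (pow_nonneg hB.r_mem.1.le l))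
      (zero_le_one.trans (hB.one_le_W x)))
  drift θ hθ x := (hB.drift θ hθ x).trans (ENNReal.ofReal_le_ofReal (by linarith))
  holder θ hθ θ' hθ' f hf hfW x := (hB.holder θ hθ θ' hθ' f hf hfW x).trans
    (mul_le_mul_of_nonneg_right (mul_le_mul_of_nonneg_right h (by positivity))
      (zero_le_one.trans (hB.one_le_W x)))

theorem LocalField.mono {π : E d → Measure X} {W : X → ℝ} {𝒦 : Set (E d)} {α C C' : ℝ}
    {g : E d → X → ℝ} (hg : LocalField π W 𝒦 α C g) (hW : ∀ x, 1 ≤ W x) (h : C ≤ C') :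
    LocalField π W 𝒦 α C' g where
  measurable := hg.measurable
  bound θ hθ x := (hg.bound θ hθ x).trans
    (mul_le_mul_of_nonneg_right h (zero_le_one.trans (hW x)))
  holder θ hθ δ hδ := (hg.holder θ hθ δ hδ).trans
    (ENNReal.ofReal_le_ofReal (mul_le_mul_of_nonneg_right h (by positivity)))

theorem rpow_le_mul_rpow {t R a b : ℝ} (ht : 0 ≤ t) (htR : t ≤ R) (hb : 0 < b) (hba : b ≤ a) :
    t ^ a ≤ R ^ (a - b) * t ^ b := by
  rcases ht.eq_or_lt with rfl | ht
  · rw [Real.zero_rpow (by linarith), Real.zero_rpow hb.ne', mul_zero]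
  · calc t ^ a = t ^ (a - b) * t ^ b := by rw [← Real.rpow_add ht]; congr 1; ring
      _ ≤ R ^ (a - b) * t ^ b := mul_le_mul_of_nonneg_right
          (Real.rpow_le_rpow ht.le htR (by linarith)) (Real.rpow_nonneg ht.le _)

/-- On a bounded set, a Hölder bound of order `a` implies one of any smaller order. -/
theorem exists_rpow_norm_sub_le {𝒦 : Set (E d)} (h𝒦 : IsCompact 𝒦) {a b : ℝ} (hb : 0 < b)
    (hba : b ≤ a) :
    ∃ D : ℝ, 1 ≤ D ∧ ∀ θ ∈ 𝒦, ∀ θ' ∈ 𝒦, ‖θ - θ'‖ ^ a ≤ D * ‖θ - θ'‖ ^ b := by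
  obtain ⟨R, hR⟩ := h𝒦.isBounded.exists_norm_le
  refine ⟨(max 1 (R + R)) ^ (a - b), Real.one_le_rpow (le_max_left _ _) (by linarith),
    fun θ hθ θ' hθ' => rpow_le_mul_rpow (norm_nonneg _) ?_ hb hba⟩
  exact ((norm_sub_le _ _).trans (add_le_add (hR θ hθ) (hR θ' hθ'))).trans (le_max_right _ _)

/-- The noise estimates run with a single exponent `κ` smaller than `υ`; on a bounded set, lowering
the exponent only costs a constant. -/
theorem LocalBounds.exists_exponent_le {P : Kernel (E d × X) X} {π : E d → Measure X} {W : X → ℝ}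
    {𝒦 : Set (E d)} {p υ C r : ℝ} (hB : LocalBounds P π W 𝒦 p υ C r) (h𝒦 : IsCompact 𝒦) {κ : ℝ}
    (hκ : 0 < κ) (hκυ : κ ≤ υ) : ∃ C', LocalBounds P π W 𝒦 p κ C' r := by
  obtain ⟨D, hD1, hD⟩ := exists_rpow_norm_sub_le h𝒦 hκ hκυ
  have hC0 : 0 ≤ C := zero_le_one.trans hB.one_le_C
  have h := hB.mono (le_mul_of_one_le_right hC0 hD1)
  refine ⟨C * D, h.measurable_W, h.one_le_W, h.one_le_C, h.r_mem, h.prob, h.invariant,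
    h.integrable_W, h.integral_W_le, h.integrable_W_pow, h.ergodic, h.drift,
    fun θ hθ θ' hθ' f hf hfW x => (hB.holder θ hθ θ' hθ' f hf hfW x).trans ?_⟩
  refine mul_le_mul_of_nonneg_right ?_ (zero_le_one.trans (hB.one_le_W x))
  rw [mul_assoc]
  exact mul_le_mul_of_nonneg_left (hD θ hθ θ' hθ') hC0

/-- Measurable majorant of the local oscillation of `g`. -/
theorem LocalField.exists_majorant {P : Kernel (E d × X) X} {π : E d → Measure X} {W : X → ℝ}
    {𝒦 : Set (E d)} {p υ α C r : ℝ} {g : E d → X → ℝ} (hg : LocalField π W 𝒦 α C g)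
    (hB : LocalBounds P π W 𝒦 p υ C r) {θ : E d} (hθ : θ ∈ 𝒦) {δ : ℝ} (hδ : 0 < δ) :
    ∃ φ : X → ℝ, Measurable φ ∧ (∀ x, 0 ≤ φ x) ∧ (∀ x, φ x ≤ 2 * C * W x) ∧
      (∀ θ' ∈ 𝒦, ‖θ' - θ‖ ≤ δ → ∀ x, |g θ' x - g θ x| ≤ φ x) ∧
      ∫ x, φ x ∂(π θ) ≤ 2 * C * δ ^ α := by
  have hC := zero_lt_one.trans_le hB.one_le_C
  -- Doubling the bound makes it strict, so that the infimum defining the upper integral yields an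
  -- actual measurable majorant.
  have hlt : ENNReal.ofReal (C * δ ^ α) < ENNReal.ofReal (2 * C * δ ^ α) := by
    have h : 0 < C * δ ^ α := by positivity
    rw [ENNReal.ofReal_lt_ofReal_iff (by positivity)]
    linarith
  obtain ⟨φ, hφ, hle, hint⟩ := exists_majorant_of_upperIntegral_lt
    ((hg.holder θ hθ δ hδ).trans_lt hlt)
  have hW0 : ∀ x, 0 ≤ W x := fun x => zero_le_one.trans (hB.one_le_W x)
  -- Capping the majorant at `2 C W`, which also bounds the oscillation, keeps it dominated by `W`;
  -- the ergodic estimates then apply to the majorant itself.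
  have hfin : ∀ x, min (φ x) (ENNReal.ofReal (2 * C * W x)) ≠ ∞ := fun x =>
    (min_le_right _ _).trans_lt ENNReal.ofReal_lt_top |>.ne
  have hm : Measurable fun x => min (φ x) (ENNReal.ofReal (2 * C * W x)) :=
    hφ.min (hB.measurable_W.const_mul _).ennreal_ofReal
  refine ⟨fun x => (min (φ x) (ENNReal.ofReal (2 * C * W x))).toReal, hm.ennreal_toReal,
    fun x => ENNReal.toReal_nonneg, fun x => ?_, fun θ' hθ' hd x => ?_, ?_⟩
  · exact ENNReal.toReal_le_of_le_ofReal (mul_nonneg (by positivity) (hW0 x)) (min_le_right _ _)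
  · rw [← ENNReal.ofReal_le_iff_le_toReal (hfin x)]
    refine le_min ?_ (ENNReal.ofReal_le_ofReal ?_)
    · rw [← Real.enorm_eq_ofReal_abs]
      exact (le_iSup₂_of_le (f := fun θ' (_ : θ' ∈ {θ' | θ' ∈ 𝒦 ∧ ‖θ' - θ‖ ≤ δ}) =>
        ‖g θ' x - g θ x‖ₑ) θ' ⟨hθ', hd⟩ le_rfl).trans (hle x)
    · have h1 := abs_sub (g θ' x) (g θ x)
      have h2 := hg.bound θ' hθ' x
      have h3 := hg.bound θ hθ x
      linarith
  · rw [integral_toReal hm.aemeasurable (ae_of_all _ fun x => (hfin x).lt_top)]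
    refine ENNReal.toReal_le_of_le_ofReal (by positivity) ?_
    exact (lintegral_mono fun x => min_le_left _ _).trans hint.le

theorem LocalField.measurable_section {π : E d → Measure X} {W : X → ℝ} {𝒦 : Set (E d)} {α C : ℝ}
    {g : E d → X → ℝ} (hg : LocalField π W 𝒦 α C g) (θ : E d) : Measurable (g θ) :=
  hg.measurable.comp measurable_prodMk_left

/-- The mean field is Hölder on compact sets. -/
theorem LocalField.exists_mean_holder {P : Kernel (E d × X) X} [IsMarkovKernel P]
    {π : E d → Measure X} {W : X → ℝ}
    {𝒦 : Set (E d)} {p α C r κ : ℝ} {g : E d → X → ℝ} (hg : LocalField π W 𝒦 α C g)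
    (hB : LocalBounds P π W 𝒦 p κ C r) (h𝒦 : IsCompact 𝒦) (hκ : 0 < κ) (hκα : κ ≤ α) :
    ∃ C' : ℝ, ∀ θ ∈ 𝒦, ∀ θ' ∈ 𝒦,
      |(∫ x, g θ x ∂(π θ)) - ∫ x, g θ' x ∂(π θ')| ≤ C' * ‖θ - θ'‖ ^ κ := by
  obtain ⟨D, hD1, hD⟩ := exists_rpow_norm_sub_le h𝒦 hκ hκα
  have hC := hB.C_pos
  refine ⟨2 * C * D + C * (C ^ 3 / (1 - r)), fun θ hθ θ' hθ' => ?_⟩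
  rcases eq_or_ne θ θ' with rfl | hne
  · simp [Real.zero_rpow hκ.ne']
  have hpos : 0 < ‖θ - θ'‖ := norm_pos_iff.2 (sub_ne_zero.2 hne)
  obtain ⟨φ, hφm, hφ0, hφW, hφ, hφi⟩ := hg.exists_majorant hB hθ' hpos
  have hi : ∀ θ₁ ∈ 𝒦, ∀ θ₂ ∈ 𝒦, Integrable (g θ₁) (π θ₂) := fun θ₁ h1 θ₂ h2 =>
    integrable_of_abs_le_mul (hB.integrable_W θ₂ h2) (hg.measurable_section θ₁) (hg.bound θ₁ h1)
  -- The invariant law is changed first with the field fixed, then the parameter of the field under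
  -- the fixed law `π θ'`.
  have h1 : |(∫ x, g θ x ∂(π θ)) - ∫ x, g θ x ∂(π θ')| ≤ C * (C ^ 3 / (1 - r) * ‖θ - θ'‖ ^ κ) :=
    abs_integral_sub_le_mul (fun f hf hfW => hB.invariant_holder hθ hθ' hf hfW)
      (hg.measurable_section θ) hC.le (hg.bound θ hθ)
  have h2 : |(∫ x, g θ x ∂(π θ')) - ∫ x, g θ' x ∂(π θ')| ≤ 2 * C * ‖θ - θ'‖ ^ α := by
    rw [← integral_sub (hi θ hθ θ' hθ') (hi θ' hθ' θ' hθ'), ← Real.norm_eq_abs]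
    refine (norm_integral_le_of_norm_le (integrable_of_abs_le_mul (hB.integrable_W θ' hθ') hφm
      (c := 2 * C) fun x => by rw [abs_of_nonneg (hφ0 x)]; exact hφW x)
      (ae_of_all _ fun x => hφ θ hθ le_rfl x)).trans hφi
  have h3 := hD θ hθ θ' hθ'
  calc |(∫ x, g θ x ∂(π θ)) - ∫ x, g θ' x ∂(π θ')|
      ≤ |(∫ x, g θ x ∂(π θ)) - ∫ x, g θ x ∂(π θ')| +
        |(∫ x, g θ x ∂(π θ')) - ∫ x, g θ' x ∂(π θ')| := abs_sub_le _ _ _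
    _ ≤ C * (C ^ 3 / (1 - r) * ‖θ - θ'‖ ^ κ) + 2 * C * (D * ‖θ - θ'‖ ^ κ) := by
        refine add_le_add h1 (h2.trans ?_)
        gcongr
    _ = _ := by ring

theorem FieldBound.exists_norm_le {Θ : Set (E d)} {H : E d → X → E d} {W : X → ℝ}
    (hHW : FieldBound Θ H W) {𝒦 : Set (E d)} (h𝒦 : IsCompact 𝒦) (hΘ : 𝒦 ⊆ Θ) :
    ∃ C : ℝ, 0 ≤ C ∧ ∀ θ ∈ 𝒦, ∀ x, ‖H θ x‖ ≤ C * W x := by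
  refine ⟨(⨆ θ ∈ 𝒦, wNorm W (H θ)).toReal, ENNReal.toReal_nonneg, fun θ hθ x =>
    norm_le_of_wNorm_le hHW.one_le_W ENNReal.toReal_nonneg ?_ x⟩
  rw [ENNReal.ofReal_toReal (hHW.bound 𝒦 h𝒦 hΘ).ne]
  exact le_iSup₂_of_le (f := fun θ _ => wNorm W (H θ)) θ hθ le_rfl

/-- Scalar products of `H` with a bounded Hölder vector field are regular. -/
theorem exists_localField_inner {Θ : Set (E d)} {P : Kernel (E d × X) X} {H : E d → X → E d}
    (hH : Measurable (Function.uncurry H)) {π : E d → Measure X} {W : X → ℝ} {p υ α C r : ℝ}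
    (hHW : FieldBound Θ H W) (hHα : AveragedHolder Θ H π α) {𝒦 : Set (E d)} (h𝒦 : IsCompact 𝒦)
    (hΘ : 𝒦 ⊆ Θ) (hB : LocalBounds P π W 𝒦 p υ C r) (hα : 0 < α) {v : E d → E d}
    (hv : Measurable v) {B : ℝ} (hvB : ∀ θ ∈ 𝒦, ‖v θ‖ ≤ B)
    (hvα : ∀ θ ∈ 𝒦, ∀ θ' ∈ 𝒦, ‖v θ - v θ'‖ ≤ B * ‖θ - θ'‖ ^ α) :
    ∃ C', LocalField π W 𝒦 α C' (fun θ x => inner ℝ (v θ) (H θ x)) := by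
  obtain ⟨C₁, hC₁, hb⟩ := hHW.exists_norm_le h𝒦 hΘ
  obtain ⟨C₂, hC₂, hh⟩ := hHα 𝒦 h𝒦 hΘ
  have hW0 : ∀ x, 0 ≤ W x := fun x => zero_le_one.trans (hB.one_le_W x)
  have hCp := zero_lt_one.trans_le hB.one_le_C
  -- `B` may be negative when `𝒦` is empty.
  set B' := max B 0 with hB'
  have hB0 : 0 ≤ B' := le_max_right _ _
  have hBle : B ≤ B' := le_max_left _ _
  refine ⟨B' * C₁ + B' * C₁ * C + B' * (2 * C₂), ?_, fun θ hθ x => ?_, fun θ hθ δ hδ => ?_⟩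
  · exact (hv.comp measurable_fst).inner hH
  · calc |inner ℝ (v θ) (H θ x)| ≤ ‖v θ‖ * ‖H θ x‖ := abs_real_inner_le_norm _ _
      _ ≤ B' * (C₁ * W x) := mul_le_mul ((hvB θ hθ).trans hBle) (hb θ hθ x) (norm_nonneg _) hB0
      _ = B' * C₁ * W x + 0 * W x := by ring
      _ ≤ B' * C₁ * W x + (B' * C₁ * C + B' * (2 * C₂)) * W x := by
          have := hW0 x
          gcongr
          positivity
      _ = _ := by ring
  · have hlt : ENNReal.ofReal (C₂ * δ ^ α) < ENNReal.ofReal (2 * C₂ * δ ^ α) := by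
      have h : 0 < C₂ * δ ^ α := by positivity
      rw [ENNReal.ofReal_lt_ofReal_iff (by positivity)]
      linarith
    have h1 := (le_iSup₂_of_le (f := fun θ _ => upperIntegral (π θ)
      (fun x => ⨆ θ' ∈ {θ' | θ' ∈ 𝒦 ∧ ‖θ' - θ‖ ≤ δ}, ‖H θ' x - H θ x‖ₑ)) θ hθ le_rfl).trans
      (hh δ hδ)
    obtain ⟨φ, hφ, hle, hint⟩ := exists_majorant_of_upperIntegral_lt (h1.trans_lt hlt)
    have hm : Measurable fun x => ENNReal.ofReal (B' * δ ^ α * C₁) * ENNReal.ofReal (W x) +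
        ENNReal.ofReal B' * φ x :=
      (hB.measurable_W.ennreal_ofReal.const_mul _).add (hφ.const_mul _)
    refine (upperIntegral_le_of_majorant hm fun x => iSup₂_le fun θ' hθ' => ?_).trans ?_
    · have e : inner ℝ (v θ') (H θ' x) - inner ℝ (v θ) (H θ x) =
          inner ℝ (v θ' - v θ) (H θ' x) + inner ℝ (v θ) (H θ' x - H θ x) := by
        rw [inner_sub_left, inner_sub_right]; ring
      rw [e]
      refine (enorm_add_le _ _).trans (add_le_add ?_ ?_)
      · rw [← ENNReal.ofReal_mul (by positivity), Real.enorm_eq_ofReal_abs]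
        refine ENNReal.ofReal_le_ofReal ((abs_real_inner_le_norm _ _).trans ?_)
        have h3 : ‖v θ' - v θ‖ ≤ B' * δ ^ α := (hvα θ' hθ'.1 θ hθ).trans
          (mul_le_mul hBle (Real.rpow_le_rpow (norm_nonneg _) hθ'.2 hα.le) (by positivity) hB0)
        calc ‖v θ' - v θ‖ * ‖H θ' x‖ ≤ (B' * δ ^ α) * (C₁ * W x) :=
              mul_le_mul h3 (hb θ' hθ'.1 x) (norm_nonneg _) (by positivity)
          _ = _ := by ring
      · have h4 : ‖inner ℝ (v θ) (H θ' x - H θ x)‖ₑ ≤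
            ENNReal.ofReal B' * ‖H θ' x - H θ x‖ₑ := by
          rw [Real.enorm_eq_ofReal_abs, ← ofReal_norm, ← ENNReal.ofReal_mul hB0]
          refine ENNReal.ofReal_le_ofReal ((abs_real_inner_le_norm _ _).trans ?_)
          exact mul_le_mul_of_nonneg_right ((hvB θ hθ).trans hBle) (norm_nonneg _)
        refine h4.trans (mul_le_mul_right ?_ _)
        exact (le_iSup₂_of_le (f := fun θ' (_ : θ' ∈ {θ' | θ' ∈ 𝒦 ∧ ‖θ' - θ‖ ≤ δ}) =>
          ‖H θ' x - H θ x‖ₑ) θ' hθ' le_rfl).trans (hle x)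
    · rw [lintegral_add_left (hB.measurable_W.ennreal_ofReal.const_mul _),
        lintegral_const_mul _ hB.measurable_W.ennreal_ofReal, lintegral_const_mul _ hφ,
        ← ofReal_integral_eq_lintegral_ofReal (hB.integrable_W θ hθ) (ae_of_all _ hW0)]
      calc ENNReal.ofReal (B' * δ ^ α * C₁) * ENNReal.ofReal (∫ x, W x ∂(π θ)) +
            ENNReal.ofReal B' * ∫⁻ x, φ x ∂(π θ)
          ≤ ENNReal.ofReal (B' * δ ^ α * C₁) * ENNReal.ofReal C +
            ENNReal.ofReal B' * ENNReal.ofReal (2 * C₂ * δ ^ α) := by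
            gcongr
            exact hB.integral_W_le θ hθ
        _ = ENNReal.ofReal (B' * δ ^ α * C₁ * C + B' * (2 * C₂ * δ ^ α)) := by
            rw [← ENNReal.ofReal_mul (by positivity), ← ENNReal.ofReal_mul hB0,
              ← ENNReal.ofReal_add (by positivity) (by positivity)]
        _ ≤ _ := by
            refine ENNReal.ofReal_le_ofReal ?_
            have : 0 ≤ B' * C₁ * δ ^ α := by positivity
            nlinarith

theorem inner_meanField {P : Kernel (E d × X) X} {Θ : Set (E d)} {H : E d → X → E d}
    (hH : Measurable (Function.uncurry H)) {π : E d → Measure X} {W : X → ℝ} {p υ C r : ℝ}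
    (hHW : FieldBound Θ H W) {𝒦 : Set (E d)} (h𝒦 : IsCompact 𝒦) (hΘ : 𝒦 ⊆ Θ)
    (hB : LocalBounds P π W 𝒦 p υ C r) (v : E d) {θ : E d} (hθ : θ ∈ 𝒦) :
    ∫ x, inner ℝ v (H θ x) ∂(π θ) = inner ℝ v (meanField H π θ) := by
  obtain ⟨C₁, -, hb⟩ := hHW.exists_norm_le h𝒦 hΘ
  have hm : Measurable (H θ) := hH.comp measurable_prodMk_left
  have hi : Integrable (H θ) (π θ) := ((hB.integrable_W θ hθ).const_mul C₁).mono'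
    hm.aestronglyMeasurable (ae_of_all _ fun x => hb θ hθ x)
  exact integral_inner hi v

end LocalField

/-! ### Decomposition along lags and maximal inequality for dependent sums -/

section Lag

variable {Ω : Type*} {m0 : MeasurableSpace Ω} {μ : Measure Ω}

theorem lintegral_abs_rpow_condExp_le {m : MeasurableSpace Ω} {q : ℝ} (hq : 1 ≤ q) (Z : Ω → ℝ) :
    ∫⁻ ω, ENNReal.ofReal (|(μ[Z | m]) ω| ^ q) ∂μ ≤ ∫⁻ ω, ENNReal.ofReal (|Z ω| ^ q) ∂μ := by
  have hq0 : 0 < q := by linarith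
  have h := eLpNorm_condExp_le_eLpNorm (μ := μ) (m := m) Z (p := ENNReal.ofReal q)
    (by rw [← ENNReal.ofReal_one]; exact ENNReal.ofReal_le_ofReal hq)
  have hne : ENNReal.ofReal q ≠ 0 := by simpa using hq0
  rw [eLpNorm_eq_lintegral_rpow_enorm_toReal hne ENNReal.ofReal_ne_top,
    eLpNorm_eq_lintegral_rpow_enorm_toReal hne ENNReal.ofReal_ne_top,
    ENNReal.toReal_ofReal hq0.le, ENNReal.rpow_le_rpow_iff (by positivity)] at h
  have e : ∀ t : ℝ, ‖t‖ₑ ^ q = ENNReal.ofReal (|t| ^ q) := fun t => by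
    rw [Real.enorm_eq_ofReal_abs, ENNReal.ofReal_rpow_of_nonneg (abs_nonneg _) hq0.le]
  simpa only [e] using h

variable [IsProbabilityMeasure μ] {𝓕 : Filtration ℕ m0}

/-- The `i`-th lagged projection: `E[Z_{j+i} | 𝓕_{j+1}]`, restricted to the indices whose lag is at
least `i`. -/
def lagged (μ : Measure Ω) (𝓕 : Filtration ℕ m0) (Z : ℕ → Ω → ℝ) (L : ℕ → ℕ) (i j : ℕ) : Ω → ℝ :=
  if i ≤ L (j + i) then μ[Z (j + i) | 𝓕 (j + 1)] else 0

/-- Each `Z k` telescopes through its conditional expectations at times `k + 1, k, …, k - L k`.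
Collecting the differences with the same lag `i` over all `k` gives one martingale-difference sum
for each `i`; what remains is the conditional expectation at the full lag. -/
theorem sum_eq_sum_lagged {Z : ℕ → Ω → ℝ} (hZ : ∀ k, StronglyMeasurable[𝓕 (k + 1)] (Z k))
    (hZi : ∀ k, Integrable (Z k) μ) {L : ℕ → ℕ} (hL : ∀ k, L k ≤ k) :
    ∀ᵐ ω ∂μ, ∀ n, ∑ k ∈ Finset.range n, Z k ω =
      ∑ i ∈ Finset.range n, centeredSum μ 𝓕 (lagged μ 𝓕 Z L i) (n - i) ω +
        ∑ k ∈ Finset.range n, (μ[Z k | 𝓕 (k - L k)]) ω := by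
  -- The tower property makes the centering of the lagged variable the next term of the telescope.
  have htower : ∀ᵐ ω ∂μ, ∀ i j, i ≤ L (j + i) →
      (μ[lagged μ 𝓕 Z L i j | 𝓕 j]) ω = (μ[Z (j + i) | 𝓕 j]) ω := by
    rw [ae_all_iff]; intro i
    rw [ae_all_iff]; intro j
    by_cases h : i ≤ L (j + i)
    · have := condExp_condExp_of_le (μ := μ) (f := Z (j + i)) (𝓕.mono (Nat.le_succ j))
        (𝓕.le (j + 1))
      filter_upwards [this] with ω hω _
      simp only [lagged, h, if_true]
      exact hω
    · exact ae_of_all _ fun ω h' => absurd h' h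
  filter_upwards [htower] with ω hω n
  have hterm : ∀ i j, lagged μ 𝓕 Z L i j ω - (μ[lagged μ 𝓕 Z L i j | 𝓕 j]) ω =
      if i ≤ L (j + i) then (μ[Z (j + i) | 𝓕 (j + 1)]) ω - (μ[Z (j + i) | 𝓕 j]) ω else 0 := by
    intro i j
    by_cases h : i ≤ L (j + i)
    · rw [hω i j h]
      simp [lagged, h]
    · simp [lagged, h, condExp_zero]
  -- Reindexing by `k = j + i` turns `n - i` terms into a sum over all `k < n`; the missing indices
  -- `k < i` contribute zero because `L k ≤ k`.
  have hcs : ∀ i ∈ Finset.range n, centeredSum μ 𝓕 (lagged μ 𝓕 Z L i) (n - i) ω =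
      ∑ k ∈ Finset.range n, if i ≤ L k then
        (μ[Z k | 𝓕 (k - i + 1)]) ω - (μ[Z k | 𝓕 (k - i)]) ω else 0 := by
    intro i hi
    have hin : i ≤ n := (Finset.mem_range.1 hi).le
    unfold centeredSum
    rw [← Finset.sum_range_add_sum_Ico _ hin, Finset.sum_Ico_eq_sum_range]
    rw [Finset.sum_eq_zero (s := Finset.range i), zero_add]
    · refine Finset.sum_congr rfl fun j _ => ?_
      rw [hterm, add_comm i j, Nat.add_sub_cancel]
    · intro k hk
      have := Finset.mem_range.1 hk
      exact if_neg fun h => by have := hL k; omega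
  rw [Finset.sum_congr rfl hcs, Finset.sum_comm, ← Finset.sum_add_distrib]
  refine Finset.sum_congr rfl fun k hk => ?_
  have hkn := Finset.mem_range.1 hk
  have h1 : ∑ i ∈ Finset.range n, (if i ≤ L k then
      (μ[Z k | 𝓕 (k - i + 1)]) ω - (μ[Z k | 𝓕 (k - i)]) ω else 0) =
      ∑ i ∈ Finset.range (L k + 1),
        ((μ[Z k | 𝓕 (k + 1 - i)]) ω - (μ[Z k | 𝓕 (k + 1 - (i + 1))]) ω) := by
    rw [← Finset.sum_filter]
    have hf : (Finset.range n).filter (fun i => i ≤ L k) = Finset.range (L k + 1) := by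
      ext i
      have := hL k
      simp only [Finset.mem_filter, Finset.mem_range]
      omega
    rw [hf]
    refine Finset.sum_congr rfl fun i hi => ?_
    have h2 : k - i + 1 = k + 1 - i := by
      have := Finset.mem_range.1 hi
      have := hL k
      omega
    rw [h2, show k - i = k + 1 - (i + 1) by omega]
  rw [h1, Finset.sum_range_sub' (fun i => (μ[Z k | 𝓕 (k + 1 - i)]) ω),
    show k + 1 - (L k + 1) = k - L k by omega, Nat.sub_zero,
    condExp_of_stronglyMeasurable (𝓕.le _) (hZ k) (hZi k)]
  ring

/-- These telescoping weights distribute an allowed deviation over infinitely many lags, each share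
being only polynomially small in the lag. -/
theorem sum_one_div_le (n : ℕ) :
    ∑ i ∈ Finset.range n, 1 / (((i : ℝ) + 1) * (i + 2)) ≤ 1 := by
  have h : ∀ n : ℕ, ∑ i ∈ Finset.range n, 1 / (((i : ℝ) + 1) * (i + 2)) = 1 - 1 / ((n : ℝ) + 1) := by
    intro n
    induction n with
    | zero => simp
    | succ n ih =>
      rw [Finset.sum_range_succ, ih]
      push_cast
      field_simp
      ring
  rw [h]
  have : (0 : ℝ) < 1 / ((n : ℝ) + 1) := by positivity
  linarith

/-- Maximal inequality for the partial sums of an adapted sequence, in terms of the moments of order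
`q ∈ [1, 2]` and of lagged conditional expectations. -/
theorem measure_exists_lt_abs_sum_le {q : ℝ} (hq1 : 1 ≤ q) (hq2 : q ≤ 2) {Z : ℕ → Ω → ℝ}
    (hZ : ∀ k, StronglyMeasurable[𝓕 (k + 1)] (Z k)) (hZi : ∀ k, Integrable (Z k) μ)
    {L : ℕ → ℕ} (hL : ∀ k, L k ≤ k) {δ : ℝ} (hδ : 0 < δ) (hδ1 : δ ≤ 1) :
    μ {ω | ∃ n, δ < |∑ k ∈ Finset.range n, Z k ω|} ≤
      ENNReal.ofReal (32 / δ ^ 2) *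
        ∑' k, ENNReal.ofReal (((L k : ℝ) + 2) ^ 5) * ∫⁻ ω, ENNReal.ofReal (|Z k ω| ^ q) ∂μ +
      ENNReal.ofReal (2 / δ) * ∑' k, ∫⁻ ω, ‖(μ[Z k | 𝓕 (k - L k)]) ω‖ₑ ∂μ := by
  set Y : ℕ → ℕ → Ω → ℝ := lagged μ 𝓕 Z L with hY
  set V : Ω → ℝ≥0∞ := fun ω => ∑' k, ‖(μ[Z k | 𝓕 (k - L k)]) ω‖ₑ with hV
  set N : ℕ → ℝ≥0∞ := fun k => ∫⁻ ω, ENNReal.ofReal (|Z k ω| ^ q) ∂μ with hN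
  -- Half of `δ` is shared among the lags, `D i` being the share of lag `i`; the other half is kept
  -- for the remainders `V`.
  set D : ℕ → ℝ := fun i => δ / 2 * (1 / (((i : ℝ) + 1) * (i + 2))) with hD
  have hD0 : ∀ i, 0 < D i := fun i => by positivity
  have hDsum : ∀ n, ∑ i ∈ Finset.range n, D i ≤ δ / 2 := by
    intro n
    simp only [hD]
    rw [← Finset.mul_sum]
    exact mul_le_of_le_one_right (by positivity) (sum_one_div_le n)
  have hD1 : ∀ i, D i ≤ 1 := by
    intro i
    have h := (Finset.single_le_sum (fun j _ => (hD0 j).le) (Finset.self_mem_range_succ i)).trans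
      (hDsum (i + 1))
    linarith
  have hYm : ∀ i j, StronglyMeasurable[𝓕 (j + 1)] (Y i j) := by
    intro i j
    simp only [hY, lagged]
    split_ifs
    · exact stronglyMeasurable_condExp
    · exact stronglyMeasurable_zero
  have hYi : ∀ i j, Integrable (Y i j) μ := by
    intro i j
    simp only [hY, lagged]
    split_ifs
    · exact integrable_condExp
    · exact integrable_zero _ _ _
  have hYq : ∀ i j, ∫⁻ ω, ENNReal.ofReal (|Y i j ω| ^ q) ∂μ ≤
      if i ≤ L (j + i) then N (j + i) else 0 := by
    intro i j
    simp only [hY, lagged]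
    split_ifs with h
    · exact lintegral_abs_rpow_condExp_le hq1 _
    · simp [Real.zero_rpow (by linarith : q ≠ 0)]
  have hVm : Measurable V := Measurable.tsum fun k =>
    (stronglyMeasurable_condExp.mono (𝓕.le _)).measurable.enorm
  have hVi : ∫⁻ ω, V ω ∂μ = ∑' k, ∫⁻ ω, ‖(μ[Z k | 𝓕 (k - L k)]) ω‖ₑ ∂μ :=
    lintegral_tsum fun k => (stronglyMeasurable_condExp.mono (𝓕.le _)).measurable.enorm.aemeasurable
  have hmax : ∀ i, μ {ω | ∃ n, D i < |centeredSum μ 𝓕 (Y i) n ω|} ≤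
      ∑' k, ENNReal.ofReal (8 / D i ^ 2) * if i ≤ L k then N k else 0 := by
    intro i
    refine (measure_exists_lt_abs_centeredSum_le hq1 hq2 (hYm i) (hYi i) (hD0 i) (hD1 i)).trans ?_
    rw [ENNReal.tsum_mul_left]
    refine mul_le_mul_right ((ENNReal.tsum_le_tsum (hYq i)).trans ?_) _
    exact ENNReal.tsum_comp_le_tsum_of_injective (add_left_injective i)
      (fun k => if i ≤ L k then N k else 0)
  have hmaxV : μ {ω | ENNReal.ofReal (δ / 2) ≤ V ω} ≤ ENNReal.ofReal (2 / δ) * ∫⁻ ω, V ω ∂μ := by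
    have h := mul_meas_ge_le_lintegral (μ := μ) hVm (ENNReal.ofReal (δ / 2))
    calc μ {ω | ENNReal.ofReal (δ / 2) ≤ V ω}
        = ENNReal.ofReal (2 / δ) *
            (ENNReal.ofReal (δ / 2) * μ {ω | ENNReal.ofReal (δ / 2) ≤ V ω}) := by
          rw [← mul_assoc, ← ENNReal.ofReal_mul (by positivity),
            show 2 / δ * (δ / 2) = 1 by field_simp, ENNReal.ofReal_one, one_mul]
      _ ≤ _ := mul_le_mul_right h _
  have hsub : μ {ω | ∃ n, δ < |∑ k ∈ Finset.range n, Z k ω|} ≤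
      μ ((⋃ i, {ω | ∃ n, D i < |centeredSum μ 𝓕 (Y i) n ω|}) ∪
        {ω | ENNReal.ofReal (δ / 2) ≤ V ω}) := by
    refine measure_mono_ae ?_
    filter_upwards [sum_eq_sum_lagged hZ hZi hL] with ω hω
    rintro ⟨n, hn⟩
    by_contra hcon
    have h1 : ∀ i m, |centeredSum μ 𝓕 (Y i) m ω| ≤ D i := by
      intro i m
      by_contra h
      exact hcon (Or.inl (mem_iUnion.2 ⟨i, m, not_le.1 h⟩))
    have h2 : V ω < ENNReal.ofReal (δ / 2) := by
      by_contra h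
      exact hcon (Or.inr (not_lt.1 h))
    have h3 : |∑ k ∈ Finset.range n, (μ[Z k | 𝓕 (k - L k)]) ω| < δ / 2 := by
      rw [← ENNReal.ofReal_lt_ofReal_iff (by positivity)]
      refine lt_of_le_of_lt ?_ h2
      rw [← Real.enorm_eq_ofReal_abs]
      exact (enorm_sum_le _ _).trans (ENNReal.sum_le_tsum _)
    have h4 : |∑ i ∈ Finset.range n, centeredSum μ 𝓕 (Y i) (n - i) ω| ≤ δ / 2 :=
      (Finset.abs_sum_le_sum_abs _ _).trans
        ((Finset.sum_le_sum fun i _ => h1 i (n - i)).trans (hDsum n))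
    rw [hω n] at hn
    have := abs_add_le (∑ i ∈ Finset.range n, centeredSum μ 𝓕 (Y i) (n - i) ω)
      (∑ k ∈ Finset.range n, (μ[Z k | 𝓕 (k - L k)]) ω)
    linarith
  -- The cost `1 / D i ^ 2` is of fourth order in the lag. Summing over the lags up to `L k`
  -- produces the fifth power in the statement.
  have hDsq : ∀ i l : ℕ, i ≤ l → 8 / D i ^ 2 ≤ 32 / δ ^ 2 * ((l : ℝ) + 2) ^ 4 := by
    intro i l hil
    have e : 8 / D i ^ 2 = 32 / δ ^ 2 * (((i : ℝ) + 1) * (i + 2)) ^ 2 := by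
      simp only [hD]
      field_simp
      norm_num
    rw [e]
    have h : (i : ℝ) ≤ l := by exact_mod_cast hil
    refine mul_le_mul_of_nonneg_left ?_ (by positivity)
    have h2 : ((i : ℝ) + 1) * (i + 2) ≤ ((l : ℝ) + 2) * (l + 2) := by gcongr; linarith
    calc (((i : ℝ) + 1) * (i + 2)) ^ 2 ≤ (((l : ℝ) + 2) * (l + 2)) ^ 2 := by gcongr
      _ = _ := by ring
  have hswap : ∑' i, ∑' k, (ENNReal.ofReal (8 / D i ^ 2) * if i ≤ L k then N k else 0) ≤
      ENNReal.ofReal (32 / δ ^ 2) * ∑' k, ENNReal.ofReal (((L k : ℝ) + 2) ^ 5) * N k := by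
    rw [ENNReal.tsum_comm, ← ENNReal.tsum_mul_left]
    refine ENNReal.tsum_le_tsum fun k => ?_
    rw [tsum_eq_sum (s := Finset.range (L k + 1)) (fun i hi => by
      rw [if_neg (fun h => hi (Finset.mem_range.2 (Nat.lt_succ_of_le h))), mul_zero])]
    calc ∑ i ∈ Finset.range (L k + 1), (ENNReal.ofReal (8 / D i ^ 2) * if i ≤ L k then N k else 0)
        ≤ ∑ i ∈ Finset.range (L k + 1),
            ENNReal.ofReal (32 / δ ^ 2 * ((L k : ℝ) + 2) ^ 4) * N k := by
          refine Finset.sum_le_sum fun i hi => ?_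
          have hi' : i ≤ L k := Nat.lt_succ_iff.1 (Finset.mem_range.1 hi)
          rw [if_pos hi']
          exact mul_le_mul_left (ENNReal.ofReal_le_ofReal (hDsq i _ hi')) _
      _ = ENNReal.ofReal (((L k : ℝ) + 1) * (32 / δ ^ 2 * ((L k : ℝ) + 2) ^ 4)) * N k := by
          rw [Finset.sum_const, Finset.card_range, nsmul_eq_mul,
            ENNReal.ofReal_mul (p := (L k : ℝ) + 1) (by positivity), mul_assoc,
            ← Nat.cast_succ, ENNReal.ofReal_natCast]
      _ ≤ ENNReal.ofReal (32 / δ ^ 2 * ((L k : ℝ) + 2) ^ 5) * N k := by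
          refine mul_le_mul_left (ENNReal.ofReal_le_ofReal ?_) _
          have h : (L k : ℝ) + 1 ≤ L k + 2 := by linarith
          calc ((L k : ℝ) + 1) * (32 / δ ^ 2 * ((L k : ℝ) + 2) ^ 4)
              ≤ ((L k : ℝ) + 2) * (32 / δ ^ 2 * ((L k : ℝ) + 2) ^ 4) := by gcongr
            _ = _ := by ring
      _ = _ := by rw [ENNReal.ofReal_mul (by positivity), mul_assoc]
  calc _ ≤ _ := hsub
    _ ≤ _ := measure_union_le _ _
    _ ≤ ∑' i, μ {ω | ∃ n, D i < |centeredSum μ 𝓕 (Y i) n ω|} +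
        ENNReal.ofReal (2 / δ) * ∫⁻ ω, V ω ∂μ := add_le_add (measure_iUnion_le _) hmaxV
    _ ≤ _ := by
        rw [hVi]
        gcongr
        exact (ENNReal.tsum_le_tsum hmax).trans hswap

end Lag

/-! ### Conditional expectation of the future of a Markov chain -/

section Shift

variable {S : Type*} [MeasurableSpace S] (Q : Kernel S S) [hQ : IsMarkovKernel Q]

instance : IsMarkovKernel (chainKernel Q) :=
  ⟨fun s => inferInstanceAs (IsProbabilityMeasure (chainLaw Q hQ s))⟩

/-- The version of `map_restrict_chainLaw` for the whole future path; the present state is kept as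
first coordinate so that the image is a composition-product with `chainKernel`. -/
theorem map_restrict_chainLaw_shift (s : S) (n : ℕ) {A : Set (ℕ → S)}
    (hA : MeasurableSet[natFil S n] A) :
    ((chainLaw Q hQ s).restrict A).map (fun ω => (ω n, fun k => ω (n + k))) =
      (((chainLaw Q hQ s).restrict A).map (fun ω => ω n)) ⊗ₘ chainKernel Q := by
  have hA' : MeasurableSet A := (natFil S).le n _ hA
  refine Measure.ext_of_lintegral _ fun F hF => ?_
  have hI : Measurable[natFil S n] (A.indicator (1 : (ℕ → S) → ℝ≥0∞)) :=
    (measurable_const (a := (1 : ℝ≥0∞))).indicator hA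
  have e : ∀ G : (ℕ → S) → ℝ≥0∞, ∫⁻ ω, A.indicator 1 ω * G ω ∂(chainLaw Q hQ s) =
      ∫⁻ ω in A, G ω ∂(chainLaw Q hQ s) := by
    intro G
    rw [← lintegral_indicator hA']
    refine lintegral_congr fun ω => ?_
    by_cases h : ω ∈ A <;> simp [h]
  have hsh : Measurable fun (ω : ℕ → S) => (ω n, fun k => ω (n + k)) := by fun_prop
  have hF0 : Measurable fun ω : ℕ → S => F (ω 0, ω) := hF.comp (by fun_prop)
  have h := lintegral_chainLaw_shift Q s n hI hF0
  simp only [add_zero] at h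
  rw [e, e] at h
  rw [lintegral_map hF hsh, h, Measure.lintegral_compProd hF,
    lintegral_map (f := fun t => ∫⁻ ω, F (t, ω) ∂(chainKernel Q t)) hF.lintegral_kernel_prod_right'
      (measurable_pi_apply n)]
  refine lintegral_congr fun ω => ?_
  rw [chainKernel_apply]
  have hfr := lintegral_chainLaw_frestrictLe Q (ω n) 0
    (Φ := fun q => F (q.1 ⟨0, Finset.mem_Iic.2 le_rfl⟩, q.2)) (hF.comp (by fun_prop))
  have hm0 : Measurable fun t : S => ∫⁻ ω', F (t, ω') ∂(chainKernel Q t) :=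
    hF.lintegral_kernel_prod_right'
  have hz := lintegral_chainLaw_zero Q (ω n) hm0
  refine Eq.trans ?_ hz
  refine Eq.trans hfr (lintegral_congr fun ω' => ?_)
  have hfr0 : Preorder.frestrictLe (π := fun _ : ℕ => S) 0 ω' = fun _ => ω' 0 := by
    ext ⟨i, hi⟩
    obtain rfl : i = 0 := Nat.le_zero.1 (Finset.mem_Iic.1 hi)
    rfl
  rw [hfr0]
  rfl

theorem setIntegral_chainLaw_shift (s : S) (n : ℕ) {A : Set (ℕ → S)}
    (hA : MeasurableSet[natFil S n] A) {F : (ℕ → S) → ℝ} (hF : Measurable F)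
    (hi : IntegrableOn (fun ω => F (fun k => ω (n + k))) A (chainLaw Q hQ s)) :
    IntegrableOn (fun ω => ∫ ω', F ω' ∂(chainLaw Q hQ (ω n))) A (chainLaw Q hQ s) ∧
    ∫ ω in A, F (fun k => ω (n + k)) ∂(chainLaw Q hQ s) =
      ∫ ω in A, ∫ ω', F ω' ∂(chainLaw Q hQ (ω n)) ∂(chainLaw Q hQ s) := by
  have hm := map_restrict_chainLaw_shift Q s n hA
  have h2 : Measurable fun (ω : ℕ → S) => (ω n, fun k => ω (n + k)) := by fun_prop
  have hF2 : Measurable fun q : S × (ℕ → S) => F q.2 := hF.comp measurable_snd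
  have hic : Integrable (fun q : S × (ℕ → S) => F q.2)
      ((((chainLaw Q hQ s).restrict A).map (fun ω => ω n)) ⊗ₘ chainKernel Q) := by
    rw [← hm]
    exact (integrable_map_measure hF2.aestronglyMeasurable h2.aemeasurable).2 hi
  have hsm : StronglyMeasurable fun t => ∫ ω', F ω' ∂(chainKernel Q t) :=
    hF.stronglyMeasurable.integral_kernel
  constructor
  · have h := ((Measure.integrable_compProd_iff hic.aestronglyMeasurable).1 hic).2
    have h3 : Integrable (fun t => ∫ ω', F ω' ∂(chainKernel Q t))
        (((chainLaw Q hQ s).restrict A).map (fun ω => ω n)) :=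
      h.mono' hsm.aestronglyMeasurable (ae_of_all _ fun t => norm_integral_le_integral_norm _)
    exact (integrable_map_measure hsm.aestronglyMeasurable
      (measurable_pi_apply n).aemeasurable).1 h3
  · have h := Measure.integral_compProd hic
    rw [← hm, integral_map h2.aemeasurable hF2.aestronglyMeasurable,
      integral_map (measurable_pi_apply n).aemeasurable hsm.aestronglyMeasurable] at h
    exact h

/-- This turns a lagged conditional expectation of the noise into an expectation under the chain
restarted at the present state. -/
theorem condExp_chainLaw_shift (s : S) (n : ℕ) {F : (ℕ → S) → ℝ} (hF : Measurable F)
    (hi : Integrable (fun ω => F (fun k => ω (n + k))) (chainLaw Q hQ s)) :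
    (chainLaw Q hQ s)[fun ω => F (fun k => ω (n + k)) | natFil S n]
      =ᵐ[chainLaw Q hQ s] fun ω => ∫ ω', F ω' ∂(chainLaw Q hQ (ω n)) := by
  have hsm : StronglyMeasurable fun t => ∫ ω', F ω' ∂(chainKernel Q t) :=
    hF.stronglyMeasurable.integral_kernel
  refine (ae_eq_condExp_of_forall_setIntegral_eq ((natFil S).le n) hi (fun B hB _ => ?_)
    (fun B hB _ => ?_) ?_).symm
  · exact (setIntegral_chainLaw_shift Q s n hB hF hi.integrableOn).1
  · exact (setIntegral_chainLaw_shift Q s n hB hF hi.integrableOn).2.symm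
  · exact (hsm.measurable.comp
      (measurable_eval_natFil (le_refl n))).stronglyMeasurable.aestronglyMeasurable

end Shift

/-! ### Chains with a slowly moving parameter: paths and moments -/

section Driven

variable {d : ℕ} {X : Type*} [MeasurableSpace X]

/-- The Markov chain `(X_n, θ_n, N_n)` in which `X_{n+1}` is drawn from `P_{θ_n}(X_n, ·)`, the
parameter `θ_{n+1} = move (X_n, θ_n, N_n) X_{n+1}` stays in `𝒦`, with increments of order
`γ (N_n + 1)`, and `N_n` counts the steps. -/
structure IsDriven (P : Kernel (E d × X) X) (W : X → ℝ) (γ : ℕ → ℝ) (𝒦 : Set (E d)) (C : ℝ)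
    (move : (X × E d × ℕ) × X → E d) (Q : Kernel (X × E d × ℕ) (X × E d × ℕ)) : Prop where
  measurable_move : Measurable move
  apply : ∀ t, Q t = (P (t.2.1, t.1)).map fun y => (y, move (t, y), t.2.2 + 1)
  mem : ∀ t, t.2.1 ∈ 𝒦 → ∀ y, move (t, y) ∈ 𝒦
  norm_le : ∀ t, t.2.1 ∈ 𝒦 → ∀ y, ‖move (t, y) - t.2.1‖ ≤ C * (γ (t.2.2 + 1) * W y)

/-- `W(X_0) + ⋯ + W(X_l)`. -/
def pathSum (W : X → ℝ) (l : ℕ) (ω : ℕ → X × E d × ℕ) : ℝ :=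
  ∑ j ∈ Finset.range (l + 1), W (ω j).1

theorem measurable_pathSum {W : X → ℝ} (hW : Measurable W) (l : ℕ) :
    Measurable (pathSum (d := d) W l) :=
  Finset.measurable_sum _ fun j _ => hW.comp (measurable_pi_apply j).fst

theorem le_pathSum {W : X → ℝ} (hW : ∀ x, 1 ≤ W x) {j l : ℕ} (h : j ≤ l)
    (ω : ℕ → X × E d × ℕ) : W (ω j).1 ≤ pathSum W l ω :=
  Finset.single_le_sum (f := fun j => W (ω j).1) (fun _ _ => zero_le_one.trans (hW _))
    (Finset.mem_range.2 (Nat.lt_succ_of_le h))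

theorem one_le_pathSum {W : X → ℝ} (hW : ∀ x, 1 ≤ W x) (l : ℕ) (ω : ℕ → X × E d × ℕ) :
    1 ≤ pathSum W l ω := (hW _).trans (le_pathSum hW (Nat.zero_le l) ω)

namespace IsDriven

variable {P : Kernel (E d × X) X} [IsMarkovKernel P] {π : E d → Measure X} {W : X → ℝ}
  {γ : ℕ → ℝ} {𝒦 : Set (E d)} {p κ C r : ℝ} {move : (X × E d × ℕ) × X → E d}
  {Q : Kernel (X × E d × ℕ) (X × E d × ℕ)} [hQ : IsMarkovKernel Q]

theorem measurable_next (hD : IsDriven P W γ 𝒦 C move Q) (t : X × E d × ℕ) :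
    Measurable fun y => (y, move (t, y), t.2.2 + 1) :=
  measurable_id.prodMk ((hD.measurable_move.comp measurable_prodMk_left).prodMk measurable_const)

theorem lintegral_fst (hD : IsDriven P W γ 𝒦 C move Q) (t : X × E d × ℕ) {f : X → ℝ≥0∞}
    (hf : Measurable f) : ∫⁻ t', f t'.1 ∂(Q t) = ∫⁻ y, f y ∂(P (t.2.1, t.1)) := by
  have hm : Measurable fun t' : X × E d × ℕ => f t'.1 := hf.comp measurable_fst
  rw [hD.apply, lintegral_map hm (hD.measurable_next t)]

theorem integral_fst (hD : IsDriven P W γ 𝒦 C move Q) (t : X × E d × ℕ) {f : X → ℝ}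
    (hf : Measurable f) : ∫ t', f t'.1 ∂(Q t) = ∫ y, f y ∂(P (t.2.1, t.1)) := by
  have hm : Measurable fun t' : X × E d × ℕ => f t'.1 := hf.comp measurable_fst
  rw [hD.apply, integral_map (hD.measurable_next t).aemeasurable hm.aestronglyMeasurable]

/-- Along the chain, the parameters stay in `𝒦`, the counter increases by one and the increments
of the parameter are controlled. -/
theorem ae_path (hD : IsDriven P W γ 𝒦 C move Q) (hW : Measurable W) (h𝒦 : MeasurableSet 𝒦)
    {t : X × E d × ℕ} (ht : t.2.1 ∈ 𝒦) :
    ∀ᵐ ω ∂(chainLaw Q hQ t), (ω 0).2.1 = t.2.1 ∧ W (ω 0).1 = W t.1 ∧ ∀ k, (ω k).2.1 ∈ 𝒦 ∧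
      (ω k).2.2 = t.2.2 + k ∧
      ‖(ω (k + 1)).2.1 - (ω k).2.1‖ ≤ C * (γ (t.2.2 + k + 1) * W (ω (k + 1)).1) := by
  have hp : MeasurableSet {q : (X × E d × ℕ) × (X × E d × ℕ) | q.2.2.2 = q.1.2.2 + 1 ∧
      (q.1.2.1 ∈ 𝒦 → q.2.2.1 ∈ 𝒦 ∧
        ‖q.2.2.1 - q.1.2.1‖ ≤ C * (γ (q.1.2.2 + 1) * W q.2.1))} := by
    have h1 : Measurable fun q : (X × E d × ℕ) × (X × E d × ℕ) => ‖q.2.2.1 - q.1.2.1‖ := by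
      fun_prop
    have h2 : Measurable fun q : (X × E d × ℕ) × (X × E d × ℕ) =>
        C * (γ (q.1.2.2 + 1) * W q.2.1) :=
      (((measurable_of_countable fun n => γ (n + 1)).comp
        (by fun_prop : Measurable fun q : (X × E d × ℕ) × (X × E d × ℕ) => q.1.2.2)).mul
        (hW.comp (by fun_prop))).const_mul C
    have h3 : MeasurableSet {q : (X × E d × ℕ) × (X × E d × ℕ) | q.1.2.1 ∈ 𝒦} :=
      (by fun_prop : Measurable fun q : (X × E d × ℕ) × (X × E d × ℕ) => q.1.2.1) h𝒦
    have h4 : MeasurableSet {q : (X × E d × ℕ) × (X × E d × ℕ) | q.2.2.1 ∈ 𝒦} :=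
      (by fun_prop : Measurable fun q : (X × E d × ℕ) × (X × E d × ℕ) => q.2.2.1) h𝒦
    have h5 : MeasurableSet {q : (X × E d × ℕ) × (X × E d × ℕ) | q.2.2.2 = q.1.2.2 + 1} :=
      measurableSet_eq_fun (by fun_prop) (by fun_prop)
    exact h5.inter (h3.himp (h4.inter (measurableSet_le h1 h2)))
  have hstep := ae_chainLaw_step Q t (p := fun q => q.2.2.2 = q.1.2.2 + 1 ∧
      (q.1.2.1 ∈ 𝒦 → q.2.2.1 ∈ 𝒦 ∧
        ‖q.2.2.1 - q.1.2.1‖ ≤ C * (γ (q.1.2.2 + 1) * W q.2.1))) hp fun s => by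
    rw [hD.apply]
    refine (ae_map_iff (hD.measurable_next s).aemeasurable (measurable_prodMk_left hp)).2 ?_
    exact ae_of_all _ fun y => ⟨rfl, fun hs => ⟨hD.mem s hs y, hD.norm_le s hs y⟩⟩
  -- `X` need not have measurable points, so the initial condition is recorded only through the
  -- parameter and counter and through `W`.
  filter_upwards [hstep, ae_chainLaw_zero Q t (f := fun t => t.2) measurable_snd,
    ae_chainLaw_zero Q t (f := fun t => W t.1) (hW.comp measurable_fst)] with ω h1 h2 h3
  refine ⟨by rw [h2], h3, ?_⟩
  have key : ∀ k, (ω k).2.1 ∈ 𝒦 ∧ (ω k).2.2 = t.2.2 + k := by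
    intro k
    induction k with
    | zero => rw [h2]; exact ⟨ht, rfl⟩
    | succ k ih => exact ⟨((h1 k).2 ih.1).1, by rw [(h1 k).1, ih.2]; rfl⟩
  exact fun k => ⟨(key k).1, (key k).2, by
    have := ((h1 k).2 (key k).1).2
    rwa [(key k).2] at this⟩

/-- The drift is uniform over `𝒦`, so the moving parameter is harmless: the moments satisfy `u_{k+1}
≤ r u_k + C`. The additive `C / (1 - r)` is absorbed because `W ≥ 1`. -/
theorem lintegral_W_pow_le (hD : IsDriven P W γ 𝒦 C move Q) (hB : LocalBounds P π W 𝒦 p κ C r)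
    (h𝒦 : MeasurableSet 𝒦) {t : X × E d × ℕ} (ht : t.2.1 ∈ 𝒦) (hp : 1 < p) (k : ℕ) :
    ∫⁻ ω, ENNReal.ofReal (W (ω k).1 ^ p) ∂(chainLaw Q hQ t) ≤
      ENNReal.ofReal ((1 + C / (1 - r)) * W t.1 ^ p) := by
  have hWp : ∀ x, 1 ≤ W x ^ p := fun x => Real.one_le_rpow (hB.one_le_W x) (by linarith)
  have hr := hB.r_mem
  have hr1 : 0 < 1 - r := by linarith [hr.2]
  have hC := hB.C_pos
  have hm : Measurable fun x => ENNReal.ofReal (W x ^ p) :=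
    (hB.measurable_W.pow_const p).ennreal_ofReal
  have key : ∫⁻ ω, ENNReal.ofReal (W (ω k).1 ^ p) ∂(chainLaw Q hQ t) ≤
      ENNReal.ofReal (W t.1 ^ p + C / (1 - r)) := by
    induction k with
    | zero =>
      have hm1 : Measurable fun t : X × E d × ℕ => ENNReal.ofReal (W t.1 ^ p) :=
        hm.comp measurable_fst
      rw [lintegral_chainLaw_zero Q t hm1]
      refine ENNReal.ofReal_le_ofReal ?_
      have : 0 < C / (1 - r) := by positivity
      linarith
    | succ k ih =>
      have h := lintegral_chainLaw_step Q t k (Z := fun _ => 1) measurable_const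
        (F := fun q => ENNReal.ofReal (W q.2.1 ^ p)) (hm.comp (by fun_prop))
      simp only [one_mul] at h
      rw [h]
      calc ∫⁻ ω, ∫⁻ s', ENNReal.ofReal (W s'.1 ^ p) ∂(Q (ω k)) ∂(chainLaw Q hQ t)
          ≤ ∫⁻ ω, (ENNReal.ofReal r * ENNReal.ofReal (W (ω k).1 ^ p) + ENNReal.ofReal C)
              ∂(chainLaw Q hQ t) := by
            refine lintegral_mono_ae ?_
            filter_upwards [hD.ae_path hB.measurable_W h𝒦 ht] with ω hω
            rw [hD.lintegral_fst _ hm]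
            refine (hB.drift _ (hω.2.2 k).1 _).trans ?_
            rw [ENNReal.ofReal_add (mul_nonneg hr.1.le (by linarith [hWp (ω k).1])) hC.le,
              ENNReal.ofReal_mul hr.1.le]
        _ = ENNReal.ofReal r * ∫⁻ ω, ENNReal.ofReal (W (ω k).1 ^ p) ∂(chainLaw Q hQ t) +
              ENNReal.ofReal C := by
            have hmk : Measurable fun ω : ℕ → X × E d × ℕ => ENNReal.ofReal (W (ω k).1 ^ p) :=
              hm.comp (by fun_prop)
            rw [lintegral_add_right _ measurable_const, lintegral_const_mul _ hmk]
            simp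
        _ ≤ ENNReal.ofReal r * ENNReal.ofReal (W t.1 ^ p + C / (1 - r)) + ENNReal.ofReal C := by
            gcongr
        _ ≤ _ := by
            rw [← ENNReal.ofReal_mul hr.1.le, ← ENNReal.ofReal_add _ hC.le]
            · refine ENNReal.ofReal_le_ofReal ?_
              have e : r * (C / (1 - r)) + C = C / (1 - r) := by field_simp; ring
              have : r * W t.1 ^ p ≤ W t.1 ^ p :=
                mul_le_of_le_one_left (by linarith [hWp t.1]) hr.2.le
              linarith
            · have := hWp t.1
              have : 0 ≤ C / (1 - r) := by positivity
              exact mul_nonneg hr.1.le (by linarith)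
  refine key.trans (ENNReal.ofReal_le_ofReal ?_)
  have : C / (1 - r) ≤ C / (1 - r) * W t.1 ^ p :=
    le_mul_of_one_le_right (by positivity) (hWp _)
  linarith

/-- Convexity of `t ^ p` reduces to single moments. The path sum is needed because it controls the
displacement of the parameter over several steps. -/
theorem integrable_pathSum_pow (hD : IsDriven P W γ 𝒦 C move Q)
    (hB : LocalBounds P π W 𝒦 p κ C r) (h𝒦 : MeasurableSet 𝒦) {t : X × E d × ℕ}
    (ht : t.2.1 ∈ 𝒦) (hp : 1 < p) (l : ℕ) :
    Integrable (fun ω => pathSum W l ω ^ p) (chainLaw Q hQ t) ∧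
      ∫ ω, pathSum W l ω ^ p ∂(chainLaw Q hQ t) ≤
        ((l : ℝ) + 1) ^ p * ((1 + C / (1 - r)) * W t.1 ^ p) := by
  have hW0 : ∀ x, 0 ≤ W x := fun x => zero_le_one.trans (hB.one_le_W x)
  have hS0 : ∀ ω : ℕ → X × E d × ℕ, 0 ≤ pathSum W l ω ^ p := fun ω =>
    Real.rpow_nonneg (zero_le_one.trans (one_le_pathSum hB.one_le_W l ω)) p
  have hM : 0 ≤ (1 + C / (1 - r)) * W t.1 ^ p := by
    have := hB.C_pos
    have : 0 < 1 - r := by linarith [hB.r_mem.2]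
    exact mul_nonneg (by positivity) (Real.rpow_nonneg (hW0 _) _)
  have hm : Measurable fun ω : ℕ → X × E d × ℕ => pathSum W l ω ^ p :=
    (measurable_pathSum hB.measurable_W l).pow_const p
  have hpt : ∀ ω : ℕ → X × E d × ℕ, pathSum W l ω ^ p ≤
      ((l : ℝ) + 1) ^ (p - 1) * ∑ j ∈ Finset.range (l + 1), W (ω j).1 ^ p := by
    intro ω
    have h := Real.rpow_sum_le_const_mul_sum_rpow (Finset.range (l + 1))
      (fun j => W (ω j).1) hp.le
    simp only [abs_of_nonneg (hW0 _), Finset.card_range] at h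
    push_cast at h
    exact h
  have key : ∫⁻ ω, ENNReal.ofReal (pathSum W l ω ^ p) ∂(chainLaw Q hQ t) ≤
      ENNReal.ofReal (((l : ℝ) + 1) ^ p * ((1 + C / (1 - r)) * W t.1 ^ p)) := by
    calc ∫⁻ ω, ENNReal.ofReal (pathSum W l ω ^ p) ∂(chainLaw Q hQ t)
        ≤ ∫⁻ ω, ENNReal.ofReal (((l : ℝ) + 1) ^ (p - 1)) *
            ∑ j ∈ Finset.range (l + 1), ENNReal.ofReal (W (ω j).1 ^ p) ∂(chainLaw Q hQ t) := by
          refine lintegral_mono fun ω => ?_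
          rw [← ENNReal.ofReal_sum_of_nonneg fun j _ => Real.rpow_nonneg (hW0 _) p,
            ← ENNReal.ofReal_mul (by positivity)]
          exact ENNReal.ofReal_le_ofReal (hpt ω)
      _ = ENNReal.ofReal (((l : ℝ) + 1) ^ (p - 1)) *
            ∑ j ∈ Finset.range (l + 1),
              ∫⁻ ω, ENNReal.ofReal (W (ω j).1 ^ p) ∂(chainLaw Q hQ t) := by
          have hmj : ∀ j : ℕ, Measurable fun ω : ℕ → X × E d × ℕ => ENNReal.ofReal (W (ω j).1 ^ p) :=
            fun j => ((hB.measurable_W.comp (measurable_pi_apply j).fst).pow_const p).ennreal_ofReal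
          rw [lintegral_const_mul _ (Finset.measurable_sum _ fun j _ => hmj j),
            lintegral_finsetSum _ fun j _ => hmj j]
      _ ≤ ENNReal.ofReal (((l : ℝ) + 1) ^ (p - 1)) *
            ∑ j ∈ Finset.range (l + 1), ENNReal.ofReal ((1 + C / (1 - r)) * W t.1 ^ p) := by
          gcongr with j _
          exact hD.lintegral_W_pow_le hB h𝒦 ht hp j
      _ = _ := by
          have e : ((l : ℝ) + 1) ^ p = ((l : ℝ) + 1) ^ (p - 1) * ((l + 1 : ℕ) : ℝ) := by
            rw [Real.rpow_sub_one (by positivity)]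
            push_cast
            field_simp
          rw [e, Finset.sum_const, Finset.card_range, nsmul_eq_mul, mul_assoc (_ ^ (p - 1)),
            ENNReal.ofReal_mul (p := ((l : ℝ) + 1) ^ (p - 1)) (by positivity),
            ENNReal.ofReal_mul (p := ((l + 1 : ℕ) : ℝ)) (Nat.cast_nonneg _),
            ENNReal.ofReal_natCast]
  refine ⟨⟨hm.aestronglyMeasurable, ?_⟩, ?_⟩
  · rw [hasFiniteIntegral_iff_ofReal (ae_of_all _ hS0)]
    exact key.trans_lt ENNReal.ofReal_lt_top
  · rw [integral_eq_lintegral_of_nonneg_ae (ae_of_all _ hS0) hm.aestronglyMeasurable]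
    exact ENNReal.toReal_le_of_le_ofReal (mul_nonneg (by positivity) hM) key

end IsDriven

end Driven

/-! ### Decay of the conditional mean of the noise -/

section Driven

variable {d : ℕ} {X : Type*} [MeasurableSpace X]

namespace IsDriven

variable {P : Kernel (E d × X) X} [IsMarkovKernel P] {π : E d → Measure X} {W : X → ℝ}
  {γ : ℕ → ℝ} {𝒦 : Set (E d)} {p κ α C r : ℝ} {move : (X × E d × ℕ) × X → E d}
  {Q : Kernel (X × E d × ℕ) (X × E d × ℕ)} [hQ : IsMarkovKernel Q] {t : X × E d × ℕ}

theorem ae_norm_sub_le (hD : IsDriven P W γ 𝒦 C move Q) (hB : LocalBounds P π W 𝒦 p κ C r)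
    (h𝒦 : MeasurableSet 𝒦) (ht : t.2.1 ∈ 𝒦) (hγ : ∀ n, 0 ≤ γ n) (hγa : Antitone γ) :
    ∀ᵐ ω ∂(chainLaw Q hQ t), ∀ j,
      ‖(ω j).2.1 - t.2.1‖ ≤ C * (γ t.2.2 * pathSum W j ω) := by
  filter_upwards [hD.ae_path hB.measurable_W h𝒦 ht] with ω hω j
  have hC := hB.C_pos
  induction j with
  | zero =>
    rw [hω.1, sub_self, norm_zero]
    exact mul_nonneg hC.le (mul_nonneg (hγ _)
      (zero_le_one.trans (one_le_pathSum hB.one_le_W 0 ω)))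
  | succ j ih =>
    have h1 : ‖(ω (j + 1)).2.1 - t.2.1‖ ≤
        ‖(ω (j + 1)).2.1 - (ω j).2.1‖ + ‖(ω j).2.1 - t.2.1‖ := norm_sub_le_norm_sub_add_norm_sub _ _ _
    have h2 := (hω.2.2 j).2.2
    have h3 : γ (t.2.2 + j + 1) ≤ γ t.2.2 := hγa (by omega)
    have h4 : C * (γ (t.2.2 + j + 1) * W (ω (j + 1)).1) ≤ C * (γ t.2.2 * W (ω (j + 1)).1) :=
      mul_le_mul_of_nonneg_left (mul_le_mul_of_nonneg_right h3 (hB.W_pos _).le) hC.le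
    have e : pathSum W (j + 1) ω = pathSum W j ω + W (ω (j + 1)).1 :=
      Finset.sum_range_succ _ _
    rw [e]
    linarith

/-- The displacement contributes `κ` powers of the path sum and `W` one more. The condition `1 + κ ≤
p` is what lets the moment of order `p` absorb both. -/
theorem ae_rpow_mul_le (hD : IsDriven P W γ 𝒦 C move Q) (hB : LocalBounds P π W 𝒦 p κ C r)
    (h𝒦 : MeasurableSet 𝒦) (ht : t.2.1 ∈ 𝒦) (hγ : ∀ n, 0 ≤ γ n) (hγa : Antitone γ)
    (hκ : 0 < κ) (hκp : 1 + κ ≤ p) :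
    ∀ᵐ ω ∂(chainLaw Q hQ t), ∀ j,
      ‖(ω j).2.1 - t.2.1‖ ^ κ * W (ω j).1 ≤ (C * γ t.2.2) ^ κ * pathSum W j ω ^ p := by
  filter_upwards [hD.ae_norm_sub_le hB h𝒦 ht hγ hγa] with ω hω j
  have hC := hB.C_pos
  have hS := one_le_pathSum hB.one_le_W j ω
  have hS0 : 0 < pathSum W j ω := by linarith
  have h1 : ‖(ω j).2.1 - t.2.1‖ ^ κ ≤ (C * γ t.2.2) ^ κ * pathSum W j ω ^ κ := by
    rw [← Real.mul_rpow (mul_nonneg hC.le (hγ _)) hS0.le]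
    refine Real.rpow_le_rpow (norm_nonneg _) ((hω j).trans (le_of_eq (by ring))) hκ.le
  have h2 := le_pathSum hB.one_le_W (le_refl j) ω
  calc ‖(ω j).2.1 - t.2.1‖ ^ κ * W (ω j).1
      ≤ (C * γ t.2.2) ^ κ * pathSum W j ω ^ κ * pathSum W j ω :=
        mul_le_mul h1 h2 (hB.W_pos _).le (mul_nonneg
          (Real.rpow_nonneg (mul_nonneg hC.le (hγ _)) _) (Real.rpow_nonneg hS0.le _))
    _ = (C * γ t.2.2) ^ κ * pathSum W j ω ^ (κ + 1) := by
        rw [Real.rpow_add_one hS0.ne', mul_assoc]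
    _ ≤ _ := mul_le_mul_of_nonneg_left
        (Real.rpow_le_rpow_of_exponent_le hS (by linarith))
        (Real.rpow_nonneg (mul_nonneg hC.le (hγ _)) _)

theorem integrable_W (hD : IsDriven P W γ 𝒦 C move Q) (hB : LocalBounds P π W 𝒦 p κ C r)
    (h𝒦 : MeasurableSet 𝒦) (ht : t.2.1 ∈ 𝒦) (hp : 1 < p) (k : ℕ) :
    Integrable (fun ω => W (ω k).1) (chainLaw Q hQ t) := by
  refine (hD.integrable_pathSum_pow hB h𝒦 ht hp k).1.mono'
    (hB.measurable_W.comp (measurable_pi_apply k).fst).aestronglyMeasurable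
    (ae_of_all _ fun ω => ?_)
  rw [Real.norm_eq_abs, abs_of_pos (hB.W_pos _)]
  exact (le_pathSum hB.one_le_W le_rfl ω).trans
    (Real.self_le_rpow_of_one_le (one_le_pathSum hB.one_le_W k ω) hp.le)

/-- Comparison with the chain whose parameter is frozen. -/
theorem abs_integral_sub_iter_le (hD : IsDriven P W γ 𝒦 C move Q)
    (hB : LocalBounds P π W 𝒦 p κ C r) (h𝒦 : MeasurableSet 𝒦) (ht : t.2.1 ∈ 𝒦)
    (hγ : ∀ n, 0 ≤ γ n) (hγa : Antitone γ) (hp : 1 < p) (hκ : 0 < κ) (hκp : 1 + κ ≤ p)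
    {f : X → ℝ} (hf : Measurable f) (hfW : ∀ x, |f x| ≤ W x) (l : ℕ) :
    |(∫ ω, f (ω l).1 ∂(chainLaw Q hQ t)) - iter P t.2.1 l f t.1| ≤
      C ^ 2 * (C * γ t.2.2) ^ κ * ((l : ℝ) ^ (p + 1) * ((1 + C / (1 - r)) * W t.1 ^ p)) := by
  set μ := chainLaw Q hQ t with hμ
  have hC := hB.C_pos
  have hr := hB.r_mem
  have hr1 : 0 < 1 - r := by linarith [hr.2]
  set B : ℝ := (1 + C / (1 - r)) * W t.1 ^ p with hBdef
  have hB0 : 0 ≤ B := mul_nonneg (by positivity) (Real.rpow_nonneg (hB.W_pos _).le _)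
  have hcγ : 0 ≤ C * γ t.2.2 := mul_nonneg hC.le (hγ _)
  -- Interpolation: follow the true chain for `j` steps, then the frozen kernel for `l - j` steps.
  -- Passing from `j` to `j + 1` replaces one frozen transition by a true one.
  obtain ⟨a, ha⟩ : ∃ a : ℕ → ℝ, ∀ j, a j = ∫ ω, iter P t.2.1 (l - j) f (ω j).1 ∂μ :=
    ⟨_, fun _ => rfl⟩
  have hfit : ∀ j i : ℕ, Integrable (fun ω => iter P t.2.1 i f (ω j).1) μ := fun j i =>
    ((hD.integrable_W hB h𝒦 ht hp j).const_mul (2 * C)).mono'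
      ((measurable_iter t.2.1 i hf).comp (measurable_pi_apply j).fst).aestronglyMeasurable
      (ae_of_all _ fun ω => hB.abs_iter_le ht i hf hfW _)
  have ha0 : a 0 = iter P t.2.1 l f t.1 := by
    rw [ha, Nat.sub_zero]
    have h := ae_chainLaw_zero Q t (f := fun t' : X × E d × ℕ => iter P t.2.1 l f t'.1)
      ((measurable_iter t.2.1 l hf).comp measurable_fst)
    rw [integral_congr_ae h]
    simp
  have hal : a l = ∫ ω, f (ω l).1 ∂μ := by
    rw [ha, Nat.sub_self]
    exact integral_congr_ae (ae_of_all _ fun ω => iter_zero _ hf _)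
  have hstep : ∀ j < l, |a (j + 1) - a j| ≤
      C ^ 2 * (C * γ t.2.2) ^ κ * ((l : ℝ) ^ p * B) := by
    intro j hj
    have hlj : l - j = (l - (j + 1)) + 1 := by omega
    set i := l - (j + 1) with hi
    have hmi := measurable_iter (P := P) t.2.1 i hf
    have hst := setIntegral_chainLaw_step Q t j (A := univ)
      (by exact @MeasurableSet.univ _ (natFil _ j))
      (c := fun q => iter P t.2.1 i f q.2.1) (hmi.comp (by fun_prop))
      (hfit (j + 1) i).integrableOn
    simp only [Measure.restrict_univ, integrableOn_univ] at hst
    have e1 : a (j + 1) = ∫ ω, ∫ y, iter P t.2.1 i f y ∂(P ((ω j).2.1, (ω j).1)) ∂μ := by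
      rw [ha, ← hi, hst.2]
      exact integral_congr_ae (ae_of_all _ fun ω => hD.integral_fst (ω j) hmi)
    have i1 : Integrable (fun ω => ∫ y, iter P t.2.1 i f y ∂(P ((ω j).2.1, (ω j).1))) μ :=
      hst.1.congr (ae_of_all _ fun ω => hD.integral_fst (ω j) hmi)
    have hs : ∀ x, iter P t.2.1 (i + 1) f x = ∫ y, iter P t.2.1 i f y ∂(P (t.2.1, x)) :=
      hB.iter_succ ht i hf (c := 1) (by simpa using hfW)
    have i2 : Integrable (fun ω => ∫ y, iter P t.2.1 i f y ∂(P (t.2.1, (ω j).1))) μ :=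
      (hfit j (i + 1)).congr (ae_of_all _ fun ω => hs _)
    have e2 : a j = ∫ ω, ∫ y, iter P t.2.1 i f y ∂(P (t.2.1, (ω j).1)) ∂μ := by
      rw [ha, hlj]
      exact integral_congr_ae (ae_of_all _ fun ω => hs _)
    have hS := hD.integrable_pathSum_pow hB h𝒦 ht hp j
    rw [e1, e2, ← integral_sub i1 i2, ← Real.norm_eq_abs]
    refine (norm_integral_le_of_norm_le (hS.1.const_mul (C ^ 2 * (C * γ t.2.2) ^ κ)) ?_).trans ?_
    · filter_upwards [hD.ae_path hB.measurable_W h𝒦 ht,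
        hD.ae_rpow_mul_le hB h𝒦 ht hγ hγa hκ hκp] with ω h1 h2
      refine (hB.abs_integral_iter_sub_le ht (h1.2.2 j).1 i hf hfW (ω j).1).trans ?_
      have h3 : r ^ i ≤ 1 := pow_le_one₀ hr.1.le hr.2.le
      have h4 : 0 ≤ ‖(ω j).2.1 - t.2.1‖ ^ κ * W (ω j).1 :=
        mul_nonneg (by positivity) (hB.W_pos _).le
      calc C ^ 2 * r ^ i * ‖(ω j).2.1 - t.2.1‖ ^ κ * W (ω j).1
          = C ^ 2 * (r ^ i * (‖(ω j).2.1 - t.2.1‖ ^ κ * W (ω j).1)) := by ring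
        _ ≤ C ^ 2 * (1 * ((C * γ t.2.2) ^ κ * pathSum W j ω ^ p)) := by
            refine mul_le_mul_of_nonneg_left ?_ (by positivity)
            exact mul_le_mul h3 (h2 j) h4 zero_le_one
        _ = _ := by ring
    · rw [integral_const_mul]
      refine mul_le_mul_of_nonneg_left (hS.2.trans ?_)
        (mul_nonneg (by positivity) (Real.rpow_nonneg hcγ _))
      refine mul_le_mul_of_nonneg_right (Real.rpow_le_rpow (by positivity) ?_ (by linarith)) hB0
      exact_mod_cast hj
  have hsum : |a l - a 0| ≤ ∑ j ∈ Finset.range l,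
      C ^ 2 * (C * γ t.2.2) ^ κ * ((l : ℝ) ^ p * B) := by
    rw [← Finset.sum_range_sub a l]
    exact (Finset.abs_sum_le_sum_abs _ _).trans
      (Finset.sum_le_sum fun j hj => hstep j (Finset.mem_range.1 hj))
  rw [hal, ha0] at hsum
  refine hsum.trans (le_of_eq ?_)
  rw [Finset.sum_const, Finset.card_range, nsmul_eq_mul]
  rcases Nat.eq_zero_or_pos l with rfl | hl
  · simp [Real.zero_rpow (by linarith : p + 1 ≠ 0)]
  · rw [Real.rpow_add_one (by positivity)]
    ring

/-- The comparison with the frozen chain is combined with geometric ergodicity of the frozen kernel;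
dividing by `c` normalizes `f` to the domination by `W` used there. -/
theorem abs_integral_sub_invariant_le (hD : IsDriven P W γ 𝒦 C move Q)
    (hB : LocalBounds P π W 𝒦 p κ C r) (h𝒦 : MeasurableSet 𝒦) (ht : t.2.1 ∈ 𝒦)
    (hγ : ∀ n, 0 ≤ γ n) (hγa : Antitone γ) (hp : 1 < p) (hκ : 0 < κ) (hκp : 1 + κ ≤ p)
    {f : X → ℝ} (hf : Measurable f) {c : ℝ} (hc : 0 < c) (hfW : ∀ x, |f x| ≤ c * W x) (l : ℕ) :
    |(∫ ω, f (ω l).1 ∂(chainLaw Q hQ t)) - ∫ x, f x ∂(π t.2.1)| ≤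
      c * (C ^ 2 * (C * γ t.2.2) ^ κ * ((l : ℝ) ^ (p + 1) * ((1 + C / (1 - r)) * W t.1 ^ p)) +
        C * r ^ l * W t.1) := by
  have hm : Measurable fun x => c⁻¹ * f x := hf.const_mul _
  have hb : ∀ x, |c⁻¹ * f x| ≤ W x := fun x => by
    rw [abs_mul, abs_of_pos (inv_pos.2 hc), inv_mul_le_iff₀ hc]
    exact hfW x
  have h1 := hD.abs_integral_sub_iter_le hB h𝒦 ht hγ hγa hp hκ hκp hm hb l
  have h2 := hB.abs_iter_sub_le ht l hm hb t.1
  have h3 := (abs_sub_le _ _ _).trans (add_le_add h1 h2)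
  rw [integral_const_mul, integral_const_mul, ← mul_sub, abs_mul, abs_of_pos (inv_pos.2 hc),
    inv_mul_le_iff₀ hc] at h3
  exact h3

/-- The centered field along a transition. -/
def noise (g : E d → X → ℝ) (gbar : E d → ℝ) (q : (X × E d × ℕ) × (X × E d × ℕ)) : ℝ :=
  g q.1.2.1 q.2.1 - gbar q.1.2.1

theorem measurable_noise {g : E d → X → ℝ} (hg : Measurable (Function.uncurry g))
    {gbar : E d → ℝ} (hb : Measurable gbar) : Measurable (noise g gbar) :=
  (hg.comp (by fun_prop : Measurable fun q : (X × E d × ℕ) × (X × E d × ℕ) =>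
    (q.1.2.1, q.2.1))).sub (hb.comp (by fun_prop))

theorem abs_noise_le (hB : LocalBounds P π W 𝒦 p κ C r) {g : E d → X → ℝ}
    (hg : LocalField π W 𝒦 α C g) {gbar : E d → ℝ} (hgb : ∀ θ ∈ 𝒦, gbar θ = ∫ x, g θ x ∂(π θ))
    {q : (X × E d × ℕ) × (X × E d × ℕ)} (hq : q.1.2.1 ∈ 𝒦) :
    |noise g gbar q| ≤ 2 * C ^ 2 * W q.2.1 := by
  have hC := hB.one_le_C
  have h1 := hg.bound _ hq q.2.1
  have h2 : |gbar q.1.2.1| ≤ C * C := by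
    rw [hgb _ hq, ← Real.norm_eq_abs]
    refine (norm_integral_le_of_norm_le ((hB.integrable_W _ hq).const_mul C)
      (ae_of_all _ fun x => hg.bound _ hq x)).trans ?_
    rw [integral_const_mul]
    exact mul_le_mul_of_nonneg_left (hB.integral_W_le _ hq) (by linarith)
  have hW := hB.one_le_W q.2.1
  have h3 : |noise g gbar q| ≤ |g q.1.2.1 q.2.1| + |gbar q.1.2.1| := abs_sub _ _
  have h4 : C ≤ C ^ 2 := by nlinarith
  have h5 : C * W q.2.1 ≤ C ^ 2 * W q.2.1 := mul_le_mul_of_nonneg_right h4 (by linarith)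
  have h6 : C ^ 2 ≤ C ^ 2 * W q.2.1 := le_mul_of_one_le_right (by positivity) hW
  nlinarith

theorem integrable_noise (hD : IsDriven P W γ 𝒦 C move Q)
    (hB : LocalBounds P π W 𝒦 p κ C r) {g : E d → X → ℝ} (hg : LocalField π W 𝒦 α C g)
    (h𝒦 : MeasurableSet 𝒦) (ht : t.2.1 ∈ 𝒦) (hp : 1 < p) {gbar : E d → ℝ}
    (hgm : Measurable gbar) (hgb : ∀ θ ∈ 𝒦, gbar θ = ∫ x, g θ x ∂(π θ)) (l : ℕ) :
    Integrable (fun ω => noise g gbar (ω l, ω (l + 1))) (chainLaw Q hQ t) := by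
  refine ((hD.integrable_W hB h𝒦 ht hp (l + 1)).const_mul (2 * C ^ 2)).mono'
    ((measurable_noise hg.measurable hgm).comp (by fun_prop)).aestronglyMeasurable ?_
  filter_upwards [hD.ae_path hB.measurable_W h𝒦 ht] with ω hω
  exact abs_noise_le hB hg hgb (q := (ω l, ω (l + 1))) (hω.2.2 l).1

/-- A dichotomy on the displacement. If it is at most `γ₀ ^ s`, the majorant `φ` of the local
oscillation applies. Otherwise `1 ≤ C S γ₀ ^ (1 - s)`; raising this to the power `p - 1` produces a
factor `γ₀ ^ κ` that can multiply the trivial bound `2 C S`. -/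
theorem abs_noise_sub_le {φ : X → ℝ} {g : E d → X → ℝ} (hB : LocalBounds P π W 𝒦 p κ C r)
    (hg : LocalField π W 𝒦 α C g) (hp : 1 < p) (hφ0 : ∀ x, 0 ≤ φ x)
    {s γ₀ : ℝ} (hsp : κ ≤ (p - 1) * (1 - s)) (hγ0 : 0 < γ₀) (hγ1 : γ₀ ≤ 1) {θ₀ θ : E d}
    (h0 : θ₀ ∈ 𝒦) (h1 : θ ∈ 𝒦) (hφ : ∀ θ' ∈ 𝒦, ‖θ' - θ₀‖ ≤ γ₀ ^ s → ∀ x, |g θ' x - g θ₀ x| ≤ φ x)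
    {S : ℝ} {x : X} (hS1 : 1 ≤ S) (hxS : W x ≤ S) (hθS : ‖θ - θ₀‖ ≤ C * (γ₀ * S)) :
    |g θ x - g θ₀ x| ≤ φ x + 2 * C ^ p * γ₀ ^ κ * S ^ p := by
  have hC := hB.one_le_C
  have hC0 : 0 < C := by linarith
  have hS0 : 0 < S := by linarith
  have hnn : 0 ≤ 2 * C ^ p * γ₀ ^ κ * S ^ p := by positivity
  by_cases h : ‖θ - θ₀‖ ≤ γ₀ ^ s
  · have := hφ θ h1 h x
    linarith
  · have h2 : γ₀ ^ s ≤ C * (γ₀ * S) := (not_le.1 h).le.trans hθS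
    have h3 : 1 ≤ C * S * γ₀ ^ (1 - s) := by
      have : γ₀ ^ s * γ₀ ^ (1 - s) = γ₀ := by
        rw [← Real.rpow_add hγ0]; simp
      have hp1 : 0 < γ₀ ^ s := Real.rpow_pos_of_pos hγ0 _
      have h4 : γ₀ ^ s * 1 ≤ γ₀ ^ s * (C * S * γ₀ ^ (1 - s)) := by
        calc γ₀ ^ s * 1 ≤ C * (γ₀ * S) := by rw [mul_one]; exact h2
          _ = C * S * (γ₀ ^ s * γ₀ ^ (1 - s)) := by rw [this]; ring
          _ = _ := by ring
      exact le_of_mul_le_mul_left h4 hp1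
    have h5 : 1 ≤ (C * S) ^ (p - 1) * γ₀ ^ κ := by
      calc 1 ≤ (C * S * γ₀ ^ (1 - s)) ^ (p - 1) := Real.one_le_rpow h3 (by linarith)
        _ = (C * S) ^ (p - 1) * γ₀ ^ ((1 - s) * (p - 1)) := by
            rw [Real.mul_rpow (by positivity) (by positivity), ← Real.rpow_mul hγ0.le]
        _ ≤ _ := mul_le_mul_of_nonneg_left
            (Real.rpow_le_rpow_of_exponent_ge hγ0 hγ1 (by linarith)) (by positivity)
    have h6 : C * S ≤ C ^ p * γ₀ ^ κ * S ^ p := by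
      calc C * S = C * S * 1 := by ring
        _ ≤ C * S * ((C * S) ^ (p - 1) * γ₀ ^ κ) :=
            mul_le_mul_of_nonneg_left h5 (by positivity)
        _ = (C * S) ^ p * γ₀ ^ κ := by
            rw [Real.rpow_sub_one (by positivity)]
            field_simp
        _ = _ := by rw [Real.mul_rpow hC0.le hS0.le]; ring
    have h7 := abs_sub (g θ x) (g θ₀ x)
    have h8 := hg.bound θ h1 x
    have h9 := hg.bound θ₀ h0 x
    have h10 : C * W x ≤ C * S := mul_le_mul_of_nonneg_left hxS hC0.le
    have := hφ0 x
    linarith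

/-- Bookkeeping for the next estimate: `G` stands for `γ ^ κ`, `R` for the geometric term, `L` for
the power of the lag and `B` for the moment bound. All powers of `C` that occur are at most `C ^ (p
+ 3)`. -/
theorem noise_bound_le {C p κ G R L B : ℝ} (hC1 : 1 ≤ C) (hκ : 0 < κ) (hκp : 1 + κ ≤ p) (hG0 : 0 ≤ G)
    (hRB : 0 ≤ R * B) (hLB : 1 ≤ L * B) :
    (2 * C * (C ^ 2 * C ^ κ * (G * (L * B)) + C * (R * B)) + 2 * C * G +
      2 * C ^ p * G * (L * B) + C * (C ^ κ * G * (L * B))) +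
      C * (C ^ 2 * C ^ κ * (G * (L * B)) + C * (R * B)) ≤
    8 * C ^ (p + 3) * B * (R + G * L) := by
  have hC : 0 < C := by linarith
  have hGLB : 0 ≤ G * (L * B) := mul_nonneg hG0 (by linarith)
  have hΛe : ∀ q : ℝ, q ≤ p + 3 → C ^ q ≤ C ^ (p + 3) := fun q hq =>
    Real.rpow_le_rpow_of_exponent_le hC1 hq
  have k1 : C * (C ^ 2 * C ^ κ) ≤ C ^ (p + 3) := by
    have : C * (C ^ 2 * C ^ κ) = C ^ (κ + 3) := by
      rw [Real.rpow_add hC]; norm_cast; ring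
    rw [this]
    exact hΛe _ (by linarith)
  have k2 : C ≤ C ^ (p + 3) := by simpa using hΛe 1 (by linarith)
  have k3 : C ^ p ≤ C ^ (p + 3) := hΛe p (by linarith)
  have k4 : C * C ^ κ ≤ C ^ (p + 3) := by
    have : C * C ^ κ = C ^ (κ + 1) := by rw [Real.rpow_add_one hC.ne']; ring
    rw [this]
    exact hΛe _ (by linarith)
  have k5 : C * C ≤ C ^ (p + 3) := by
    have := hΛe 2 (by linarith)
    rw [Real.rpow_two] at this
    nlinarith
  have hGle : G ≤ G * (L * B) := le_mul_of_one_le_right hG0 hLB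
  have m1 := mul_le_mul_of_nonneg_right k1 hGLB
  have m2 : C * G ≤ C ^ (p + 3) * (G * (L * B)) := mul_le_mul k2 hGle hG0 (by linarith)
  have m3 := mul_le_mul_of_nonneg_right k3 hGLB
  have m4 := mul_le_mul_of_nonneg_right k4 hGLB
  have m5 := mul_le_mul_of_nonneg_right k5 hRB
  have m6 : 0 ≤ C ^ (p + 3) * (R * B) := mul_nonneg (by linarith) hRB
  have e : 8 * C ^ (p + 3) * B * (R + G * L) =
      8 * (C ^ (p + 3) * (R * B)) + 8 * (C ^ (p + 3) * (G * (L * B))) := by ring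
  rw [e]
  linarith

/-- Conditionally on the past, the noise at a lag `l` is small on average. -/
theorem abs_integral_noise_le (hD : IsDriven P W γ 𝒦 C move Q)
    (hB : LocalBounds P π W 𝒦 p κ C r) {g : E d → X → ℝ} (hg : LocalField π W 𝒦 α C g)
    (h𝒦 : MeasurableSet 𝒦) (ht : t.2.1 ∈ 𝒦)
    (hγ : ∀ n, 0 ≤ γ n) (hγa : Antitone γ) (hp : 1 < p) (hκ : 0 < κ) (hκp : 1 + κ ≤ p)
    {gbar : E d → ℝ} (hgm : Measurable gbar) (hgb : ∀ θ ∈ 𝒦, gbar θ = ∫ x, g θ x ∂(π θ))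
    (hmean : ∀ θ ∈ 𝒦, ∀ θ' ∈ 𝒦, |gbar θ - gbar θ'| ≤ C * ‖θ - θ'‖ ^ κ)
    {s : ℝ} (hsα : κ ≤ s * α) (hsp : κ ≤ (p - 1) * (1 - s))
    (hγ0 : 0 < γ t.2.2) (hγ1 : γ t.2.2 ≤ 1) (l : ℕ) :
    |∫ ω, noise g gbar (ω l, ω (l + 1)) ∂(chainLaw Q hQ t)| ≤
      8 * C ^ (p + 3) * ((1 + C / (1 - r)) * W t.1 ^ p) *
        (r ^ l + γ t.2.2 ^ κ * ((l : ℝ) + 2) ^ (p + 1)) := by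
  set μ := chainLaw Q hQ t with hμ
  set γ₀ := γ t.2.2 with hγ₀
  set θ₀ := t.2.1 with hθ₀
  set B : ℝ := (1 + C / (1 - r)) * W t.1 ^ p with hBdef
  set L : ℝ := ((l : ℝ) + 2) ^ (p + 1) with hL
  have hC1 := hB.one_le_C
  have hC := hB.C_pos
  have hr := hB.r_mem
  have hr1 : 0 < 1 - r := by linarith [hr.2]
  have hWB : W t.1 ≤ B := by
    have h1 : W t.1 ≤ W t.1 ^ p := Real.self_le_rpow_of_one_le (hB.one_le_W _) hp.le
    have h2 : W t.1 ^ p ≤ B := by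
      refine le_mul_of_one_le_left (Real.rpow_nonneg (hB.W_pos _).le _) ?_
      have : 0 < C / (1 - r) := by positivity
      linarith
    linarith
  have hB1 : 1 ≤ B := (hB.one_le_W _).trans hWB
  have hL1 : 1 ≤ L := Real.one_le_rpow (by linarith [(Nat.cast_nonneg l : (0 : ℝ) ≤ l)]) (by linarith)
  -- The oscillation scale `γ₀ ^ s` is much larger than a typical displacement, yet small enough
  -- that the mean oscillation is of order `γ₀ ^ κ`.
  obtain ⟨φ, hφm, hφ0, hφW, hφ, hφi⟩ := hg.exists_majorant hB ht (Real.rpow_pos_of_pos hγ0 s)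
  have hgθm := hg.measurable_section θ₀
  have hWi := hD.integrable_W hB h𝒦 ht hp (l + 1)
  have hS := hD.integrable_pathSum_pow hB h𝒦 ht hp (l + 1)
  have hS' := hD.integrable_pathSum_pow hB h𝒦 ht hp l
  have hobs : Measurable fun ω : ℕ → X × E d × ℕ => (ω (l + 1)).1 := (measurable_pi_apply _).fst
  have ig : Integrable (fun ω : ℕ → X × E d × ℕ => g θ₀ (ω (l + 1)).1) μ :=
    (hWi.const_mul C).mono' (hgθm.comp hobs).aestronglyMeasurable
      (ae_of_all _ fun ω => hg.bound θ₀ ht _)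
  have iφ : Integrable (fun ω : ℕ → X × E d × ℕ => φ (ω (l + 1)).1) μ :=
    (hWi.const_mul (2 * C)).mono' (hφm.comp hobs).aestronglyMeasurable
      (ae_of_all _ fun ω => by rw [Real.norm_eq_abs, abs_of_nonneg (hφ0 _)]; exact hφW _)
  have inoise := hD.integrable_noise hB hg h𝒦 ht hp hgm hgb l
  -- Both `g θ₀` and the majorant are averaged against `π θ₀`. The lag is `l + 1` because the noise
  -- at step `l` reads the observation at time `l + 1`.
  have b1 := hD.abs_integral_sub_invariant_le hB h𝒦 ht hγ hγa hp hκ hκp hgθm hC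
    (hg.bound θ₀ ht) (l + 1)
  have b2 := hD.abs_integral_sub_invariant_le hB h𝒦 ht hγ hγa hp hκ hκp hφm (c := 2 * C)
    (by positivity) (fun x => by rw [abs_of_nonneg (hφ0 x)]; exact hφW x) (l + 1)
  -- Freezing the parameter at `θ₀` in both `g` and `gbar` costs the oscillation of `g` and the
  -- Hölder variation of its mean.
  have key : |(∫ ω, noise g gbar (ω l, ω (l + 1)) ∂μ) -
      ((∫ ω, g θ₀ (ω (l + 1)).1 ∂μ) - gbar θ₀)| ≤
      (∫ ω, φ (ω (l + 1)).1 ∂μ) + 2 * C ^ p * γ₀ ^ κ * ∫ ω, pathSum W (l + 1) ω ^ p ∂μ +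
        C * ((C * γ₀) ^ κ * ∫ ω, pathSum W l ω ^ p ∂μ) := by
    have e1 : (∫ ω, g θ₀ (ω (l + 1)).1 ∂μ) - gbar θ₀ =
        ∫ ω, (g θ₀ (ω (l + 1)).1 - gbar θ₀) ∂μ := by
      rw [integral_sub ig (integrable_const _)]; simp
    have i1 : Integrable (fun ω => φ (ω (l + 1)).1 +
        2 * C ^ p * γ₀ ^ κ * pathSum W (l + 1) ω ^ p) μ := iφ.add (hS.1.const_mul _)
    have i2 : Integrable (fun ω => C * ((C * γ₀) ^ κ * pathSum W l ω ^ p)) μ :=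
      (hS'.1.const_mul ((C * γ₀) ^ κ)).const_mul C
    have i3 : Integrable (fun ω : ℕ → X × E d × ℕ => g θ₀ (ω (l + 1)).1 - gbar θ₀) μ :=
      ig.sub (integrable_const _)
    rw [e1, ← integral_sub inoise i3, ← integral_const_mul,
      ← integral_const_mul, ← integral_const_mul, ← integral_add iφ (hS.1.const_mul _),
      ← integral_add i1 i2, ← Real.norm_eq_abs]
    refine norm_integral_le_of_norm_le (i1.add i2) ?_
    filter_upwards [hD.ae_path hB.measurable_W h𝒦 ht, hD.ae_norm_sub_le hB h𝒦 ht hγ hγa,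
      hD.ae_rpow_mul_le hB h𝒦 ht hγ hγa hκ hκp] with ω h1 h2 h3
    have hlS : pathSum W l ω ≤ pathSum W (l + 1) ω := by
      have : pathSum W (l + 1) ω = pathSum W l ω + W (ω (l + 1)).1 := Finset.sum_range_succ _ _
      rw [this]
      linarith [hB.W_pos (ω (l + 1)).1]
    have h4 := abs_noise_sub_le hB hg hp hφ0 hsp hγ0 hγ1 ht (h1.2.2 l).1 hφ
      (one_le_pathSum hB.one_le_W (l + 1) ω) (le_pathSum hB.one_le_W le_rfl ω)
      ((h2 l).trans (mul_le_mul_of_nonneg_left (mul_le_mul_of_nonneg_left hlS hγ0.le) hC.le))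
    have h5 : |gbar θ₀ - gbar (ω l).2.1| ≤ C * ((C * γ₀) ^ κ * pathSum W l ω ^ p) := by
      rw [abs_sub_comm]
      refine (hmean _ (h1.2.2 l).1 _ ht).trans (mul_le_mul_of_nonneg_left ?_ hC.le)
      exact (le_mul_of_one_le_right (by positivity) (hB.one_le_W _)).trans (h3 l)
    have e : noise g gbar (ω l, ω (l + 1)) - (g θ₀ (ω (l + 1)).1 - gbar θ₀) =
        (g (ω l).2.1 (ω (l + 1)).1 - g θ₀ (ω (l + 1)).1) + (gbar θ₀ - gbar (ω l).2.1) := by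
      unfold noise; ring
    rw [e, Real.norm_eq_abs]
    exact (abs_add_le _ _).trans (add_le_add h4 h5)
  have hcγ : (C * γ₀) ^ κ = C ^ κ * γ₀ ^ κ := Real.mul_rpow hC.le hγ0.le
  set G := γ₀ ^ κ with hG
  have hG0 : 0 ≤ G := by positivity
  set R := r ^ l with hR
  have hR0 : 0 ≤ R := pow_nonneg hr.1.le l
  have hl1 : ((l + 1 : ℕ) : ℝ) ^ (p + 1) ≤ L := by
    refine Real.rpow_le_rpow (by positivity) (by push_cast; linarith) (by linarith)
  have hl2 : ∀ x : ℝ, 1 ≤ x → x ≤ (l : ℝ) + 2 → x ^ p ≤ L := fun x hx hx2 =>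
    (Real.rpow_le_rpow (by linarith) hx2 (by linarith)).trans
      (Real.rpow_le_rpow_of_exponent_le (by linarith) (by linarith))
  have hE : C ^ 2 * (C * γ₀) ^ κ * (((l + 1 : ℕ) : ℝ) ^ (p + 1) * B) + C * r ^ (l + 1) * W t.1 ≤
      C ^ 2 * C ^ κ * (G * (L * B)) + C * (R * B) := by
    rw [hcγ]
    refine add_le_add ?_ ?_
    · calc C ^ 2 * (C ^ κ * G) * (((l + 1 : ℕ) : ℝ) ^ (p + 1) * B)
          ≤ C ^ 2 * (C ^ κ * G) * (L * B) := by gcongr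
        _ = _ := by ring
    · rw [mul_assoc]
      refine mul_le_mul_of_nonneg_left (mul_le_mul ?_ hWB (hB.W_pos _).le hR0) hC.le
      exact pow_le_pow_of_le_one hr.1.le hr.2.le (Nat.le_succ l)
  -- Here `κ ≤ s α` makes the mean oscillation at scale `γ₀ ^ s` at most of order `γ₀ ^ κ`.
  have hδ : (γ₀ ^ s) ^ α ≤ G := by
    rw [← Real.rpow_mul hγ0.le]
    exact Real.rpow_le_rpow_of_exponent_ge hγ0 hγ1 hsα
  have hSl1 : ∫ ω, pathSum W (l + 1) ω ^ p ∂μ ≤ L * B := by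
    refine hS.2.trans (mul_le_mul_of_nonneg_right (hl2 _ ?_ ?_) (by linarith))
    · push_cast; linarith [(Nat.cast_nonneg l : (0 : ℝ) ≤ l)]
    · push_cast; linarith
  have hSl : ∫ ω, pathSum W l ω ^ p ∂μ ≤ L * B := by
    refine hS'.2.trans (mul_le_mul_of_nonneg_right (hl2 _ ?_ ?_) (by linarith))
    · linarith [(Nat.cast_nonneg l : (0 : ℝ) ≤ l)]
    · linarith
  have hfin : |∫ ω, noise g gbar (ω l, ω (l + 1)) ∂μ| ≤
      (2 * C * (C ^ 2 * C ^ κ * (G * (L * B)) + C * (R * B)) + 2 * C * G +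
        2 * C ^ p * G * (L * B) + C * (C ^ κ * G * (L * B))) +
        C * (C ^ 2 * C ^ κ * (G * (L * B)) + C * (R * B)) := by
    have h1 := abs_le.1 key
    have h2 := abs_le.1 (b1.trans (mul_le_mul_of_nonneg_left hE hC.le))
    have h3 := (abs_le.1 (b2.trans (mul_le_mul_of_nonneg_left hE (by positivity)))).2
    have h4 : ∫ x, φ x ∂(π t.2.1) ≤ 2 * C * G :=
      hφi.trans (mul_le_mul_of_nonneg_left hδ (by positivity))
    have h5 : 2 * C ^ p * G * ∫ ω, pathSum W (l + 1) ω ^ p ∂μ ≤ 2 * C ^ p * G * (L * B) :=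
      mul_le_mul_of_nonneg_left hSl1 (by positivity)
    have h6 : C * ((C * γ₀) ^ κ * ∫ ω, pathSum W l ω ^ p ∂μ) ≤ C * (C ^ κ * G * (L * B)) := by
      rw [hcγ]
      exact mul_le_mul_of_nonneg_left (mul_le_mul_of_nonneg_left hSl (by positivity)) hC.le
    rw [← hgb θ₀ ht] at h2
    rw [abs_le]
    constructor <;> linarith [h1.1, h1.2, h2.1, h2.2]
  refine hfin.trans (noise_bound_le hC1 hκ hκp hG0 ?_ ?_)
  · exact mul_nonneg (pow_nonneg hr.1.le l) (by linarith)
  · exact one_le_mul_of_one_le_of_one_le hL1 hB1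

end IsDriven

end Driven

/-! ### Maximal inequality for the weighted noise of a driven chain -/

/-- The rate in the maximal inequality for the noise started at time `N`, with lags `lag n`. -/
def noiseRate (γ : ℕ → ℝ) (lag : ℕ → ℕ) (r κ p δ : ℝ) (N : ℕ) : ℝ≥0∞ :=
  ENNReal.ofReal (32 / δ ^ 2) *
      ∑' k, ENNReal.ofReal (((lag (N + k) : ℝ) + 2) ^ 5 * γ (N + k) ^ (1 + κ)) +
    ENNReal.ofReal (2 / δ) *
      ∑' k, ENNReal.ofReal (γ (N + k) * (r ^ k + r ^ lag (N + k) +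
        γ (N + k - lag (N + k)) ^ κ * ((lag (N + k) : ℝ) + 2) ^ (p + 1)))

section Driven

variable {d : ℕ} {X : Type*} [MeasurableSpace X]

/-- The weighted noise at step `k` of a chain started at time `N`. -/
def stepNoise (γ : ℕ → ℝ) (g : E d → X → ℝ) (gbar : E d → ℝ) (N k : ℕ)
    (ω : ℕ → X × E d × ℕ) : ℝ :=
  γ (N + k + 1) * IsDriven.noise g gbar (ω k, ω (k + 1))

namespace IsDriven

variable {P : Kernel (E d × X) X} [IsMarkovKernel P] {π : E d → Measure X} {W : X → ℝ}
  {γ : ℕ → ℝ} {𝒦 : Set (E d)} {p κ α C r : ℝ} {move : (X × E d × ℕ) × X → E d}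
  {Q : Kernel (X × E d × ℕ) (X × E d × ℕ)} [hQ : IsMarkovKernel Q] {t : X × E d × ℕ}

theorem measurable_stepNoise {g : E d → X → ℝ} (hg : Measurable (Function.uncurry g))
    {gbar : E d → ℝ} (hb : Measurable gbar) (N k : ℕ) :
    Measurable[natFil (X × E d × ℕ) (k + 1)] (stepNoise γ g gbar N k) :=
  (((measurable_noise hg hb).comp ((measurable_eval_natFil (Nat.le_succ k)).prodMk
    (measurable_eval_natFil (le_refl (k + 1)))))).const_mul _

/-- The quantity `2 C² W` that bounds the noise is at least one, so its power `1 + κ` may be raised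
to `p`, where the drift controls moments. -/
theorem lintegral_stepNoise_pow_le (hD : IsDriven P W γ 𝒦 C move Q)
    (hB : LocalBounds P π W 𝒦 p κ C r) {g : E d → X → ℝ} (hg : LocalField π W 𝒦 α C g)
    (h𝒦 : MeasurableSet 𝒦) (ht : t.2.1 ∈ 𝒦)
    (hγ : ∀ n, 0 < γ n) (hγa : Antitone γ) (hp : 1 < p) (hκ : 0 < κ) (hκp : 1 + κ ≤ p)
    {gbar : E d → ℝ} (hgb : ∀ θ ∈ 𝒦, gbar θ = ∫ x, g θ x ∂(π θ)) (k : ℕ) :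
    ∫⁻ ω, ENNReal.ofReal (|stepNoise γ g gbar t.2.2 k ω| ^ (1 + κ)) ∂(chainLaw Q hQ t) ≤
      ENNReal.ofReal (γ (t.2.2 + k) ^ (1 + κ) *
        ((2 * C ^ 2) ^ p * ((1 + C / (1 - r)) * W t.1 ^ p))) := by
  have hC := hB.one_le_C
  have hC0 := hB.C_pos
  have hγk := hγ (t.2.2 + k)
  have hWp : ∀ x, 0 ≤ W x ^ p := fun x => Real.rpow_nonneg (hB.W_pos x).le p
  calc ∫⁻ ω, ENNReal.ofReal (|stepNoise γ g gbar t.2.2 k ω| ^ (1 + κ)) ∂(chainLaw Q hQ t)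
      ≤ ∫⁻ ω, ENNReal.ofReal (γ (t.2.2 + k) ^ (1 + κ) * (2 * C ^ 2) ^ p) *
          ENNReal.ofReal (W (ω (k + 1)).1 ^ p) ∂(chainLaw Q hQ t) := by
        refine lintegral_mono_ae ?_
        filter_upwards [hD.ae_path hB.measurable_W h𝒦 ht] with ω hω
        rw [← ENNReal.ofReal_mul (by positivity)]
        refine ENNReal.ofReal_le_ofReal ?_
        have h1 := abs_noise_le hB hg hgb (q := (ω k, ω (k + 1))) (hω.2.2 k).1
        have h2 : |stepNoise γ g gbar t.2.2 k ω| ≤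
            γ (t.2.2 + k) * (2 * C ^ 2 * W (ω (k + 1)).1) := by
          unfold stepNoise
          rw [abs_mul, abs_of_pos (hγ _)]
          exact mul_le_mul (hγa (Nat.le_succ _)) h1 (abs_nonneg _) hγk.le
        have h3 : 1 ≤ 2 * C ^ 2 * W (ω (k + 1)).1 := by
          have := hB.one_le_W (ω (k + 1)).1
          nlinarith
        calc |stepNoise γ g gbar t.2.2 k ω| ^ (1 + κ)
            ≤ (γ (t.2.2 + k) * (2 * C ^ 2 * W (ω (k + 1)).1)) ^ (1 + κ) :=
              Real.rpow_le_rpow (abs_nonneg _) h2 (by linarith)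
          _ = γ (t.2.2 + k) ^ (1 + κ) * (2 * C ^ 2 * W (ω (k + 1)).1) ^ (1 + κ) :=
              Real.mul_rpow hγk.le (by linarith)
          _ ≤ γ (t.2.2 + k) ^ (1 + κ) * (2 * C ^ 2 * W (ω (k + 1)).1) ^ p :=
              mul_le_mul_of_nonneg_left (Real.rpow_le_rpow_of_exponent_le h3 hκp) (by positivity)
          _ = _ := by
              rw [Real.mul_rpow (by positivity) (hB.W_pos _).le]
              ring
    _ = ENNReal.ofReal (γ (t.2.2 + k) ^ (1 + κ) * (2 * C ^ 2) ^ p) *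
          ∫⁻ ω, ENNReal.ofReal (W (ω (k + 1)).1 ^ p) ∂(chainLaw Q hQ t) :=
        lintegral_const_mul _
          ((hB.measurable_W.comp (measurable_pi_apply (k + 1)).fst).pow_const p).ennreal_ofReal
    _ ≤ _ := by
        rw [← mul_assoc, ENNReal.ofReal_mul (p := _ * (2 * C ^ 2) ^ p) (by positivity)]
        gcongr
        exact hD.lintegral_W_pow_le hB h𝒦 ht hp (k + 1)

/-- Conditioning at time `m` restarts the driven chain at `ω m`, whose counter is the initial one
plus `m`. The estimate of the mean noise therefore involves the step size at that later time, and
the remaining `W ^ p` is integrated by the drift. -/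
theorem lintegral_condExp_stepNoise_le (hD : IsDriven P W γ 𝒦 C move Q)
    (hB : LocalBounds P π W 𝒦 p κ C r) {g : E d → X → ℝ} (hg : LocalField π W 𝒦 α C g)
    (h𝒦 : MeasurableSet 𝒦) (ht : t.2.1 ∈ 𝒦)
    (hγ : ∀ n, 0 < γ n) (hγa : Antitone γ) (hp : 1 < p) (hκ : 0 < κ) (hκp : 1 + κ ≤ p)
    {gbar : E d → ℝ} (hgm : Measurable gbar) (hgb : ∀ θ ∈ 𝒦, gbar θ = ∫ x, g θ x ∂(π θ))
    (hmean : ∀ θ ∈ 𝒦, ∀ θ' ∈ 𝒦, |gbar θ - gbar θ'| ≤ C * ‖θ - θ'‖ ^ κ)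
    {s : ℝ} (hsα : κ ≤ s * α) (hsp : κ ≤ (p - 1) * (1 - s))
    (hγ1 : γ t.2.2 ≤ 1) (m l : ℕ) :
    ∫⁻ ω, ‖((chainLaw Q hQ t)[stepNoise γ g gbar t.2.2 (m + l) |
        natFil (X × E d × ℕ) m]) ω‖ₑ ∂(chainLaw Q hQ t) ≤
      ENNReal.ofReal (γ (t.2.2 + (m + l)) *
        (r ^ l + γ (t.2.2 + m) ^ κ * ((l : ℝ) + 2) ^ (p + 1)) *
        (8 * C ^ (p + 3) * (1 + C / (1 - r)) * ((1 + C / (1 - r)) * W t.1 ^ p))) := by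
  have hC0 := hB.C_pos
  have hr := hB.r_mem
  have hr1 : 0 < 1 - r := by linarith [hr.2]
  have hr0 := hr.1
  have hγk := hγ (t.2.2 + (m + l))
  have hγm := hγ (t.2.2 + m)
  obtain ⟨F, hF⟩ : ∃ F : (ℕ → X × E d × ℕ) → ℝ,
      F = fun ω => γ (t.2.2 + (m + l) + 1) * noise g gbar (ω l, ω (l + 1)) := ⟨_, rfl⟩
  have hFm : Measurable F := by
    rw [hF]
    exact ((measurable_noise hg.measurable hgm).comp (by fun_prop)).const_mul _
  have hFe : (fun ω => F (fun k => ω (m + k))) = stepNoise γ g gbar t.2.2 (m + l) := by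
    rw [hF]; rfl
  have hFi : Integrable (fun ω => F (fun k => ω (m + k))) (chainLaw Q hQ t) := by
    rw [hFe]
    exact (hD.integrable_noise hB hg h𝒦 ht hp hgm hgb (m + l)).const_mul _
  have hcond := condExp_chainLaw_shift Q t m hFm hFi
  rw [hFe] at hcond
  set c : ℝ := γ (t.2.2 + (m + l)) *
    (r ^ l + γ (t.2.2 + m) ^ κ * ((l : ℝ) + 2) ^ (p + 1)) * (8 * C ^ (p + 3) * (1 + C / (1 - r)))
    with hc
  have hc0 : 0 ≤ c := by positivity
  calc _ ≤ ∫⁻ ω, ENNReal.ofReal c * ENNReal.ofReal (W (ω m).1 ^ p) ∂(chainLaw Q hQ t) := by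
        refine lintegral_mono_ae ?_
        filter_upwards [hcond, hD.ae_path hB.measurable_W h𝒦 ht] with ω h1 h2
        obtain ⟨h3, h4, -⟩ := h2.2.2 m
        have hγ1' : γ (ω m).2.2 ≤ 1 := by
          rw [h4]; exact (hγa (Nat.le_add_right _ _)).trans hγ1
        have h5 := hD.abs_integral_noise_le hB hg h𝒦 h3 (fun n => (hγ n).le) hγa hp hκ hκp hgm hgb
          hmean hsα hsp (hγ _) hγ1' l
        rw [h1, hF, integral_const_mul, Real.enorm_eq_ofReal_abs, abs_mul, abs_of_pos (hγ _),
          ← ENNReal.ofReal_mul hc0]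
        refine ENNReal.ofReal_le_ofReal ?_
        refine (mul_le_mul (hγa (Nat.le_succ (t.2.2 + (m + l)))) h5 (abs_nonneg _) hγk.le).trans
          (le_of_eq ?_)
        rw [h4, hc]
        ring
    _ = ENNReal.ofReal c * ∫⁻ ω, ENNReal.ofReal (W (ω m).1 ^ p) ∂(chainLaw Q hQ t) :=
        lintegral_const_mul _
          ((hB.measurable_W.comp (measurable_pi_apply m).fst).pow_const p).ennreal_ofReal
    _ ≤ _ := by
        rw [← mul_assoc (γ (t.2.2 + (m + l)) * _), ← hc, ENNReal.ofReal_mul hc0]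
        gcongr
        exact hD.lintegral_W_pow_le hB h𝒦 ht hp m

/-- Maximal inequality for the weighted noise. -/
theorem measure_exists_lt_abs_sum_stepNoise_le (hD : IsDriven P W γ 𝒦 C move Q)
    (hB : LocalBounds P π W 𝒦 p κ C r) {g : E d → X → ℝ} (hg : LocalField π W 𝒦 α C g)
    (h𝒦 : MeasurableSet 𝒦) (ht : t.2.1 ∈ 𝒦)
    (hγ : ∀ n, 0 < γ n) (hγa : Antitone γ) (hp : 1 < p) (hκ : 0 < κ) (hκ1 : κ ≤ 1)
    (hκp : 1 + κ ≤ p)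
    {gbar : E d → ℝ} (hgm : Measurable gbar) (hgb : ∀ θ ∈ 𝒦, gbar θ = ∫ x, g θ x ∂(π θ))
    (hmean : ∀ θ ∈ 𝒦, ∀ θ' ∈ 𝒦, |gbar θ - gbar θ'| ≤ C * ‖θ - θ'‖ ^ κ)
    {s : ℝ} (hsα : κ ≤ s * α) (hsp : κ ≤ (p - 1) * (1 - s))
    (hγ1 : γ t.2.2 ≤ 1) (lag : ℕ → ℕ) {δ : ℝ} (hδ : 0 < δ) (hδ1 : δ ≤ 1) :
    (chainLaw Q hQ t) {ω | ∃ n, δ < |∑ k ∈ Finset.range n, stepNoise γ g gbar t.2.2 k ω|} ≤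
      ENNReal.ofReal (((2 * C ^ 2) ^ p + 8 * C ^ (p + 3) * (1 + C / (1 - r))) *
        ((1 + C / (1 - r)) * W t.1 ^ p)) * noiseRate γ lag r κ p δ t.2.2 := by
  have hC0 := hB.C_pos
  have hr := hB.r_mem
  have hr0 := hr.1
  have hr1 : 0 < 1 - r := by linarith [hr.2]
  have hWp : 0 ≤ W t.1 ^ p := Real.rpow_nonneg (hB.W_pos _).le p
  set N := t.2.2 with hN
  set B : ℝ := (1 + C / (1 - r)) * W t.1 ^ p with hBdef
  have hB0 : 0 ≤ B := by positivity
  set K : ℝ := ((2 * C ^ 2) ^ p + 8 * C ^ (p + 3) * (1 + C / (1 - r))) with hK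
  have hK1 : (2 * C ^ 2) ^ p ≤ K := by
    have : 0 ≤ 8 * C ^ (p + 3) * (1 + C / (1 - r)) := by positivity
    linarith
  have hK2 : 8 * C ^ (p + 3) * (1 + C / (1 - r)) ≤ K := by
    have : 0 ≤ (2 * C ^ 2) ^ p := by positivity
    linarith
  have hK0 : 0 ≤ K := by positivity
  have h := measure_exists_lt_abs_sum_le (μ := chainLaw Q hQ t) (𝓕 := natFil (X × E d × ℕ))
    (q := 1 + κ) (by linarith) (by linarith) (Z := stepNoise γ g gbar N)
    (fun k => (measurable_stepNoise hg.measurable hgm N k).stronglyMeasurable)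
    (fun k => (hD.integrable_noise hB hg h𝒦 ht hp hgm hgb k).const_mul _)
    -- There is no past before the start of the chain, so the lag is cut at `k`.
    (L := fun k => min k (lag (N + k))) (fun k => min_le_left _ _) hδ hδ1
  refine h.trans ?_
  rw [noiseRate, mul_add, mul_left_comm (ENNReal.ofReal (K * B)) (ENNReal.ofReal (32 / δ ^ 2)),
    mul_left_comm (ENNReal.ofReal (K * B)) (ENNReal.ofReal (2 / δ))]
  refine add_le_add (mul_le_mul_right ?_ _) (mul_le_mul_right ?_ _) <;>
    rw [← ENNReal.tsum_mul_left] <;> refine ENNReal.tsum_le_tsum fun k => ?_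
  · have hγk := hγ (N + k)
    refine (mul_le_mul_right (hD.lintegral_stepNoise_pow_le hB hg h𝒦 ht hγ hγa hp hκ hκp hgb k)
      _).trans ?_
    rw [← ENNReal.ofReal_mul (by positivity), ← ENNReal.ofReal_mul (by positivity)]
    refine ENNReal.ofReal_le_ofReal ?_
    have hL : (((min k (lag (N + k)) : ℕ) : ℝ) + 2) ^ 5 ≤ ((lag (N + k) : ℝ) + 2) ^ 5 := by
      gcongr
      exact min_le_right _ _
    calc (((min k (lag (N + k)) : ℕ) : ℝ) + 2) ^ 5 * (γ (N + k) ^ (1 + κ) * ((2 * C ^ 2) ^ p * B))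
        ≤ ((lag (N + k) : ℝ) + 2) ^ 5 * (γ (N + k) ^ (1 + κ) * (K * B)) := by gcongr
      _ = _ := by ring
  · have hγk := hγ (N + k)
    set l := min k (lag (N + k)) with hl
    have hlk : l ≤ k := min_le_left _ _
    have hll : l ≤ lag (N + k) := min_le_right _ _
    have h1 := hD.lintegral_condExp_stepNoise_le hB hg h𝒦 ht hγ hγa hp hκ hκp hgm hgb hmean hsα
      hsp hγ1 (k - l) l
    rw [Nat.sub_add_cancel hlk] at h1
    refine h1.trans ?_
    rw [← ENNReal.ofReal_mul (by positivity)]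
    refine ENNReal.ofReal_le_ofReal ?_
    -- The cut is the origin of the term `r ^ k` in `noiseRate`: one of the two powers is `r ^ l`
    -- itself.
    have e1 : r ^ l ≤ r ^ k + r ^ lag (N + k) := by
      rcases le_total k (lag (N + k)) with h | h
      · rw [hl, min_eq_left h]
        have : 0 ≤ r ^ lag (N + k) := by positivity
        linarith
      · rw [hl, min_eq_right h]
        have : 0 ≤ r ^ k := by positivity
        linarith
    have e2 : γ (N + (k - l)) ^ κ ≤ γ (N + k - lag (N + k)) ^ κ :=
      Real.rpow_le_rpow (hγ _).le (hγa (by omega)) hκ.le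
    have hγ2 := hγ (N + (k - l))
    have e3 : ((l : ℝ) + 2) ^ (p + 1) ≤ ((lag (N + k) : ℝ) + 2) ^ (p + 1) := by
      refine Real.rpow_le_rpow (by positivity) ?_ (by linarith)
      have : (l : ℝ) ≤ lag (N + k) := by exact_mod_cast hll
      linarith
    have hγ3 := hγ (N + k - lag (N + k))
    calc γ (N + k) * (r ^ l + γ (N + (k - l)) ^ κ * ((l : ℝ) + 2) ^ (p + 1)) *
          (8 * C ^ (p + 3) * (1 + C / (1 - r)) * B)
        ≤ γ (N + k) * ((r ^ k + r ^ lag (N + k)) + γ (N + k - lag (N + k)) ^ κ *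
            ((lag (N + k) : ℝ) + 2) ^ (p + 1)) * (K * B) := by gcongr
      _ = _ := by ring

end IsDriven

end Driven

/-! ### Polynomial step sizes and logarithmic lags -/

section StepSizes

variable {γ₀ β : ℝ}

theorem polyStep_pos (hγ₀ : 0 < γ₀) (n : ℕ) : 0 < polyStep γ₀ β n := by
  unfold polyStep
  positivity

theorem antitone_polyStep (hγ₀ : 0 < γ₀) (hβ : 0 < β) : Antitone (polyStep γ₀ β) := by
  intro m n h
  unfold polyStep
  have : (m : ℝ) ≤ n := by exact_mod_cast h
  gcongr

theorem polyStep_eq (n : ℕ) : polyStep γ₀ β n = γ₀ * ((n : ℝ) + 1) ^ (-β) := by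
  rw [polyStep, Real.rpow_neg (by positivity), div_eq_mul_inv]

theorem tendsto_polyStep (hβ : 0 < β) : Tendsto (polyStep γ₀ β) atTop (𝓝 0) := by
  have h : Tendsto (fun n : ℕ => (n : ℝ) + 1) atTop atTop :=
    tendsto_atTop_add_const_right _ _ tendsto_natCast_atTop_atTop
  have := ((tendsto_rpow_neg_atTop hβ).comp h).const_mul γ₀
  rw [mul_zero] at this
  exact this.congr fun n => (polyStep_eq n).symm

theorem summable_nat_add_one_rpow {s : ℝ} (hs : s < -1) :
    Summable fun n : ℕ => ((n : ℝ) + 1) ^ s := by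
  have h := (summable_nat_add_iff 1).2 (Real.summable_nat_rpow.2 hs)
  exact_mod_cast h

theorem tendsto_tsum_ofReal_add {a : ℕ → ℝ} (ha : Summable a) :
    Tendsto (fun N => ∑' k, ENNReal.ofReal (a (N + k))) atTop (𝓝 0) := by
  have h := ENNReal.tendsto_sum_nat_add (fun n => ENNReal.ofReal (a n)) ha.tsum_ofReal_ne_top
  simpa only [add_comm] using h

/-- Sufficient conditions for the rate of the maximal inequality to vanish. -/
theorem tendsto_noiseRate {γ : ℕ → ℝ} (hγ : ∀ n, 0 ≤ γ n) (hγa : Antitone γ)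
    (hγ0 : Tendsto γ atTop (𝓝 0)) {lag : ℕ → ℕ} {r κ p δ : ℝ} (hr : r ∈ Ioo (0 : ℝ) 1)
    (h1 : Summable fun n => ((lag n : ℝ) + 2) ^ 5 * γ n ^ (1 + κ))
    (h2 : Summable fun n => γ n * (r ^ lag n + γ (n - lag n) ^ κ * ((lag n : ℝ) + 2) ^ (p + 1))) :
    Tendsto (noiseRate γ lag r κ p δ) atTop (𝓝 0) := by
  have l1 := ENNReal.Tendsto.const_mul (a := ENNReal.ofReal (32 / δ ^ 2))
    (tendsto_tsum_ofReal_add h1) (Or.inr ENNReal.ofReal_ne_top)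
  have l2 := tendsto_tsum_ofReal_add h2
  have l3 : Tendsto (fun N => ENNReal.ofReal (γ N * ∑' k : ℕ, r ^ k)) atTop (𝓝 0) := by
    have := ENNReal.tendsto_ofReal (hγ0.mul_const (∑' k : ℕ, r ^ k))
    simpa using this
  have l4 := ENNReal.Tendsto.const_mul (a := ENNReal.ofReal (2 / δ)) (l3.add l2)
    (Or.inr ENNReal.ofReal_ne_top)
  have l5 := l1.add l4
  simp only [add_zero, mul_zero] at l5
  refine tendsto_of_tendsto_of_tendsto_of_le_of_le tendsto_const_nhds l5 (fun _ => zero_le)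
    fun N => ?_
  have hgeo := summable_geometric_of_lt_one hr.1.le hr.2
  -- The part with `r ^ k` does not become small through the tail of a series but through its
  -- prefactor `γ N`.
  unfold noiseRate
  refine add_le_add le_rfl (mul_le_mul_right ?_ _)
  rw [← tsum_mul_left, ENNReal.ofReal_tsum_of_nonneg
    (fun k => mul_nonneg (hγ N) (pow_nonneg hr.1.le k)) (hgeo.mul_left _), ← ENNReal.tsum_add]
  refine ENNReal.tsum_le_tsum fun k => ?_
  refine le_trans (ENNReal.ofReal_le_ofReal ?_) ENNReal.ofReal_add_le
  have h3 := mul_le_mul_of_nonneg_right (hγa (Nat.le_add_right N k)) (pow_nonneg hr.1.le k)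
  nlinarith

/-- A power of a logarithm is negligible against any power: the logarithm is compared with exponent
`ε / q`, and the result is raised to the power `q`. -/
theorem log_lag_le {c : ℝ} (hc : 0 < c) {q ε : ℝ} (hq : 0 < q) (hε : 0 < ε) :
    ∃ A : ℝ, 0 ≤ A ∧ ∀ n : ℕ, ((⌈c * Real.log ((n : ℝ) + 1)⌉₊ : ℝ) + 2) ^ q ≤
      A * ((n : ℝ) + 1) ^ ε := by
  have hη : 0 < ε / q := by positivity
  refine ⟨(c / (ε / q) + 3) ^ q, by positivity, fun n => ?_⟩
  have hn : (1 : ℝ) ≤ (n : ℝ) + 1 := by linarith [(Nat.cast_nonneg n : (0 : ℝ) ≤ n)]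
  have hl0 : 0 ≤ Real.log ((n : ℝ) + 1) := Real.log_nonneg hn
  have h1 := (Nat.ceil_lt_add_one (mul_nonneg hc.le hl0)).le
  have h2 := Real.log_le_rpow_div (zero_le_one.trans hn) hη
  have h3 : (1 : ℝ) ≤ ((n : ℝ) + 1) ^ (ε / q) := Real.one_le_rpow hn hη.le
  have h4 : (⌈c * Real.log ((n : ℝ) + 1)⌉₊ : ℝ) + 2 ≤
      (c / (ε / q) + 3) * ((n : ℝ) + 1) ^ (ε / q) := by
    have h5 : c * Real.log ((n : ℝ) + 1) ≤ c * (((n : ℝ) + 1) ^ (ε / q) / (ε / q)) :=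
      mul_le_mul_of_nonneg_left h2 hc.le
    have e : (c / (ε / q) + 3) * ((n : ℝ) + 1) ^ (ε / q) =
        c * (((n : ℝ) + 1) ^ (ε / q) / (ε / q)) + 3 * ((n : ℝ) + 1) ^ (ε / q) := by ring
    rw [e]
    linarith
  refine (Real.rpow_le_rpow (by positivity) h4 hq.le).trans (le_of_eq ?_)
  rw [Real.mul_rpow (by positivity) (by positivity), ← Real.rpow_mul (by positivity),
    div_mul_cancel₀ _ hq.ne']

/-- The coefficient `1 / (-log r)` is chosen so that `r` to the lag is at most `1 / (n + 1)`,
summable against step sizes of order `n ^ (-β)`. -/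
theorem pow_log_lag_le {r : ℝ} (hr : r ∈ Ioo (0 : ℝ) 1) (n : ℕ) :
    r ^ ⌈(-Real.log r)⁻¹ * Real.log ((n : ℝ) + 1)⌉₊ ≤ ((n : ℝ) + 1) ^ (-1 : ℝ) := by
  have hl : Real.log r < 0 := Real.log_neg hr.1 hr.2
  rw [← Real.rpow_natCast]
  refine (Real.rpow_le_rpow_of_exponent_ge hr.1 hr.2.le (Nat.le_ceil _)).trans (le_of_eq ?_)
  rw [Real.rpow_def_of_pos hr.1, Real.rpow_def_of_pos (by positivity)]
  congr 1
  have := hl.ne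
  field_simp

/-- Logarithmic lags make the rate of the maximal inequality vanish. -/
theorem exists_lag (hγ₀ : 0 < γ₀) (hβ0 : 0 < β) {r κ p : ℝ} (hr : r ∈ Ioo (0 : ℝ) 1)
    (hκ : 0 < κ) (hp : 0 < p) (hβκ : 1 < β * (1 + κ)) :
    ∃ lag : ℕ → ℕ, ∀ δ : ℝ, Tendsto (noiseRate (polyStep γ₀ β) lag r κ p δ) atTop (𝓝 0) := by
  have hlr : Real.log r < 0 := Real.log_neg hr.1 hr.2
  obtain ⟨L, hL⟩ : ∃ L : ℕ → ℕ, L = fun n : ℕ => ⌈(-Real.log r)⁻¹ * Real.log ((n : ℝ) + 1)⌉₊ :=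
    ⟨_, rfl⟩
  have hc : 0 < (-Real.log r)⁻¹ := inv_pos.2 (neg_pos.2 hlr)
  -- Half of the margin in `β (1 + κ) > 1` is spent on the powers of the lag.
  set ε : ℝ := (β * (1 + κ) - 1) / 2 with hε
  have hε0 : 0 < ε := by rw [hε]; linarith
  obtain ⟨A, hA0, hA⟩ := log_lag_le hc (q := 5) (ε := ε) (by norm_num) hε0
  obtain ⟨A', hA'0, hA'⟩ := log_lag_le hc (q := p + 1) (ε := ε) (by linarith) hε0
  have hγp := polyStep_pos (β := β) hγ₀
  have hγpow : ∀ (n : ℕ) (q : ℝ), polyStep γ₀ β n ^ q = γ₀ ^ q * ((n : ℝ) + 1) ^ (-(β * q)) := by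
    intro n q
    rw [polyStep_eq, Real.mul_rpow hγ₀.le (by positivity), ← Real.rpow_mul (by positivity)]
    ring_nf
  -- The lag is capped at `n / 2` so that the step size at `n - lag n` stays comparable to the one
  -- at `n`.
  have hLm : ∀ n, min (L n) (n / 2) ≤ L n := fun n => min_le_left _ _
  have hLmr : ∀ n, ((min (L n) (n / 2) : ℕ) : ℝ) ≤ L n := fun n => by exact_mod_cast hLm n
  refine ⟨fun n => min (L n) (n / 2), fun δ => tendsto_noiseRate (fun n => (hγp n).le)
    (antitone_polyStep hγ₀ hβ0) (tendsto_polyStep hβ0) hr ?_ ?_⟩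
  · refine Summable.of_nonneg_of_le (f := fun n : ℕ => A * γ₀ ^ (1 + κ) *
      ((n : ℝ) + 1) ^ (ε - β * (1 + κ))) (fun n => ?_) (fun n => ?_) ?_
    · exact mul_nonneg (by positivity) (Real.rpow_nonneg (hγp n).le _)
    · have h1 : (((min (L n) (n / 2) : ℕ) : ℝ) + 2) ^ 5 ≤ A * ((n : ℝ) + 1) ^ ε := by
        have h2 := hA n
        have e : (5 : ℝ) = ((5 : ℕ) : ℝ) := by norm_num
        rw [e, Real.rpow_natCast] at h2
        refine le_trans ?_ h2
        have := hLmr n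
        rw [hL] at this
        rw [hL]
        gcongr
      rw [hγpow]
      calc (((min (L n) (n / 2) : ℕ) : ℝ) + 2) ^ 5 *
            (γ₀ ^ (1 + κ) * ((n : ℝ) + 1) ^ (-(β * (1 + κ))))
          ≤ A * ((n : ℝ) + 1) ^ ε * (γ₀ ^ (1 + κ) * ((n : ℝ) + 1) ^ (-(β * (1 + κ)))) := by gcongr
        _ = A * γ₀ ^ (1 + κ) * (((n : ℝ) + 1) ^ ε * ((n : ℝ) + 1) ^ (-(β * (1 + κ)))) := by ring
        _ = _ := by rw [← Real.rpow_add (by positivity)]; ring_nf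
    · exact (summable_nat_add_one_rpow (by rw [hε]; linarith)).mul_left _
  · have hs0 : 0 < Real.sqrt r := Real.sqrt_pos.2 hr.1
    have hs1 : Real.sqrt r < 1 := by
      rw [Real.sqrt_lt' one_pos, one_pow]; exact hr.2
    refine Summable.of_nonneg_of_le (f := fun n : ℕ => γ₀ * ((n : ℝ) + 1) ^ (-β + -1) +
      γ₀ * r⁻¹ * Real.sqrt r ^ n + (γ₀ * γ₀ ^ κ * 2 ^ (β * κ) * A') *
        ((n : ℝ) + 1) ^ (ε - β * (1 + κ))) (fun n => ?_) (fun n => ?_) ?_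
    · have := hγp n
      have := hγp (n - min (L n) (n / 2))
      have := hr.1
      positivity
    · have e1 : r ^ min (L n) (n / 2) ≤ ((n : ℝ) + 1) ^ (-1 : ℝ) + r⁻¹ * Real.sqrt r ^ n := by
        have h1 : r ^ L n ≤ ((n : ℝ) + 1) ^ (-1 : ℝ) := by rw [hL]; exact pow_log_lag_le hr n
        have h2 : r ^ (n / 2) ≤ r⁻¹ * Real.sqrt r ^ n := by
          rw [le_inv_mul_iff₀ hr.1]
          calc r * r ^ (n / 2) ≤ Real.sqrt r * r ^ (n / 2) := by
                refine mul_le_mul_of_nonneg_right ?_ (pow_nonneg hr.1.le _)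
                nlinarith [Real.mul_self_sqrt hr.1.le]
            _ = Real.sqrt r ^ (2 * (n / 2) + 1) := by
                rw [pow_succ, pow_mul, Real.sq_sqrt hr.1.le]; ring
            _ ≤ Real.sqrt r ^ n := pow_le_pow_of_le_one hs0.le hs1.le (by omega)
        have h3 : 0 ≤ ((n : ℝ) + 1) ^ (-1 : ℝ) := by positivity
        have h4 : 0 ≤ r⁻¹ * Real.sqrt r ^ n := by have := hr.1; positivity
        rcases le_total (L n) (n / 2) with h | h
        · rw [min_eq_left h]; linarith
        · rw [min_eq_right h]; linarith
      have e2 : polyStep γ₀ β (n - min (L n) (n / 2)) ^ κ ≤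
          γ₀ ^ κ * 2 ^ (β * κ) * ((n : ℝ) + 1) ^ (-(β * κ)) := by
        rw [hγpow, mul_assoc]
        refine mul_le_mul_of_nonneg_left ?_ (by positivity)
        have h1 : ((n : ℝ) + 1) / 2 ≤ ((n - min (L n) (n / 2) : ℕ) : ℝ) + 1 := by
          have h2 : n ≤ 2 * (n - min (L n) (n / 2)) := by
            have : min (L n) (n / 2) ≤ n / 2 := min_le_right _ _
            omega
          have h3 : (n : ℝ) ≤ 2 * ((n - min (L n) (n / 2) : ℕ) : ℝ) := by exact_mod_cast h2
          linarith
        refine (Real.rpow_le_rpow_of_nonpos (by positivity) h1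
          (neg_nonpos.2 (by positivity))).trans (le_of_eq ?_)
        rw [Real.div_rpow (by positivity) (by norm_num), Real.rpow_neg (by norm_num : (0:ℝ) ≤ 2),
          div_inv_eq_mul, mul_comm]
      have e3 : (((min (L n) (n / 2) : ℕ) : ℝ) + 2) ^ (p + 1) ≤ A' * ((n : ℝ) + 1) ^ ε := by
        refine le_trans (Real.rpow_le_rpow (by positivity) ?_ (by linarith)) (hA' n)
        have := hLmr n
        rw [hL] at this
        rw [hL]
        linarith
      have hb0 : 0 ≤ r⁻¹ * Real.sqrt r ^ n := by have := hr.1; positivity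
      have hγ1 : polyStep γ₀ β n ≤ γ₀ := by
        have := antitone_polyStep hγ₀ hβ0 (Nat.zero_le n)
        refine this.trans (le_of_eq ?_)
        simp [polyStep]
      have hγn := hγp n
      have k1 : polyStep γ₀ β n * (r⁻¹ * Real.sqrt r ^ n) ≤ γ₀ * r⁻¹ * Real.sqrt r ^ n := by
        rw [mul_assoc γ₀]
        exact mul_le_mul_of_nonneg_right hγ1 hb0
      have k2 : polyStep γ₀ β n * ((n : ℝ) + 1) ^ (-1 : ℝ) = γ₀ * ((n : ℝ) + 1) ^ (-β + -1) := by
        rw [polyStep_eq, mul_assoc, ← Real.rpow_add (by positivity)]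
      have k3 : polyStep γ₀ β n * (γ₀ ^ κ * 2 ^ (β * κ) * ((n : ℝ) + 1) ^ (-(β * κ)) *
          (A' * ((n : ℝ) + 1) ^ ε)) = (γ₀ * γ₀ ^ κ * 2 ^ (β * κ) * A') *
            ((n : ℝ) + 1) ^ (ε - β * (1 + κ)) := by
        rw [polyStep_eq, show ε - β * (1 + κ) = -β + -(β * κ) + ε by ring,
          Real.rpow_add (by positivity), Real.rpow_add (by positivity)]
        ring
      have hγm := hγp (n - min (L n) (n / 2))
      calc polyStep γ₀ β n * (r ^ min (L n) (n / 2) + polyStep γ₀ β (n - min (L n) (n / 2)) ^ κ *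
            (((min (L n) (n / 2) : ℕ) : ℝ) + 2) ^ (p + 1))
          ≤ polyStep γ₀ β n * ((((n : ℝ) + 1) ^ (-1 : ℝ) + r⁻¹ * Real.sqrt r ^ n) +
            γ₀ ^ κ * 2 ^ (β * κ) * ((n : ℝ) + 1) ^ (-(β * κ)) * (A' * ((n : ℝ) + 1) ^ ε)) := by
            gcongr
        _ ≤ _ := by rw [mul_add, mul_add, k2, k3]; linarith
    · refine ((summable_nat_add_one_rpow (by linarith)).mul_left γ₀).add
        ((summable_geometric_of_lt_one hs0.le hs1).mul_left _) |>.add ?_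
      exact (summable_nat_add_one_rpow (by rw [hε]; linarith)).mul_left _

end StepSizes

/-! ### Comparison of a killed chain with a dominating chain -/

section Compare

variable {S T Y : Type*} [MeasurableSpace S] [MeasurableSpace T] [MeasurableSpace Y]

/-- Paths that start in `S₀` and stay in `G` during the first `n` steps. -/
def survival (S₀ G : Set S) (n : ℕ) : Set (ℕ → S) := {ω | ω 0 ∈ S₀ ∧ ∀ j < n, ω (j + 1) ∈ G}

/-- The finite paths underlying `survival`. -/
def survivalSet (S₀ G : Set S) (n : ℕ) : Set (Finset.Iic n → S) :=
  {x | x ⟨0, Finset.mem_Iic.2 (Nat.zero_le n)⟩ ∈ S₀ ∧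
    ∀ j, ∀ hj : j < n, x ⟨j + 1, Finset.mem_Iic.2 hj⟩ ∈ G}

theorem mem_of_mem_survival {S₀ G : Set S} (hG : G ⊆ S₀) {n : ℕ} {ω : ℕ → S}
    (h : ω ∈ survival S₀ G n) : ω n ∈ S₀ := by
  cases n with
  | zero => exact h.1
  | succ n => exact hG (h.2 n (Nat.lt_succ_self n))

/-- Extension of a finite path by one step. -/
def snocPath {n : ℕ} (q : (Finset.Iic n → S) × S) : Finset.Iic (n + 1) → S := fun i =>
  if h : (i : ℕ) ≤ n then q.1 ⟨i, Finset.mem_Iic.2 h⟩ else q.2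

theorem measurable_snocPath (n : ℕ) : Measurable (snocPath (S := S) (n := n)) := by
  refine measurable_pi_lambda _ fun i => ?_
  by_cases h : (i : ℕ) ≤ n
  · simp only [snocPath, h, dif_pos]; fun_prop
  · simp only [snocPath, h, dif_neg, not_false_iff]; fun_prop

theorem frestrictLe_succ (n : ℕ) (ω : ℕ → S) : Preorder.frestrictLe (π := fun _ => S) (n + 1) ω =
    snocPath (Preorder.frestrictLe (π := fun _ => S) n ω, ω (n + 1)) := by
  ext i
  by_cases h : (i : ℕ) ≤ n
  · simp [snocPath, h]
  · have : (i : ℕ) = n + 1 := by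
      have := Finset.mem_Iic.1 i.2
      omega
    simp [snocPath, this]

/-- A chain dominates, through the map `φ`, the chain killed when it leaves `G`. -/
structure IsDominated (Q : Kernel S S) (Q' : Kernel T T) (φ : S → T) (obs : S → Y) (obs' : T → Y)
    (S₀ G : Set S) : Prop where
  measurable_map : Measurable φ
  measurable_obs : Measurable obs
  measurable_obs' : Measurable obs'
  measurableSet_start : MeasurableSet S₀
  measurableSet_alive : MeasurableSet G
  alive_subset : G ⊆ S₀
  obs_eq : ∀ s ∈ G, obs' (φ s) = obs s
  lintegral_le : ∀ s ∈ S₀, ∀ f : T → ℝ≥0∞, Measurable f →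
    ∫⁻ s', G.indicator (fun s' => f (φ s')) s' ∂(Q s) ≤ ∫⁻ t', f t' ∂(Q' (φ s))
  lintegral_obs_le : ∀ s ∈ S₀, ∀ f : Y → ℝ≥0∞, Measurable f →
    ∫⁻ s', f (obs s') ∂(Q s) ≤ ∫⁻ t', f (obs' t') ∂(Q' (φ s))

namespace IsDominated

variable {Q : Kernel S S} {Q' : Kernel T T} [hQ : IsMarkovKernel Q] [hQ' : IsMarkovKernel Q']
  {φ : S → T} {obs : S → Y} {obs' : T → Y} {S₀ G : Set S}

theorem measurableSet_survivalSet (h : IsDominated Q Q' φ obs obs' S₀ G) (n : ℕ) :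
    MeasurableSet (survivalSet S₀ G n) := by
  refine ((measurable_pi_apply (⟨0, Finset.mem_Iic.2 (Nat.zero_le n)⟩ : Finset.Iic n))
    h.measurableSet_start).inter ?_
  have e : {x : Finset.Iic n → S | ∀ j, ∀ hj : j < n, x ⟨j + 1, Finset.mem_Iic.2 hj⟩ ∈ G} =
      ⋂ j, ⋂ hj : j < n, (fun x : Finset.Iic n → S => x ⟨j + 1, Finset.mem_Iic.2 hj⟩) ⁻¹' G := by
    ext x; simp
  change MeasurableSet {x : Finset.Iic n → S |
    ∀ j, ∀ hj : j < n, x ⟨j + 1, Finset.mem_Iic.2 hj⟩ ∈ G}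
  rw [e]
  exact MeasurableSet.iInter fun j => MeasurableSet.iInter fun hj =>
    (measurable_pi_apply _) h.measurableSet_alive

/-- Induction with an arbitrary `F`, so that the last transition can be integrated out. On the
survival event the current state lies in `S₀`, where domination replaces `Q` by `Q'` and leaves a
function of the image path up to time `n`. -/
theorem lintegral_frestrictLe_le (h : IsDominated Q Q' φ obs obs' S₀ G) (s : S) (n : ℕ) :
    ∀ F : (Finset.Iic n → T) → ℝ≥0∞, Measurable F →
    ∫⁻ ω, (survival S₀ G n).indicator (fun ω => F fun i => φ (ω i)) ω ∂(chainLaw Q hQ s) ≤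
      ∫⁻ ω, F (Preorder.frestrictLe (π := fun _ => T) n ω) ∂(chainLaw Q' hQ' (φ s)) := by
  have hφ := h.measurable_map
  induction n with
  | zero =>
    intro F hF
    have hg : Measurable fun t : T => F (fun _ => t) :=
      hF.comp (measurable_pi_lambda _ fun _ => measurable_id)
    have e : ∀ ω : ℕ → T, F (Preorder.frestrictLe (π := fun _ => T) 0 ω) =
        (fun t : T => F (fun _ => t)) (ω 0) := by
      intro ω
      congr 1
      ext i
      have : (i : ℕ) = 0 := Nat.le_zero.1 (Finset.mem_Iic.1 i.2)
      simp [Preorder.frestrictLe, this]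
    simp_rw [e]
    have hg' : Measurable fun s : S => F (fun _ => φ s) := hg.comp hφ
    rw [lintegral_chainLaw_zero Q' (φ s) hg, ← lintegral_chainLaw_zero Q s hg']
    refine lintegral_mono fun ω => (indicator_le_self _ _ _).trans (le_of_eq ?_)
    congr 1
    ext i
    have : (i : ℕ) = 0 := Nat.le_zero.1 (Finset.mem_Iic.1 i.2)
    simp [this]
  | succ n ih =>
    intro F hF
    have hFs : Measurable fun q : (Finset.Iic n → T) × T => F (snocPath q) :=
      hF.comp (measurable_snocPath n)
    have hΨ : Measurable fun x : Finset.Iic n → T =>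
        ∫⁻ t', F (snocPath (x, t')) ∂((Q'.comap (fun x : Finset.Iic n → T =>
          x ⟨n, Finset.mem_Iic.2 le_rfl⟩) (measurable_pi_apply _)) x) :=
      Measurable.lintegral_kernel_prod_right' hFs
    simp_rw [frestrictLe_succ]
    rw [isMarkovLaw_chainLaw Q' (φ s) n _ hFs]
    refine le_trans ?_ (ih _ hΨ)
    have hA := h.measurableSet_survivalSet n
    set A := survivalSet S₀ G n with hAdef
    have hAm : ∀ ω : ℕ → S, Preorder.frestrictLe (π := fun _ => S) n ω ∈ A ↔
        ω ∈ survival S₀ G n := fun ω => Iff.rfl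
    have hmφ : Measurable fun q : (Finset.Iic n → S) × S =>
        F (snocPath ((fun i => φ (q.1 i)), φ q.2)) := by
      refine hFs.comp ((measurable_pi_lambda _ fun i => ?_).prodMk (hφ.comp measurable_snd))
      exact hφ.comp ((measurable_pi_apply i).comp measurable_fst)
    have hm : Measurable fun q : (Finset.Iic n → S) × S => A.indicator 1 q.1 *
        G.indicator 1 q.2 * F (snocPath ((fun i => φ (q.1 i)), φ q.2)) :=
      ((((measurable_const (a := (1 : ℝ≥0∞))).indicator hA).comp measurable_fst).mul
        (((measurable_const (a := (1 : ℝ≥0∞))).indicator h.measurableSet_alive).comp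
          measurable_snd)).mul hmφ
    have hL := isMarkovLaw_chainLaw Q s n _ hm
    calc _ = ∫⁻ ω, A.indicator 1 (Preorder.frestrictLe (π := fun _ => S) n ω) *
          G.indicator 1 (ω (n + 1)) * F (snocPath
            ((fun i => φ (Preorder.frestrictLe (π := fun _ => S) n ω i)), φ (ω (n + 1))))
            ∂(chainLaw Q hQ s) := by
          refine lintegral_congr fun ω => ?_
          have e : (fun i : Finset.Iic (n + 1) => φ (ω i)) = snocPath
              ((fun i => φ (Preorder.frestrictLe (π := fun _ => S) n ω i)), φ (ω (n + 1))) :=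
            frestrictLe_succ n fun j => φ (ω j)
          rw [← e]
          by_cases h1 : ω ∈ survival S₀ G n <;> by_cases h2 : ω (n + 1) ∈ G
          · have h3 : ω ∈ survival S₀ G (n + 1) := by
              refine ⟨h1.1, fun j hj => ?_⟩
              rcases Nat.lt_succ_iff_lt_or_eq.1 hj with h4 | rfl
              · exact h1.2 j h4
              · exact h2
            rw [indicator_of_mem h3, indicator_of_mem ((hAm ω).2 h1), indicator_of_mem h2]
            simp
          · have h3 : ω ∉ survival S₀ G (n + 1) := fun h3 => h2 (h3.2 n (Nat.lt_succ_self n))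
            rw [indicator_of_notMem h3, indicator_of_notMem h2]
            simp
          · have h3 : ω ∉ survival S₀ G (n + 1) := fun h3 =>
              h1 ⟨h3.1, fun j hj => h3.2 j (hj.trans (Nat.lt_succ_self n))⟩
            rw [indicator_of_notMem h3, indicator_of_notMem (fun h4 => h1 ((hAm ω).1 h4))]
            simp
          · have h3 : ω ∉ survival S₀ G (n + 1) := fun h3 => h2 (h3.2 n (Nat.lt_succ_self n))
            rw [indicator_of_notMem h3, indicator_of_notMem h2]
            simp
      _ = _ := hL
      _ ≤ _ := by
          refine lintegral_mono fun ω => ?_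
          dsimp only
          by_cases h1 : ω ∈ survival S₀ G n
          · rw [indicator_of_mem h1, indicator_of_mem ((hAm ω).2 h1)]
            have hf : Measurable fun t' : T => F (snocPath
                ((fun i => φ (Preorder.frestrictLe (π := fun _ => S) n ω i)), t')) :=
              hFs.comp measurable_prodMk_left
            refine le_trans (le_of_eq (lintegral_congr fun s' => ?_))
              (h.lintegral_le (ω n) (mem_of_mem_survival h.alive_subset h1) _ hf)
            by_cases h2 : s' ∈ G <;> simp [h2]
          · rw [indicator_of_notMem h1, indicator_of_notMem (fun h4 => h1 ((hAm ω).1 h4))]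
            simp

/-- One observation beyond survival is included: at the step that leaves `G`, the new image state is
not controlled but the observation is. The noise of the exit step must be counted in the stability
argument. -/
theorem measure_le (h : IsDominated Q Q' φ obs obs' S₀ G) (s : S) (n : ℕ)
    {D : Set ((Finset.Iic n → T) × Y)} (hD : MeasurableSet D) :
    (chainLaw Q hQ s) {ω | ω ∈ survival S₀ G n ∧
        ((fun i : Finset.Iic n => φ (ω i)), obs (ω (n + 1))) ∈ D} ≤
      (chainLaw Q' hQ' (φ s))
        {ω | (Preorder.frestrictLe (π := fun _ => T) n ω, obs' (ω (n + 1))) ∈ D} := by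
  have hφ := h.measurable_map
  have hobs := h.measurable_obs
  have hobs' := h.measurable_obs'
  have hA := h.measurableSet_survivalSet n
  set A := survivalSet S₀ G n with hAdef
  have hAm : ∀ ω : ℕ → S, Preorder.frestrictLe (π := fun _ => S) n ω ∈ A ↔
      ω ∈ survival S₀ G n := fun ω => Iff.rfl
  have hI : Measurable (D.indicator (1 : (Finset.Iic n → T) × Y → ℝ≥0∞)) :=
    measurable_one.indicator hD
  have hmφ : Measurable fun q : (Finset.Iic n → S) × S =>
      ((fun i => φ (q.1 i) : Finset.Iic n → T), obs q.2) :=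
    (measurable_pi_lambda _ fun i => hφ.comp ((measurable_pi_apply i).comp measurable_fst)).prodMk
      (hobs.comp measurable_snd)
  have hm : Measurable fun q : (Finset.Iic n → S) × S => A.indicator 1 q.1 *
      D.indicator (1 : (Finset.Iic n → T) × Y → ℝ≥0∞) (fun i => φ (q.1 i), obs q.2) :=
    (((measurable_const (a := (1 : ℝ≥0∞))).indicator hA).comp measurable_fst).mul (hI.comp hmφ)
  have hm' : Measurable fun q : (Finset.Iic n → T) × T =>
      D.indicator (1 : (Finset.Iic n → T) × Y → ℝ≥0∞) (q.1, obs' q.2) :=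
    hI.comp (measurable_fst.prodMk (hobs'.comp measurable_snd))
  have hΨ : Measurable fun x : Finset.Iic n → T =>
      ∫⁻ t', D.indicator (1 : (Finset.Iic n → T) × Y → ℝ≥0∞) (x, obs' t')
        ∂((Q'.comap (fun x : Finset.Iic n → T =>
          x ⟨n, Finset.mem_Iic.2 le_rfl⟩) (measurable_pi_apply _)) x) :=
    Measurable.lintegral_kernel_prod_right' hm'
  have hE' : MeasurableSet
      {ω : ℕ → T | (Preorder.frestrictLe (π := fun _ => T) n ω, obs' (ω (n + 1))) ∈ D} :=
    ((by fun_prop : Measurable (Preorder.frestrictLe (π := fun _ : ℕ => T) n)).prodMk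
      (hobs'.comp (measurable_pi_apply (n + 1)))) hD
  set U : Set (ℕ → S) := {ω | ω ∈ survival S₀ G n ∧
        ((fun i : Finset.Iic n => φ (ω i)), obs (ω (n + 1))) ∈ D} with hU
  have hUm : ∀ ω, ω ∈ U ↔ ω ∈ survival S₀ G n ∧
        ((fun i : Finset.Iic n => φ (ω i)), obs (ω (n + 1))) ∈ D := fun _ => Iff.rfl
  have hE : MeasurableSet U :=
    (((by fun_prop : Measurable (Preorder.frestrictLe (π := fun _ : ℕ => S) n)) hA)).inter
      (((measurable_pi_lambda _ fun i => hφ.comp (measurable_pi_apply _)).prodMk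
        (hobs.comp (measurable_pi_apply (n + 1)))) hD)
  rw [← lintegral_indicator_one hE, ← lintegral_indicator_one hE']
  refine le_trans (le_of_eq (lintegral_congr fun ω => ?_)) (le_trans
    (le_of_eq (isMarkovLaw_chainLaw Q s n _ hm)) (le_trans (lintegral_mono fun ω => ?_) (le_trans
      (h.lintegral_frestrictLe_le s n _ hΨ)
      (le_of_eq (isMarkovLaw_chainLaw Q' (φ s) n _ hm').symm))))
  · dsimp only
    by_cases h1 : ω ∈ survival S₀ G n
    · rw [indicator_of_mem ((hAm ω).2 h1)]
      by_cases h2 : ((fun i : Finset.Iic n => φ (ω i)), obs (ω (n + 1))) ∈ D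
      · rw [indicator_of_mem ((hUm ω).2 ⟨h1, h2⟩)]
        exact (by rw [indicator_of_mem h2]; simp : (1 : ℝ≥0∞) =
          1 * D.indicator 1 ((fun i : Finset.Iic n => φ (ω i)), obs (ω (n + 1))))
      · rw [indicator_of_notMem (fun h3 => h2 ((hUm ω).1 h3).2)]
        exact (by rw [indicator_of_notMem h2]; simp : (0 : ℝ≥0∞) =
          1 * D.indicator 1 ((fun i : Finset.Iic n => φ (ω i)), obs (ω (n + 1))))
    · rw [indicator_of_notMem (fun h3 => h1 ((hUm ω).1 h3).1),
        indicator_of_notMem (fun h4 => h1 ((hAm ω).1 h4)), zero_mul]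
  · dsimp only
    by_cases h1 : ω ∈ survival S₀ G n
    · rw [indicator_of_mem h1, indicator_of_mem ((hAm ω).2 h1)]
      simp only [Pi.one_apply, one_mul]
      exact h.lintegral_obs_le (ω n) (mem_of_mem_survival h.alive_subset h1)
        (fun y => D.indicator (1 : (Finset.Iic n → T) × Y → ℝ≥0∞)
          ((fun i : Finset.Iic n => φ (ω i)), y)) (hI.comp measurable_prodMk_left)
    · rw [indicator_of_notMem h1, indicator_of_notMem (fun h4 => h1 ((hAm ω).1 h4))]
      simp

/-- Events along the killed chain are at most as likely as along the dominating chain. -/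
theorem measure_exists_le (h : IsDominated Q Q' φ obs obs' S₀ G) (s : S)
    {D : ∀ n, Set ((Finset.Iic n → T) × Y)} (hD : ∀ n, MeasurableSet (D n)) :
    (chainLaw Q hQ s) {ω | ∃ n, ω ∈ survival S₀ G n ∧
        ((fun i : Finset.Iic n => φ (ω i)), obs (ω (n + 1))) ∈ D n} ≤
      (chainLaw Q' hQ' (φ s))
        {ω | ∃ n, (Preorder.frestrictLe (π := fun _ => T) n ω, obs' (ω (n + 1))) ∈ D n} := by
  classical
  have hobs' := h.measurable_obs'
  -- First-entrance versions of the events. They are disjoint for the dominating chain, so that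
  -- summing the inequalities over `n` bounds the probability of the union.
  obtain ⟨D', hD'⟩ : ∃ D' : ∀ n, Set ((Finset.Iic n → T) × Y), ∀ n, D' n = D n \ ⋃ m, ⋃ hm : m < n,
      {q : (Finset.Iic n → T) × Y | ((fun i : Finset.Iic m => q.1 ⟨i, Finset.mem_Iic.2
        ((Finset.mem_Iic.1 i.2).trans hm.le)⟩ : Finset.Iic m → T),
        obs' (q.1 ⟨m + 1, Finset.mem_Iic.2 hm⟩)) ∈ D m} := ⟨_, fun _ => rfl⟩
  have hD'm : ∀ n, MeasurableSet (D' n) := by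
    intro n
    rw [hD']
    refine (hD n).diff (MeasurableSet.iUnion fun m => MeasurableSet.iUnion fun hm => ?_)
    refine ((measurable_pi_lambda _ fun i => ?_).prodMk ?_) (hD m)
    · exact (measurable_pi_apply _).comp measurable_fst
    · exact hobs'.comp ((measurable_pi_apply _).comp measurable_fst)
  have hsub : {ω | ∃ n, ω ∈ survival S₀ G n ∧
      ((fun i : Finset.Iic n => φ (ω i)), obs (ω (n + 1))) ∈ D n} ⊆
      ⋃ n, {ω | ω ∈ survival S₀ G n ∧
        ((fun i : Finset.Iic n => φ (ω i)), obs (ω (n + 1))) ∈ D' n} := by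
    intro ω hω
    have hω' : ∃ n, ω ∈ survival S₀ G n ∧
      ((fun i : Finset.Iic n => φ (ω i)), obs (ω (n + 1))) ∈ D n := hω
    have h1 := Nat.find_spec hω'
    refine mem_iUnion.2 ⟨Nat.find hω', h1.1, ?_⟩
    rw [hD']
    refine ⟨h1.2, fun h2 => ?_⟩
    simp only [mem_iUnion] at h2
    obtain ⟨m, hm, h3⟩ := h2
    refine Nat.find_min hω' hm ⟨⟨h1.1.1, fun j hj => h1.1.2 j (hj.trans hm)⟩, ?_⟩
    -- On surviving paths, the earlier observations can be read from the image path; hence an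
    -- earlier entrance for the image is one for the original chain.
    have h4 : obs' (φ (ω (m + 1))) = obs (ω (m + 1)) := h.obs_eq _ (h1.1.2 m hm)
    rw [← h4]
    exact h3
  have hE' : ∀ n, MeasurableSet
      {ω : ℕ → T | (Preorder.frestrictLe (π := fun _ => T) n ω, obs' (ω (n + 1))) ∈ D' n} :=
    fun n => ((by fun_prop : Measurable (Preorder.frestrictLe (π := fun _ : ℕ => T) n)).prodMk
      (hobs'.comp (measurable_pi_apply (n + 1)))) (hD'm n)
  have hdisj : Pairwise (Function.onFun Disjoint fun n =>
      {ω : ℕ → T | (Preorder.frestrictLe (π := fun _ => T) n ω, obs' (ω (n + 1))) ∈ D' n}) := by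
    have key : ∀ m n, m < n → Disjoint
        {ω : ℕ → T | (Preorder.frestrictLe (π := fun _ => T) m ω, obs' (ω (m + 1))) ∈ D' m}
        {ω : ℕ → T | (Preorder.frestrictLe (π := fun _ => T) n ω, obs' (ω (n + 1))) ∈ D' n} := by
      intro m n hmn
      rw [Set.disjoint_left]
      intro ω h1 h2
      change _ ∈ D' m at h1
      change _ ∈ D' n at h2
      rw [hD'] at h1 h2
      refine h2.2 (mem_iUnion.2 ⟨m, mem_iUnion.2 ⟨hmn, ?_⟩⟩)
      exact h1.1
    intro m n hmn
    rcases lt_or_gt_of_ne hmn with h1 | h1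
    · exact key m n h1
    · exact (key n m h1).symm
  calc _ ≤ _ := measure_mono hsub
    _ ≤ ∑' n, (chainLaw Q hQ s) {ω | ω ∈ survival S₀ G n ∧
        ((fun i : Finset.Iic n => φ (ω i)), obs (ω (n + 1))) ∈ D' n} := measure_iUnion_le _
    _ ≤ ∑' n, (chainLaw Q' hQ' (φ s))
        {ω | (Preorder.frestrictLe (π := fun _ => T) n ω, obs' (ω (n + 1))) ∈ D' n} :=
        ENNReal.tsum_le_tsum fun n => h.measure_le s n (hD'm n)
    _ = (chainLaw Q' hQ' (φ s)) (⋃ n,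
        {ω | (Preorder.frestrictLe (π := fun _ => T) n ω, obs' (ω (n + 1))) ∈ D' n}) :=
        (measure_iUnion hdisj hE').symm
    _ ≤ _ := by
        refine measure_mono (iUnion_subset fun n ω hω => ⟨n, ?_⟩)
        change _ ∈ D' n at hω
        rw [hD'] at hω
        exact hω.1

end IsDominated

end Compare

/-! ### The algorithm dominated by the chain that rejects outside proposals -/

section Retained

variable {d : ℕ} {X : Type*} [MeasurableSpace X]

open Classical in
/-- The parameter update which rejects the proposals outside `𝒦`. -/
def retainMove (H : E d → X → E d) (γ : ℕ → ℝ) (𝒦 : Set (E d)) (q : (X × E d × ℕ) × X) : E d :=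
  if q.1.2.1 + γ (q.1.2.2 + 1) • H q.1.2.1 q.2 ∈ 𝒦 then
    q.1.2.1 + γ (q.1.2.2 + 1) • H q.1.2.1 q.2 else q.1.2.1

theorem measurable_retainMove {H : E d → X → E d} (hH : Measurable (Function.uncurry H))
    (γ : ℕ → ℝ) {𝒦 : Set (E d)} (h𝒦 : MeasurableSet 𝒦) : Measurable (retainMove H γ 𝒦) := by
  have h1 : Measurable fun q : (X × E d × ℕ) × X =>
      q.1.2.1 + γ (q.1.2.2 + 1) • H q.1.2.1 q.2 := by
    have h2 : Measurable fun q : (X × E d × ℕ) × X => γ (q.1.2.2 + 1) :=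
      (measurable_of_countable fun n => γ (n + 1)).comp
        (by fun_prop : Measurable fun q : (X × E d × ℕ) × X => q.1.2.2)
    have h3 : Measurable fun q : (X × E d × ℕ) × X => H q.1.2.1 q.2 :=
      hH.comp (by fun_prop : Measurable fun q : (X × E d × ℕ) × X => (q.1.2.1, q.2))
    exact (by fun_prop : Measurable fun q : (X × E d × ℕ) × X => q.1.2.1).add (h2.smul h3)
  exact Measurable.ite (h1 h𝒦) h1 (by fun_prop)

/-- The transition kernel of the chain that rejects the proposals outside `𝒦`. -/
def retainKernel (P : Kernel (E d × X) X) (H : E d → X → E d) (γ : ℕ → ℝ) (𝒦 : Set (E d)) :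
    Kernel (X × E d × ℕ) (X × E d × ℕ) :=
  (Kernel.id ×ₖ P.comap (fun t : X × E d × ℕ => (t.2.1, t.1)) (by fun_prop)).map
    fun q => (q.2, retainMove H γ 𝒦 q, q.1.2.2 + 1)

theorem measurable_retainStep {H : E d → X → E d} (hH : Measurable (Function.uncurry H))
    (γ : ℕ → ℝ) {𝒦 : Set (E d)} (h𝒦 : MeasurableSet 𝒦) :
    Measurable fun q : (X × E d × ℕ) × X => (q.2, retainMove H γ 𝒦 q, q.1.2.2 + 1) :=
  measurable_snd.prodMk ((measurable_retainMove hH γ h𝒦).prodMk (by fun_prop))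

theorem isMarkovKernel_retainKernel (P : Kernel (E d × X) X) [IsMarkovKernel P]
    {H : E d → X → E d} (hH : Measurable (Function.uncurry H)) (γ : ℕ → ℝ) {𝒦 : Set (E d)}
    (h𝒦 : MeasurableSet 𝒦) : IsMarkovKernel (retainKernel P H γ 𝒦) :=
  Kernel.IsMarkovKernel.map _ (measurable_retainStep hH γ h𝒦)

theorem retainKernel_apply (P : Kernel (E d × X) X) [IsMarkovKernel P]
    {H : E d → X → E d} (hH : Measurable (Function.uncurry H)) (γ : ℕ → ℝ) {𝒦 : Set (E d)}
    (h𝒦 : MeasurableSet 𝒦) (t : X × E d × ℕ) : retainKernel P H γ 𝒦 t =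
      (P (t.2.1, t.1)).map fun y => (y, retainMove H γ 𝒦 (t, y), t.2.2 + 1) := by
  have hu := measurable_retainStep hH γ h𝒦
  rw [retainKernel, Kernel.map_apply _ hu, Kernel.prod_apply, Kernel.id_apply,
    Kernel.comap_apply, Measure.dirac_prod, Measure.map_map hu measurable_prodMk_left]
  rfl

theorem isDriven_retainKernel (P : Kernel (E d × X) X) [IsMarkovKernel P]
    {H : E d → X → E d} (hH : Measurable (Function.uncurry H)) {γ : ℕ → ℝ} (hγ : ∀ n, 0 ≤ γ n)
    {𝒦 : Set (E d)} (h𝒦 : MeasurableSet 𝒦) {W : X → ℝ} {C : ℝ} (hC : 0 ≤ C) (hW : ∀ x, 0 ≤ W x)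
    (hb : ∀ θ ∈ 𝒦, ∀ x, ‖H θ x‖ ≤ C * W x) :
    IsDriven P W γ 𝒦 C (retainMove H γ 𝒦) (retainKernel P H γ 𝒦) where
  measurable_move := measurable_retainMove hH γ h𝒦
  apply := retainKernel_apply P hH γ h𝒦
  mem t ht y := by
    unfold retainMove
    split_ifs with h
    · exact h
    · exact ht
  norm_le t ht y := by
    have h0 : 0 ≤ C * (γ (t.2.2 + 1) * W y) := mul_nonneg hC (mul_nonneg (hγ _) (hW y))
    unfold retainMove
    split_ifs with h
    · rw [add_sub_cancel_left, norm_smul, Real.norm_of_nonneg (hγ _)]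
      calc γ (t.2.2 + 1) * ‖H t.2.1 y‖ ≤ γ (t.2.2 + 1) * (C * W y) :=
            mul_le_mul_of_nonneg_left (hb _ ht y) (hγ _)
        _ = _ := by ring
    · simpa using h0

/-- The current point, parameter and step index of the algorithm. -/
def restartMap (xs : X) (θs : E d) (s : State X d) : X × E d × ℕ :=
  ((halfPoint xs θs s).2, (halfPoint xs θs s).1, s.index + s.count)

theorem measurable_restartMap (xs : X) (θs : E d) : Measurable (restartMap xs θs) := by
  have h := measurable_halfPoint (X := X) xs θs
  exact h.snd.prodMk (h.fst.prodMk (by fun_prop))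

/-- The states reached, without restart, while the active set has index `i` and the parameter is
in `𝒦`. -/
def aliveSet (X : Type*) (𝒦 : Set (E d)) (i : ℕ) : Set (State X d) :=
  {s | s.index = i ∧ s.count ≠ 0 ∧ s.theta ∈ 𝒦}

/-- The states with active set of index `i`. -/
def levelSet (X : Type*) (d i : ℕ) : Set (State X d) := {s | s.index = i}

theorem measurableSet_levelSet (i : ℕ) : MeasurableSet (levelSet X d i) :=
  (by fun_prop : Measurable fun s : State X d => s.2.2.1) (measurableSet_singleton i)

theorem measurableSet_aliveSet {𝒦 : Set (E d)} (h𝒦 : MeasurableSet 𝒦) (i : ℕ) :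
    MeasurableSet (aliveSet X 𝒦 i) :=
  (measurableSet_levelSet i).inter
    (((by fun_prop : Measurable fun s : State X d => s.2.2.2)
      (measurableSet_singleton 0).compl).inter
    ((by fun_prop : Measurable fun s : State X d => s.2.1) h𝒦))

/-- A state of `aliveSet` has nonzero count, so the proposal was accepted by the algorithm, and it
lies in `𝒦`, so the auxiliary chain retains it too. The step index, active index plus count, then
grows by one in both chains. -/
theorem restartMap_update_of_mem {K : ℕ → Set (E d)} {H : E d → X → E d} {γ : ℕ → ℝ} {xs : X}
    {θs : E d} {𝒦 : Set (E d)} {i : ℕ} {s : State X d} {y : X}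
    (h : update K H γ xs θs s y ∈ aliveSet X 𝒦 i) :
    restartMap xs θs (update K H γ xs θs s y) =
      (y, retainMove H γ 𝒦 (restartMap xs θs s, y), (restartMap xs θs s).2.2 + 1) := by
  by_cases hk : newTheta H γ xs θs s y ∈ K s.index
  · have e : update K H γ xs θs s y = (y, newTheta H γ xs θs s y, s.index, s.count + 1) :=
      if_pos hk
    rw [e] at h ⊢
    have h3 : newTheta H γ xs θs s y ∈ 𝒦 := h.2.2
    have e2 : retainMove H γ 𝒦 (restartMap xs θs s, y) = newTheta H γ xs θs s y := if_pos h3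
    rw [e2]
    have e3 : halfPoint xs θs ((y, newTheta H γ xs θs s y, s.index, s.count + 1) : State X d) =
        (newTheta H γ xs θs s y, y) := if_neg (Nat.succ_ne_zero _)
    rw [restartMap, e3]
    rfl
  · have e : update K H γ xs θs s y = (y, newTheta H γ xs θs s y, s.index + 1, 0) := if_neg hk
    rw [e] at h
    exact absurd rfl h.2.1

/-- Both chains draw from the same kernel at the same half point, so the observations agree always
and the moves agree as long as the new state is alive. The starting set is the whole level `i`
because a restarted state, with count zero, is not alive. -/
theorem isDominated_stepKernel (P : Kernel (E d × X) X) [IsMarkovKernel P]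
    {K : ℕ → Set (E d)} (hK : ∀ i, MeasurableSet (K i))
    {H : E d → X → E d} (hH : Measurable (Function.uncurry H)) (γ : ℕ → ℝ) (xs : X) (θs : E d)
    {𝒦 : Set (E d)} (h𝒦 : MeasurableSet 𝒦) (i : ℕ) :
    IsDominated (stepKernel P K H γ xs θs) (retainKernel P H γ 𝒦) (restartMap xs θs)
      (fun s : State X d => s.1) (fun t : X × E d × ℕ => t.1) (levelSet X d i)
      (aliveSet X 𝒦 i) where
  measurable_map := measurable_restartMap xs θs
  measurable_obs := measurable_fst
  measurable_obs' := measurable_fst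
  measurableSet_start := measurableSet_levelSet i
  measurableSet_alive := measurableSet_aliveSet h𝒦 i
  alive_subset := fun s hs => hs.1
  obs_eq s hs := by
    have e : halfPoint xs θs s = (s.theta, s.1) := if_neg hs.2.1
    rw [restartMap, e]
  lintegral_le s hs f hf := by
    have hu : Measurable (update K H γ xs θs s) :=
      (measurable_update hK hH γ xs θs).comp measurable_prodMk_left
    have hr : Measurable fun y => (y, retainMove H γ 𝒦 (restartMap xs θs s, y),
        (restartMap xs θs s).2.2 + 1) :=
      (measurable_retainStep hH γ h𝒦).comp measurable_prodMk_left
    have hfφ : Measurable fun s' : State X d => f (restartMap xs θs s') :=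
      hf.comp (measurable_restartMap xs θs)
    rw [stepKernel_apply P hK hH, retainKernel_apply P hH γ h𝒦,
      lintegral_map (hfφ.indicator (measurableSet_aliveSet h𝒦 i)) hu, lintegral_map hf hr]
    refine lintegral_mono fun y => ?_
    by_cases h : update K H γ xs θs s y ∈ aliveSet X 𝒦 i
    · rw [indicator_of_mem h, restartMap_update_of_mem h]
    · rw [indicator_of_notMem h]
      exact zero_le
  lintegral_obs_le s hs f hf := by
    have hu : Measurable (update K H γ xs θs s) :=
      (measurable_update hK hH γ xs θs).comp measurable_prodMk_left
    have hr : Measurable fun y => (y, retainMove H γ 𝒦 (restartMap xs θs s, y),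
        (restartMap xs θs s).2.2 + 1) :=
      (measurable_retainStep hH γ h𝒦).comp measurable_prodMk_left
    have hf1 : Measurable fun s' : State X d => f s'.1 := hf.comp measurable_fst
    have hf2 : Measurable fun t' : X × E d × ℕ => f t'.1 := hf.comp measurable_fst
    rw [stepKernel_apply P hK hH, retainKernel_apply P hH γ h𝒦, lintegral_map hf1 hu,
      lintegral_map hf2 hr]
    refine lintegral_mono fun y => le_of_eq ?_
    congr 1
    by_cases hk : newTheta H γ xs θs s y ∈ K s.index
    · have e : update K H γ xs θs s y = (y, newTheta H γ xs θs s y, s.index, s.count + 1) :=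
        if_pos hk
      rw [e]
    · have e : update K H γ xs θs s y = (y, newTheta H γ xs θs s y, s.index + 1, 0) := if_neg hk
      rw [e]

end Retained

/-! ### Maximal inequality transferred to the noise of the algorithm -/

section NoiseBound

variable {d : ℕ} {X : Type*} [MeasurableSpace X]

/-- The weighted noise of a transition from `t` with new observation `y`. -/
def weightedNoise (γ : ℕ → ℝ) (g : E d → X → ℝ) (gbar : E d → ℝ) (t : X × E d × ℕ) (y : X) : ℝ :=
  γ (t.2.2 + 1) * (g t.2.1 y - gbar t.2.1)

theorem measurable_weightedNoise (γ : ℕ → ℝ) {g : E d → X → ℝ}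
    (hg : Measurable (Function.uncurry g)) {gbar : E d → ℝ} (hb : Measurable gbar) :
    Measurable fun q : (X × E d × ℕ) × X => weightedNoise γ g gbar q.1 q.2 := by
  have h1 : Measurable fun q : (X × E d × ℕ) × X => γ (q.1.2.2 + 1) :=
    (measurable_of_countable fun n => γ (n + 1)).comp
      (by fun_prop : Measurable fun q : (X × E d × ℕ) × X => q.1.2.2)
  exact h1.mul ((hg.comp (by fun_prop : Measurable fun q : (X × E d × ℕ) × X =>
    (q.1.2.1, q.2))).sub (hb.comp (by fun_prop)))

namespace IsDriven

variable {P : Kernel (E d × X) X} [IsMarkovKernel P] {π : E d → Measure X} {W : X → ℝ}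
  {γ : ℕ → ℝ} {𝒦 : Set (E d)} {p κ α C r : ℝ} {move : (X × E d × ℕ) × X → E d}
  {Q : Kernel (X × E d × ℕ) (X × E d × ℕ)} [hQ : IsMarkovKernel Q]

/-- Sums that begin at time `m` are handled by restarting the chain there, with counter increased by
`m`, and integrating `W ^ p` of the state at that time by the drift. All dependence on the initial
state is in the factor `W ^ p`. -/
theorem exists_noise_rate (hD : IsDriven P W γ 𝒦 C move Q)
    (hB : LocalBounds P π W 𝒦 p κ C r) {g : E d → X → ℝ} (hg : LocalField π W 𝒦 α C g)
    (h𝒦 : MeasurableSet 𝒦) (hγ : ∀ n, 0 < γ n) (hγa : Antitone γ)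
    (hγ0 : Tendsto γ atTop (𝓝 0)) (hp : 1 < p) (hκ : 0 < κ) (hκ1 : κ ≤ 1)
    (hκp : 1 + κ ≤ p)
    {gbar : E d → ℝ} (hgm : Measurable gbar) (hgb : ∀ θ ∈ 𝒦, gbar θ = ∫ x, g θ x ∂(π θ))
    (hmean : ∀ θ ∈ 𝒦, ∀ θ' ∈ 𝒦, |gbar θ - gbar θ'| ≤ C * ‖θ - θ'‖ ^ κ)
    {s : ℝ} (hsα : κ ≤ s * α) (hsp : κ ≤ (p - 1) * (1 - s))
    {lag : ℕ → ℕ} (hlag : ∀ δ : ℝ, Tendsto (noiseRate γ lag r κ p δ) atTop (𝓝 0)) :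
    ∃ R : ℝ → ℕ → ℝ≥0∞, (∀ δ, Tendsto (R δ) atTop (𝓝 0)) ∧
      ∀ t : X × E d × ℕ, t.2.1 ∈ 𝒦 → ∀ δ : ℝ, 0 < δ → δ ≤ 1 → ∀ m : ℕ,
      (chainLaw Q hQ t) {ω | ∃ n, m ≤ n ∧ δ < |∑ k ∈ Finset.Ico m (n + 1),
          weightedNoise γ g gbar (ω k) (ω (k + 1)).1|} ≤
        ENNReal.ofReal (W t.1 ^ p) * R δ (t.2.2 + m) := by
  classical
  have hr1 : 0 < 1 - r := by linarith [hB.r_mem.2]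
  have hC0 := hB.C_pos
  obtain ⟨M, hM⟩ : ∃ M : ℝ, M = 1 + C / (1 - r) := ⟨_, rfl⟩
  have hM0 : 0 < M := by rw [hM]; positivity
  obtain ⟨A, hA⟩ : ∃ A : ℝ, A = (2 * C ^ 2) ^ p + 8 * C ^ (p + 3) * (1 + C / (1 - r)) := ⟨_, rfl⟩
  have hA0 : 0 ≤ A := by rw [hA]; positivity
  -- The noise estimate requires a step size at most one; the rate is set to infinity for the other
  -- indices, of which there are finitely many.
  refine ⟨fun δ n => if γ n ≤ 1 then ENNReal.ofReal (A * M * M) * noiseRate γ lag r κ p δ n else ∞,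
    fun δ => ?_, fun t ht δ hδ hδ1 m => ?_⟩
  · have h1 := ENNReal.Tendsto.const_mul (hlag δ) (a := ENNReal.ofReal (A * M * M))
      (Or.inr ENNReal.ofReal_ne_top)
    rw [mul_zero] at h1
    refine h1.congr' ?_
    filter_upwards [hγ0.eventually (ge_mem_nhds one_pos)] with n hn
    rw [if_pos hn]
  · beta_reduce
    by_cases hγ1 : γ (t.2.2 + m) ≤ 1
    swap
    · rw [if_neg hγ1, ENNReal.mul_top]
      · exact le_top
      · have := Real.rpow_pos_of_pos (hB.W_pos t.1) p
        simpa using this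
    rw [if_pos hγ1]
    have hnm := measurable_weightedNoise γ hg.measurable hgm
    obtain ⟨U, hU⟩ : ∃ U : Set (ℕ → X × E d × ℕ), U = {ω | ∃ n, δ < |∑ k ∈ Finset.range n,
        weightedNoise γ g gbar (ω k) (ω (k + 1)).1|} := ⟨_, rfl⟩
    have hUm : MeasurableSet U := by
      have e : U = ⋃ n, {ω | δ < |∑ k ∈ Finset.range n,
          weightedNoise γ g gbar (ω k) (ω (k + 1)).1|} := by
        rw [hU]; ext ω; simp
      rw [e]
      refine MeasurableSet.iUnion fun n => measurableSet_lt measurable_const ?_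
      have h3 : Measurable fun ω : ℕ → X × E d × ℕ => ∑ k ∈ Finset.range n,
          weightedNoise γ g gbar (ω k) (ω (k + 1)).1 :=
        Finset.measurable_sum _ fun k _ => hnm.comp
          (by fun_prop : Measurable fun ω : ℕ → X × E d × ℕ => (ω k, (ω (k + 1)).1))
      exact h3.abs
    have hUle : ∀ t' : X × E d × ℕ, t'.2.1 ∈ 𝒦 → γ t'.2.2 ≤ 1 → (chainLaw Q hQ t') U ≤
        ENNReal.ofReal (A * M) * noiseRate γ lag r κ p δ t'.2.2 *
          ENNReal.ofReal (W t'.1 ^ p) := by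
      intro t' ht' hγt'
      have h := hD.measure_exists_lt_abs_sum_stepNoise_le hB hg h𝒦 ht' hγ hγa hp hκ hκ1 hκp hgm hgb
        hmean hsα hsp hγt' lag hδ hδ1
      have h2 : (chainLaw Q hQ t') U ≤ (chainLaw Q hQ t') {ω | ∃ n, δ < |∑ k ∈ Finset.range n,
          stepNoise γ g gbar t'.2.2 k ω|} := by
        refine measure_mono_ae ?_
        filter_upwards [hD.ae_path hB.measurable_W h𝒦 ht'] with ω hω hωU
        have hωU' : ω ∈ U := hωU
        rw [hU] at hωU'
        obtain ⟨n, hn⟩ := hωU'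
        refine ⟨n, lt_of_lt_of_eq hn ?_⟩
        congr 1
        refine Finset.sum_congr rfl fun k _ => ?_
        rw [weightedNoise, stepNoise, noise, (hω.2.2 k).2.1]
      refine h2.trans (h.trans (le_of_eq ?_))
      rw [← hA, ← hM, ← mul_assoc, ENNReal.ofReal_mul (p := A * M) (by positivity)]
      ring
    have hsub : {ω : ℕ → X × E d × ℕ | ∃ n, m ≤ n ∧ δ < |∑ k ∈ Finset.Ico m (n + 1),
          weightedNoise γ g gbar (ω k) (ω (k + 1)).1|} ⊆ {ω | (fun k => ω (m + k)) ∈ U} := by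
      rintro ω ⟨n, hmn, hn⟩
      change _ ∈ U
      rw [hU]
      refine ⟨n + 1 - m, ?_⟩
      rwa [Finset.sum_Ico_eq_sum_range] at hn
    have hsh : Measurable fun (ω : ℕ → X × E d × ℕ) k => ω (m + k) := by fun_prop
    have h1 : (chainLaw Q hQ t) {ω | (fun k => ω (m + k)) ∈ U} =
        ∫⁻ ω, (chainLaw Q hQ (ω m)) U ∂(chainLaw Q hQ t) := by
      have h := lintegral_chainLaw_shift Q t m (Z := fun _ => 1) measurable_const
        (F := U.indicator 1) (measurable_one.indicator hUm)
      simp only [one_mul, lintegral_indicator_one hUm] at h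
      rw [← h]
      exact (lintegral_indicator_one (hsh hUm)).symm
    refine (measure_mono hsub).trans (h1.le.trans ?_)
    calc ∫⁻ ω, (chainLaw Q hQ (ω m)) U ∂(chainLaw Q hQ t)
        ≤ ∫⁻ ω, ENNReal.ofReal (A * M) * noiseRate γ lag r κ p δ (t.2.2 + m) *
          ENNReal.ofReal (W (ω m).1 ^ p) ∂(chainLaw Q hQ t) := by
          refine lintegral_mono_ae ?_
          filter_upwards [hD.ae_path hB.measurable_W h𝒦 ht] with ω hω
          have h2 := hUle (ω m) (hω.2.2 m).1 (by rw [(hω.2.2 m).2.1]; exact hγ1)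
          rwa [(hω.2.2 m).2.1] at h2
      _ = ENNReal.ofReal (A * M) * noiseRate γ lag r κ p δ (t.2.2 + m) *
          ∫⁻ ω, ENNReal.ofReal (W (ω m).1 ^ p) ∂(chainLaw Q hQ t) :=
          lintegral_const_mul _
            ((hB.measurable_W.comp (measurable_pi_apply m).fst).pow_const p).ennreal_ofReal
      _ ≤ ENNReal.ofReal (A * M) * noiseRate γ lag r κ p δ (t.2.2 + m) *
          ENNReal.ofReal (M * W t.1 ^ p) := by
          gcongr
          rw [hM]
          exact hD.lintegral_W_pow_le hB h𝒦 ht hp m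
      _ = _ := by
          rw [ENNReal.ofReal_mul hM0.le, ENNReal.ofReal_mul (p := A * M) (by positivity)]
          ring

end IsDriven

/-- The weighted noise of the algorithm at step `k`. -/
def algNoise (γ : ℕ → ℝ) (g : E d → X → ℝ) (gbar : E d → ℝ) (xs : X) (θs : E d) (k : ℕ)
    (ω : ℕ → State X d) : ℝ :=
  weightedNoise γ g gbar (restartMap xs θs (ω k)) (ω (k + 1)).1

/-- The noise up to step `n` depends only on the image path up to time `n` and on the observation at
time `n + 1`, which is the form of event covered by the domination. Survival is required only up to
time `n`. -/
theorem measure_exists_algNoise_le {P : Kernel (E d × X) X} [IsMarkovKernel P]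
    {K : ℕ → Set (E d)} (hK : ∀ i, MeasurableSet (K i))
    {H : E d → X → E d} (hH : Measurable (Function.uncurry H)) {γ : ℕ → ℝ} (xs : X) (θs : E d)
    {𝒦 : Set (E d)} (h𝒦 : MeasurableSet 𝒦) (i : ℕ) {g : E d → X → ℝ}
    (hg : Measurable (Function.uncurry g)) {gbar : E d → ℝ} (hgm : Measurable gbar) (δ : ℝ)
    (s : State X d) (m : ℕ) :
    (chainLaw (stepKernel P K H γ xs θs) (isMarkovKernel_stepKernel P hK hH γ xs θs) s)
      {ω | ∃ n, m ≤ n ∧ ω ∈ survival (levelSet X d i) (aliveSet X 𝒦 i) n ∧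
        δ < |∑ k ∈ Finset.Ico m (n + 1), algNoise γ g gbar xs θs k ω|} ≤
    (chainLaw (retainKernel P H γ 𝒦) (isMarkovKernel_retainKernel P hH γ h𝒦)
      (restartMap xs θs s)) {ω | ∃ n, m ≤ n ∧ δ < |∑ k ∈ Finset.Ico m (n + 1),
          weightedNoise γ g gbar (ω k) (ω (k + 1)).1|} := by
  have := isMarkovKernel_stepKernel P hK hH γ xs θs
  have := isMarkovKernel_retainKernel P hH γ h𝒦
  have hdom := isDominated_stepKernel P hK hH γ xs θs h𝒦 i
  have hnm := measurable_weightedNoise γ hg hgm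
  -- Reads the state at time `j` from such data. The dummy parameter and counter at time `n + 1` are
  -- never used, since only the observation is taken there.
  obtain ⟨st, hst⟩ : ∃ st : ∀ n : ℕ, ℕ → (Finset.Iic n → X × E d × ℕ) × X → X × E d × ℕ,
      st = fun n j q => if h : j ≤ n then q.1 ⟨j, Finset.mem_Iic.2 h⟩ else (q.2, 0, 0) := ⟨_, rfl⟩
  have hstm : ∀ n j, Measurable (st n j) := by
    intro n j
    rw [hst]
    by_cases h : j ≤ n
    · simp only [h, dif_pos]; fun_prop
    · simp only [h, dif_neg, not_false_iff]; fun_prop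
  have hst1 : ∀ n j q (h : j ≤ n), st n j q = q.1 ⟨j, Finset.mem_Iic.2 h⟩ := by
    intro n j q h
    rw [hst]
    exact dif_pos h
  have hst2 : ∀ n q, (st n (n + 1) q).1 = q.2 := by
    intro n q
    rw [hst]
    simp
  obtain ⟨D, hD⟩ : ∃ D : ∀ n : ℕ, Set ((Finset.Iic n → X × E d × ℕ) × X), D = fun n =>
      {q | m ≤ n ∧ δ < |∑ k ∈ Finset.Ico m (n + 1),
        weightedNoise γ g gbar (st n k q) (st n (k + 1) q).1|} := ⟨_, rfl⟩
  have hDm : ∀ n, MeasurableSet (D n) := by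
    intro n
    rw [hD]
    have h3 : Measurable fun q : (Finset.Iic n → X × E d × ℕ) × X =>
        ∑ k ∈ Finset.Ico m (n + 1), weightedNoise γ g gbar (st n k q) (st n (k + 1) q).1 :=
      Finset.measurable_sum _ fun k _ => hnm.comp ((hstm n k).prodMk (hstm n (k + 1)).fst)
    have h4 : MeasurableSet {q : (Finset.Iic n → X × E d × ℕ) × X | δ < |∑ k ∈ Finset.Ico m (n + 1),
        weightedNoise γ g gbar (st n k q) (st n (k + 1) q).1|} :=
      measurableSet_lt measurable_const h3.abs
    exact (MeasurableSet.const (m ≤ n)).inter h4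
  refine le_trans (measure_mono ?_) ((hdom.measure_exists_le s hDm).trans (measure_mono ?_))
  · rintro ω ⟨n, hmn, hsurv, hn⟩
    refine ⟨n, hsurv, ?_⟩
    rw [hD]
    refine ⟨hmn, lt_of_lt_of_eq hn ?_⟩
    congr 1
    refine Finset.sum_congr rfl fun k hk => ?_
    have hkn : k ≤ n := Nat.lt_succ_iff.1 (Finset.mem_Ico.1 hk).2
    rw [hst1 n k _ hkn]
    rcases hkn.eq_or_lt with rfl | hlt
    · rw [hst2]; rfl
    · rw [hst1 n (k + 1) _ hlt]
      have h4 := hdom.obs_eq _ (hsurv.2 k hlt)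
      dsimp only at h4 ⊢
      rw [h4]
      rfl
  · rintro ω ⟨n, hn⟩
    rw [hD] at hn
    refine ⟨n, hn.1, lt_of_lt_of_eq hn.2 ?_⟩
    congr 1
    refine Finset.sum_congr rfl fun k hk => ?_
    have hkn : k ≤ n := Nat.lt_succ_iff.1 (Finset.mem_Ico.1 hk).2
    rw [hst1 n k _ hkn]
    rcases hkn.eq_or_lt with rfl | hlt
    · rw [hst2]; rfl
    · rw [hst1 n (k + 1) _ hlt]; rfl

end NoiseBound

/-! ### Exponents, regularity of the mean field and the noise rate -/

section Setting

variable {d : ℕ} {X : Type*} [MeasurableSpace X]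

/-- The standing assumptions on the algorithm, without the Lyapunov function. -/
structure Setting (Θ : Set (E d)) (K : ℕ → Set (E d)) (P : Kernel (E d × X) X)
    (H : E d → X → E d) (π : E d → Measure X) (W : X → ℝ) (p α υ γ₀ β : ℝ) : Prop where
  isOpen : IsOpen Θ
  cover : IsCompactCover Θ K
  measurable_H : Measurable (Function.uncurry H)
  one_lt_p : 1 < p
  alpha_mem : α ∈ Ioc (0 : ℝ) 1
  upsilon_mem : υ ∈ Ioc (0 : ℝ) 1
  gamma_pos : 0 < γ₀
  beta_mem : β ∈ Ioc (max (1 / p) ((1 + min α υ / p) / (1 + min α υ))) 1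
  field : FieldBound Θ H W
  ergodic : UniformErgodicity Θ P π W p
  holderKernels : HolderKernels Θ P W υ
  holderField : AveragedHolder Θ H π α

/-- With `a = min α υ`, take `s = (p - 1) / (p + a)` and `κ = s a`. Then `1 + κ = p (1 + a) / (p +
a)` is the reciprocal of the bound `(1 + a / p) / (1 + a)` on `β`, which gives the last inequality.
-/
theorem exists_exponents {p α υ β : ℝ} (hp : 1 < p) (hα : α ∈ Ioc (0 : ℝ) 1)
    (hυ : υ ∈ Ioc (0 : ℝ) 1)
    (hβ : β ∈ Ioc (max (1 / p) ((1 + min α υ / p) / (1 + min α υ))) 1) :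
    ∃ κ s : ℝ, 0 < κ ∧ κ ≤ 1 ∧ 1 + κ ≤ p ∧ κ ≤ υ ∧ κ ≤ α ∧ κ ≤ s * α ∧
      κ ≤ (p - 1) * (1 - s) ∧ 1 < β * (1 + κ) := by
  set a := min α υ with ha
  have ha0 : 0 < a := lt_min hα.1 hυ.1
  have ha1 : a ≤ α := min_le_left _ _
  have ha2 : a ≤ υ := min_le_right _ _
  have hpa : 0 < p + a := by linarith
  have hs0 : 0 < (p - 1) / (p + a) := div_pos (by linarith) hpa
  have hs1 : (p - 1) / (p + a) ≤ 1 := by rw [div_le_one hpa]; linarith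
  have hle : (p - 1) / (p + a) * a ≤ a := mul_le_of_le_one_left ha0.le hs1
  refine ⟨(p - 1) / (p + a) * a, (p - 1) / (p + a), mul_pos hs0 ha0, ?_, ?_, ?_, ?_, ?_, ?_, ?_⟩
  · linarith [hα.2]
  · have : (p - 1) / (p + a) * a = (p - 1) * (a / (p + a)) := by ring
    have h2 : a / (p + a) ≤ 1 := by rw [div_le_one hpa]; linarith
    nlinarith
  · linarith
  · linarith
  · exact mul_le_mul_of_nonneg_left ha1 hs0.le
  · have : (p - 1) * (1 - (p - 1) / (p + a)) = (p - 1) / (p + a) * (1 + a) := by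
      field_simp
      ring
    rw [this]
    exact mul_le_mul_of_nonneg_left (by linarith) hs0.le
  · have h1 : (1 + a / p) / (1 + a) < β := lt_of_le_of_lt (le_max_right _ _) hβ.1
    have h2 : (1 + a / p) / (1 + a) * (1 + (p - 1) / (p + a) * a) = 1 := by
      have : p ≠ 0 := by linarith
      have : (1 + a) ≠ 0 := by linarith
      field_simp
      ring
    have h3 : 0 < 1 + (p - 1) / (p + a) * a := by
      have := mul_pos hs0 ha0
      linarith
    exact h2.symm.trans_lt (mul_lt_mul_of_pos_right h1 h3)

namespace Setting

variable {Θ : Set (E d)} {K : ℕ → Set (E d)} {P : Kernel (E d × X) X} [IsMarkovKernel P]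
    {H : E d → X → E d} {π : E d → Measure X} {W : X → ℝ} {p α υ γ₀ β : ℝ}

theorem subset_theta (hS : Setting Θ K P H π W p α υ γ₀ β) (i : ℕ) : K i ⊆ Θ := by
  rw [← hS.cover.iUnion_eq]
  exact subset_iUnion K i

theorem monotone_cover (hS : Setting Θ K P H π W p α υ γ₀ β) : Monotone K :=
  monotone_nat_of_le_succ fun i => (hS.cover.subset_interior i).trans interior_subset

theorem measurableSet_cover (hS : Setting Θ K P H π W p α υ γ₀ β) (i : ℕ) : MeasurableSet (K i) :=
  (hS.cover.compact i).measurableSet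

theorem beta_pos (hS : Setting Θ K P H π W p α υ γ₀ β) : 0 < β := by
  have h1 : 1 / p < β := lt_of_le_of_lt (le_max_left _ _) hS.beta_mem.1
  have : 0 < 1 / p := by have := hS.one_lt_p; positivity
  linarith

/-- A compact subset of `Θ` lies in one of the sets of the cover. -/
theorem exists_subset_cover (hS : Setting Θ K P H π W p α υ γ₀ β) {𝒦 : Set (E d)}
    (h𝒦 : IsCompact 𝒦) (hΘ : 𝒦 ⊆ Θ) : ∃ i, 𝒦 ⊆ K i := by
  obtain ⟨i, hi⟩ := h𝒦.elim_directed_cover (fun i => interior (K i)) (fun i => isOpen_interior)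
    (fun θ hθ => by
      have h1 : θ ∈ ⋃ i, K i := by rw [hS.cover.iUnion_eq]; exact hΘ hθ
      obtain ⟨i, hi⟩ := mem_iUnion.1 h1
      exact mem_iUnion.2 ⟨i + 1, hS.cover.subset_interior i hi⟩)
    (directed_of_isDirected_le fun i j hij => interior_mono (hS.monotone_cover hij))
  exact ⟨i, hi.trans interior_subset⟩

/-- Hölder continuity of the mean of `⟨v, H⟩`. -/
theorem exists_inner_holder (hS : Setting Θ K P H π W p α υ γ₀ β) {𝒦 : Set (E d)}
    (h𝒦 : IsCompact 𝒦) (hΘ : 𝒦 ⊆ Θ) {v : E d → E d} (hv : Measurable v) {B : ℝ}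
    (hvB : ∀ θ ∈ 𝒦, ‖v θ‖ ≤ B) (hvα : ∀ θ ∈ 𝒦, ∀ θ' ∈ 𝒦, ‖v θ - v θ'‖ ≤ B * ‖θ - θ'‖ ^ α)
    {κ : ℝ} (hκ : 0 < κ) (hκα : κ ≤ α) (hκυ : κ ≤ υ) :
    ∃ C r, LocalBounds P π W 𝒦 p κ C r ∧
      LocalField π W 𝒦 α C (fun θ x => inner ℝ (v θ) (H θ x)) ∧
      (∀ θ ∈ 𝒦, ∀ x, ‖H θ x‖ ≤ C * W x) ∧
      ∀ θ ∈ 𝒦, ∀ θ' ∈ 𝒦, |inner ℝ (v θ) (meanField H π θ) - inner ℝ (v θ') (meanField H π θ')| ≤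
        C * ‖θ - θ'‖ ^ κ := by
  obtain ⟨C₀, r, hB₀⟩ := exists_localBounds hS.one_lt_p hS.field hS.ergodic hS.holderKernels h𝒦 hΘ
  obtain ⟨C₁, hB₁⟩ := hB₀.exists_exponent_le h𝒦 hκ hκυ
  obtain ⟨C₂, hg⟩ := exists_localField_inner hS.measurable_H hS.field hS.holderField h𝒦 hΘ hB₁
    hS.alpha_mem.1 hv hvB hvα
  obtain ⟨C₃, -, hb⟩ := hS.field.exists_norm_le h𝒦 hΘ
  have hB₂ := hB₁.mono (le_max_left C₁ C₂)
  have hg₂ := hg.mono hB₁.one_le_W (le_max_right C₁ C₂)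
  obtain ⟨C₄, hm⟩ := hg₂.exists_mean_holder hB₂ h𝒦 hκ hκα
  set C := max (max (max C₁ C₂) C₃) C₄ with hC
  have hW0 : ∀ x, 0 ≤ W x := fun x => zero_le_one.trans (hB₁.one_le_W x)
  refine ⟨C, r, hB₂.mono ((le_max_left _ _).trans (le_max_left _ _)),
    hg₂.mono hB₁.one_le_W ((le_max_left _ _).trans (le_max_left _ _)), fun θ hθ x =>
    (hb θ hθ x).trans (mul_le_mul_of_nonneg_right ((le_max_right _ _).trans (le_max_left _ _))
      (hW0 x)), fun θ hθ θ' hθ' => ?_⟩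
  have h1 := hm θ hθ θ' hθ'
  rw [inner_meanField hS.measurable_H hS.field h𝒦 hΘ hB₁ (v θ) hθ,
    inner_meanField hS.measurable_H hS.field h𝒦 hΘ hB₁ (v θ') hθ'] at h1
  exact h1.trans (mul_le_mul_of_nonneg_right (le_max_right _ _) (by positivity))

theorem norm_le_sum_abs (x : E d) :
    ‖x‖ ≤ ∑ j, |inner ℝ (EuclideanSpace.single j (1 : ℝ)) x| := by
  have h := (EuclideanSpace.basisFun (Fin d) ℝ).sum_repr' x
  conv_lhs => rw [← h]
  refine (norm_sum_le _ _).trans (Finset.sum_le_sum fun j _ => ?_)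
  rw [norm_smul, EuclideanSpace.basisFun_apply]
  simp

/-- Testing against the basis vectors gives Hölder continuity on each set of the cover. Since each
set lies in the interior of the next, this yields continuity at every point of `Θ`. -/
theorem continuousOn_meanField (hS : Setting Θ K P H π W p α υ γ₀ β) :
    ContinuousOn (meanField H π) Θ := by
  obtain ⟨κ, s, hκ0, hκ1, hκp, hκυ, hκα, -⟩ :=
    exists_exponents hS.one_lt_p hS.alpha_mem hS.upsilon_mem hS.beta_mem
  have hcomp : ∀ i, ContinuousOn (meanField H π) (K i) := by
    intro i
    have h1 : ∀ j : Fin d, ∃ C : ℝ, ∀ θ ∈ K i, ∀ θ' ∈ K i,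
        |inner ℝ (EuclideanSpace.single j (1 : ℝ)) (meanField H π θ - meanField H π θ')| ≤
          C * ‖θ - θ'‖ ^ κ := by
      intro j
      obtain ⟨C, r, -, -, -, h⟩ := hS.exists_inner_holder (hS.cover.compact i) (hS.subset_theta i)
        (v := fun _ => EuclideanSpace.single j (1 : ℝ)) measurable_const (B := 1) (by simp)
        (fun θ _ θ' _ => by simp; positivity) hκ0 hκα hκυ
      exact ⟨C, fun θ hθ θ' hθ' => by rw [inner_sub_right]; exact h θ hθ θ' hθ'⟩
    choose C hC using h1
    have h2 : ∀ θ ∈ K i, ∀ θ' ∈ K i, ‖meanField H π θ - meanField H π θ'‖ ≤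
        (∑ j, C j) * ‖θ - θ'‖ ^ κ := fun θ hθ θ' hθ' => by
      refine (norm_le_sum_abs _).trans ?_
      rw [Finset.sum_mul]
      exact Finset.sum_le_sum fun j _ => hC j θ hθ θ' hθ'
    intro θ' hθ'
    rw [ContinuousWithinAt, tendsto_iff_norm_sub_tendsto_zero]
    have h3 : Tendsto (fun θ => (∑ j, C j) * ‖θ - θ'‖ ^ κ) (𝓝[K i] θ') (𝓝 0) := by
      have h4 : Continuous fun θ : E d => (∑ j, C j) * ‖θ - θ'‖ ^ κ :=
        continuous_const.mul ((continuous_id.sub continuous_const).norm.rpow_const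
          fun _ => Or.inr hκ0.le)
      have := h4.tendsto θ'
      simp only [sub_self, norm_zero, Real.zero_rpow hκ0.ne', mul_zero] at this
      exact this.mono_left nhdsWithin_le_nhds
    refine tendsto_of_tendsto_of_tendsto_of_le_of_le' tendsto_const_nhds h3
      (Eventually.of_forall fun _ => norm_nonneg _) ?_
    filter_upwards [self_mem_nhdsWithin] with θ hθ
    exact h2 θ hθ θ' hθ'
  intro θ hθ
  rw [← hS.cover.iUnion_eq] at hθ
  obtain ⟨i, hi⟩ := mem_iUnion.1 hθ
  exact ((hcomp (i + 1)).continuousAt (mem_interior_iff_mem_nhds.1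
    (hS.cover.subset_interior i hi))).continuousWithinAt

/-- Maximal inequality for the noise of the algorithm tested against `v`. -/
theorem exists_algNoise_rate (hS : Setting Θ K P H π W p α υ γ₀ β) {𝒦 : Set (E d)}
    (h𝒦 : IsCompact 𝒦) (hΘ : 𝒦 ⊆ Θ) {v : E d → E d} (hv : Measurable v) {B : ℝ}
    (hvB : ∀ θ ∈ 𝒦, ‖v θ‖ ≤ B) (hvα : ∀ θ ∈ 𝒦, ∀ θ' ∈ 𝒦, ‖v θ - v θ'‖ ≤ B * ‖θ - θ'‖ ^ α)
    (xs : X) (θs : E d) :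
    ∃ gbar : E d → ℝ, Measurable gbar ∧ (∀ θ ∈ 𝒦, gbar θ = inner ℝ (v θ) (meanField H π θ)) ∧
      ∃ R : ℝ → ℕ → ℝ≥0∞, (∀ δ, Tendsto (R δ) atTop (𝓝 0)) ∧
      ∀ (i : ℕ) (s : State X d), (halfPoint xs θs s).1 ∈ 𝒦 → ∀ δ : ℝ, 0 < δ → δ ≤ 1 → ∀ m : ℕ,
      (chainLaw (stepKernel P K H (polyStep γ₀ β) xs θs)
        (isMarkovKernel_stepKernel P hS.measurableSet_cover hS.measurable_H _ xs θs) s)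
        {ω | ∃ n, m ≤ n ∧ ω ∈ survival (levelSet X d i) (aliveSet X 𝒦 i) n ∧
          δ < |∑ k ∈ Finset.Ico m (n + 1), algNoise (polyStep γ₀ β)
            (fun θ x => inner ℝ (v θ) (H θ x)) gbar xs θs k ω|} ≤
        ENNReal.ofReal (W (halfPoint xs θs s).2 ^ p) * R δ (s.index + s.count + m) := by
  classical
  obtain ⟨κ, s, hκ0, hκ1, hκp, hκυ, hκα, hsα, hsp, hβκ⟩ :=
    exists_exponents hS.one_lt_p hS.alpha_mem hS.upsilon_mem hS.beta_mem
  obtain ⟨C, r, hB, hg, hH, hm⟩ := hS.exists_inner_holder h𝒦 hΘ hv hvB hvα hκ0 hκα hκυ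
  have h𝒦m := h𝒦.measurableSet
  obtain ⟨lag, hlag⟩ := exists_lag hS.gamma_pos hS.beta_pos hB.r_mem hκ0
    (zero_lt_one.trans hS.one_lt_p) hβκ
  have hmf := (hS.continuousOn_meanField).mono hΘ
  have hvc : ContinuousOn v 𝒦 := by
    intro θ' hθ'
    rw [ContinuousWithinAt, tendsto_iff_norm_sub_tendsto_zero]
    have h3 : Tendsto (fun θ => B * ‖θ - θ'‖ ^ α) (𝓝[𝒦] θ') (𝓝 0) := by
      have h4 : Continuous fun θ : E d => B * ‖θ - θ'‖ ^ α :=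
        continuous_const.mul ((continuous_id.sub continuous_const).norm.rpow_const
          fun _ => Or.inr hS.alpha_mem.1.le)
      have := h4.tendsto θ'
      simp only [sub_self, norm_zero, Real.zero_rpow hS.alpha_mem.1.ne', mul_zero] at this
      exact this.mono_left nhdsWithin_le_nhds
    refine tendsto_of_tendsto_of_tendsto_of_le_of_le' tendsto_const_nhds h3
      (Eventually.of_forall fun _ => norm_nonneg _) ?_
    filter_upwards [self_mem_nhdsWithin] with θ hθ
    exact hvα θ hθ θ' hθ'
  -- The mean is extended by zero outside `𝒦`: its measurability comes from continuity on `𝒦`.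
  obtain ⟨gbar, hgbar⟩ : ∃ gbar : E d → ℝ, gbar = 𝒦.piecewise
      (fun θ => inner ℝ (v θ) (meanField H π θ)) (fun _ => 0) := ⟨_, rfl⟩
  have hgm : Measurable gbar := by
    rw [hgbar]
    exact (hvc.inner hmf).measurable_piecewise continuousOn_const h𝒦m
  have hge : ∀ θ ∈ 𝒦, gbar θ = inner ℝ (v θ) (meanField H π θ) := fun θ hθ => by
    rw [hgbar, piecewise_eq_of_mem _ _ _ hθ]
  have hgb : ∀ θ ∈ 𝒦, gbar θ = ∫ x, inner ℝ (v θ) (H θ x) ∂(π θ) := fun θ hθ => by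
    rw [hge θ hθ, inner_meanField hS.measurable_H hS.field h𝒦 hΘ hB (v θ) hθ]
  have hmean : ∀ θ ∈ 𝒦, ∀ θ' ∈ 𝒦, |gbar θ - gbar θ'| ≤ C * ‖θ - θ'‖ ^ κ :=
    fun θ hθ θ' hθ' => by
      rw [hge θ hθ, hge θ' hθ']
      exact hm θ hθ θ' hθ'
  have hγp := polyStep_pos (β := β) hS.gamma_pos
  have hMk := isMarkovKernel_retainKernel P hS.measurable_H (polyStep γ₀ β) h𝒦m
  have hD := isDriven_retainKernel P hS.measurable_H (fun n => (hγp n).le) h𝒦m hB.C_pos.le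
    (fun x => (hB.W_pos x).le) hH
  obtain ⟨R, hR, hle⟩ := hD.exists_noise_rate hB hg h𝒦m hγp
    (antitone_polyStep hS.gamma_pos hS.beta_pos) (tendsto_polyStep hS.beta_pos) hS.one_lt_p hκ0
    hκ1 hκp hgm hgb hmean hsα hsp hlag
  refine ⟨gbar, hgm, hge, R, hR, fun i s hs δ hδ hδ1 m => ?_⟩
  exact (measure_exists_algNoise_le hS.measurableSet_cover hS.measurable_H xs θs h𝒦m i
    hg.measurable hgm δ s m).trans (hle (restartMap xs θs s) hs δ hδ hδ1 m)

end Setting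

end Setting

/-! ### Descent of the Lyapunov function and stability of perturbed recursions -/

section Lyapunov

variable {d : ℕ} {Θ : Set (E d)} {h : E d → E d} {w : E d → ℝ}

namespace IsLyapunov

theorem continuousOn (hw : IsLyapunov Θ h w) : ContinuousOn w Θ := hw.contDiffOn.continuousOn

theorem hasFDerivAt (hw : IsLyapunov Θ h w) (hΘ : IsOpen Θ) {θ : E d} (hθ : θ ∈ Θ) :
    HasFDerivAt w (fderiv ℝ w θ) θ :=
  ((hw.contDiffOn.differentiableOn one_ne_zero).differentiableAt (hΘ.mem_nhds hθ)).hasFDerivAt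

theorem fderiv_apply (θ v : E d) : fderiv ℝ w θ v = inner ℝ (gradient w θ) v := by
  rw [gradient, InnerProductSpace.toDual_symm_apply]

theorem continuousOn_gradient (hw : IsLyapunov Θ h w) (hΘ : IsOpen Θ) :
    ContinuousOn (gradient w) Θ :=
  (InnerProductSpace.toDual ℝ (E d)).symm.continuous.comp_continuousOn
    (hw.contDiffOn.continuousOn_fderiv_of_isOpen hΘ le_rfl)

theorem inner_le_zero (hw : IsLyapunov Θ h w) {θ : E d} (hθ : θ ∈ Θ) :
    inner ℝ (gradient w θ) (h θ) ≤ 0 := by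
  by_cases hL : θ ∈ stationarySet Θ w h
  · exact hL.2.le
  · exact (hw.inner_neg θ ⟨hθ, hL⟩).le

/-- Compact level sets give `w` a minimizer on the open set `Θ`, where the gradient vanishes. -/
theorem stationarySet_nonempty (hw : IsLyapunov Θ h w) (hΘ : IsOpen Θ) (hne : Θ.Nonempty) :
    (stationarySet Θ w h).Nonempty := by
  obtain ⟨θ₁, hθ₁⟩ := hne
  have hc := hw.isCompact_level (w θ₁ + 1) (by linarith [hw.nonneg θ₁ hθ₁])
  obtain ⟨θ₀, hθ₀, hmin⟩ := hc.exists_isMinOn ⟨θ₁, hθ₁, by linarith⟩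
    (hw.continuousOn.mono fun θ hθ => hθ.1)
  have hmin1 : ∀ θ ∈ Θ, w θ₀ ≤ w θ := by
    intro θ hθ
    by_cases h1 : w θ ≤ w θ₁ + 1
    · exact hmin ⟨hθ, h1⟩
    · linarith [hθ₀.2]
  have hloc : IsLocalMin w θ₀ := by
    filter_upwards [hΘ.mem_nhds hθ₀.1] with θ hθ
    exact hmin1 θ hθ
  refine ⟨θ₀, hθ₀.1, ?_⟩
  rw [← fderiv_apply, hloc.fderiv_eq_zero]
  simp

/-- A compact subset of `Θ` has a neighbourhood on which `w` is nearly constant at small scale. -/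
theorem exists_radius (hw : IsLyapunov Θ h w) (hΘ : IsOpen Θ) {𝒦 : Set (E d)} (h𝒦 : IsCompact 𝒦)
    (hsub : 𝒦 ⊆ Θ) {ε : ℝ} (hε : 0 < ε) :
    ∃ ρ, 0 < ρ ∧ ∀ z ∈ 𝒦, ∀ y, ‖y - z‖ < ρ → y ∈ Θ ∧ |w y - w z| < ε := by
  obtain ⟨ρ₁, hρ₁, h1⟩ := h𝒦.exists_thickening_subset_open hΘ hsub
  have h2 := h𝒦.uniformContinuousAt_of_continuousAt w
    (fun θ hθ => hw.continuousOn.continuousAt (hΘ.mem_nhds (hsub hθ))) (Metric.dist_mem_uniformity hε)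
  obtain ⟨ρ₂, hρ₂, h3⟩ := Metric.mem_uniformity_dist.1 h2
  refine ⟨min ρ₁ ρ₂, lt_min hρ₁ hρ₂, fun z hz y hy => ⟨h1 ?_, ?_⟩⟩
  · rw [Metric.mem_thickening_iff]
    exact ⟨z, hz, by rw [dist_eq_norm]; exact hy.trans_le (min_le_left _ _)⟩
  · have h4 : dist z y < ρ₂ := by
      rw [dist_comm, dist_eq_norm]; exact hy.trans_le (min_le_right _ _)
    have h5 : dist (w z) (w y) < ε := h3 h4 hz
    rwa [dist_comm, Real.dist_eq] at h5

/-- Uniform decrease of `w` along `h`, away from the stationary set. -/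
theorem exists_descent (hw : IsLyapunov Θ h w) (hΘ : IsOpen Θ) (hh : ContinuousOn h Θ)
    {B : Set (E d)} (hB : IsCompact B) (hsub : B ⊆ Θ) (hL : Disjoint B (stationarySet Θ w h)) :
    ∃ η ρ, 0 < η ∧ 0 < ρ ∧ ∀ z ∈ B, ∀ θ, ‖θ - z‖ < ρ → ∀ γ, 0 ≤ γ → γ * ‖h θ‖ < ρ →
      w (z + γ • h θ) ≤ w z - η * γ := by
  have hg := hw.continuousOn_gradient hΘ
  -- The descent rate on the compact set is at least `2 η`; half of it is kept as a reserve for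
  -- perturbations of the two arguments.
  obtain ⟨η, hη, hBη⟩ : ∃ η, 0 < η ∧ ∀ z ∈ B, inner ℝ (gradient w z) (h z) ≤ -(2 * η) := by
    rcases B.eq_empty_or_nonempty with rfl | hne
    · exact ⟨1, one_pos, by simp⟩
    · have hin : ContinuousOn (fun z => inner ℝ (gradient w z) (h z)) B :=
        (hg.mono hsub).inner (hh.mono hsub)
      obtain ⟨z₀, hz₀, hmax⟩ := hB.exists_isMaxOn hne hin
      have hneg := hw.inner_neg z₀ ⟨hsub hz₀, fun hz => (disjoint_left.1 hL) hz₀ hz⟩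
      refine ⟨-(inner ℝ (gradient w z₀) (h z₀)) / 2, by linarith, fun z hz => ?_⟩
      have : inner ℝ (gradient w z) (h z) ≤ inner ℝ (gradient w z₀) (h z₀) := hmax hz
      linarith
  obtain ⟨ρ₁, hρ₁, h1⟩ := hB.exists_thickening_subset_open hΘ hsub
  -- The gradient and `h` will be evaluated at different points near `z`; continuity uniform near
  -- the diagonal handles both at once.
  have hdiag : IsCompact ((fun z : E d => (z, z)) '' B) := hB.image (by fun_prop)
  obtain ⟨F, hF⟩ : ∃ F : E d × E d → ℝ, F = fun q => inner ℝ (gradient w q.1) (h q.2) :=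
    ⟨_, rfl⟩
  have h2 := hdiag.uniformContinuousAt_of_continuousAt F (by
      rintro _ ⟨z, hz, rfl⟩
      have e1 : ContinuousAt (fun q : E d × E d => gradient w q.1) (z, z) :=
        ContinuousAt.comp (f := Prod.fst) (g := gradient w)
          (hg.continuousAt (hΘ.mem_nhds (hsub hz))) continuousAt_fst
      have e2 : ContinuousAt (fun q : E d × E d => h q.2) (z, z) :=
        ContinuousAt.comp (f := Prod.snd) (g := h)
          (hh.continuousAt (hΘ.mem_nhds (hsub hz))) continuousAt_snd
      rw [hF]
      exact e1.inner e2) (Metric.dist_mem_uniformity hη)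
  obtain ⟨ρ₂, hρ₂, h3⟩ := Metric.mem_uniformity_dist.1 h2
  have h4 : ∀ z ∈ B, ∀ y θ, ‖y - z‖ < ρ₂ → ‖θ - z‖ < ρ₂ →
      inner ℝ (gradient w y) (h θ) ≤ -η := by
    intro z hz y θ hy hθ
    have h5 : dist ((z, z) : E d × E d) (y, θ) < ρ₂ := by
      rw [Prod.dist_eq, max_lt_iff, dist_comm, dist_eq_norm, dist_comm z θ, dist_eq_norm]
      exact ⟨hy, hθ⟩
    have h6 : dist (F (z, z)) (F (y, θ)) < η := h3 h5 (mem_image_of_mem _ hz)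
    rw [Real.dist_eq, abs_lt, hF] at h6
    dsimp only at h6
    linarith [hBη z hz, h6.1]
  refine ⟨η, min ρ₁ ρ₂, hη, lt_min hρ₁ hρ₂, fun z hz θ hθ γ hγ hγh => ?_⟩
  have hnear : ∀ t ∈ Icc 0 γ, ‖z + t • h θ - z‖ < min ρ₁ ρ₂ := by
    intro t ht
    rw [add_sub_cancel_left, norm_smul, Real.norm_of_nonneg ht.1]
    exact (mul_le_mul_of_nonneg_right ht.2 (norm_nonneg _)).trans_lt hγh
  have hmem : ∀ t ∈ Icc 0 γ, z + t • h θ ∈ Θ := fun t ht => h1 <| by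
    rw [Metric.mem_thickening_iff]
    exact ⟨z, hz, by rw [dist_eq_norm]; exact (hnear t ht).trans_le (min_le_left _ _)⟩
  have hder : ∀ t ∈ Icc 0 γ, HasDerivAt (fun t : ℝ => w (z + t • h θ))
      (inner ℝ (gradient w (z + t • h θ)) (h θ)) t := by
    intro t ht
    have e1 : HasDerivAt (fun t : ℝ => z + t • h θ) (h θ) t := by
      simpa using ((hasDerivAt_id t).smul_const (h θ)).const_add z
    have := (hw.hasFDerivAt hΘ (hmem t ht)).comp_hasDerivAt t e1
    rwa [fderiv_apply] at this
  have h7 := (convex_Icc (0 : ℝ) γ).image_sub_le_mul_sub_of_deriv_le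
    (f := fun t : ℝ => w (z + t • h θ)) (C := -η)
    (fun t ht => (hder t ht).continuousAt.continuousWithinAt)
    (fun t ht => (hder t (interior_subset ht)).differentiableAt.differentiableWithinAt)
    (fun t ht => by
      rw [(hder t (interior_subset ht)).deriv]
      exact h4 z hz _ θ ((hnear t (interior_subset ht)).trans_le (min_le_right _ _))
        (hθ.trans_le (min_le_right _ _))) 0 ⟨le_rfl, hγ⟩ γ ⟨hγ, le_rfl⟩ hγ
  simp only [zero_smul, add_zero, sub_zero] at h7
  linarith

/-- With small steps and small accumulated noise the recursion stays in a level set. -/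
theorem exists_stable (hw : IsLyapunov Θ h w) (hΘ : IsOpen Θ) (hh : ContinuousOn h Θ)
    {M : ℝ} (hM : 0 ≤ M) (hLM : ∀ θ ∈ stationarySet Θ w h, w θ ≤ M) :
    ∃ δ γmax, 0 < δ ∧ δ ≤ 1 ∧ 0 < γmax ∧ ∀ (x u : ℕ → E d) (γ : ℕ → ℝ) (n : ℕ),
      x 0 ∈ Θ → w (x 0) ≤ M →
      (∀ k < n, 0 ≤ γ k ∧ γ k ≤ γmax ∧ x (k + 1) = x k + γ k • h (x k) + u k) →
      (∀ k ≤ n, ‖∑ j ∈ Finset.range k, u j‖ ≤ δ) → x n ∈ {θ | θ ∈ Θ ∧ w θ ≤ M + 1} := by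
  have hc1 := hw.isCompact_level (M + 1) (by linarith)
  have hs1 : {θ | θ ∈ Θ ∧ w θ ≤ M + 1} ⊆ Θ := fun θ hθ => hθ.1
  obtain ⟨ρ₁, hρ₁, h1⟩ := hw.exists_radius hΘ hc1 hs1 (ε := 1 / 4) (by norm_num)
  -- The shell `M + 1/4 ≤ w ≤ M + 1` contains no stationary point, so `w` decreases uniformly there.
  obtain ⟨B, hBdef⟩ : ∃ B : Set (E d), B = {θ | θ ∈ Θ ∧ w θ ≤ M + 1} ∩ w ⁻¹' Ici (M + 1 / 4) :=
    ⟨_, rfl⟩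
  have hB : IsCompact B := by
    rw [hBdef]
    exact hc1.of_isClosed_subset ((hw.continuousOn.mono hs1).preimage_isClosed_of_isClosed
      hc1.isClosed isClosed_Ici) inter_subset_left
  have hBL : Disjoint B (stationarySet Θ w h) := by
    rw [disjoint_left, hBdef]
    rintro θ ⟨-, hθ⟩ hL
    have h2 := hLM θ hL
    have h3 : M + 1 / 4 ≤ w θ := hθ
    linarith
  obtain ⟨η, ρ₂, hη, hρ₂, h2⟩ := hw.exists_descent hΘ hh hB
    (by rw [hBdef]; exact inter_subset_left.trans hs1) hBL
  obtain ⟨A, hA⟩ := hc1.exists_bound_of_continuousOn (hh.mono hs1)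
  obtain ⟨ρ, hρ⟩ : ∃ ρ, ρ = min (min ρ₁ ρ₂) 1 := ⟨_, rfl⟩
  have hρ0 : 0 < ρ := by rw [hρ]; exact lt_min (lt_min hρ₁ hρ₂) one_pos
  have hρ1 : ρ ≤ ρ₁ := by rw [hρ]; exact (min_le_left _ _).trans (min_le_left _ _)
  have hρ2 : ρ ≤ ρ₂ := by rw [hρ]; exact (min_le_left _ _).trans (min_le_right _ _)
  have hρ3 : ρ ≤ 1 := by rw [hρ]; exact min_le_right _ _
  have hA1 : 0 < |A| + 1 := by positivity
  -- Accumulated noise up to `ρ / 2` and drift steps below `ρ` keep every point within the radii of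
  -- the two local estimates.
  refine ⟨ρ / 2, ρ / 2 / (|A| + 1), by positivity, by linarith, by positivity,
    fun x u γ n hx0 hx0M hrec hsum => ?_⟩
  -- The invariant concerns `z k = x k - Σ u j`, which moves by `γ k • h (x k)` only. Below `M +
  -- 1/4` one step raises `w` by less than `1/4`; above, it lowers `w`. Thus `w (z k) ≤ M + 1/2`,
  -- and `x k` is close enough to `z k` for `w (x k) ≤ M + 1`.
  have key : ∀ k ≤ n, (x k - ∑ j ∈ Finset.range k, u j ∈ Θ ∧
      w (x k - ∑ j ∈ Finset.range k, u j) ≤ M + 1 / 2) ∧ x k ∈ {θ | θ ∈ Θ ∧ w θ ≤ M + 1} := by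
    have second : ∀ k ≤ n, (x k - ∑ j ∈ Finset.range k, u j ∈ Θ ∧
      w (x k - ∑ j ∈ Finset.range k, u j) ≤ M + 1 / 2) → x k ∈ {θ | θ ∈ Θ ∧ w θ ≤ M + 1} := by
      intro k hk h3
      have h4 := h1 (x k - ∑ j ∈ Finset.range k, u j) ⟨h3.1, by linarith [h3.2]⟩ (x k) (by
        rw [sub_sub_cancel]
        linarith [hsum k hk])
      exact ⟨h4.1, by linarith [(abs_lt.1 h4.2).2, h3.2]⟩
    intro k
    induction k with
    | zero =>
      intro _
      simp only [Finset.range_zero, Finset.sum_empty, sub_zero]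
      exact ⟨⟨hx0, by linarith⟩, hx0, by linarith⟩
    | succ k ih =>
      intro hk
      obtain ⟨⟨hz, hzM⟩, hxk⟩ := ih (by omega)
      obtain ⟨hγ0, hγ1, hr⟩ := hrec k (by omega)
      have first : x (k + 1) - ∑ j ∈ Finset.range (k + 1), u j ∈ Θ ∧
          w (x (k + 1) - ∑ j ∈ Finset.range (k + 1), u j) ≤ M + 1 / 2 := by
        have e : x (k + 1) - ∑ j ∈ Finset.range (k + 1), u j =
            (x k - ∑ j ∈ Finset.range k, u j) + γ k • h (x k) := by
          rw [hr, Finset.sum_range_succ]; abel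
        have hγh : γ k * ‖h (x k)‖ < ρ := by
          calc γ k * ‖h (x k)‖ ≤ ρ / 2 / (|A| + 1) * (|A| + 1) :=
                mul_le_mul hγ1 ((hA _ hxk).trans (by linarith [le_abs_self A]))
                  (norm_nonneg _) (by positivity)
            _ = ρ / 2 := by field_simp
            _ < ρ := by linarith
        rw [e]
        have h4 := h1 (x k - ∑ j ∈ Finset.range k, u j) ⟨hz, by linarith⟩
          ((x k - ∑ j ∈ Finset.range k, u j) + γ k • h (x k)) (by
            rw [add_sub_cancel_left, norm_smul, Real.norm_of_nonneg hγ0]; linarith)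
        refine ⟨h4.1, ?_⟩
        by_cases hcase : w (x k - ∑ j ∈ Finset.range k, u j) ≤ M + 1 / 4
        · linarith [(abs_lt.1 h4.2).2]
        · have h5 := h2 (x k - ∑ j ∈ Finset.range k, u j) (by
            rw [hBdef]
            exact ⟨⟨hz, by linarith⟩, (not_le.1 hcase).le⟩) (x k) (by
              rw [sub_sub_cancel]; linarith [hsum k (by omega)]) (γ k) hγ0 (by linarith)
          have : 0 ≤ η * γ k := by positivity
          linarith
      exact ⟨first, second (k + 1) hk first⟩
  exact (key n le_rfl).2

end IsLyapunov

end Lyapunov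

/-! ### Convergence to one connected component -/

section Components

variable {F : Type*} [MetricSpace F]

/-- A sequence with vanishing increments that approaches a compact set approaches one of its
connected components. -/
theorem exists_tendsto_infDist_connectedComponentIn {L : Set F} (hL : IsCompact L)
    (hne : L.Nonempty) {x : ℕ → F} (hx : Tendsto (fun k => Metric.infDist (x k) L) atTop (𝓝 0))
    (hinc : Tendsto (fun k => dist (x (k + 1)) (x k)) atTop (𝓝 0)) :
    ∃ θ₀ ∈ L, Tendsto (fun k => Metric.infDist (x k) (connectedComponentIn L θ₀)) atTop (𝓝 0) := by
  choose y hyL hy using fun k => hL.exists_infDist_eq_dist hne (x k)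
  -- The component is the one of a cluster point of the nearest points in `L`.
  obtain ⟨θ₀, hθ₀, φ, hφ, hlim⟩ := hL.tendsto_subseq hyL
  refine ⟨θ₀, hθ₀, ?_⟩
  have : CompactSpace L := isCompact_iff_compactSpace.1 hL
  rw [Metric.tendsto_atTop]
  intro ε hε
  obtain ⟨V, hV⟩ : ∃ V : Set L, V =
      {z : L | Metric.infDist (z : F) (connectedComponentIn L θ₀) < ε / 2} := ⟨_, rfl⟩
  have hVo : IsOpen V := by
    rw [hV]
    exact isOpen_lt ((Metric.continuous_infDist_pt _).comp continuous_subtype_val) continuous_const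
  have hCV : connectedComponent (⟨θ₀, hθ₀⟩ : L) ⊆ V := by
    intro z hz
    rw [hV]
    have : (z : F) ∈ connectedComponentIn L θ₀ := by
      rw [connectedComponentIn_eq_image hθ₀]
      exact mem_image_of_mem _ hz
    change Metric.infDist (z : F) _ < ε / 2
    rw [Metric.infDist_zero_of_mem this]
    linarith
  -- In a compact Hausdorff space a component is the intersection of its clopen neighbourhoods, so
  -- some clopen `Z` containing `θ₀` lies in the neighbourhood `V` of the component.
  obtain ⟨Z, hZc, hZ0, hZV⟩ : ∃ Z : Set L, IsClopen Z ∧ (⟨θ₀, hθ₀⟩ : L) ∈ Z ∧ Z ⊆ V := by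
    have : Nonempty {s : Set L // IsClopen s ∧ (⟨θ₀, hθ₀⟩ : L) ∈ s} :=
      ⟨⟨univ, isClopen_univ, mem_univ _⟩⟩
    obtain ⟨⟨Z, hZ⟩, hZV⟩ := exists_subset_nhds_of_compactSpace
      (V := fun s : {s : Set L // IsClopen s ∧ (⟨θ₀, hθ₀⟩ : L) ∈ s} => (s : Set L))
      (fun s t => ⟨⟨s.1 ∩ t.1, s.2.1.inter t.2.1, s.2.2, t.2.2⟩, inter_subset_left,
        inter_subset_right⟩) (fun s => s.2.1.isClosed) (U := V) (fun z hz => hVo.mem_nhds (hCV (by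
          rw [connectedComponent_eq_iInter_isClopen]; exact hz)))
    exact ⟨Z, hZ.1, hZ.2, hZV⟩
  have hA : IsCompact (Subtype.val '' Z) := hZc.isClosed.isCompact.image continuous_subtype_val
  have hB : IsCompact (Subtype.val '' Zᶜ) :=
    hZc.compl.isClosed.isCompact.image continuous_subtype_val
  have hAB : Disjoint (Subtype.val '' Z) (Subtype.val '' Zᶜ) :=
    (disjoint_image_iff Subtype.val_injective).2 disjoint_compl_right
  obtain ⟨r, hr, hdisj⟩ := hAB.exists_thickenings hA hB.isClosed
  have hdisj' : ∀ a ∈ Metric.thickening r (Subtype.val '' Z),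
      a ∉ Metric.thickening r (Subtype.val '' Zᶜ) := fun a ha => disjoint_left.1 hdisj ha
  -- Going from `y k` to `x k`, `x (k + 1)` and `y (k + 1)` takes three moves shorter than `r / 3`,
  -- too little to cross from `Z` to its complement. The bound `ε / 2` is for the final distance.
  obtain ⟨r', hr'⟩ : ∃ r', r' = min (r / 3) (ε / 2) := ⟨_, rfl⟩
  have hr'0 : 0 < r' := by rw [hr']; exact lt_min (by linarith) (by linarith)
  have hr'1 : r' ≤ r / 3 := by rw [hr']; exact min_le_left _ _
  have hr'2 : r' ≤ ε / 2 := by rw [hr']; exact min_le_right _ _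
  have e1 := hx.eventually (gt_mem_nhds hr'0)
  have e2 := hinc.eventually (gt_mem_nhds hr'0)
  obtain ⟨N, hN⟩ := eventually_atTop.1 (e1.and e2)
  have hyr : ∀ k, N ≤ k → dist (x k) (y k) < r' := fun k hk => by
    rw [← hy k]; exact (hN k hk).1
  have hstep : ∀ k, N ≤ k → y k ∈ Subtype.val '' Z → y (k + 1) ∈ Subtype.val '' Z := by
    intro k hk hyk
    by_contra hnot
    have hyB : y (k + 1) ∈ Subtype.val '' Zᶜ :=
      ⟨⟨y (k + 1), hyL _⟩, fun h => hnot ⟨_, h, rfl⟩, rfl⟩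
    refine hdisj' (y (k + 1)) ?_
      (Metric.self_subset_thickening hr _ hyB)
    refine Metric.mem_thickening_iff.2 ⟨y k, hyk, ?_⟩
    have h1 := hyr k hk
    have h2 := hyr (k + 1) (by omega)
    have h3 := (hN k hk).2
    have h4 := dist_triangle (y (k + 1)) (x (k + 1)) (y k)
    have h5 := dist_triangle (x (k + 1)) (x k) (y k)
    rw [dist_comm (y (k + 1)) (x (k + 1))] at h4
    linarith
  obtain ⟨k₀, hk₀, hyk₀⟩ : ∃ k₀, N ≤ k₀ ∧ y k₀ ∈ Subtype.val '' Z := by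
    have h1 := Metric.tendsto_atTop.1 hlim r hr
    obtain ⟨n, hn⟩ := h1
    refine ⟨φ (max n N), (le_max_right n N).trans (hφ.id_le _), ?_⟩
    by_contra hnot
    have hyB : y (φ (max n N)) ∈ Subtype.val '' Zᶜ :=
      ⟨⟨_, hyL _⟩, fun h => hnot ⟨_, h, rfl⟩, rfl⟩
    refine hdisj' (y (φ (max n N))) ?_
      (Metric.self_subset_thickening hr _ hyB)
    exact Metric.mem_thickening_iff.2 ⟨θ₀, ⟨⟨θ₀, hθ₀⟩, hZ0, rfl⟩, hn _ (le_max_left n N)⟩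
  refine ⟨k₀, fun k hk => ?_⟩
  have hyk : y k ∈ Subtype.val '' Z := by
    induction k, hk using Nat.le_induction with
    | base => exact hyk₀
    | succ k hk ih => exact hstep k (hk₀.trans hk) ih
  rw [Real.dist_eq, sub_zero, abs_of_nonneg Metric.infDist_nonneg]
  obtain ⟨z, hz, hzy⟩ := hyk
  have h1 : Metric.infDist (z : F) (connectedComponentIn L θ₀) < ε / 2 := by
    have := hZV hz
    rwa [hV] at this
  have h2 := Metric.infDist_le_infDist_add_dist (s := connectedComponentIn L θ₀) (x := x k) (y := z)
  have h3 := hyr k (hk₀.trans hk)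
  rw [← hzy] at h3
  linarith

end Components

/-! ### Noise-free shadow sequences and convergence of the Lyapunov function -/

section Shadow

variable {d : ℕ} {Θ : Set (E d)} {h : E d → E d} {w : E d → ℝ}

/-- A sequence `x` in a compact set, and a recursion `y` driven by `h` along `x` that is
asymptotic to `x`. -/
structure IsShadow (Θ : Set (E d)) (h : E d → E d) (γ : ℕ → ℝ) (𝒦 : Set (E d)) (x y : ℕ → E d) :
    Prop where
  isCompact : IsCompact 𝒦
  subset : 𝒦 ⊆ Θ
  mem : ∀ k, x k ∈ 𝒦
  tendsto_sub : Tendsto (fun k => ‖x k - y k‖) atTop (𝓝 0)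
  succ_eq : ∀ k, y (k + 1) = y k + γ k • h (x k)
  step_nonneg : ∀ k, 0 ≤ γ k
  step_tendsto : Tendsto γ atTop (𝓝 0)
  step_sum : Tendsto (fun n => ∑ k ∈ Finset.range n, γ k) atTop atTop

namespace IsShadow

variable {γ : ℕ → ℝ} {𝒦 : Set (E d)} {x y : ℕ → E d}

theorem exists_bound (hs : IsShadow Θ h γ 𝒦 x y) (hh : ContinuousOn h Θ) :
    ∃ A, 0 < A ∧ ∀ k, ‖h (x k)‖ ≤ A := by
  obtain ⟨A, hA⟩ := hs.isCompact.exists_bound_of_continuousOn (hh.mono hs.subset)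
  exact ⟨|A| + 1, by positivity, fun k => (hA _ (hs.mem k)).trans (by linarith [le_abs_self A])⟩

theorem tendsto_step (hs : IsShadow Θ h γ 𝒦 x y) (hh : ContinuousOn h Θ) :
    Tendsto (fun k => γ k * ‖h (x k)‖) atTop (𝓝 0) := by
  obtain ⟨A, -, hA⟩ := hs.exists_bound hh
  refine squeeze_zero (fun k => mul_nonneg (hs.step_nonneg k) (norm_nonneg _))
    (fun k => mul_le_mul_of_nonneg_left (hA k) (hs.step_nonneg k)) ?_
  simpa using hs.step_tendsto.mul_const A

theorem norm_succ_sub (hs : IsShadow Θ h γ 𝒦 x y) (k : ℕ) :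
    ‖y (k + 1) - y k‖ = γ k * ‖h (x k)‖ := by
  rw [hs.succ_eq, add_sub_cancel_left, norm_smul, Real.norm_of_nonneg (hs.step_nonneg k)]

theorem tendsto_increment (hs : IsShadow Θ h γ 𝒦 x y) (hh : ContinuousOn h Θ) :
    Tendsto (fun k => ‖x (k + 1) - x k‖) atTop (𝓝 0) := by
  have h1 := ((hs.tendsto_sub.comp (tendsto_add_atTop_nat 1)).add (hs.tendsto_step hh)).add
    hs.tendsto_sub
  simp only [add_zero] at h1
  refine squeeze_zero (fun k => norm_nonneg _) (fun k => ?_) h1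
  have e : x (k + 1) - x k = (x (k + 1) - y (k + 1)) + (y (k + 1) - y k) - (x k - y k) := by abel
  rw [e, Function.comp_apply, ← hs.norm_succ_sub]
  exact (norm_sub_le _ _).trans (add_le_add (norm_add_le _ _) le_rfl)

/-- Eventually `y` lies in a compact neighbourhood of `𝒦`. -/
theorem exists_compact (hs : IsShadow Θ h γ 𝒦 x y) (hΘ : IsOpen Θ) :
    ∃ 𝒦' ⊆ Θ, IsCompact 𝒦' ∧ ∀ᶠ k in atTop, y k ∈ 𝒦' := by
  obtain ⟨ρ, hρ, h1⟩ := hs.isCompact.exists_cthickening_subset_open hΘ hs.subset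
  refine ⟨_, h1, hs.isCompact.cthickening, ?_⟩
  filter_upwards [hs.tendsto_sub.eventually (gt_mem_nhds hρ)] with k hk
  refine Metric.mem_cthickening_of_dist_le (y k) (x k) ρ 𝒦 (hs.mem k) ?_
  rw [dist_comm, dist_eq_norm]
  exact hk.le

/-- The values of `w` along `y` and along `x` have the same limit. -/
theorem tendsto_sub_lyapunov (hs : IsShadow Θ h γ 𝒦 x y) (hΘ : IsOpen Θ)
    (hw : IsLyapunov Θ h w) : Tendsto (fun k => w (y k) - w (x k)) atTop (𝓝 0) := by
  rw [Metric.tendsto_nhds]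
  intro ε hε
  obtain ⟨ρ, hρ, h1⟩ := hw.exists_radius hΘ hs.isCompact hs.subset hε
  filter_upwards [hs.tendsto_sub.eventually (gt_mem_nhds hρ)] with k hk
  rw [Real.dist_eq, sub_zero]
  exact (h1 (x k) (hs.mem k) (y k) (by rwa [norm_sub_rev])).2

/-- If `w (y k)` crossed from below `a` to above `b` infinitely often, pick a value `c` between them
outside the closed set `w(ℒ)`. In a thin band of values below `c` the function `w` decreases, and
eventually steps are too short to jump over the band, so once below `c` the sequence stays there. -/
theorem exists_tendsto_lyapunov (hs : IsShadow Θ h γ 𝒦 x y) (hΘ : IsOpen Θ)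
    (hh : ContinuousOn h Θ) (hw : IsLyapunov Θ h w)
    (hint : interior (w '' stationarySet Θ w h) = ∅) :
    ∃ l, Tendsto (fun k => w (y k)) atTop (𝓝 l) := by
  obtain ⟨𝒦', h𝒦'Θ, h𝒦', hev⟩ := hs.exists_compact hΘ
  obtain ⟨A, hA⟩ := h𝒦'.exists_bound_of_continuousOn (hw.continuousOn.mono h𝒦'Θ)
  have hLc : IsClosed (w '' stationarySet Θ w h) :=
    (hw.isCompact_stationarySet.image_of_continuousOn
      (hw.continuousOn.mono fun θ hθ => hθ.1)).isClosed
  refine tendsto_of_no_upcrossings dense_univ (fun a _ b _ hab => ?_) ?_ ?_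
  · rintro ⟨h1, h2⟩
    obtain ⟨c, hcL, hac, hcb⟩ : ∃ c, c ∉ w '' stationarySet Θ w h ∧ a < c ∧ c < b := by
      by_contra! hcon
      have h3 : Ioo a b ⊆ interior (w '' stationarySet Θ w h) :=
        interior_maximal (fun c hc => by
          by_contra hcL
          exact absurd hc.2 (not_lt.2 (hcon c hcL hc.1))) isOpen_Ioo
      rw [hint] at h3
      exact h3 (⟨by linarith, by linarith⟩ : (a + b) / 2 ∈ Ioo a b)
    obtain ⟨ε, hε, hball⟩ := Metric.isOpen_iff.1 hLc.isOpen_compl c hcL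
    obtain ⟨B, hB⟩ : ∃ B : Set (E d), B = 𝒦' ∩ w ⁻¹' Icc (c - ε / 2) c := ⟨_, rfl⟩
    have hBc : IsCompact B := by
      rw [hB]
      exact h𝒦'.of_isClosed_subset ((hw.continuousOn.mono h𝒦'Θ).preimage_isClosed_of_isClosed
        h𝒦'.isClosed isClosed_Icc) inter_subset_left
    have hBL : Disjoint B (stationarySet Θ w h) := by
      rw [disjoint_left, hB]
      rintro θ ⟨-, hθ1, hθ2⟩ hθL
      refine hball (a := w θ) ?_ (mem_image_of_mem w hθL)
      rw [Metric.mem_ball, Real.dist_eq, abs_lt]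
      constructor <;> linarith
    obtain ⟨η, ρ, hη, hρ, hdesc⟩ := hw.exists_descent hΘ hh hBc
      (by rw [hB]; exact inter_subset_left.trans h𝒦'Θ) hBL
    obtain ⟨ρ', hρ', hrad⟩ := hw.exists_radius hΘ h𝒦' h𝒦'Θ (ε := ε / 2) (by positivity)
    obtain ⟨N, hN⟩ := eventually_atTop.1 (hev.and ((hs.tendsto_sub.eventually (gt_mem_nhds hρ)).and
      ((hs.tendsto_step hh).eventually (gt_mem_nhds (lt_min hρ hρ')))))
    obtain ⟨k₀, hk₀, hk₀a⟩ := (frequently_atTop.1 h1) N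
    have hstay : ∀ k, k₀ ≤ k → w (y k) ≤ c := by
      intro k hk
      induction k, hk using Nat.le_induction with
      | base => linarith
      | succ k hk ih =>
        obtain ⟨hy1, hy2, hy3⟩ := hN k (hk₀.trans hk)
        by_cases hcase : c - ε / 2 ≤ w (y k)
        · have h4 := hdesc (y k) (by rw [hB]; exact ⟨hy1, hcase, ih⟩) (x k) hy2 (γ k)
            (hs.step_nonneg k) (hy3.trans_le (min_le_left _ _))
          rw [← hs.succ_eq] at h4
          have := mul_nonneg hη.le (hs.step_nonneg k)
          linarith
        · have h4 := (hrad (y k) hy1 (y (k + 1)) (by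
            rw [hs.norm_succ_sub]; exact hy3.trans_le (min_le_right _ _))).2
          linarith [(abs_lt.1 h4).2, not_le.1 hcase]
    obtain ⟨k, hk, hkb⟩ := (frequently_atTop.1 h2) k₀
    linarith [hstay k hk]
  · refine isBoundedUnder_of_eventually_le (a := A) ?_
    filter_upwards [hev] with k hk
    exact (le_abs_self _).trans (hA _ hk)
  · refine isBoundedUnder_of_eventually_ge (a := -A) ?_
    filter_upwards [hev] with k hk
    exact (abs_le.1 (hA _ hk)).1

/-- If `w` converges along the path, the path approaches the stationary set. -/
theorem tendsto_infDist (hs : IsShadow Θ h γ 𝒦 x y) (hΘ : IsOpen Θ)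
    (hh : ContinuousOn h Θ) (hw : IsLyapunov Θ h w)
    (hl : ∃ l, Tendsto (fun k => w (y k)) atTop (𝓝 l)) :
    Tendsto (fun k => Metric.infDist (x k) (stationarySet Θ w h)) atTop (𝓝 0) := by
  obtain ⟨𝒦', h𝒦'Θ, h𝒦', hev⟩ := hs.exists_compact hΘ
  obtain ⟨A, hA0, hA⟩ := hs.exists_bound hh
  obtain ⟨l, hl⟩ := hl
  rcases (stationarySet Θ w h).eq_empty_or_nonempty with hLe | hLne
  · simp [hLe]
  have hy : Tendsto (fun k => Metric.infDist (y k) (stationarySet Θ w h)) atTop (𝓝 0) := by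
    rw [Metric.tendsto_nhds]
    intro ε' hε'
    -- A point at distance `2 ε` from the stationary set must travel at least `ε` before coming
    -- closer than `ε`, and descent holds all along.
    obtain ⟨ε, hε, rfl⟩ : ∃ ε, 0 < ε ∧ ε' = 2 * ε := ⟨ε' / 2, by positivity, by ring⟩
    obtain ⟨B, hB⟩ : ∃ B : Set (E d), B =
        𝒦' ∩ {θ | ε ≤ Metric.infDist θ (stationarySet Θ w h)} := ⟨_, rfl⟩
    have hBc : IsCompact B := by
      rw [hB]
      exact h𝒦'.inter_right (isClosed_le continuous_const (Metric.continuous_infDist_pt _))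
    have hBL : Disjoint B (stationarySet Θ w h) := by
      rw [disjoint_left, hB]
      rintro θ ⟨-, hθ⟩ hθL
      have h1 : ε ≤ Metric.infDist θ (stationarySet Θ w h) := hθ
      rw [Metric.infDist_zero_of_mem hθL] at h1
      linarith
    obtain ⟨η, ρ, hη, hρ, hdesc⟩ := hw.exists_descent hΘ hh hBc
      (by rw [hB]; exact inter_subset_left.trans h𝒦'Θ) hBL
    obtain ⟨N, hN⟩ := eventually_atTop.1 (hev.and ((hs.tendsto_sub.eventually (gt_mem_nhds hρ)).and
      (((hs.tendsto_step hh).eventually (gt_mem_nhds hρ)).and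
        (Metric.tendsto_nhds.1 hl (η * ε / A / 2) (by positivity)))))
    filter_upwards [eventually_ge_atTop N] with k hk
    rw [Real.dist_eq, sub_zero, abs_of_nonneg Metric.infDist_nonneg]
    by_contra hfar
    have hfar := not_lt.1 hfar
    -- As long as the descent lasts, `w` drops by at least `η` times the elapsed step sum, while the
    -- displacement is at most `A` times that sum. Eventually `w` varies by less than `η ε / A`, so
    -- the displacement stays below `ε` and the descent never ends; this bounds the step sum, which
    -- is impossible.
    have key : ∀ j, η * ∑ i ∈ Finset.range j, γ (k + i) ≤ w (y k) - w (y (k + j)) ∧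
        ‖y (k + j) - y k‖ ≤ A * ∑ i ∈ Finset.range j, γ (k + i) := by
      intro j
      induction j with
      | zero => simp
      | succ j ih =>
        obtain ⟨hy1, hy2, hy3, hy4⟩ := hN (k + j) (by omega)
        have h1 := (hN k hk).2.2.2
        rw [Real.dist_eq, abs_lt] at h1 hy4
        have h2 : η * (A * ∑ i ∈ Finset.range j, γ (k + i)) < η * ε := by
          have h3 : η * ∑ i ∈ Finset.range j, γ (k + i) < η * ε / A := by linarith [ih.1]
          rw [lt_div_iff₀ hA0] at h3
          linarith
        have h3 : ‖y (k + j) - y k‖ < ε := ih.2.trans_lt (lt_of_mul_lt_mul_left h2 hη.le)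
        have h4 := Metric.infDist_le_infDist_add_dist (s := stationarySet Θ w h) (x := y k)
          (y := y (k + j))
        rw [dist_comm, dist_eq_norm] at h4
        have h5 := hdesc (y (k + j)) (by
          rw [hB]; exact ⟨hy1, show ε ≤ _ by linarith⟩) (x (k + j)) hy2 (γ (k + j))
          (hs.step_nonneg _) hy3
        rw [← hs.succ_eq] at h5
        rw [Finset.sum_range_succ, ← add_assoc, mul_add, mul_add]
        refine ⟨by linarith [ih.1], ?_⟩
        calc ‖y (k + j + 1) - y k‖ ≤ ‖y (k + j + 1) - y (k + j)‖ + ‖y (k + j) - y k‖ := by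
              have e : y (k + j + 1) - y k = (y (k + j + 1) - y (k + j)) + (y (k + j) - y k) := by
                abel
              rw [e]
              exact norm_add_le _ _
          _ ≤ γ (k + j) * A + A * ∑ i ∈ Finset.range j, γ (k + i) := by
              rw [hs.norm_succ_sub]
              exact add_le_add (mul_le_mul_of_nonneg_left (hA _) (hs.step_nonneg _)) ih.2
          _ = _ := by ring
    have hbound : ∀ j, ∑ i ∈ Finset.range j, γ (k + i) ≤ ε / A := by
      intro j
      have h1 := (hN k hk).2.2.2
      have h2 := (hN (k + j) (by omega)).2.2.2
      rw [Real.dist_eq, abs_lt] at h1 h2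
      have h3 : η * ∑ i ∈ Finset.range j, γ (k + i) ≤ η * (ε / A) := by
        rw [← mul_div_assoc]
        linarith [(key j).1]
      exact le_of_mul_le_mul_left h3 hη
    obtain ⟨n, hn⟩ := ((hs.step_sum.eventually_gt_atTop
      (∑ i ∈ Finset.range k, γ i + ε / A)).and (eventually_ge_atTop k)).exists
    obtain ⟨j, rfl⟩ := Nat.exists_eq_add_of_le hn.2
    have h1 := hn.1
    rw [Finset.sum_range_add] at h1
    linarith [hbound j]
  have h2 := hy.add hs.tendsto_sub
  simp only [add_zero] at h2
  refine squeeze_zero (fun k => Metric.infDist_nonneg) (fun k => ?_) h2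
  rw [← dist_eq_norm]
  exact Metric.infDist_le_infDist_add_dist

end IsShadow

/-- Second-order expansion of a function with Lipschitz gradient near a compact set. -/
theorem IsLyapunov.exists_expansion (hw : IsLyapunov Θ h w) (hΘ : IsOpen Θ)
    (hlip : LocallyLipschitzOn Θ (gradient w)) {𝒦 : Set (E d)} (h𝒦 : IsCompact 𝒦)
    (hsub : 𝒦 ⊆ Θ) : ∃ ρ A, 0 < ρ ∧ 0 ≤ A ∧ ∀ z ∈ 𝒦, ∀ y, ‖y - z‖ < ρ →
      |w y - w z - inner ℝ (gradient w z) (y - z)| ≤ A * ‖y - z‖ ^ 2 := by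
  obtain ⟨ρ, hρ, h1⟩ := h𝒦.exists_cthickening_subset_open hΘ hsub
  obtain ⟨A, hA⟩ := (hlip.mono h1).exists_lipschitzOnWith_of_compact h𝒦.cthickening
  refine ⟨ρ, A, hρ, A.2, fun z hz y hy => ?_⟩
  have hmem : ∀ u ∈ Metric.closedBall z ‖y - z‖, u ∈ Metric.cthickening ρ 𝒦 := fun u hu =>
    Metric.mem_cthickening_of_dist_le u z ρ 𝒦 hz ((Metric.mem_closedBall.1 hu).trans hy.le)
  have hz0 : z ∈ Metric.closedBall z ‖y - z‖ := Metric.mem_closedBall_self (norm_nonneg _)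
  have h2 := (convex_closedBall z ‖y - z‖).norm_image_sub_le_of_norm_hasFDerivWithin_le'
    (f := w) (f' := fderiv ℝ w) (φ := fderiv ℝ w z) (C := A * ‖y - z‖) (x := z) (y := y)
    (fun u hu => (hw.hasFDerivAt hΘ (h1 (hmem u hu))).hasFDerivWithinAt)
    (fun u hu => by
      have h3 := hA.dist_le_mul u (hmem u hu) z (hmem z hz0)
      have h4 : ‖fderiv ℝ w u - fderiv ℝ w z‖ = ‖gradient w u - gradient w z‖ := by
        rw [gradient, gradient, ← map_sub, LinearIsometryEquiv.norm_map]
      rw [h4, ← dist_eq_norm]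
      exact h3.trans (mul_le_mul_of_nonneg_left (Metric.mem_closedBall.1 hu) A.2)) hz0
    (Metric.mem_closedBall.2 (dist_eq_norm y z).le)
  rw [IsLyapunov.fderiv_apply, Real.norm_eq_abs] at h2
  calc _ ≤ A * ‖y - z‖ * ‖y - z‖ := h2
    _ = _ := by ring

/-- A sequence bounded below that decreases up to the terms of a convergent series converges. -/
theorem exists_tendsto_of_le_add {a ζ : ℕ → ℝ} (h0 : ∀ k, 0 ≤ a k)
    (hζ : CauchySeq fun n => ∑ k ∈ Finset.range n, ζ k)
    (hle : ∀ᶠ k in atTop, a (k + 1) ≤ a k + ζ k) : ∃ l, Tendsto a atTop (𝓝 l) := by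
  obtain ⟨N, hN⟩ := eventually_atTop.1 hle
  obtain ⟨s, hs⟩ := cauchySeq_tendsto_of_complete hζ
  -- Subtracting the partial sums of the convergent series leaves a decreasing sequence that is
  -- bounded below.
  obtain ⟨b, hb⟩ : ∃ b : ℕ → ℝ, b = fun k => a (k + N) - ∑ j ∈ Finset.range (k + N), ζ j :=
    ⟨_, rfl⟩
  have hanti : Antitone b := antitone_nat_of_succ_le fun k => by
    rw [hb]
    dsimp only
    rw [add_right_comm, Finset.sum_range_succ]
    linarith [hN (k + N) (by omega)]
  have hsN := hs.comp (tendsto_add_atTop_nat N)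
  obtain ⟨c, hc⟩ := hsN.bddAbove_range
  have hbdd : BddBelow (range b) := ⟨-c, by
    rintro _ ⟨k, rfl⟩
    have h1 := hc (mem_range_self k)
    rw [hb]
    simp only [Function.comp_apply] at h1 ⊢
    linarith [h0 (k + N)]⟩
  have h3 := (tendsto_atTop_ciInf hanti hbdd).add hsN
  refine ⟨_, (tendsto_add_atTop_iff_nat N).1 (h3.congr fun k => ?_)⟩
  rw [hb]
  simp

end Shadow

/-! ### Pathwise recursion of the algorithm -/

section Paths

variable {d : ℕ} {X : Type*} [MeasurableSpace X]

/-- The parameter and the counters follow the recursion of the algorithm. -/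
def IsPath (K : ℕ → Set (E d)) (H : E d → X → E d) (γ : ℕ → ℝ) (xs : X) (θs : E d)
    (ω : ℕ → State X d) : Prop :=
  ∀ n, (ω (n + 1)).2 = (update K H γ xs θs (ω n) (ω (n + 1)).1).2

variable {K : ℕ → Set (E d)} {H : E d → X → E d} {γ : ℕ → ℝ} {xs : X} {θs : E d}

theorem update_of_mem {s : State X d} {y : X} (h : newTheta H γ xs θs s y ∈ K s.index) :
    update K H γ xs θs s y = (y, newTheta H γ xs θs s y, s.index, s.count + 1) := if_pos h

theorem update_of_notMem {s : State X d} {y : X} (h : newTheta H γ xs θs s y ∉ K s.index) :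
    update K H γ xs θs s y = (y, newTheta H γ xs θs s y, s.index + 1, 0) := if_neg h

theorem halfPoint_of_count_eq_zero {s : State X d} (h : s.count = 0) :
    halfPoint xs θs s = (θs, xs) := if_pos h

theorem halfPoint_of_count_ne_zero {s : State X d} (h : s.count ≠ 0) :
    halfPoint xs θs s = (s.theta, s.1) := if_neg h

/-- The observation is left out of the identity: it is the draw itself, and equality in `X` need not
be a measurable event. -/
theorem ae_isPath {P : Kernel (E d × X) X} [IsMarkovKernel P] (hK : ∀ i, MeasurableSet (K i))
    (hH : Measurable (Function.uncurry H)) (γ : ℕ → ℝ) (xs : X) (θs : E d) (s : State X d) :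
    ∀ᵐ ω ∂(chainLaw (stepKernel P K H γ xs θs) (isMarkovKernel_stepKernel P hK hH γ xs θs) s),
      IsPath K H γ xs θs ω := by
  have := isMarkovKernel_stepKernel P hK hH γ xs θs
  have hu := measurable_update hK hH γ xs θs
  have hm : Measurable fun q : State X d × State X d => (update K H γ xs θs q.1 q.2.1).2 :=
    (hu.comp (by fun_prop : Measurable fun q : State X d × State X d => (q.1, q.2.1))).snd
  have hm2 : Measurable fun q : State X d × State X d => q.2.2 := by fun_prop
  have hset : MeasurableSet {q : State X d × State X d |
      q.2.2 = (update K H γ xs θs q.1 q.2.1).2} := measurableSet_eq_fun hm2 hm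
  refine ae_chainLaw_step (stepKernel P K H γ xs θs) s
    (p := fun q => q.2.2 = (update K H γ xs θs q.1 q.2.1).2) hset (fun s => ?_)
  rw [stepKernel_apply P hK hH]
  have hus : Measurable (update K H γ xs θs s) := hu.comp measurable_prodMk_left
  refine (ae_map_iff hus.aemeasurable (measurable_prodMk_left hset)).2 (Eventually.of_forall ?_)
  intro y
  have : (update K H γ xs θs s y).1 = y := by
    by_cases h : newTheta H γ xs θs s y ∈ K s.index
    · rw [update_of_mem h]
    · rw [update_of_notMem h]
  rw [mem_ofPred_eq, this]

namespace IsPath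

variable {ω : ℕ → State X d}

theorem theta_succ (hω : IsPath K H γ xs θs ω) (n : ℕ) :
    (ω (n + 1)).theta = newTheta H γ xs θs (ω n) (ω (n + 1)).1 := by
  rw [State.theta, hω n]
  by_cases h : newTheta H γ xs θs (ω n) (ω (n + 1)).1 ∈ K (ω n).index
  · rw [update_of_mem h]
  · rw [update_of_notMem h]

theorem of_mem (hω : IsPath K H γ xs θs ω) {n : ℕ} (h : (ω (n + 1)).theta ∈ K (ω n).index) :
    (ω (n + 1)).index = (ω n).index ∧ (ω (n + 1)).count = (ω n).count + 1 := by
  rw [hω.theta_succ] at h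
  rw [State.index, State.count, hω n, update_of_mem h]
  exact ⟨rfl, rfl⟩

theorem of_notMem (hω : IsPath K H γ xs θs ω) {n : ℕ} (h : (ω (n + 1)).theta ∉ K (ω n).index) :
    (ω (n + 1)).index = (ω n).index + 1 ∧ (ω (n + 1)).count = 0 := by
  rw [hω.theta_succ] at h
  rw [State.index, State.count, hω n, update_of_notMem h]
  exact ⟨rfl, rfl⟩

theorem monotone_index (hω : IsPath K H γ xs θs ω) : Monotone fun n => (ω n).index := by
  refine monotone_nat_of_le_succ fun n => ?_
  by_cases h : (ω (n + 1)).theta ∈ K (ω n).index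
  · exact (hω.of_mem h).1.ge
  · rw [(hω.of_notMem h).1]
    exact Nat.le_succ _

theorem of_index_eq (hω : IsPath K H γ xs θs ω) {n : ℕ}
    (h : (ω (n + 1)).index = (ω n).index) :
    (ω (n + 1)).theta ∈ K (ω n).index ∧ (ω (n + 1)).count = (ω n).count + 1 := by
  by_cases h1 : (ω (n + 1)).theta ∈ K (ω n).index
  · exact ⟨h1, (hω.of_mem h1).2⟩
  · have := (hω.of_notMem h1).1
    omega

end IsPath

/-- The deviation of the step `k` of the algorithm from the step along the mean field. -/
def driftNoise (H : E d → X → E d) (π : E d → Measure X) (γ : ℕ → ℝ) (xs : X) (θs : E d) (k : ℕ)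
    (ω : ℕ → State X d) : E d :=
  γ ((ω k).index + (ω k).count + 1) • (H (halfPoint xs θs (ω k)).1 (ω (k + 1)).1 -
    meanField H π (halfPoint xs θs (ω k)).1)

theorem newTheta_eq (H : E d → X → E d) (π : E d → Measure X) (γ : ℕ → ℝ) (xs : X) (θs : E d)
    (k : ℕ) (ω : ℕ → State X d) : newTheta H γ xs θs (ω k) (ω (k + 1)).1 =
      (halfPoint xs θs (ω k)).1 + γ ((ω k).index + (ω k).count + 1) •
        meanField H π (halfPoint xs θs (ω k)).1 + driftNoise H π γ xs θs k ω := by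
  rw [newTheta, driftNoise, smul_sub]
  abel

theorem algNoise_eq_inner {π : E d → Measure X} {v : E d → E d} {gbar : E d → ℝ}
    {ω : ℕ → State X d} {k : ℕ}
    (h : gbar (halfPoint xs θs (ω k)).1 = inner ℝ (v (halfPoint xs θs (ω k)).1)
      (meanField H π (halfPoint xs θs (ω k)).1)) :
    algNoise γ (fun θ x => inner ℝ (v θ) (H θ x)) gbar xs θs k ω =
      inner ℝ (v (halfPoint xs θs (ω k)).1) (driftNoise H π γ xs θs k ω) := by
  rw [algNoise, weightedNoise, driftNoise, inner_smul_right, inner_sub_right, ← h]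
  rfl

end Paths

/-! ### Probability of another restart -/

section Restart

variable {d : ℕ} {X : Type*} [MeasurableSpace X]

theorem tendsto_finset_sum_zero {ι : Type*} (s : Finset ι) {R : ι → ℕ → ℝ≥0∞}
    (h : ∀ j ∈ s, Tendsto (R j) atTop (𝓝 0)) :
    Tendsto (fun n => ∑ j ∈ s, R j n) atTop (𝓝 0) := by
  have := tendsto_finsetSum s h
  simpa using this

namespace Setting

variable {Θ : Set (E d)} {K : ℕ → Set (E d)} {P : Kernel (E d × X) X} [IsMarkovKernel P]
    {H : E d → X → E d} {π : E d → Measure X} {W : X → ℝ} {p α υ γ₀ β : ℝ} {w : E d → ℝ}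

/-- The accumulated noise is small after a restart with large index. -/
theorem exists_driftNoise_rate (hS : Setting Θ K P H π W p α υ γ₀ β) {𝒦 : Set (E d)}
    (h𝒦 : IsCompact 𝒦) (hΘ : 𝒦 ⊆ Θ) (xs : X) {θs : E d} (hθs : θs ∈ 𝒦) {δ : ℝ} (hδ : 0 < δ)
    (hδ1 : δ ≤ 1) :
    ∃ R : ℕ → ℝ≥0∞, Tendsto R atTop (𝓝 0) ∧
      ∀ (i : ℕ) (s : State X d), s.index = i → s.count = 0 →
      (chainLaw (stepKernel P K H (polyStep γ₀ β) xs θs)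
        (isMarkovKernel_stepKernel P hS.measurableSet_cover hS.measurable_H _ xs θs) s)
        {ω | ∃ n, ω ∈ survival (levelSet X d i) (aliveSet X 𝒦 i) n ∧
          δ < ‖∑ k ∈ Finset.range (n + 1), driftNoise H π (polyStep γ₀ β) xs θs k ω‖} ≤ R i := by
  have h1 := fun j : Fin d => hS.exists_algNoise_rate h𝒦 hΘ
    (v := fun _ => EuclideanSpace.single j (1 : ℝ)) measurable_const (B := 1) (by simp)
    (fun θ _ θ' _ => by simp; positivity) xs θs
  choose gbar hgm hg R hR hle using h1
  -- If the `d` coordinates are at most `δ'` in absolute value, the norm is at most `δ`. Dividing by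
  -- `d + 1` also covers `d = 0`.
  obtain ⟨δ', hδ'⟩ : ∃ δ', δ' = δ / (d + 1) := ⟨_, rfl⟩
  have hd1 : (0 : ℝ) < d + 1 := by positivity
  have hδ'0 : 0 < δ' := by rw [hδ']; positivity
  have hδ'1 : δ' ≤ 1 := by
    rw [hδ', div_le_one hd1]
    have : (0 : ℝ) ≤ d := Nat.cast_nonneg d
    linarith
  refine ⟨fun i => ∑ j, ENNReal.ofReal (W xs ^ p) * R j δ' i,
    tendsto_finset_sum_zero _ fun j _ => ?_, fun i s hsi hsc => ?_⟩
  · have := ENNReal.Tendsto.const_mul (hR j δ') (a := ENNReal.ofReal (W xs ^ p))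
      (Or.inr ENNReal.ofReal_ne_top)
    rwa [mul_zero] at this
  have := isMarkovKernel_stepKernel P hS.measurableSet_cover hS.measurable_H (polyStep γ₀ β) xs θs
  have hcm : Measurable fun s : State X d => s.2.2.2 := by fun_prop
  have h0 := ae_chainLaw_zero (stepKernel P K H (polyStep γ₀ β) xs θs) s hcm
  have hhalf : halfPoint xs θs s = (θs, xs) := halfPoint_of_count_eq_zero hsc
  refine le_trans (measure_mono_ae ?_) ((measure_iUnion_le (fun j : Fin d =>
    {ω | ∃ n, 0 ≤ n ∧ ω ∈ survival (levelSet X d i) (aliveSet X 𝒦 i) n ∧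
      δ' < |∑ k ∈ Finset.Ico 0 (n + 1), algNoise (polyStep γ₀ β)
        (fun θ x => inner ℝ (EuclideanSpace.single j (1 : ℝ)) (H θ x)) (gbar j) xs θs k ω|})).trans ?_)
  · filter_upwards [h0] with ω hω0 hω
    obtain ⟨n, hsurv, hn⟩ := hω
    have hmem : ∀ k ≤ n, (halfPoint xs θs (ω k)).1 ∈ 𝒦 := by
      intro k hk
      cases k with
      | zero =>
        rw [halfPoint_of_count_eq_zero (hω0.trans hsc)]
        exact hθs
      | succ k =>
        have h2 := hsurv.2 k hk
        rw [halfPoint_of_count_ne_zero h2.2.1]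
        exact h2.2.2
    by_contra hcon
    have h3 : ∀ j : Fin d, |inner ℝ (EuclideanSpace.single j (1 : ℝ))
        (∑ k ∈ Finset.range (n + 1), driftNoise H π (polyStep γ₀ β) xs θs k ω)| ≤ δ' := by
      intro j
      by_contra hj
      refine hcon (mem_iUnion.2 ⟨j, n, Nat.zero_le n, hsurv, ?_⟩)
      rw [inner_sum] at hj
      rw [← Finset.range_eq_Ico]
      refine lt_of_lt_of_eq (not_le.1 hj) (congrArg _ (Finset.sum_congr rfl fun k hk => ?_))
      exact (algNoise_eq_inner (v := fun _ => EuclideanSpace.single j (1 : ℝ))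
        (hg j _ (hmem k (Nat.lt_succ_iff.1 (Finset.mem_range.1 hk))))).symm
    have h4 := (norm_le_sum_abs _).trans (Finset.sum_le_sum fun j _ => h3 j)
    rw [Finset.sum_const, Finset.card_univ, Fintype.card_fin, nsmul_eq_mul] at h4
    have h5 : (d : ℝ) * δ' ≤ δ := by
      rw [hδ', mul_div_assoc', div_le_iff₀ hd1]
      linarith
    linarith
  · rw [tsum_fintype]
    refine Finset.sum_le_sum fun j _ => ?_
    -- At a restart the point is always `xs` and the step index is `i`, so the bound depends on `s`
    -- through `i` only.
    have h2 := hle j i s (by rw [hhalf]; exact hθs) δ' hδ'0 hδ'1 0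
    rwa [hhalf, hsi, hsc] at h2

/-- After a restart with large index, the active set changes with probability at most one half. -/
theorem exists_exit_le (hS : Setting Θ K P H π W p α υ γ₀ β)
    (hw : IsLyapunov Θ (meanField H π) w) (xs : X) {θs : E d} (hθs : θs ∈ Θ) :
    ∃ i₀, ∀ i, i₀ ≤ i → ∀ s : State X d, s.index = i → s.count = 0 →
      (chainLaw (stepKernel P K H (polyStep γ₀ β) xs θs)
        (isMarkovKernel_stepKernel P hS.measurableSet_cover hS.measurable_H _ xs θs) s)
        {ω | ∃ n, (ω n).index ≠ i} ≤ 2⁻¹ := by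
  -- The level `M` must dominate `w` at the restart point and on the whole stationary set.
  obtain ⟨M, hM0, hMs, hML⟩ : ∃ M, 0 ≤ M ∧ w θs ≤ M ∧
      ∀ θ ∈ stationarySet Θ w (meanField H π), w θ ≤ M := by
    obtain ⟨A, hA⟩ := hw.isCompact_stationarySet.exists_bound_of_continuousOn
      (hw.continuousOn.mono fun θ hθ => hθ.1)
    exact ⟨max (w θs) A, (hw.nonneg θs hθs).trans (le_max_left _ _), le_max_left _ _,
      fun θ hθ => (le_abs_self _).trans ((hA θ hθ).trans (le_max_right _ _))⟩
  obtain ⟨δ, γmax, hδ, hδ1, hγmax, hstab⟩ :=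
    hw.exists_stable hS.isOpen hS.continuousOn_meanField hM0 hML
  obtain ⟨𝒦, h𝒦def⟩ : ∃ 𝒦 : Set (E d), 𝒦 = {θ | θ ∈ Θ ∧ w θ ≤ M + 1} := ⟨_, rfl⟩
  have h𝒦 : IsCompact 𝒦 := by rw [h𝒦def]; exact hw.isCompact_level _ (by linarith)
  have h𝒦Θ : 𝒦 ⊆ Θ := by rw [h𝒦def]; exact fun θ hθ => hθ.1
  have hθ𝒦 : θs ∈ 𝒦 := by rw [h𝒦def]; exact ⟨hθs, by linarith⟩
  obtain ⟨i₁, hi₁⟩ := hS.exists_subset_cover h𝒦 h𝒦Θ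
  obtain ⟨R, hR, hle⟩ := hS.exists_driftNoise_rate h𝒦 h𝒦Θ xs hθ𝒦 hδ hδ1
  have hγ0 : ∀ n, 0 < polyStep γ₀ β n := polyStep_pos hS.gamma_pos
  -- The steps after a restart with index `i` are `polyStep` at `i + count + 1`, hence all small
  -- once `i` is large.
  obtain ⟨i₂, hi₂⟩ := eventually_atTop.1
    (((tendsto_polyStep (γ₀ := γ₀) hS.beta_pos).eventually (ge_mem_nhds hγmax)).and
      (hR.eventually (ge_mem_nhds (by simp : (0 : ℝ≥0∞) < 2⁻¹))))
  refine ⟨max i₁ i₂, fun i hi s hsi hsc => ?_⟩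
  have hi1 : 𝒦 ⊆ K i := hi₁.trans (hS.monotone_cover ((le_max_left _ _).trans hi))
  have hi2 : i₂ ≤ i := (le_max_right _ _).trans hi
  have := isMarkovKernel_stepKernel P hS.measurableSet_cover hS.measurable_H (polyStep γ₀ β) xs θs
  have hcm : Measurable fun s : State X d => s.2.2 := by fun_prop
  have h0 := ae_chainLaw_zero (stepKernel P K H (polyStep γ₀ β) xs θs) s hcm
  have hpath := ae_isPath (P := P) hS.measurableSet_cover hS.measurable_H (polyStep γ₀ β) xs θs s
  refine (measure_mono_ae ?_).trans ((hle i s hsi hsc).trans (hi₂ i hi2).2)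
  filter_upwards [h0, hpath] with ω hω0 hω hexit
  by_contra hgood
  have hgood : ∀ n, ω ∈ survival (levelSet X d i) (aliveSet X 𝒦 i) n →
      ‖∑ k ∈ Finset.range (n + 1), driftNoise H π (polyStep γ₀ β) xs θs k ω‖ ≤ δ := fun n hn =>
    not_lt.1 fun hlt => hgood ⟨n, hn, hlt⟩
  have hω0i : (ω 0).index = i := by rw [State.index, hω0]; exact hsi
  have hω0c : (ω 0).count = 0 := by rw [State.count, hω0]; exact hsc
  -- The recursion starts from `θs`: at count zero, the recorded parameter of the state is
  -- discarded.
  obtain ⟨x, hx0, hx1⟩ : ∃ x : ℕ → E d, x 0 = θs ∧ ∀ k, x (k + 1) = (ω (k + 1)).theta :=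
    ⟨fun k => Nat.casesOn k θs fun k => (ω (k + 1)).theta, rfl, fun k => rfl⟩
  -- Survival up to time `n` gives the bound on the noise through step `n`, hence by stability the
  -- next parameter lies in `𝒦 ⊆ K i`, is accepted, and survival extends to `n + 1`.
  have hsurv : ∀ n, ω ∈ survival (levelSet X d i) (aliveSet X 𝒦 i) n := by
    intro n
    induction n with
    | zero => exact ⟨hω0i, fun j hj => absurd hj (Nat.not_lt_zero j)⟩
    | succ n ih =>
      have hidx : ∀ k ≤ n, (ω k).index = i := fun k hk => by
        cases k with
        | zero => exact hω0i
        | succ k => exact (ih.2 k hk).1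
      have hhalf : ∀ k ≤ n, (halfPoint xs θs (ω k)).1 = x k := fun k hk => by
        cases k with
        | zero => rw [halfPoint_of_count_eq_zero hω0c, hx0]
        | succ k => rw [halfPoint_of_count_ne_zero (ih.2 k hk).2.1, hx1]
      have hmem := hstab x (fun k => driftNoise H π (polyStep γ₀ β) xs θs k ω)
        (fun k => polyStep γ₀ β ((ω k).index + (ω k).count + 1)) (n + 1) (by rw [hx0]; exact hθs)
        (by rw [hx0]; exact hMs)
        (fun k hk => ⟨(hγ0 _).le, (hi₂ _ (by
            have := hidx k (by omega)
            omega)).1, by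
          rw [hx1, hω.theta_succ, newTheta_eq H π, hhalf k (by omega)]⟩)
        (fun k hk => by
          cases k with
          | zero => simpa using hδ.le
          | succ k => exact hgood k ⟨ih.1, fun j hj => ih.2 j (by omega)⟩)
      rw [← h𝒦def, hx1] at hmem
      have h2 := hω.of_mem (n := n) (by rw [hidx n le_rfl]; exact hi1 hmem)
      refine ⟨ih.1, fun j hj => ?_⟩
      rcases Nat.lt_succ_iff_lt_or_eq.1 hj with h3 | rfl
      · exact ih.2 j h3
      · exact ⟨h2.1.trans (hidx j le_rfl), by rw [h2.2]; exact Nat.succ_ne_zero _, hmem⟩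
  obtain ⟨n, hn⟩ := hexit
  exact hn (mem_of_mem_survival (fun s hs => hs.1) (hsurv n))

end Setting

end Restart

/-! ### Finitely many restarts and almost sure convergence of the noise series -/

section AlmostSure

variable {d : ℕ} {X : Type*} [MeasurableSpace X]

theorem measurable_algNoise (γ : ℕ → ℝ) {g : E d → X → ℝ}
    (hg : Measurable (Function.uncurry g)) {gbar : E d → ℝ} (hb : Measurable gbar) (xs : X)
    (θs : E d) (k : ℕ) : Measurable (algNoise γ g gbar xs θs k) := by
  have h1 : Measurable fun ω : ℕ → State X d => restartMap xs θs (ω k) :=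
    (measurable_restartMap xs θs).comp (measurable_pi_apply k)
  have h2 : Measurable fun ω : ℕ → State X d => (ω (k + 1)).1 := by fun_prop
  have h3 : Measurable fun ω : ℕ → State X d =>
      weightedNoise γ g gbar (restartMap xs θs (ω k)) (ω (k + 1)).1 :=
    (measurable_weightedNoise γ hg hb).comp (h1.prodMk h2)
  exact h3

namespace Setting

variable {Θ : Set (E d)} {K : ℕ → Set (E d)} {P : Kernel (E d × X) X} [IsMarkovKernel P]
    {H : E d → X → E d} {π : E d → Measure X} {W : X → ℝ} {p α υ γ₀ β : ℝ} {w : E d → ℝ}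

/-- The Markov property is applied at the first time the index reaches `i`. Since `i > 0` and the
index starts at zero, that time is a restart, and reaching `i + 1` afterwards means leaving the
level `i`. -/
theorem measure_index_succ_le (hS : Setting Θ K P H π W p α υ γ₀ β) (xs : X) (θs : E d) {i : ℕ}
    (hi : 0 < i)
    (hexit : ∀ s : State X d, s.index = i → s.count = 0 →
      (chainLaw (stepKernel P K H (polyStep γ₀ β) xs θs)
        (isMarkovKernel_stepKernel P hS.measurableSet_cover hS.measurable_H _ xs θs) s)
        {ω | ∃ n, (ω n).index ≠ i} ≤ 2⁻¹) {s₀ : State X d} (hs₀ : s₀.index = 0) :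
    (chainLaw (stepKernel P K H (polyStep γ₀ β) xs θs)
        (isMarkovKernel_stepKernel P hS.measurableSet_cover hS.measurable_H _ xs θs) s₀)
        {ω | ∃ n, i + 1 ≤ (ω n).index} ≤
      2⁻¹ * (chainLaw (stepKernel P K H (polyStep γ₀ β) xs θs)
        (isMarkovKernel_stepKernel P hS.measurableSet_cover hS.measurable_H _ xs θs) s₀)
        {ω | ∃ n, i ≤ (ω n).index} := by
  classical
  have hQ := isMarkovKernel_stepKernel P hS.measurableSet_cover hS.measurable_H (polyStep γ₀ β)
    xs θs
  obtain ⟨Q, hQdef⟩ : ∃ Q, Q = stepKernel P K H (polyStep γ₀ β) xs θs := ⟨_, rfl⟩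
  have hpath := ae_isPath (P := P) hS.measurableSet_cover hS.measurable_H (polyStep γ₀ β) xs θs s₀
  simp only [← hQdef] at hQ hexit hpath ⊢
  have him : Measurable fun s : State X d => s.2.2.1 := by fun_prop
  have h0 := ae_chainLaw_zero Q s₀ him
  -- Decomposition by the value `n` of the first time at which the index is at least `i`.
  obtain ⟨T, hT⟩ : ∃ T : ℕ → Set (ℕ → State X d), T = fun n =>
      {ω | i ≤ (ω n).index} ∩ ⋂ m ∈ Finset.range n, {ω | (ω m).index < i} := ⟨_, rfl⟩
  have hTfil : ∀ n, MeasurableSet[natFil (State X d) n] (T n) := by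
    intro n
    rw [hT]
    have hc : ∀ m ≤ n, Measurable[natFil (State X d) n] fun ω : ℕ → State X d => (ω m).2.2.1 :=
      fun m hm => him.comp (measurable_eval_natFil hm)
    refine MeasurableSet.inter (hc n le_rfl measurableSet_Ici) ?_
    exact Finset.measurableSet_biInter _ fun m hm =>
      hc m (Finset.mem_range.1 hm).le measurableSet_Iio
  have hTm : ∀ n, MeasurableSet (T n) := fun n => (natFil (State X d)).le n _ (hTfil n)
  obtain ⟨D, hD⟩ : ∃ D : Set (ℕ → State X d), D = {ω | ∃ n, (ω n).index ≠ i} := ⟨_, rfl⟩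
  have hDm : MeasurableSet D := by
    rw [hD, ofPred_exists]
    exact MeasurableSet.iUnion fun n =>
      (him.comp (measurable_pi_apply n)) (measurableSet_singleton i).compl
  have hstep : ∀ n, (chainLaw Q hQ s₀) (T n ∩ {ω | (fun k => ω (n + k)) ∈ D}) ≤
      2⁻¹ * (chainLaw Q hQ s₀) (T n) := by
    intro n
    have h1 := lintegral_chainLaw_shift Q s₀ n (Z := (T n).indicator 1)
      ((measurable_const (a := (1 : ℝ≥0∞))).indicator (hTfil n))
      (F := D.indicator 1) (measurable_one.indicator hDm)
    simp only [lintegral_indicator_one hDm] at h1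
    have hsh : Measurable fun (ω : ℕ → State X d) k => ω (n + k) := by fun_prop
    have hSm : MeasurableSet (T n ∩ {ω | (fun k => ω (n + k)) ∈ D}) := (hTm n).inter (hsh hDm)
    have e : ∀ ω : ℕ → State X d, (T n).indicator (1 : (ℕ → State X d) → ℝ≥0∞) ω *
        D.indicator (1 : (ℕ → State X d) → ℝ≥0∞) (fun k => ω (n + k)) =
        (T n ∩ {ω | (fun k => ω (n + k)) ∈ D}).indicator 1 ω := by
      intro ω
      by_cases h2 : ω ∈ T n <;> by_cases h3 : (fun k => ω (n + k)) ∈ D <;> simp [h2, h3]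
    simp only [e, lintegral_indicator_one hSm] at h1
    rw [h1, ← lintegral_indicator_one (hTm n),
      ← lintegral_const_mul _ (measurable_one.indicator (hTm n))]
    refine lintegral_mono_ae ?_
    filter_upwards [h0, hpath] with ω hω0 hω
    by_cases h2 : ω ∈ T n
    swap
    · simp [h2]
    have h3 : i ≤ (ω n).index ∧ ∀ m < n, (ω m).index < i := by
      rw [hT] at h2
      simpa using h2
    -- The index grows by at most one at a time, and only at a rejection, which sets the count to
    -- zero.
    have h4 : (ω n).index = i ∧ (ω n).count = 0 := by
      cases n with
      | zero =>
        have h5 : (ω 0).index = 0 := hω0.trans hs₀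
        omega
      | succ n =>
        have h5 := h3.2 n (Nat.lt_succ_self n)
        by_cases h6 : (ω (n + 1)).theta ∈ K (ω n).index
        · have := (hω.of_mem h6).1
          omega
        · have := hω.of_notMem h6
          exact ⟨by omega, this.2⟩
    rw [indicator_of_mem h2, Pi.one_apply, one_mul, mul_one, hD]
    exact hexit (ω n) h4.1 h4.2
  have hcover : {ω : ℕ → State X d | ∃ n, i + 1 ≤ (ω n).index} ⊆
      ⋃ n, T n ∩ {ω | (fun k => ω (n + k)) ∈ D} := by
    rintro ω ⟨n', hn'⟩
    have hex : ∃ n, i ≤ (ω n).index := ⟨n', by omega⟩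
    have hle : Nat.find hex ≤ n' := Nat.find_min' hex (by omega)
    refine mem_iUnion.2 ⟨Nat.find hex, ?_, ?_⟩
    · rw [hT]
      simp only [mem_inter_iff, mem_ofPred_eq, mem_iInter, Finset.mem_range]
      exact ⟨Nat.find_spec hex, fun m hm => not_le.1 (Nat.find_min hex hm)⟩
    · change _ ∈ D
      rw [hD]
      refine ⟨n' - Nat.find hex, ?_⟩
      change (ω (Nat.find hex + (n' - Nat.find hex))).index ≠ i
      rw [Nat.add_sub_cancel' hle]
      omega
  have hdisj : Pairwise (Function.onFun Disjoint T) := by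
    have key : ∀ m n, m < n → Disjoint (T m) (T n) := by
      intro m n hmn
      rw [disjoint_left, hT]
      rintro ω ⟨h1, -⟩ ⟨-, h2⟩
      have h3 := mem_iInter₂.1 h2 m (Finset.mem_range.2 hmn)
      have h4 : i ≤ (ω m).index := h1
      have h5 : (ω m).index < i := h3
      omega
    intro m n hmn
    rcases lt_or_gt_of_ne hmn with h1 | h1
    · exact key m n h1
    · exact (key n m h1).symm
  calc (chainLaw Q hQ s₀) {ω | ∃ n, i + 1 ≤ (ω n).index}
      ≤ ∑' n, (chainLaw Q hQ s₀) (T n ∩ {ω | (fun k => ω (n + k)) ∈ D}) :=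
        (measure_mono hcover).trans (measure_iUnion_le _)
    _ ≤ ∑' n, 2⁻¹ * (chainLaw Q hQ s₀) (T n) := ENNReal.tsum_le_tsum hstep
    _ = 2⁻¹ * (chainLaw Q hQ s₀) (⋃ n, T n) := by
        rw [ENNReal.tsum_mul_left, measure_iUnion hdisj hTm]
    _ ≤ 2⁻¹ * (chainLaw Q hQ s₀) {ω | ∃ n, i ≤ (ω n).index} := by
        gcongr
        refine iUnion_subset fun n ω hω => ?_
        rw [hT] at hω
        exact ⟨n, hω.1⟩

/-- Almost surely the active set is eventually constant. -/
theorem ae_exists_alive (hS : Setting Θ K P H π W p α υ γ₀ β)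
    (hw : IsLyapunov Θ (meanField H π) w) (xs : X) {θs : E d} (hθs : θs ∈ Θ) {s₀ : State X d}
    (hs₀ : s₀.index = 0) :
    ∀ᵐ ω ∂(chainLaw (stepKernel P K H (polyStep γ₀ β) xs θs)
        (isMarkovKernel_stepKernel P hS.measurableSet_cover hS.measurable_H _ xs θs) s₀),
      ∃ i n, ∀ k, ω (n + k) ∈ aliveSet X (K i) i := by
  classical
  obtain ⟨i₀, hi₀⟩ := hS.exists_exit_le hw xs hθs
  have hpath := ae_isPath (P := P) hS.measurableSet_cover hS.measurable_H (polyStep γ₀ β) xs θs s₀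
  obtain ⟨μ, hμ⟩ : ∃ μ, μ = chainLaw (stepKernel P K H (polyStep γ₀ β) xs θs)
        (isMarkovKernel_stepKernel P hS.measurableSet_cover hS.measurable_H _ xs θs) s₀ := ⟨_, rfl⟩
  have hμp : IsProbabilityMeasure μ := by rw [hμ]; infer_instance
  have hgeo : ∀ k, μ {ω | ∃ n, i₀ + 1 + k ≤ (ω n).index} ≤ 2⁻¹ ^ k := by
    intro k
    induction k with
    | zero => simpa using prob_le_one
    | succ k ih =>
      have h1 := hS.measure_index_succ_le xs θs (i := i₀ + 1 + k) (by omega)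
        (hi₀ _ (by omega)) hs₀
      rw [← hμ] at h1
      rw [pow_succ']
      exact h1.trans (mul_le_mul_right ih _)
  have hzero : μ {ω | ∀ i, ∃ n, i ≤ (ω n).index} = 0 := by
    have h1 : Tendsto (fun k => (2⁻¹ : ℝ≥0∞) ^ k) atTop (𝓝 0) :=
      ENNReal.tendsto_pow_atTop_nhds_zero_of_lt_one (by simp)
    refine le_antisymm (ge_of_tendsto' h1 fun k => ?_) zero_le
    have h2 : {ω : ℕ → State X d | ∀ i, ∃ n, i ≤ (ω n).index} ⊆
        {ω | ∃ n, i₀ + 1 + k ≤ (ω n).index} := fun ω hω => hω _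
    exact (measure_mono h2).trans (hgeo k)
  rw [← hμ] at hpath ⊢
  have hbdd : ∀ᵐ ω ∂μ, ∃ i, ∀ n, (ω n).index < i := by
    rw [ae_iff]
    have h2 : {ω : ℕ → State X d | ¬ ∃ i, ∀ n, (ω n).index < i} ⊆
        {ω | ∀ i, ∃ n, i ≤ (ω n).index} := by
      intro ω hω i
      by_contra! hcon
      exact hω ⟨i, hcon⟩
    exact measure_mono_null h2 hzero
  filter_upwards [hpath, hbdd] with ω hω hb
  -- Here `i` is the least strict upper bound of the indices, so the final index is `i - 1`.
  obtain ⟨i, hi⟩ : ∃ i, i = Nat.find hb := ⟨_, rfl⟩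
  have hspec : ∀ n, (ω n).index < i := by rw [hi]; exact Nat.find_spec hb
  have hipos : 0 < i := (Nat.zero_le _).trans_lt (hspec 0)
  have hmin := Nat.find_min hb (m := i - 1) (by omega)
  push Not at hmin
  obtain ⟨n, hn⟩ := hmin
  have hconst : ∀ k, (ω (n + k)).index = i - 1 := fun k => by
    have h1 : (ω n).index ≤ (ω (n + k)).index := hω.monotone_index (by omega)
    have h2 := hspec (n + k)
    omega
  -- One more step is waited for: at time `n` the count may still be zero, whereas an unchanged
  -- index means acceptance.
  refine ⟨i - 1, n + 1, fun k => ?_⟩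
  rw [add_right_comm]
  have h1 := hω.of_index_eq (n := n + k) (by rw [add_assoc, hconst, hconst])
  rw [hconst] at h1
  exact ⟨by rw [add_assoc]; exact hconst (k + 1), by rw [h1.2]; exact Nat.succ_ne_zero _, h1.1⟩

/-- A measurable property of the paths that holds almost surely whenever the initial state is in
a measurable set holds for all the shifted paths that start in this set. -/
theorem ae_shift_of_mem (hS : Setting Θ K P H π W p α υ γ₀ β) (xs : X) (θs : E d)
    {G : Set (State X d)} (hG : MeasurableSet G) {A : Set (ℕ → State X d)} (hA : MeasurableSet A)
    (h : ∀ s ∈ G, ∀ᵐ ω ∂(chainLaw (stepKernel P K H (polyStep γ₀ β) xs θs)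
        (isMarkovKernel_stepKernel P hS.measurableSet_cover hS.measurable_H _ xs θs) s),
      (∀ k, ω k ∈ G) → ω ∈ A) (s₀ : State X d) :
    ∀ᵐ ω ∂(chainLaw (stepKernel P K H (polyStep γ₀ β) xs θs)
        (isMarkovKernel_stepKernel P hS.measurableSet_cover hS.measurable_H _ xs θs) s₀),
      ∀ n, (∀ k, ω (n + k) ∈ G) → (fun k => ω (n + k)) ∈ A := by
  have := isMarkovKernel_stepKernel P hS.measurableSet_cover hS.measurable_H (polyStep γ₀ β) xs θs
  rw [ae_all_iff]
  intro n
  have hGm : MeasurableSet {ω : ℕ → State X d | ∀ k, ω k ∈ G} := by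
    rw [ofPred_forall]
    exact MeasurableSet.iInter fun k => measurable_pi_apply k hG
  refine ae_chainLaw_shift (stepKernel P K H (polyStep γ₀ β) xs θs) s₀ n
    (p := fun ω => (∀ k, ω k ∈ G) → ω ∈ A) ?_ fun s => ?_
  · have e : {ω : ℕ → State X d | (∀ k, ω k ∈ G) → ω ∈ A} =
        {ω : ℕ → State X d | ∀ k, ω k ∈ G}ᶜ ∪ A := by
      ext ω
      simp only [mem_ofPred_eq, mem_union, mem_compl_iff, imp_iff_not_or]
    rw [e]
    exact hGm.compl.union hA
  · by_cases hs : s ∈ G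
    · exact h s hs
    · have hm : Measurable fun s : State X d => (s ∈ G : Prop) := measurableSet_setOfPred.1 hG
      filter_upwards [ae_chainLaw_zero (stepKernel P K H (polyStep γ₀ β) xs θs) s hm] with ω hω hall
      exact absurd (hω ▸ hall 0) hs

/-- Almost sure convergence of the series of the noise tested against `v`. -/
theorem ae_cauchySeq_inner (hS : Setting Θ K P H π W p α υ γ₀ β) (xs : X) (θs : E d) (i : ℕ)
    {v : E d → E d} (hv : Measurable v) {B : ℝ} (hvB : ∀ θ ∈ K i, ‖v θ‖ ≤ B)
    (hvα : ∀ θ ∈ K i, ∀ θ' ∈ K i, ‖v θ - v θ'‖ ≤ B * ‖θ - θ'‖ ^ α) (s₀ : State X d) :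
    ∀ᵐ ω ∂(chainLaw (stepKernel P K H (polyStep γ₀ β) xs θs)
        (isMarkovKernel_stepKernel P hS.measurableSet_cover hS.measurable_H _ xs θs) s₀),
      ∀ n, (∀ k, ω (n + k) ∈ aliveSet X (K i) i) →
        CauchySeq fun m => ∑ k ∈ Finset.range m, inner ℝ (v (ω (n + k)).theta)
          (driftNoise H π (polyStep γ₀ β) xs θs (n + k) ω) := by
  have hsub := hS.subset_theta i
  have hcomp := hS.cover.compact i
  obtain ⟨gbar, hgm, hg, R, hR, hle⟩ := hS.exists_algNoise_rate hcomp hsub hv hvB hvα xs θs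
  obtain ⟨κ, s, hκ0, hκ1, hκp, hκυ, hκα, -⟩ :=
    exists_exponents hS.one_lt_p hS.alpha_mem hS.upsilon_mem hS.beta_mem
  obtain ⟨C, r, -, hf, -⟩ := hS.exists_inner_holder hcomp hsub hv hvB hvα hκ0 hκα hκυ
  obtain ⟨N, hN⟩ : ∃ N : ℕ → (ℕ → State X d) → ℝ, N = algNoise (polyStep γ₀ β)
    (fun θ x => inner ℝ (v θ) (H θ x)) gbar xs θs := ⟨_, rfl⟩
  have hNm : ∀ k, Measurable (N k) := by
    intro k
    rw [hN]
    exact measurable_algNoise _ hf.measurable hgm xs θs k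
  obtain ⟨ε, hε⟩ : ∃ ε : ℕ → ℝ, ε = fun j : ℕ => 1 / ((j : ℝ) + 1) := ⟨_, rfl⟩
  have hε0 : ∀ j, 0 < ε j := fun j => by rw [hε]; positivity
  have hε1 : ∀ j, ε j ≤ 1 := fun j => by
    rw [hε]
    have : (0 : ℝ) ≤ j := Nat.cast_nonneg j
    exact (div_le_one (by positivity)).2 (by linarith)
  -- `A j` is the Cauchy property with tolerance `1 / (j + 1)`, written as a measurable set of
  -- paths.
  obtain ⟨A, hA⟩ : ∃ A : ℕ → Set (ℕ → State X d), A = fun j =>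
    ⋃ m, ⋂ n, ⋂ (_ : m ≤ n), {ω | |∑ k ∈ Finset.Ico m (n + 1), N k ω| ≤ ε j} := ⟨_, rfl⟩
  have hAm : ∀ j, MeasurableSet (A j) := by
    intro j
    rw [hA]
    refine MeasurableSet.iUnion fun m => MeasurableSet.iInter fun n =>
      MeasurableSet.iInter fun _ => ?_
    have h1 : Measurable fun ω : ℕ → State X d => ∑ k ∈ Finset.Ico m (n + 1), N k ω :=
      Finset.measurable_sum _ fun k _ => hNm k
    exact measurableSet_le h1.abs measurable_const
  have hae := hS.ae_shift_of_mem xs θs (measurableSet_aliveSet (X := X) hcomp.measurableSet i)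
    (MeasurableSet.iInter hAm) (fun s hs => ?_) s₀
  · filter_upwards [hae] with ω hω n hn
    have h1 := hω n hn
    have hNe : ∀ k, N k (fun k => ω (n + k)) = inner ℝ (v (ω (n + k)).theta)
          (driftNoise H π (polyStep γ₀ β) xs θs (n + k) ω) := by
      intro k
      have h2 := hn k
      have h3 : halfPoint xs θs (ω (n + k)) = ((ω (n + k)).theta, (ω (n + k)).1) :=
        halfPoint_of_count_ne_zero h2.2.1
      have h4 := algNoise_eq_inner (γ := polyStep γ₀ β) (H := H) (π := π) (v := v) (gbar := gbar)
        (xs := xs) (θs := θs) (ω := ω) (k := n + k) (by rw [h3]; exact hg _ h2.2.2)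
      rw [h3] at h4
      rw [hN]
      exact h4
    rw [Metric.cauchySeq_iff']
    intro δ hδ
    obtain ⟨j, hj⟩ := exists_nat_one_div_lt hδ
    have h2 := mem_iInter.1 h1 j
    rw [hA] at h2
    obtain ⟨m, hm⟩ := mem_iUnion.1 h2
    refine ⟨m, fun m' hm' => ?_⟩
    rw [Real.dist_eq, ← Finset.sum_Ico_eq_sub _ hm']
    rcases Nat.eq_or_lt_of_le hm' with rfl | hlt
    · simpa using hδ
    · obtain ⟨l, rfl⟩ : ∃ l, m' = l + 1 := ⟨m' - 1, by omega⟩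
      have h3 := mem_iInter₂.1 hm l (by omega)
      have h4 : |∑ k ∈ Finset.Ico m (l + 1), N k (fun k => ω (n + k))| ≤ ε j := h3
      simp only [hNe] at h4
      rw [hε] at h4
      exact h4.trans_lt hj
  · have hhalf : halfPoint xs θs s = (s.theta, s.1) := halfPoint_of_count_ne_zero hs.2.1
    have hj : ∀ j, ∀ᵐ ω ∂(chainLaw (stepKernel P K H (polyStep γ₀ β) xs θs)
        (isMarkovKernel_stepKernel P hS.measurableSet_cover hS.measurable_H _ xs θs) s),
        (∀ k, ω k ∈ aliveSet X (K i) i) → ω ∈ A j := by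
      intro j
      -- Failure of `A j` by a surviving path implies a large noise sum beyond every `m`, and the
      -- probability of that event tends to zero.
      have h1 : Tendsto (fun m => ENNReal.ofReal (W (halfPoint xs θs s).2 ^ p) *
          R (ε j) (s.index + s.count + m)) atTop (𝓝 0) := by
        have h2 : Tendsto (fun m => s.index + s.count + m) atTop atTop :=
          tendsto_atTop_mono (fun m => Nat.le_add_left _ _) tendsto_id
        have := ENNReal.Tendsto.const_mul ((hR (ε j)).comp h2)
          (a := ENNReal.ofReal (W (halfPoint xs θs s).2 ^ p)) (Or.inr ENNReal.ofReal_ne_top)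
        rwa [mul_zero] at this
      refine le_antisymm (ge_of_tendsto' h1 fun m => ?_) zero_le
      refine (measure_mono ?_).trans
        (hle i s (by rw [hhalf]; exact hs.2.2) (ε j) (hε0 j) (hε1 j) m)
      intro ω hω
      obtain ⟨hω1, hω2⟩ := Classical.not_imp.1 hω
      rw [hA] at hω2
      have h3 := fun h => hω2 (mem_iUnion.2 ⟨m, h⟩)
      simp only [mem_iInter, mem_ofPred_eq] at h3
      obtain ⟨n, hmn, hn⟩ := not_forall₂.1 h3
      refine ⟨n, hmn, ⟨(hω1 0).1, fun l _ => hω1 (l + 1)⟩, ?_⟩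
      rw [hN] at hn
      exact not_le.1 hn
    filter_upwards [ae_all_iff.2 hj] with ω hω hall
    exact mem_iInter.2 fun j => hω j hall

/-- Almost sure summability of the squared steps. -/
theorem ae_summable_sq (hS : Setting Θ K P H π W p α υ γ₀ β) (xs : X) (θs : E d) (i : ℕ)
    (hβ2 : 1 / 2 < β) (s₀ : State X d) :
    ∀ᵐ ω ∂(chainLaw (stepKernel P K H (polyStep γ₀ β) xs θs)
        (isMarkovKernel_stepKernel P hS.measurableSet_cover hS.measurable_H _ xs θs) s₀),
      ∀ n, (∀ k, ω (n + k) ∈ aliveSet X (K i) i) →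
        Summable fun k => polyStep γ₀ β k ^ 2 * W (ω (n + (k + 1))).1 ^ p := by
  have hsub := hS.subset_theta i
  have hcomp := hS.cover.compact i
  have h𝒦m := hcomp.measurableSet
  obtain ⟨κ, s, hκ0, hκ1, hκp, hκυ, hκα, -⟩ :=
    exists_exponents hS.one_lt_p hS.alpha_mem hS.upsilon_mem hS.beta_mem
  obtain ⟨C, r, hB, hf, hH, -⟩ := hS.exists_inner_holder hcomp hsub (v := fun _ => 0)
    measurable_const (B := 0) (by simp) (by simp) hκ0 hκα hκυ
  have hγp : ∀ n, 0 < polyStep γ₀ β n := polyStep_pos hS.gamma_pos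
  have hW0 : ∀ x, 0 ≤ W x ^ p := fun x => Real.rpow_nonneg (hB.W_pos x).le p
  have hterm : ∀ k x, 0 ≤ polyStep γ₀ β k ^ 2 * W x ^ p := fun k x =>
    mul_nonneg (sq_nonneg _) (hW0 x)
  have hWm : ∀ k, Measurable fun ω : ℕ → State X d =>
      ENNReal.ofReal (polyStep γ₀ β k ^ 2 * W (ω (k + 1)).1 ^ p) := fun k =>
    (measurable_const.mul ((hB.measurable_W.comp (measurable_pi_apply (k + 1)).fst).pow_const
      p)).ennreal_ofReal
  have hsq : Summable fun k => polyStep γ₀ β k ^ 2 := by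
    have h1 := (summable_nat_add_one_rpow (s := -(2 * β)) (by linarith)).mul_left (γ₀ ^ 2)
    refine h1.congr fun k => ?_
    rw [polyStep_eq, mul_pow, ← Real.rpow_mul_natCast (by positivity)]
    congr 2
    push_cast
    ring
  obtain ⟨A, hA⟩ : ∃ A : Set (ℕ → State X d), A = {ω |
      ∑' k, ENNReal.ofReal (polyStep γ₀ β k ^ 2 * W (ω (k + 1)).1 ^ p) < ∞} := ⟨_, rfl⟩
  have hAm : MeasurableSet A := by
    rw [hA]
    exact measurableSet_lt (Measurable.tsum hWm) measurable_const
  have hae := hS.ae_shift_of_mem xs θs (measurableSet_aliveSet (X := X) h𝒦m i) hAm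
    (fun s hs => ?_) s₀
  · filter_upwards [hae] with ω hω n hn
    have h1 := hω n hn
    rw [hA] at h1
    have h2 := ENNReal.summable_toReal (ne_of_lt h1)
    refine h2.congr fun k => ENNReal.toReal_ofReal (hterm k _)
  · have hhalf : halfPoint xs θs s = (s.theta, s.1) := halfPoint_of_count_ne_zero hs.2.1
    have := isMarkovKernel_stepKernel P hS.measurableSet_cover hS.measurable_H (polyStep γ₀ β)
      xs θs
    have := isMarkovKernel_retainKernel P hS.measurable_H (polyStep γ₀ β) h𝒦m
    have hdom := isDominated_stepKernel P hS.measurableSet_cover hS.measurable_H (polyStep γ₀ β)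
      xs θs h𝒦m i
    have hD := isDriven_retainKernel P hS.measurable_H (fun n => (hγp n).le) h𝒦m hB.C_pos.le
      (fun x => (hB.W_pos x).le) hH
    have hst : (restartMap xs θs s).2.1 ∈ K i := by
      rw [restartMap, hhalf]
      exact hs.2.2
    obtain ⟨c, hc⟩ : ∃ c, c = (1 + C / (1 - r)) * W (restartMap xs θs s).1 ^ p := ⟨_, rfl⟩
    have hsurvm : ∀ n, MeasurableSet (survival (levelSet X d i) (aliveSet X (K i) i) n) := by
      intro n
      have e : survival (levelSet X d i) (aliveSet X (K i) i) n =
          {ω | ω 0 ∈ levelSet X d i} ∩ ⋂ j ∈ Finset.range n, {ω | ω (j + 1) ∈ aliveSet X (K i) i} := by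
        ext ω
        simp [survival]
      rw [e]
      exact (measurable_pi_apply 0 (measurableSet_levelSet i)).inter
        (Finset.measurableSet_biInter _ fun j _ =>
          measurable_pi_apply (j + 1) (measurableSet_aliveSet h𝒦m i))
    -- On surviving paths the observations are those of the image path, so the moment bound of the
    -- dominating chain passes to the algorithm.
    have hk : ∀ k, ∫⁻ ω, (survival (levelSet X d i) (aliveSet X (K i) i) (k + 1)).indicator
        (fun ω => ENNReal.ofReal (polyStep γ₀ β k ^ 2 * W (ω (k + 1)).1 ^ p)) ω
        ∂(chainLaw (stepKernel P K H (polyStep γ₀ β) xs θs)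
        (isMarkovKernel_stepKernel P hS.measurableSet_cover hS.measurable_H _ xs θs) s) ≤
        ENNReal.ofReal (polyStep γ₀ β k ^ 2 * c) := by
      intro k
      have hFm : Measurable fun x : Finset.Iic (k + 1) → X × E d × ℕ =>
          ENNReal.ofReal (polyStep γ₀ β k ^ 2 *
            W (x ⟨k + 1, Finset.mem_Iic.2 le_rfl⟩).1 ^ p) :=
        (measurable_const.mul ((hB.measurable_W.comp (by fun_prop)).pow_const p)).ennreal_ofReal
      have h1 := hdom.lintegral_frestrictLe_le s (k + 1) _ hFm
      refine le_trans (le_of_eq (lintegral_congr fun ω => ?_)) (h1.trans ?_)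
      · by_cases hω : ω ∈ survival (levelSet X d i) (aliveSet X (K i) i) (k + 1)
        · rw [indicator_of_mem hω, indicator_of_mem hω]
          have h2 := hdom.obs_eq _ (hω.2 k (Nat.lt_succ_self k))
          dsimp only at h2 ⊢
          rw [h2]
        · rw [indicator_of_notMem hω, indicator_of_notMem hω]
      · have h2 := hD.lintegral_W_pow_le hB h𝒦m hst hS.one_lt_p (k + 1)
        rw [← hc] at h2
        simp only [Preorder.frestrictLe_apply, ENNReal.ofReal_mul (sq_nonneg (polyStep γ₀ β k))]
        have h3 : Measurable fun ω : ℕ → X × E d × ℕ => ENNReal.ofReal (W (ω (k + 1)).1 ^ p) :=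
          ((hB.measurable_W.comp (by fun_prop : Measurable fun ω : ℕ → X × E d × ℕ =>
            (ω (k + 1)).1)).pow_const p).ennreal_ofReal
        rw [lintegral_const_mul _ h3]
        exact mul_le_mul_right h2 _
    have hsumm : Summable fun k => polyStep γ₀ β k ^ 2 * c := hsq.mul_right c
    have hfin : ∑' k, ENNReal.ofReal (polyStep γ₀ β k ^ 2 * c) < ∞ := hsumm.tsum_ofReal_lt_top
    have hint : ∫⁻ ω, ∑' k, (survival (levelSet X d i) (aliveSet X (K i) i) (k + 1)).indicator
        (fun ω => ENNReal.ofReal (polyStep γ₀ β k ^ 2 * W (ω (k + 1)).1 ^ p)) ω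
        ∂(chainLaw (stepKernel P K H (polyStep γ₀ β) xs θs)
        (isMarkovKernel_stepKernel P hS.measurableSet_cover hS.measurable_H _ xs θs) s) ≠ ∞ := by
      rw [lintegral_tsum fun k => ((hWm k).indicator (hsurvm (k + 1))).aemeasurable]
      exact ((ENNReal.tsum_le_tsum hk).trans_lt hfin).ne
    filter_upwards [ae_lt_top (Measurable.tsum fun k =>
      (hWm k).indicator (hsurvm (k + 1))) hint] with ω hω hall
    rw [hA]
    refine lt_of_eq_of_lt (tsum_congr fun k => ?_) hω
    have hs' : ω ∈ survival (levelSet X d i) (aliveSet X (K i) i) (k + 1) :=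
      ⟨(hall 0).1, fun l _ => hall (l + 1)⟩
    rw [indicator_of_mem hs']

end Setting

end AlmostSure

/-! ### Shadowing by the mean field and the two cases of convergence -/

section Convergence

variable {d : ℕ} {X : Type*} [MeasurableSpace X]

theorem cauchySeq_of_inner_single {u : ℕ → E d}
    (h : ∀ j : Fin d, CauchySeq fun n => inner ℝ (EuclideanSpace.single j (1 : ℝ)) (u n)) :
    CauchySeq u := by
  choose l hl using fun j => cauchySeq_tendsto_of_complete (h j)
  have h1 : Tendsto (fun n => ∑ j, inner ℝ (EuclideanSpace.single j (1 : ℝ)) (u n) •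
      EuclideanSpace.single j (1 : ℝ)) atTop (𝓝 (∑ j, l j • EuclideanSpace.single j (1 : ℝ))) :=
    tendsto_finsetSum _ fun j _ => (hl j).smul_const _
  refine (h1.congr fun n => ?_).cauchySeq
  have h2 := (EuclideanSpace.basisFun (Fin d) ℝ).sum_repr' (u n)
  simpa only [EuclideanSpace.basisFun_apply] using h2

theorem tendsto_sum_polyStep_add {γ₀ β : ℝ} (hγ₀ : 0 < γ₀) (hβ : β ≤ 1) (c : ℕ) :
    Tendsto (fun n => ∑ k ∈ Finset.range n, polyStep γ₀ β (c + k)) atTop atTop := by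
  refine (not_summable_iff_tendsto_nat_atTop_of_nonneg
    (fun k => (polyStep_pos hγ₀ _).le)).1 fun hsum => ?_
  have h1 : Summable fun k : ℕ => 1 / ((k + (c + 1) : ℕ) : ℝ) ^ β := by
    refine (hsum.mul_left γ₀⁻¹).congr fun k => ?_
    rw [polyStep, ← mul_div_assoc, inv_mul_cancel₀ hγ₀.ne']
    congr 2
    push_cast
    ring
  have h2 := (summable_nat_add_iff (f := fun k : ℕ => 1 / (k : ℝ) ^ β) (c + 1)).1 h1
  linarith [Real.summable_one_div_nat_rpow.1 h2]

theorem le_mul_rpow_of_le {t D α : ℝ} (ht : 0 ≤ t) (htD : t ≤ D) (hα : α ≤ 1) :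
    t ≤ D ^ (1 - α) * t ^ α := by
  rcases ht.eq_or_lt with rfl | ht0
  · exact mul_nonneg (Real.rpow_nonneg htD _) (Real.rpow_nonneg le_rfl _)
  · calc t = t ^ (1 - α) * t ^ α := by rw [← Real.rpow_add ht0]; simp
      _ ≤ _ := mul_le_mul_of_nonneg_right (Real.rpow_le_rpow ht htD (by linarith))
        (Real.rpow_nonneg ht _)

namespace Setting

variable {Θ : Set (E d)} {K : ℕ → Set (E d)} {P : Kernel (E d × X) X} [IsMarkovKernel P]
    {H : E d → X → E d} {π : E d → Measure X} {W : X → ℝ} {p α υ γ₀ β : ℝ} {w : E d → ℝ}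

/-- Almost sure convergence of the series of the noise. -/
theorem ae_cauchySeq_driftNoise (hS : Setting Θ K P H π W p α υ γ₀ β) (xs : X) (θs : E d) (i : ℕ)
    (s₀ : State X d) :
    ∀ᵐ ω ∂(chainLaw (stepKernel P K H (polyStep γ₀ β) xs θs)
        (isMarkovKernel_stepKernel P hS.measurableSet_cover hS.measurable_H _ xs θs) s₀),
      ∀ n, (∀ k, ω (n + k) ∈ aliveSet X (K i) i) →
        CauchySeq fun m => ∑ k ∈ Finset.range m,
          driftNoise H π (polyStep γ₀ β) xs θs (n + k) ω := by
  have h1 := fun j : Fin d => hS.ae_cauchySeq_inner xs θs i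
    (v := fun _ => EuclideanSpace.single j (1 : ℝ)) measurable_const (B := 1) (by simp)
    (fun θ _ θ' _ => by simp; positivity) s₀
  filter_upwards [ae_all_iff.2 h1] with ω hω n hn
  refine cauchySeq_of_inner_single fun j => ?_
  simpa only [inner_sum] using hω j n hn

/-- Almost sure convergence of the series of the noise tested against a gradient. -/
theorem ae_cauchySeq_gradient (hS : Setting Θ K P H π W p α υ γ₀ β)
    (hw : IsLyapunov Θ (meanField H π) w) (hlip : LocallyLipschitzOn Θ (gradient w))
    (xs : X) (θs : E d) (i : ℕ) (s₀ : State X d) :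
    ∀ᵐ ω ∂(chainLaw (stepKernel P K H (polyStep γ₀ β) xs θs)
        (isMarkovKernel_stepKernel P hS.measurableSet_cover hS.measurable_H _ xs θs) s₀),
      ∀ n, (∀ k, ω (n + k) ∈ aliveSet X (K i) i) →
        CauchySeq fun m => ∑ k ∈ Finset.range m, inner ℝ (gradient w (ω (n + k)).theta)
          (driftNoise H π (polyStep γ₀ β) xs θs (n + k) ω) := by
  have hsub := hS.subset_theta i
  have hcomp := hS.cover.compact i
  obtain ⟨A, hA⟩ := hcomp.exists_bound_of_continuousOn ((hw.continuousOn_gradient hS.isOpen).mono hsub)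
  obtain ⟨L, hL⟩ := (hlip.mono hsub).exists_lipschitzOnWith_of_compact hcomp
  have hm : Measurable (gradient w) :=
    (InnerProductSpace.toDual ℝ (E d)).symm.continuous.measurable.comp (measurable_fderiv ℝ w)
  -- A Lipschitz gradient is `α`-Hölder on a bounded set because `α ≤ 1`, so it is an admissible
  -- test field.
  refine hS.ae_cauchySeq_inner xs θs i hm
    (B := max A (L * Metric.diam (K i) ^ (1 - α))) (fun θ hθ => (hA θ hθ).trans (le_max_left _ _))
    (fun θ hθ θ' hθ' => ?_) s₀
  have h1 := hL.dist_le_mul θ hθ θ' hθ'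
  rw [dist_eq_norm, dist_eq_norm] at h1
  have h2 : ‖θ - θ'‖ ≤ Metric.diam (K i) := by
    rw [← dist_eq_norm]
    exact Metric.dist_le_diam_of_mem hcomp.isBounded hθ hθ'
  have h3 := le_mul_rpow_of_le (norm_nonneg _) h2 hS.alpha_mem.2
  calc ‖gradient w θ - gradient w θ'‖ ≤ L * (Metric.diam (K i) ^ (1 - α) * ‖θ - θ'‖ ^ α) :=
        h1.trans (mul_le_mul_of_nonneg_left h3 L.2)
    _ = L * Metric.diam (K i) ^ (1 - α) * ‖θ - θ'‖ ^ α := by ring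
    _ ≤ _ := mul_le_mul_of_nonneg_right (le_max_right _ _) (Real.rpow_nonneg (norm_nonneg _) _)

/-- A path which is never restarted and whose noise is summable shadows the mean field. -/
theorem exists_isShadow (hS : Setting Θ K P H π W p α υ γ₀ β) {xs : X} {θs : E d} {i n : ℕ}
    {ω : ℕ → State X d} (hω : IsPath K H (polyStep γ₀ β) xs θs ω)
    (hn : ∀ k, ω (n + k) ∈ aliveSet X (K i) i)
    (hc : CauchySeq fun m => ∑ k ∈ Finset.range m,
      driftNoise H π (polyStep γ₀ β) xs θs (n + k) ω) :
    ∃ (c : ℕ) (y : ℕ → E d),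
      (∀ k, (ω (n + (k + 1))).theta = (ω (n + k)).theta + polyStep γ₀ β (c + k) •
        H (ω (n + k)).theta (ω (n + (k + 1))).1) ∧
      (∀ k, (ω (n + (k + 1))).theta = (ω (n + k)).theta + polyStep γ₀ β (c + k) •
        meanField H π (ω (n + k)).theta + driftNoise H π (polyStep γ₀ β) xs θs (n + k) ω) ∧
      IsShadow Θ (meanField H π) (fun k => polyStep γ₀ β (c + k)) (K i)
        (fun k => (ω (n + k)).theta) y := by
  obtain ⟨S, hSlim⟩ := cauchySeq_tendsto_of_complete hc
  have hcount : ∀ k, (ω (n + k)).count = (ω n).count + k := by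
    intro k
    induction k with
    | zero => rfl
    | succ k ih =>
      have h1 := hω.of_index_eq (n := n + k) ((hn (k + 1)).1.trans (hn k).1.symm)
      rw [← add_assoc, h1.2, ih, add_assoc]
  have hhalf : ∀ k, halfPoint xs θs (ω (n + k)) = ((ω (n + k)).theta, (ω (n + k)).1) := fun k =>
    halfPoint_of_count_ne_zero (hn k).2.1
  -- Without restarts the step index increases by one at each iteration; the shift `c` in the
  -- statement is its value at time `n`, plus one.
  have hidx : ∀ k, (ω (n + k)).index + (ω (n + k)).count + 1 = i + (ω n).count + 1 + k := fun k => by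
    rw [hcount, (hn k).1]
    ring
  have hrec : ∀ k, (ω (n + (k + 1))).theta = (ω (n + k)).theta +
      polyStep γ₀ β (i + (ω n).count + 1 + k) • meanField H π (ω (n + k)).theta +
        driftNoise H π (polyStep γ₀ β) xs θs (n + k) ω := fun k => by
    rw [← add_assoc, hω.theta_succ, newTheta_eq H π, hhalf, hidx]
  have hrec' : ∀ k, (ω (n + (k + 1))).theta = (ω (n + k)).theta +
      polyStep γ₀ β (i + (ω n).count + 1 + k) • H (ω (n + k)).theta (ω (n + (k + 1))).1 := fun k => by
    rw [← add_assoc, hω.theta_succ, newTheta, hhalf, hidx]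
  have hγ : ∀ n, 0 < polyStep γ₀ β n := polyStep_pos hS.gamma_pos
  -- The shadow adds to `θ` the part of the noise series still to come, which tends to zero and
  -- cancels the noise in the recursion.
  refine ⟨i + (ω n).count + 1, fun k => (ω (n + k)).theta + (S - ∑ j ∈ Finset.range k,
    driftNoise H π (polyStep γ₀ β) xs θs (n + j) ω), hrec', hrec, hS.cover.compact i,
    hS.subset_theta i, fun k => (hn k).2.2, ?_, fun k => ?_, fun k => (hγ _).le, ?_,
    tendsto_sum_polyStep_add hS.gamma_pos hS.beta_mem.2 _⟩
  · have h1 := (hSlim.sub_const S).norm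
    rw [sub_self, norm_zero] at h1
    refine h1.congr fun k => ?_
    congr 1
    abel
  · rw [hrec k, Finset.sum_range_succ]
    abel
  · have h2 : Tendsto (fun k => i + (ω n).count + 1 + k) atTop atTop :=
      tendsto_atTop_mono (fun k => Nat.le_add_left _ _) tendsto_id
    exact (tendsto_polyStep hS.beta_pos).comp h2

/-- Convergence of the Lyapunov function under the second-order assumptions. -/
theorem exists_tendsto_lyapunov (hS : Setting Θ K P H π W p α υ γ₀ β)
    (hw : IsLyapunov Θ (meanField H π) w) (hlip : LocallyLipschitzOn Θ (gradient w)) (hp : 2 ≤ p)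
    {𝒦 : Set (E d)} {c : ℕ} {x y u : ℕ → E d} {ξ : ℕ → X}
    (hs : IsShadow Θ (meanField H π) (fun k => polyStep γ₀ β (c + k)) 𝒦 x y)
    (hH : ∀ k, x (k + 1) = x k + polyStep γ₀ β (c + k) • H (x k) (ξ k))
    (hu : ∀ k, x (k + 1) = x k + polyStep γ₀ β (c + k) • meanField H π (x k) + u k)
    (hc : CauchySeq fun m => ∑ k ∈ Finset.range m, inner ℝ (gradient w (x k)) (u k))
    (hsum : Summable fun k => polyStep γ₀ β k ^ 2 * W (ξ k) ^ p) :
    ∃ l, Tendsto (fun k => w (y k)) atTop (𝓝 l) := by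
  have hh := hS.continuousOn_meanField
  have hγ : ∀ n, 0 < polyStep γ₀ β n := polyStep_pos hS.gamma_pos
  obtain ⟨ρ, A, hρ, hA, hexp⟩ := hw.exists_expansion hS.isOpen hlip hs.isCompact hs.subset
  obtain ⟨C, hC, hb⟩ := hS.field.exists_norm_le hs.isCompact hs.subset
  have hsq : Summable fun k => ‖x (k + 1) - x k‖ ^ 2 := by
    refine Summable.of_nonneg_of_le (fun k => sq_nonneg _) (fun k => ?_) (hsum.mul_left (C ^ 2))
    have hW1 := hS.field.one_le_W (ξ k)
    have h1 : ‖x (k + 1) - x k‖ ≤ polyStep γ₀ β k * (C * W (ξ k)) := by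
      rw [hH k, add_sub_cancel_left, norm_smul, Real.norm_of_nonneg (hγ _).le]
      exact mul_le_mul (antitone_polyStep hS.gamma_pos hS.beta_pos (Nat.le_add_left k c))
        (hb _ (hs.mem k) _) (norm_nonneg _) (hγ _).le
    -- The assumption `p ≥ 2` turns summability with `W ^ p` into summability of the squared
    -- increments.
    have h2 : W (ξ k) ^ 2 ≤ W (ξ k) ^ p := by
      rw [← Real.rpow_natCast]
      exact Real.rpow_le_rpow_of_exponent_le hW1 (by exact_mod_cast hp)
    calc ‖x (k + 1) - x k‖ ^ 2 ≤ (polyStep γ₀ β k * (C * W (ξ k))) ^ 2 :=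
          pow_le_pow_left₀ (norm_nonneg _) h1 2
      _ = C ^ 2 * (polyStep γ₀ β k ^ 2 * W (ξ k) ^ 2) := by ring
      _ ≤ _ := by gcongr
  -- In the expansion of `w` the mean-field term is nonpositive and is dropped; the gradient noise
  -- and the quadratic remainder form convergent series.
  have hζ : CauchySeq fun m => ∑ k ∈ Finset.range m, (inner ℝ (gradient w (x k)) (u k) +
      A * ‖x (k + 1) - x k‖ ^ 2) := by
    obtain ⟨l, hl⟩ := cauchySeq_tendsto_of_complete hc
    have h1 := hl.add (hsq.mul_left A).hasSum.tendsto_sum_nat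
    refine (h1.congr fun m => ?_).cauchySeq
    rw [Finset.sum_add_distrib]
  obtain ⟨l, hl⟩ := exists_tendsto_of_le_add (a := fun k => w (x k))
    (fun k => hw.nonneg _ (hs.subset (hs.mem k))) hζ (by
      filter_upwards [(hs.tendsto_increment hh).eventually (gt_mem_nhds hρ)] with k hk
      have h1 := (abs_le.1 (hexp (x k) (hs.mem k) (x (k + 1)) hk)).2
      have h2 : inner ℝ (gradient w (x k)) (x (k + 1) - x k) = polyStep γ₀ β (c + k) *
          inner ℝ (gradient w (x k)) (meanField H π (x k)) + inner ℝ (gradient w (x k)) (u k) := by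
        rw [hu k, add_assoc, add_sub_cancel_left, inner_add_right, inner_smul_right]
      have h3 := mul_nonpos_of_nonneg_of_nonpos (hγ (c + k)).le
        (hw.inner_le_zero (hs.subset (hs.mem k)))
      linarith)
  have h1 := (hs.tendsto_sub_lyapunov hS.isOpen hw).add hl
  exact ⟨0 + l, h1.congr fun k => by ring⟩

end Setting

end Convergence

end StabSA

end

/-! ### Conclusion -/

theorem mainTheorem1 {d : ℕ} {X : Type*} [MeasurableSpace X]
    [MeasurableSpace.CountablyGenerated X]
    (Θ : Set (StabSA.E d)) (hΘ : IsOpen Θ)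
    (K : ℕ → Set (StabSA.E d)) (hK : StabSA.IsCompactCover Θ K)
    (P : Kernel (StabSA.E d × X) X) [IsMarkovKernel P]
    (H : StabSA.E d → X → StabSA.E d) (hH : Measurable (Function.uncurry H))
    (π : StabSA.E d → Measure X) (W : X → ℝ) (w : StabSA.E d → ℝ)
    (p α υ γ₀ β : ℝ) (hp : 1 < p) (hα : α ∈ Ioc (0 : ℝ) 1) (hυ : υ ∈ Ioc (0 : ℝ) 1)
    (hγ₀ : 0 < γ₀)
    (hβ : β ∈ Ioc (max (1 / p) ((1 + min α υ / p) / (1 + min α υ))) 1)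
    (hHW : StabSA.FieldBound Θ H W)
    (hP : StabSA.UniformErgodicity Θ P π W p)
    (hPυ : StabSA.HolderKernels Θ P W υ)
    (hHα : StabSA.AveragedHolder Θ H π α)
    (hw : StabSA.IsLyapunov Θ (StabSA.meanField H π) w)
    (xs : X) (θs : StabSA.E d) (hθs : θs ∈ K 0) :
    (∀ᵐ ω ∂(StabSA.algorithmLaw P K hK.compact H hH (StabSA.polyStep γ₀ β) xs θs 0),
      (∃ i, ∀ᶠ n in atTop, (ω n).index = i ∧ (ω n).theta ∈ K i) ∧
      (∃ i, ∀ k, (ω k).theta ∈ Θ → (ω k).theta ∈ K i)) ∧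
    ((interior (w '' StabSA.stationarySet Θ w (StabSA.meanField H π)) = ∅ ∨
        (LocallyLipschitzOn Θ (gradient w) ∧ 2 ≤ p ∧ 1 / 2 < β)) →
      ∀ᵐ ω ∂(StabSA.algorithmLaw P K hK.compact H hH (StabSA.polyStep γ₀ β) xs θs 0),
        Tendsto (fun k => Metric.infDist (ω k).theta
          (StabSA.stationarySet Θ w (StabSA.meanField H π))) atTop (𝓝 0) ∧
        Tendsto (fun k => ‖(ω (k + 1)).theta - (ω k).theta‖) atTop (𝓝 0) ∧
        ∃ θ₀ ∈ StabSA.stationarySet Θ w (StabSA.meanField H π),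
          Tendsto (fun k => Metric.infDist (ω k).theta
            (connectedComponentIn (StabSA.stationarySet Θ w (StabSA.meanField H π)) θ₀))
            atTop (𝓝 0)) := by
  have hS : StabSA.Setting Θ K P H π W p α υ γ₀ β :=
    ⟨hΘ, hK, hH, hp, hα, hυ, hγ₀, hβ, hHW, hP, hPυ, hHα⟩
  have hθΘ : θs ∈ Θ := hS.subset_theta 0 hθs
  have halive := hS.ae_exists_alive hw xs hθΘ (s₀ := (xs, θs, 0, 0)) rfl
  refine ⟨?_, fun hcase => ?_⟩
  · filter_upwards [halive] with ω hω
    obtain ⟨i, n, hn⟩ := hω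
    have hn' : ∀ k, n ≤ k → ω k ∈ StabSA.aliveSet X (K i) i := fun k hk => by
      obtain ⟨j, rfl⟩ := Nat.exists_eq_add_of_le hk
      exact hn j
    refine ⟨⟨i, eventually_atTop.2 ⟨n, fun k hk => ⟨(hn' k hk).1, (hn' k hk).2.2⟩⟩⟩, ?_⟩
    have h1 : ∀ k, ∃ j, (ω k).theta ∈ Θ → (ω k).theta ∈ K j := fun k => by
      by_cases h : (ω k).theta ∈ Θ
      · rw [← hK.iUnion_eq] at h
        obtain ⟨j, hj⟩ := mem_iUnion.1 h
        exact ⟨j, fun _ => hj⟩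
      · exact ⟨0, fun h' => absurd h' h⟩
    choose j hj using h1
    -- From time `n` on all parameters are in `K i`. The finitely many earlier ones that lie in `Θ`
    -- are each in some set of the increasing cover.
    refine ⟨max i ((Finset.range n).sup j), fun k hk => ?_⟩
    rcases lt_or_ge k n with h | h
    · exact hS.monotone_cover ((Finset.le_sup (Finset.mem_range.2 h)).trans (le_max_right _ _))
        (hj k hk)
    · exact hS.monotone_cover (le_max_left _ _) (hn' k h).2.2
  · have hpath := StabSA.ae_isPath (P := P) hS.measurableSet_cover hH
      (StabSA.polyStep γ₀ β) xs θs (xs, θs, 0, 0)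
    have hnoise := ae_all_iff.2 fun i => hS.ae_cauchySeq_driftNoise xs θs i (xs, θs, 0, 0)
    -- The two cases differ only in why `w` converges along the shadow; the random `i` and `n` of
    -- the final active set are chosen after the almost sure statements hold for all of them.
    have hlimit : ∀ᵐ ω ∂(StabSA.algorithmLaw P K hK.compact H hH (StabSA.polyStep γ₀ β) xs θs 0),
        ∀ i n, (∀ k, ω (n + k) ∈ StabSA.aliveSet X (K i) i) → ∃ y c,
          StabSA.IsShadow Θ (StabSA.meanField H π) (fun k => StabSA.polyStep γ₀ β (c + k)) (K i)
            (fun k => (ω (n + k)).theta) y ∧ ∃ l, Tendsto (fun k => w (y k)) atTop (𝓝 l) := by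
      rcases hcase with hint | ⟨hlip, hp2, hβ2⟩
      · filter_upwards [hpath, hnoise] with ω hω hωn i n hn
        obtain ⟨c, y, -, -, hs⟩ := hS.exists_isShadow hω hn (hωn i n hn)
        exact ⟨y, c, hs, hs.exists_tendsto_lyapunov hΘ hS.continuousOn_meanField hw hint⟩
      · filter_upwards [hpath, hnoise,
          ae_all_iff.2 fun i => hS.ae_cauchySeq_gradient hw hlip xs θs i (xs, θs, 0, 0),
          ae_all_iff.2 fun i => hS.ae_summable_sq xs θs i hβ2 (xs, θs, 0, 0)]
          with ω hω hωn hωg hωs i n hn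
        obtain ⟨c, y, h1, h2, hs⟩ := hS.exists_isShadow hω hn (hωn i n hn)
        exact ⟨y, c, hs, hS.exists_tendsto_lyapunov hw hlip hp2 hs
          (ξ := fun k => (ω (n + (k + 1))).1) h1 h2 (hωg i n hn) (hωs i n hn)⟩
    filter_upwards [halive, hlimit] with ω hω hωl
    obtain ⟨i, n, hn⟩ := hω
    obtain ⟨y, c, hs, hl⟩ := hωl i n hn
    have hdist := hs.tendsto_infDist hΘ hS.continuousOn_meanField hw hl
    have hinc := hs.tendsto_increment hS.continuousOn_meanField
    obtain ⟨θ₀, hθ₀, hcomp⟩ := StabSA.exists_tendsto_infDist_connectedComponentIn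
      hw.isCompact_stationarySet (hw.stationarySet_nonempty hΘ ⟨θs, hθΘ⟩) hdist
      (by simpa only [dist_eq_norm] using hinc)
    refine ⟨(tendsto_add_atTop_iff_nat n).1 (hdist.congr fun k => ?_),
      (tendsto_add_atTop_iff_nat n).1 (hinc.congr fun k => ?_), θ₀, hθ₀,
      (tendsto_add_atTop_iff_nat n).1 (hcomp.congr fun k => ?_)⟩
    · rw [add_comm n k]
    · rw [← add_assoc, add_comm n k]
    · rw [add_comm n k]
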